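/- Let $d\ge 1$, and for $1\le i\le d$ let $F_i$ be a connected simple graph on the vertex set $\{1,\dots,k_i\}$, $k_i\ge 1$. Let $p\ge\max_i k_i$ be an odd integer and $B$ a real number. Let $n\ge1$, let $\kappa:[0,1]^2\to[0,1]$ be symmetric and measurable, and let $U_1,\dots,U_n$ be independent, not necessarily identically distributed, $[0,1]$-valued random variables. Let $(Y_{vw})_{1\le v<w\le n}$ be real random variables that are conditionally independent given $U=(U_1,\dots,U_n)$, where the conditional law of $Y_{vw}$ given $U$ depends only on $(U_v,U_w)$ and $\mathbb E(Y_{vw}\mid U)=\kappa(U_v,U_w)$; this includes the unweighted case $Y_{vw}\in\{0,1\}$. Put $I^n_k=\{a\in\mathbb N^k:1\le a_1<\dots<a_k\le n\}$, $a/n=(a_1/n,\dots,a_k/n)$ and $U_a=(U_{a_1},\dots,U_{a_k})$. Let $\phi_i$ be real functions on $\{0\le x_1\le\dots\le x_{k_i}\le1\}$ and $\psi_i$ measurable real functions on $[0,1]^{k_i}$, and assume that $|Y_{vw}|$, $|\phi_i|$, $|\psi_i|$ are all bounded by $B$. Let $W=(W_1,\dots,W_d)$ with $$W_i=n^{-1/2}\sum_{a=1}^n\phi_i(a/n)\bigl(\psi_i(U_a)-\mathbb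 E\psi_i(U_a)\bigr)\quad\text{if }k_i=1,$$ $$W_i=\tbinom n{k_i}^{-1/2}\sum_{a\in I^n_{k_i}}\phi_i(a/n)\,\psi_i(U_a)\prod_{\{v,w\}\in E(F_i),\,v<w}\bigl(Y_{a_va_w}-\kappa(U_{a_v},U_{a_w})\bigr)\quad\text{if }k_i\ge2$$ (with $W_i=0$ if $n<k_i$). Then $\mathrm{Cov}(W)=\Sigma=(\sigma_{ij})$, where $$\sigma_{ij}=n^{-1}\sum_{a=1}^n\phi_i(a/n)\phi_j(a/n)\,\mathrm{Cov}\bigl(\psi_i(U_a),\psi_j(U_a)\bigr)\quad\text{if }k_i=k_j=1,$$ $$\sigma_{ij}=\tbinom n{k_i}^{-1}\sum_{a\in I^n_{k_i}}\phi_i(a/n)\phi_j(a/n)\,\mathbb E\Bigl\{\psi_i(U_a)\psi_j(U_a)\prod_{\{v,w\}\in E(F_i),\,v<w}\mathrm{Var}(Y_{a_va_w}\mid U)\Bigr\}\quad\text{if }F_i=F_j,\ k_i\ge2$$ (equal as labelled graphs; the entry is $0$ if $n<k_i$), and $\sigma_{ij}=0$ otherwise. If $Y_{vw}\in\{0,1\}$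 almost surely for all $v<w$, the conditional variances $\mathrm{Var}(Y_{vw}\mid U)$ in this formula may be replaced by $\kappa(U_v,U_w)(1-\kappa(U_v,U_w))$. Let $Z$ be a centred Gaussian vector with covariance matrix $\Sigma$, and write $|h|_\alpha=\sup_{x\in\mathbb R^d}|\partial^\alpha h(x)|$. (a) There is a constant $C$, depending only on $d$, the $F_i$, $p$ and $B$ (in particular not on $n$), such that for every $(p+2)$-times partially differentiable $h:\mathbb R^d\to\mathbb R$ whose partial derivatives $\partial^\alpha h$, $|\alpha|\le p+2$, are bounded, $$|\mathbb Eh(W)-\mathbb Eh(Z)|\le \frac{C\,\sup_{|\alpha|\le p+2}|h|_\alpha}{n^{1/2}} .$$ (b) For every $\lambda>0$ there is a constant $C$, depending only on $d$, the $F_i$, $p$, $B$ and $\lambda$ (in particular not on $n$), such that whenever all nonzero eigenvalues of $\Sigma$ are at least $\lambda$, $$\sup_{A}\,\bigl|\mathbb P(W\in A)-\mathbb P(Z\in A)\bigr|\le C\,n^{-\frac1{2(p+2)}},$$ the supremum being over all (Borel) convex sets $A\subseteq\mathbb R^d$. -/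

import Mathlib

open MeasureTheory ProbabilityTheory
open scoped unitInterval

/-- A graphon: a symmetric (Borel) measurable function `[0,1]² → [0,1]`. -/
structure Graphon where
  toFun : I → I → ℝ
  measurable_toFun : Measurable (Function.uncurry toFun)
  symm : ∀ s t, toFun s t = toFun t s
  nonneg : ∀ s t, 0 ≤ toFun s t
  le_one : ∀ s t, toFun s t ≤ 1

/-- The sigma-algebra generated by all vertex labels. -/
abbrev labelSigma {n : ℕ} {Ω : Type*} (U : Fin n → Ω → I) : MeasurableSpace Ω :=
  MeasurableSpace.comap (fun ω v => U v ω) inferInstance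

/-- The sigma-algebra generated by the labels of the two vertices `v` and `w`. -/
abbrev pairSigma {n : ℕ} {Ω : Type*} (U : Fin n → Ω → I) (v w : Fin n) : MeasurableSpace Ω :=
  MeasurableSpace.comap (fun ω => (U v ω, U w ω)) inferInstance

/-- A (possibly edge-weighted) random graph on the vertices `Fin n`, sampled from the graphon `κ`:
the labels `U v` are independent, with arbitrary laws; conditionally on the labels the edge
variables `Y v w`, `v < w`, are independent, the conditional law of `Y v w` depends only on the
labels of the end points `v` and `w`, and its mean is `κ (U v) (U w)`.
Only the variables `Y v w` with `v < w` are relevant. -/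
structure IsGraphonSample {n : ℕ} {Ω : Type*} [MeasurableSpace Ω] (P : Measure Ω)
    (κ : Graphon) (U : Fin n → Ω → I) (Y : Fin n → Fin n → Ω → ℝ) : Prop where
  measurable_label : ∀ v, Measurable (U v)
  measurable_edge : ∀ v w, v < w → Measurable (Y v w)
  indep_label : iIndepFun U P
  condIndep_edge : ∀ A : Fin n → Fin n → Set ℝ, (∀ v w, MeasurableSet (A v w)) →
    P⟦⋂ (v : Fin n) (w : Fin n) (_ : v < w), Y v w ⁻¹' A v w | labelSigma U⟧
      =ᵐ[P] fun ω => ∏ e : Fin n × Fin n with e.1 < e.2,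
        (P⟦Y e.1 e.2 ⁻¹' A e.1 e.2 | labelSigma U⟧) ω
  condLaw_edge : ∀ v w, v < w → ∀ A : Set ℝ, MeasurableSet A →
    P⟦Y v w ⁻¹' A | labelSigma U⟧ =ᵐ[P] P⟦Y v w ⁻¹' A | pairSigma U v w⟧
  condExp_edge : ∀ v w, v < w →
    P[Y v w | labelSigma U] =ᵐ[P] fun ω => κ.toFun (U v ω) (U w ω)

/-- The simplex `0 ≤ x₁ ≤ ⋯ ≤ x_k ≤ 1`. -/
def orderedSimplex (k : ℕ) : Set (Fin k → ℝ) :=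
  {x | (∀ v, x v ∈ Set.Icc (0 : ℝ) 1) ∧ Monotone x}

open Classical in
/-- The index set of strictly increasing `k`-tuples of vertices. -/
noncomputable def increasingTuples (n k : ℕ) : Finset (Fin k → Fin n) :=
  Finset.univ.filter StrictMono

/-- The point `a / n`; the vertex `a : Fin n` is the `(a + 1)`-st one. -/
noncomputable def latticePoint {n k : ℕ} (a : Fin k → Fin n) : Fin k → ℝ :=
  fun v => (((a v : ℕ) : ℝ) + 1) / (n : ℝ)

open Classical in
/-- The edges of a graph on `Fin k`, each written once, as an increasing pair. -/
noncomputable def orderedEdges {k : ℕ} (F : SimpleGraph (Fin k)) : Finset (Fin k × Fin k) :=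
  Finset.univ.filter fun e => e.1 < e.2 ∧ F.Adj e.1 e.2

/-- The normalised, weighted, centred count of the graph `F` on the vertex set `Fin k`. -/
noncomputable def centredCount {n : ℕ} {Ω : Type*} [MeasurableSpace Ω] (P : Measure Ω)
    (κ : Graphon) (U : Fin n → Ω → I) (Y : Fin n → Fin n → Ω → ℝ)
    {k : ℕ} (F : SimpleGraph (Fin k)) (φ : (Fin k → ℝ) → ℝ) (ψ : (Fin k → I) → ℝ) (ω : Ω) : ℝ :=
  if k = 1 then
    (√(n : ℝ))⁻¹ * ∑ a : Fin n, φ (latticePoint fun _ => a) *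
      (ψ (fun _ => U a ω) - ∫ ω', ψ (fun _ => U a ω') ∂P)
  else
    (√(n.choose k : ℝ))⁻¹ * ∑ a ∈ increasingTuples n k,
      φ (latticePoint a) * ψ (fun v => U (a v) ω) *
        ∏ e ∈ orderedEdges F,
          (Y (a e.1) (a e.2) ω - κ.toFun (U (a e.1) ω) (U (a e.2) ω))

/-- The two graphs, on `Fin k` and `Fin l`, are equal (not just isomorphic). -/
def SameGraph {k l : ℕ} (F : SimpleGraph (Fin k)) (H : SimpleGraph (Fin l)) : Prop :=
  ∃ h : k = l, ∀ v w, F.Adj v w ↔ H.Adj (Fin.cast h v) (Fin.cast h w)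

open Classical in
/-- The explicit covariance matrix, for edge variables whose conditional variances given
the labels are `V v w`. -/
noncomputable def countCov {n : ℕ} {Ω : Type*} [MeasurableSpace Ω] (P : Measure Ω)
    (U : Fin n → Ω → I) (V : Fin n → Fin n → Ω → ℝ)
    {d : ℕ} {k : Fin d → ℕ} (F : ∀ i, SimpleGraph (Fin (k i)))
    (φ : ∀ i, (Fin (k i) → ℝ) → ℝ) (ψ : ∀ i, (Fin (k i) → I) → ℝ) :
    Matrix (Fin d) (Fin d) ℝ :=
  Matrix.of fun i j =>
    if k i = 1 ∧ k j = 1 then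
      (n : ℝ)⁻¹ * ∑ a : Fin n,
        φ i (latticePoint fun _ => a) * φ j (latticePoint fun _ => a) *
          cov[fun ω => ψ i fun _ => U a ω, fun ω => ψ j fun _ => U a ω; P]
    else if h : SameGraph (F j) (F i) then
      (n.choose (k i) : ℝ)⁻¹ * ∑ a ∈ increasingTuples n (k i),
        φ i (latticePoint a) * φ j (latticePoint fun v => a (Fin.cast h.1 v)) *
          ∫ ω, ψ i (fun v => U (a v) ω) * ψ j (fun v => U (a (Fin.cast h.1 v)) ω) *
            ∏ e ∈ orderedEdges (F i), V (a e.1) (a e.2) ω ∂P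
    else 0

/-- The partial derivative `∂ᵢ g`. -/
noncomputable def partialDeriv {d : ℕ} (i : Fin d) (g : EuclideanSpace ℝ (Fin d) → ℝ) :
    EuclideanSpace ℝ (Fin d) → ℝ :=
  fun x => lineDeriv ℝ g x (EuclideanSpace.single i 1)

/-- The iterated partial derivative `∂_{i₁} ⋯ ∂_{i_m} g` for `l = [i₁, …, i_m]`. -/
noncomputable def iterPartial {d : ℕ} (l : List (Fin d)) (g : EuclideanSpace ℝ (Fin d) → ℝ) :
    EuclideanSpace ℝ (Fin d) → ℝ :=
  l.foldr partialDeriv g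

/-- The partial derivative `∂₁^{α₁} ⋯ ∂_d^{α_d} g` for a multi-index `α`. -/
noncomputable def multiPartial {d : ℕ} (α : Fin d → ℕ) (g : EuclideanSpace ℝ (Fin d) → ℝ) :
    EuclideanSpace ℝ (Fin d) → ℝ :=
  iterPartial ((List.finRange d).flatMap fun i => List.replicate (α i) i) g

/-- `g` is `m` times partially differentiable: all partial derivatives of order at most `m`,
in any order of differentiation, exist everywhere. -/
def PartiallyDifferentiable {d : ℕ} (m : ℕ) (g : EuclideanSpace ℝ (Fin d) → ℝ) : Prop :=
  ∀ l : List (Fin d), l.length < m → ∀ (i : Fin d) (x : EuclideanSpace ℝ (Fin d)),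
    LineDifferentiableAt ℝ (iterPartial l g) x (EuclideanSpace.single i 1)

/-- The convex set distance between two laws on `ℝ^d`. -/
noncomputable def convexSetDist {d : ℕ} (μ ν : Measure (EuclideanSpace ℝ (Fin d))) : ℝ :=
  ⨆ A : {A : Set (EuclideanSpace ℝ (Fin d)) // Convex ℝ A ∧ MeasurableSet A},
    |μ.real A.1 - ν.real A.1|

/-! ### Bounded measurable functions -/

/-- Bounded measurable real functions. -/
structure BddMeas {α : Type*} [MeasurableSpace α] (G : α → ℝ) : Prop where
  measurable : Measurable G
  bounded : ∃ K, ∀ x, |G x| ≤ K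

namespace BddMeas

variable {α β : Type*} [MeasurableSpace α] [MeasurableSpace β] {F G : α → ℝ}

lemma const (c : ℝ) : BddMeas (fun _ : α => c) := ⟨measurable_const, |c|, fun _ => le_rfl⟩

lemma mul (hF : BddMeas F) (hG : BddMeas G) : BddMeas (fun x => F x * G x) := by
  obtain ⟨K, hK⟩ := hF.bounded
  obtain ⟨L, hL⟩ := hG.bounded
  refine ⟨hF.measurable.mul hG.measurable, K * L, fun x => ?_⟩
  rw [abs_mul]
  exact mul_le_mul (hK x) (hL x) (abs_nonneg _) ((abs_nonneg _).trans (hK x))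

lemma add (hF : BddMeas F) (hG : BddMeas G) : BddMeas (fun x => F x + G x) := by
  obtain ⟨K, hK⟩ := hF.bounded
  obtain ⟨L, hL⟩ := hG.bounded
  exact ⟨hF.measurable.add hG.measurable, K + L, fun x =>
    (abs_add_le _ _).trans (add_le_add (hK x) (hL x))⟩

lemma sub (hF : BddMeas F) (hG : BddMeas G) : BddMeas (fun x => F x - G x) := by
  simpa [sub_eq_add_neg] using hF.add ((const (-1)).mul hG)

lemma sum {ι : Type*} (s : Finset ι) {H : ι → α → ℝ} (h : ∀ i ∈ s, BddMeas (H i)) :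
    BddMeas (fun x => ∑ i ∈ s, H i x) := by
  classical
  induction s using Finset.induction_on with
  | empty => simpa using const 0
  | insert a s ha ih =>
    simp only [Finset.sum_insert ha]
    exact (h a (by simp)).add (ih fun i hi => h i (by simp [hi]))

lemma prod {ι : Type*} (s : Finset ι) {H : ι → α → ℝ} (h : ∀ i ∈ s, BddMeas (H i)) :
    BddMeas (fun x => ∏ i ∈ s, H i x) := by
  classical
  induction s using Finset.induction_on with
  | empty => simpa using const 1
  | insert a s ha ih =>
    simp only [Finset.prod_insert ha]
    exact (h a (by simp)).mul (ih fun i hi => h i (by simp [hi]))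

lemma comp (hF : BddMeas F) {g : β → α} (hg : Measurable g) : BddMeas (fun x => F (g x)) :=
  ⟨hF.measurable.comp hg, hF.bounded.imp fun _ hK x => hK (g x)⟩

lemma integrable (hF : BddMeas F) (μ : Measure α) [IsFiniteMeasure μ] : Integrable F μ := by
  obtain ⟨K, hK⟩ := hF.bounded
  exact Integrable.of_bound hF.measurable.aestronglyMeasurable K (.of_forall hK)

end BddMeas

/-! ### Averaging over some of the coordinates of a product space -/

section Resample

set_option linter.unusedSectionVars false

lemma integral_comp_measurePreserving {β γ : Type*} [MeasurableSpace β] [MeasurableSpace γ]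
    {μ : Measure β} {ν : Measure γ} {f : β → γ} (hf : MeasurePreserving f μ ν) {g : γ → ℝ}
    (hg : Measurable g) : ∫ x, g (f x) ∂μ = ∫ y, g y ∂ν := by
  rw [← hf.map_eq, integral_map hf.measurable.aemeasurable hg.aestronglyMeasurable]

variable {J α : Type*} [Fintype J] [DecidableEq J] [MeasurableSpace α]
  (μ : J → Measure α) [∀ j, IsProbabilityMeasure (μ j)]

/-- The average of `G` over the coordinates in `s`. -/
noncomputable def resample (s : Finset J) (G : (J → α) → ℝ) (x : J → α) : ℝ :=
  ∫ y, G (s.piecewise y x) ∂(Measure.pi μ)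

lemma measurable_piecewise_pair (s : Finset J) :
    Measurable (fun q : (J → α) × (J → α) => s.piecewise q.1 q.2) := by
  refine measurable_pi_lambda _ fun j => ?_
  by_cases h : j ∈ s
  · simp only [Finset.piecewise_eq_of_mem _ _ _ h]; fun_prop
  · simp only [Finset.piecewise_eq_of_notMem _ _ _ h]; fun_prop

lemma measurePreserving_piecewise (s : Finset J) :
    MeasurePreserving (fun q : (J → α) × (J → α) => s.piecewise q.1 q.2)
      ((Measure.pi μ).prod (Measure.pi μ)) (Measure.pi μ) := by
  refine ⟨measurable_piecewise_pair s, ?_⟩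
  refine (Measure.pi_eq fun A hA => ?_).symm
  rw [Measure.map_apply (measurable_piecewise_pair s) (MeasurableSet.univ_pi hA)]
  have : (fun q : (J → α) × (J → α) => s.piecewise q.1 q.2) ⁻¹' (Set.univ.pi A)
      = (Set.univ.pi fun j => if j ∈ s then A j else Set.univ) ×ˢ
        (Set.univ.pi fun j => if j ∈ s then Set.univ else A j) := by
    ext q
    simp only [Set.mem_preimage, Set.mem_pi, Set.mem_univ, true_implies, Set.mem_prod]
    constructor
    · intro h
      constructor
      · intro j; have := h j; by_cases hj : j ∈ s <;> simp_all
      · intro j; have := h j; by_cases hj : j ∈ s <;> simp_all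
    · rintro ⟨h1, h2⟩ j
      have h1 := h1 j; have h2 := h2 j
      by_cases hj : j ∈ s <;> simp_all
  rw [this, Measure.prod_prod, Measure.pi_pi, Measure.pi_pi, ← Finset.prod_mul_distrib]
  refine Finset.prod_congr rfl fun j _ => ?_
  by_cases hj : j ∈ s <;> simp [hj]

variable {F G : (J → α) → ℝ}

lemma BddMeas.piecewise (hG : BddMeas G) (s : Finset J) (x : J → α) :
    BddMeas (fun y => G (s.piecewise y x)) :=
  hG.comp ((measurable_piecewise_pair s).comp (measurable_id.prodMk measurable_const))

lemma BddMeas.piecewise_pair (hG : BddMeas G) (s : Finset J) :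
    BddMeas (fun q : (J → α) × (J → α) => G (s.piecewise q.1 q.2)) :=
  hG.comp (measurable_piecewise_pair s)

lemma abs_resample_le (s : Finset J) {K : ℝ} (hK : ∀ x, |G x| ≤ K) (x : J → α) :
    |resample μ s G x| ≤ K := by
  have := norm_integral_le_of_norm_le_const (μ := Measure.pi μ)
    (f := fun y => G (s.piecewise y x)) (C := K) (.of_forall fun y => hK _)
  simpa [resample] using this

lemma BddMeas.resample (hG : BddMeas G) (s : Finset J) : BddMeas (resample μ s G) := by
  refine ⟨?_, hG.bounded.imp fun K hK x => abs_resample_le μ s hK x⟩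
  have : StronglyMeasurable (Function.uncurry fun (x y : J → α) => G (s.piecewise y x)) :=
    (hG.measurable.comp ((measurable_piecewise_pair s).comp measurable_swap)).stronglyMeasurable
  exact this.integral_prod_right.measurable

lemma integral_resample (hG : BddMeas G) (s : Finset J) :
    ∫ x, resample μ s G x ∂(Measure.pi μ) = ∫ x, G x ∂(Measure.pi μ) := by
  rw [← integral_comp_measurePreserving (measurePreserving_piecewise μ s) hG.measurable,
    integral_prod_symm]
  · rfl
  · exact (hG.piecewise_pair s).integrable _

lemma resample_resample (hG : BddMeas G) (s t : Finset J) :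
    resample μ s (resample μ t G) = resample μ (s ∪ t) G := by
  funext x
  have key : ∀ y z : J → α, t.piecewise z (s.piecewise y x) =
      (s ∪ t).piecewise (t.piecewise z y) x := by
    intro y z; funext j
    by_cases h1 : j ∈ t <;> by_cases h2 : j ∈ s <;> simp [Finset.piecewise, h1, h2]
  calc resample μ s (resample μ t G) x
      = ∫ y, ∫ z, G ((s ∪ t).piecewise (t.piecewise z y) x) ∂(Measure.pi μ) ∂(Measure.pi μ) := by
        simp only [resample, key]
    _ = ∫ q, G ((s ∪ t).piecewise (t.piecewise q.1 q.2) x)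
          ∂((Measure.pi μ).prod (Measure.pi μ)) := by
        rw [integral_prod_symm]
        exact ((hG.piecewise (s ∪ t) x).piecewise_pair t).integrable _
    _ = resample μ (s ∪ t) G x :=
        integral_comp_measurePreserving (measurePreserving_piecewise μ t)
          (hG.piecewise (s ∪ t) x).measurable

lemma resample_mul {s : Finset J} (hG : DependsOn G ((s : Set J)ᶜ)) :
    resample μ s (fun x => F x * G x) = fun x => resample μ s F x * G x := by
  funext x
  have : ∀ y, G (s.piecewise y x) = G x := fun y => hG fun j hj => by
    simp only [Set.mem_compl_iff, Finset.mem_coe] at hj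
    simp [hj]
  simp [resample, this, integral_mul_const]

lemma dependsOn_resample {s : Finset J} {u : Set J} (hG : DependsOn G u) :
    DependsOn (resample μ s G) (u \ s) := by
  intro x x' h
  have : ∀ y, G (s.piecewise y x) = G (s.piecewise y x') := fun y => hG fun j hj => by
    by_cases hs : j ∈ s
    · simp [hs]
    · simp [hs, h j ⟨hj, by simpa using hs⟩]
  simp [resample, this]

lemma resample_eq_zero_mono (hF : BddMeas F) {s t : Finset J} (h : resample μ s F = 0)
    (hst : s ⊆ t) : resample μ t F = 0 := by
  rw [← Finset.union_eq_left.2 hst, ← resample_resample μ hF, h]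
  funext x; simp [resample]

lemma resample_resample_eq_zero (hF : BddMeas F) {s : Finset J} (t : Finset J)
    (h : resample μ s F = 0) : resample μ s (resample μ t F) = 0 := by
  rw [resample_resample μ hF, Finset.union_comm, ← resample_resample μ hF, h]
  funext x; simp [resample]

lemma integral_eq_zero_of_resample (hF : BddMeas F) {s : Finset J} (h : resample μ s F = 0) :
    ∫ x, F x ∂(Measure.pi μ) = 0 := by
  rw [← integral_resample μ hF s, h]; simp

lemma resample_mul_eq_zero {s : Finset J} (h : resample μ s F = 0)
    (hG : DependsOn G ((s : Set J)ᶜ)) : resample μ s (fun x => F x * G x) = 0 := by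
  rw [resample_mul μ hG, h]; funext x; simp

lemma integral_mul_eq_zero_of_resample (hF : BddMeas F) (hG' : BddMeas G) {s : Finset J}
    (h : resample μ s F = 0) (hG : DependsOn G ((s : Set J)ᶜ)) :
    ∫ x, F x * G x ∂(Measure.pi μ) = 0 :=
  integral_eq_zero_of_resample μ (hF.mul hG') (resample_mul_eq_zero μ h hG)

lemma integral_mul_resample (hF : BddMeas F) (hG' : BddMeas G) {s : Finset J}
    (hG : DependsOn G ((s : Set J)ᶜ)) :
    ∫ x, F x * G x ∂(Measure.pi μ) = ∫ x, resample μ s F x * G x ∂(Measure.pi μ) := by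
  rw [← integral_resample μ (hF.mul hG') s, resample_mul μ hG]

lemma integral_mul_of_disjoint (hF' : BddMeas F) (hG' : BddMeas G) {s t : Set J}
    (hF : DependsOn F s) (hG : DependsOn G t) (hst : Disjoint s t) :
    ∫ x, F x * G x ∂(Measure.pi μ) = (∫ x, F x ∂(Measure.pi μ)) * ∫ x, G x ∂(Measure.pi μ) := by
  classical
  let s' : Finset J := Finset.univ.filter (· ∈ s)
  have hs' : (s' : Set J) = s := by ext; simp [s']
  rw [integral_mul_resample μ hF' hG' (s := s') (hG.mono ?_), ← integral_const_mul]
  · refine integral_congr_ae (.of_forall fun x => ?_)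
    simp only
    congr 1
    exact integral_congr_ae (.of_forall fun y => hF fun j hj => by simp [s', hj])
  · rw [hs']; exact hst.subset_compl_left

lemma resample_singleton (j : J) (hG : Measurable G) (x : J → α) :
    resample μ {j} G x = ∫ z, G (Function.update x j z) ∂(μ j) := by
  have h : ∀ y : J → α, ({j} : Finset J).piecewise y x = Function.update x j (y j) := by
    intro y; exact Finset.piecewise_singleton _ _ _
  simp only [resample, h]
  exact integral_comp_measurePreserving (measurePreserving_eval μ j)
    (hG.comp (measurable_update x))

lemma resample_sum {ι : Type*} (u : Finset ι) {H : ι → (J → α) → ℝ} (h : ∀ i ∈ u, BddMeas (H i))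
    (s : Finset J) : resample μ s (fun x => ∑ i ∈ u, H i x) =
      fun x => ∑ i ∈ u, resample μ s (H i) x := by
  funext x
  exact integral_finsetSum _ fun i hi => ((h i hi).piecewise s x).integrable _

lemma resample_const_mul (c : ℝ) (s : Finset J) : resample μ s (fun x => c * G x) =
    fun x => c * resample μ s G x := by
  funext x
  exact integral_const_mul _ _

lemma resample_sub_const (hG : BddMeas G) (c : ℝ) (s : Finset J) :
    resample μ s (fun x => G x - c) = fun x => resample μ s G x - c := by
  funext x
  simp only [resample]
  rw [integral_sub ((hG.piecewise s x).integrable _) (integrable_const _)]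
  simp

end Resample


/-! ### Counting tuples with repeated vertices -/

section Counting

set_option linter.unusedSectionVars false

variable {V : Type*} [Fintype V] [DecidableEq V]

/-- The number of functions into `V` which hit `m` and at most `r` other points. -/
lemma card_filter_image_le {β : Type*} [Fintype β] [DecidableEq β] (m : V) (r : ℕ) :
    (Finset.univ.filter fun g : β → V =>
      m ∈ Finset.univ.image g ∧ (Finset.univ.image g).card ≤ r + 1).card
      ≤ (r + 1) ^ Fintype.card β * Fintype.card V ^ r := by
  have hsub : (Finset.univ.filter fun g : β → V =>
      m ∈ Finset.univ.image g ∧ (Finset.univ.image g).card ≤ r + 1) ⊆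
      (Finset.univ : Finset ((β → Option (Fin r)) × (Fin r → V))).image
        (fun q b => (q.1 b).elim m q.2) := by
    intro g hg
    simp only [Finset.mem_filter, Finset.mem_univ, true_and] at hg
    set T := (Finset.univ.image g).erase m with hT
    have hc : T.card ≤ r := by
      rw [hT, Finset.card_erase_of_mem hg.1]; omega
    obtain ⟨emb⟩ : Nonempty (T ↪ Fin r) :=
      Function.Embedding.nonempty_of_card_le (by simpa using hc)
    refine Finset.mem_image.2 ⟨(fun b => if h : g b = m then none else
      some (emb ⟨g b, by simp [hT, h]⟩),
      Function.extend emb (fun x => (x : V)) (fun _ => m)), Finset.mem_univ _, ?_⟩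
    funext b
    by_cases h : g b = m
    · simp [h]
    · simp [h, emb.injective.extend_apply]
  refine (Finset.card_le_card hsub).trans (Finset.card_image_le.trans ?_)
  simp [Finset.card_univ]

/-- The union of the ranges of four tuples. -/
def quadSupport {k l : ℕ} (q : ((Fin k → V) × (Fin l → V)) × ((Fin k → V) × (Fin l → V))) :
    Finset V :=
  (Finset.univ.image q.1.1 ∪ Finset.univ.image q.1.2) ∪
    (Finset.univ.image q.2.1 ∪ Finset.univ.image q.2.2)

lemma card_filter_quadSupport_le {k l : ℕ} (m : V) (r : ℕ) :
    (Finset.univ.filter fun q : ((Fin k → V) × (Fin l → V)) × ((Fin k → V) × (Fin l → V)) =>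
      m ∈ quadSupport q ∧ (quadSupport q).card ≤ r + 1).card
      ≤ (r + 1) ^ (2 * (k + l)) * Fintype.card V ^ r := by
  let f : ((Fin k → V) × (Fin l → V)) × ((Fin k → V) × (Fin l → V)) →
      ((Fin k ⊕ Fin l) ⊕ (Fin k ⊕ Fin l) → V) := fun q =>
    Sum.elim (Sum.elim q.1.1 q.1.2) (Sum.elim q.2.1 q.2.2)
  have hf : Function.Injective f := by
    rintro ⟨⟨a, b⟩, c, d⟩ ⟨⟨a', b'⟩, c', d'⟩ h
    simp only [f] at h
    have h1 := congrArg (fun g => g ∘ Sum.inl) h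
    have h2 := congrArg (fun g => g ∘ Sum.inr) h
    simp only [Sum.elim_comp_inl, Sum.elim_comp_inr] at h1 h2
    have h3 := congrArg (fun g => g ∘ Sum.inl) h1
    have h4 := congrArg (fun g => g ∘ Sum.inr) h1
    have h5 := congrArg (fun g => g ∘ Sum.inl) h2
    have h6 := congrArg (fun g => g ∘ Sum.inr) h2
    simp only [Sum.elim_comp_inl, Sum.elim_comp_inr] at h3 h4 h5 h6
    simp [h3, h4, h5, h6]
  have himg : ∀ q, Finset.univ.image (f q) = quadSupport q := by
    intro q
    ext v
    simp [f, quadSupport, or_assoc]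
  have := card_filter_image_le (β := (Fin k ⊕ Fin l) ⊕ (Fin k ⊕ Fin l)) m r
  have hcard : Fintype.card ((Fin k ⊕ Fin l) ⊕ (Fin k ⊕ Fin l)) = 2 * (k + l) := by
    simp; ring
  rw [hcard] at this
  refine le_trans ?_ this
  rw [← Finset.card_image_of_injective _ hf]
  refine Finset.card_le_card fun g hg => ?_
  obtain ⟨q, hq, rfl⟩ := Finset.mem_image.1 hg
  simp only [Finset.mem_filter, Finset.mem_univ, true_and] at hq ⊢
  rwa [himg]

/-- The number of the four sets that contain `v`. -/
def multiplicity4 (A : Fin 4 → Finset V) (v : V) : ℕ :=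
  (Finset.univ.filter fun q => v ∈ A q).card

lemma sum_multiplicity4 (A : Fin 4 → Finset V) :
    ∑ v ∈ Finset.univ.biUnion A, multiplicity4 A v = ∑ q, (A q).card := by
  simp only [multiplicity4, Finset.card_filter]
  rw [Finset.sum_comm]
  refine Finset.sum_congr rfl fun q _ => ?_
  rw [← Finset.sum_filter, ← Finset.card_eq_sum_ones]
  congr 1
  ext v
  simp only [Finset.mem_filter, Finset.mem_biUnion, Finset.mem_univ, true_and]
  exact ⟨fun h => h.2, fun h => ⟨⟨q, h⟩, h⟩⟩

variable {A : Fin 4 → Finset V} {m : V}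

lemma two_le_multiplicity4 {v : V} {q q' : Fin 4} (h : q' ≠ q) (hq : v ∈ A q) (hq' : v ∈ A q') :
    2 ≤ multiplicity4 A v :=
  Finset.one_lt_card.2 ⟨q, by simpa using hq, q', by simpa using hq', h.symm⟩

lemma three_le_multiplicity4 {v : V} {q q' q'' : Fin 4} (h : q ≠ q') (h' : q ≠ q'')
    (h'' : q' ≠ q'') (hq : v ∈ A q) (hq' : v ∈ A q') (hq'' : v ∈ A q'') :
    3 ≤ multiplicity4 A v :=
  Finset.two_lt_card.2 ⟨q, by simpa using hq, q', by simpa using hq', q'',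
    by simpa using hq'', h, h', h''⟩

lemma two_mul_card_biUnion_add_two_le (hm : ∀ q, m ∈ A q)
    (hv : ∀ q, ∀ v ∈ A q, v ≠ m → ∃ q' ≠ q, v ∈ A q') :
    2 * (Finset.univ.biUnion A).card + 2 ≤ ∑ q, (A q).card := by
  have hmU : m ∈ Finset.univ.biUnion A := Finset.mem_biUnion.2 ⟨0, Finset.mem_univ _, hm 0⟩
  have h4 : multiplicity4 A m = 4 := by simp [multiplicity4, hm]
  rw [← sum_multiplicity4, ← Finset.add_sum_erase _ _ hmU, h4,
    ← Finset.card_erase_add_one hmU]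
  have : ((Finset.univ.biUnion A).erase m).card * 2 ≤
      ∑ v ∈ (Finset.univ.biUnion A).erase m, multiplicity4 A v := by
    rw [← smul_eq_mul]
    refine Finset.card_nsmul_le_sum _ _ _ fun v hv' => ?_
    obtain ⟨h1, h2⟩ := Finset.mem_erase.1 hv'
    obtain ⟨q, -, hq⟩ := Finset.mem_biUnion.1 h2
    obtain ⟨q', hne, hq'⟩ := hv q v hq h1
    exact two_le_multiplicity4 hne hq hq'
  omega

lemma two_mul_card_biUnion_add_three_le (hm : ∀ q, m ∈ A q)
    (hv : ∀ q, ∀ v ∈ A q, v ≠ m → ∃ q' ≠ q, v ∈ A q') {w : V} (hw : w ≠ m)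
    (hw3 : 3 ≤ multiplicity4 A w) :
    2 * (Finset.univ.biUnion A).card + 3 ≤ ∑ q, (A q).card := by
  have hmU : m ∈ Finset.univ.biUnion A := Finset.mem_biUnion.2 ⟨0, Finset.mem_univ _, hm 0⟩
  have h4 : multiplicity4 A m = 4 := by simp [multiplicity4, hm]
  have hwU : w ∈ (Finset.univ.biUnion A).erase m := by
    refine Finset.mem_erase.2 ⟨hw, Finset.mem_biUnion.2 ?_⟩
    obtain ⟨q, hq⟩ := Finset.card_pos.1 (show 0 < multiplicity4 A w by omega)
    exact ⟨q, Finset.mem_univ _, (Finset.mem_filter.1 hq).2⟩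
  rw [← sum_multiplicity4, ← Finset.add_sum_erase _ _ hmU, h4,
    ← Finset.card_erase_add_one hmU, ← Finset.add_sum_erase _ _ hwU,
    ← Finset.card_erase_add_one hwU]
  have : (((Finset.univ.biUnion A).erase m).erase w).card * 2 ≤
      ∑ v ∈ ((Finset.univ.biUnion A).erase m).erase w, multiplicity4 A v := by
    rw [← smul_eq_mul]
    refine Finset.card_nsmul_le_sum _ _ _ fun v hv' => ?_
    obtain ⟨h1, h2⟩ := Finset.mem_erase.1 (Finset.mem_of_mem_erase hv')
    obtain ⟨q, -, hq⟩ := Finset.mem_biUnion.1 h2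
    obtain ⟨q', hne, hq'⟩ := hv q v hq h1
    exact two_le_multiplicity4 hne hq hq'
  omega

variable {E : Fin 4 → Finset (V × V)}

lemma exists_ne_mem_of_edges
    (hE : ∀ q, ∀ e ∈ E q, e.1 ∈ A q ∧ e.2 ∈ A q)
    (hconn : ∀ q, ∀ T : Set V, m ∈ T → (∀ e ∈ E q, e.1 ∈ T ↔ e.2 ∈ T) → ∀ v ∈ A q, v ∈ T)
    (hrep : ∀ q, ∀ e ∈ E q, ∃ q' ≠ q, e ∈ E q') :
    ∀ q, ∀ v ∈ A q, v ≠ m → ∃ q' ≠ q, v ∈ A q' := by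
  intro q v hv hvm
  by_contra hcon
  push Not at hcon
  refine hconn q {v}ᶜ (by simpa using hvm.symm) (fun e he => ?_) v hv rfl
  obtain ⟨q', hne, he'⟩ := hrep q e he
  have h := hE q' e he'
  have h1 : e.1 ≠ v := fun h1 => hcon q' hne (h1 ▸ h.1)
  have h2 : e.2 ≠ v := fun h2 => hcon q' hne (h2 ▸ h.2)
  simp [h1, h2]

lemma not_mem_of_multiplicity4_le
    (hE : ∀ q, ∀ e ∈ E q, e.1 ∈ A q ∧ e.2 ∈ A q)
    (hconn : ∀ q, ∀ T : Set V, m ∈ T → (∀ e ∈ E q, e.1 ∈ T ↔ e.2 ∈ T) → ∀ v ∈ A q, v ∈ T)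
    (hrep : ∀ q, ∀ e ∈ E q, ∃ q' ≠ q, e ∈ E q')
    (hmult : ∀ v, v ≠ m → multiplicity4 A v ≤ 2)
    {q₀ q₁ q₂ q₃ : Fin 4} (h01 : q₀ ≠ q₁) (h02 : q₀ ≠ q₂) (h03 : q₀ ≠ q₃) (h12 : q₁ ≠ q₂)
    (h13 : q₁ ≠ q₃) (hall : ∀ q, q = q₀ ∨ q = q₁ ∨ q = q₂ ∨ q = q₃)
    (hmatch : ∀ e ∈ E q₀, (e.1 = m ∨ e.2 = m) → e ∈ E q₁) :
    ∀ v ∈ A q₀, v = m ∨ (v ∉ A q₂ ∧ v ∉ A q₃) := by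
  have good : ∀ v, v ≠ m → v ∈ A q₀ → v ∈ A q₁ → v ∉ A q₂ ∧ v ∉ A q₃ := by
    intro v hv h0 h1
    constructor
    · intro h2
      have := three_le_multiplicity4 h01 h02 h12 h0 h1 h2
      have := hmult v hv; omega
    · intro h3
      have := three_le_multiplicity4 h01 h03 h13 h0 h1 h3
      have := hmult v hv; omega
  have step : ∀ e ∈ E q₀, ∀ v w, ((v = e.1 ∧ w = e.2) ∨ (v = e.2 ∧ w = e.1)) →
      (v = m ∨ (v ∉ A q₂ ∧ v ∉ A q₃)) → (w = m ∨ (w ∉ A q₂ ∧ w ∉ A q₃)) := by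
    intro e he v w hvw hv
    by_cases hwm : w = m
    · exact Or.inl hwm
    right
    have he1 : e ∈ E q₁ := by
      rcases hv with hv | ⟨hv2, hv3⟩
      · refine hmatch e he ?_
        rcases hvw with ⟨h, -⟩ | ⟨h, -⟩
        · exact Or.inl (h ▸ hv)
        · exact Or.inr (h ▸ hv)
      · obtain ⟨q', hne, he'⟩ := hrep _ e he
        have hA := hE q' e he'
        have hvA : v ∈ A q' := by
          rcases hvw with ⟨h, -⟩ | ⟨h, -⟩
          · exact h ▸ hA.1
          · exact h ▸ hA.2
        rcases hall q' with rfl | rfl | rfl | rfl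
        · exact absurd rfl hne
        · exact he'
        · exact absurd hvA hv2
        · exact absurd hvA hv3
    have hA0 := hE _ e he
    have hA1 := hE _ e he1
    rcases hvw with ⟨-, h⟩ | ⟨-, h⟩
    · exact good w hwm (h ▸ hA0.2) (h ▸ hA1.2)
    · exact good w hwm (h ▸ hA0.1) (h ▸ hA1.1)
  exact fun v hv => hconn q₀ {v | v = m ∨ (v ∉ A q₂ ∧ v ∉ A q₃)} (Or.inl rfl)
    (fun e he => ⟨step e he _ _ (Or.inl ⟨rfl, rfl⟩), step e he _ _ (Or.inr ⟨rfl, rfl⟩)⟩) v hv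

/-- If every edge is repeated, the first two copies agree at `m` and some vertex other than `m` is
common to the first two and the last two copies, then the copies overlap more than pairwise. -/
lemma two_mul_card_biUnion_add_three_le_of_edges (hm : ∀ q, m ∈ A q)
    (hE : ∀ q, ∀ e ∈ E q, e.1 ∈ A q ∧ e.2 ∈ A q)
    (hconn : ∀ q, ∀ T : Set V, m ∈ T → (∀ e ∈ E q, e.1 ∈ T ↔ e.2 ∈ T) → ∀ v ∈ A q, v ∈ T)
    (hrep : ∀ q, ∀ e ∈ E q, ∃ q' ≠ q, e ∈ E q')
    (hmatch : ∀ e : V × V, (e.1 = m ∨ e.2 = m) → (e ∈ E 0 ↔ e ∈ E 1))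
    {v : V} (hvm : v ≠ m) (hv01 : v ∈ A 0 ∪ A 1) (hv23 : v ∈ A 2 ∪ A 3) :
    2 * (Finset.univ.biUnion A).card + 3 ≤ ∑ q, (A q).card := by
  have hv := exists_ne_mem_of_edges hE hconn hrep
  by_cases hmult : ∀ w, w ≠ m → multiplicity4 A w ≤ 2
  · exfalso
    have h0 := not_mem_of_multiplicity4_le hE hconn hrep hmult (q₀ := 0) (q₁ := 1) (q₂ := 2)
      (q₃ := 3) (by decide) (by decide) (by decide) (by decide) (by decide) (by decide)
      (fun e he h => (hmatch e h).1 he)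
    have h1 := not_mem_of_multiplicity4_le hE hconn hrep hmult (q₀ := 1) (q₁ := 0) (q₂ := 2)
      (q₃ := 3) (by decide) (by decide) (by decide) (by decide) (by decide) (by decide)
      (fun e he h => (hmatch e h).2 he)
    rw [Finset.mem_union] at hv01 hv23
    have : v ∉ A 2 ∧ v ∉ A 3 := by
      rcases hv01 with h | h
      · exact (h0 v h).resolve_left hvm
      · exact (h1 v h).resolve_left hvm
    tauto
  · push Not at hmult
    obtain ⟨w, hw, hw3⟩ := hmult
    exact two_mul_card_biUnion_add_three_le hm hv hw hw3

end Counting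

/-! ### Copies of a graph -/

section Copies

variable {n k : ℕ}

/-- The edges of the copy of `F` on the vertices `a`. -/
noncomputable def edgeImage (F : SimpleGraph (Fin k)) (a : Fin k → Fin n) :
    Finset (Fin n × Fin n) :=
  (orderedEdges F).image fun e => (a e.1, a e.2)

lemma mem_orderedEdges {F : SimpleGraph (Fin k)} {e : Fin k × Fin k} :
    e ∈ orderedEdges F ↔ e.1 < e.2 ∧ F.Adj e.1 e.2 := by
  simp [orderedEdges]

lemma mem_edgeImage {F : SimpleGraph (Fin k)} {a : Fin k → Fin n} {e : Fin n × Fin n} :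
    e ∈ edgeImage F a ↔ ∃ v w, v < w ∧ F.Adj v w ∧ e = (a v, a w) := by
  simp only [edgeImage, Finset.mem_image, mem_orderedEdges, Prod.exists]
  constructor
  · rintro ⟨v, w, ⟨h1, h2⟩, rfl⟩; exact ⟨v, w, h1, h2, rfl⟩
  · rintro ⟨v, w, h1, h2, rfl⟩; exact ⟨v, w, ⟨h1, h2⟩, rfl⟩

lemma mem_image_of_mem_edgeImage {F : SimpleGraph (Fin k)} {a : Fin k → Fin n}
    {e : Fin n × Fin n} (he : e ∈ edgeImage F a) :
    e.1 ∈ Finset.univ.image a ∧ e.2 ∈ Finset.univ.image a := by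
  obtain ⟨v, w, -, -, rfl⟩ := mem_edgeImage.1 he
  simp

lemma mem_of_edgeImage_closed {F : SimpleGraph (Fin k)} (hF : F.Connected) {a : Fin k → Fin n}
    {m : Fin n} (hm : m ∈ Finset.univ.image a) (T : Set (Fin n)) (hT : m ∈ T)
    (hcl : ∀ e ∈ edgeImage F a, e.1 ∈ T ↔ e.2 ∈ T) :
    ∀ v ∈ Finset.univ.image a, v ∈ T := by
  obtain ⟨u, -, rfl⟩ := Finset.mem_image.1 hm
  intro v hv
  obtain ⟨w, -, rfl⟩ := Finset.mem_image.1 hv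
  obtain ⟨p⟩ := hF.preconnected u w
  have hadj : ∀ x y, F.Adj x y → (a x ∈ T ↔ a y ∈ T) := by
    intro x y h
    rcases lt_or_gt_of_ne h.ne with hlt | hlt
    · exact hcl _ (mem_edgeImage.2 ⟨x, y, hlt, h, rfl⟩)
    · exact (hcl _ (mem_edgeImage.2 ⟨y, x, hlt, h.symm, rfl⟩)).symm
  clear hv hm
  induction p with
  | nil => exact hT
  | cons h p ih => exact ih ((hadj _ _ h).1 hT)

lemma exists_edge_of_connected {F : SimpleGraph (Fin k)} (hF : F.Connected) (hk : k ≠ 1)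
    (a : Fin k → Fin n) (v : Fin k) : ∃ e ∈ edgeImage F a, e.1 = a v ∨ e.2 = a v := by
  have : 0 < k := v.pos
  have : Nontrivial (Fin k) := Fin.nontrivial_iff_two_le.2 (by omega)
  obtain ⟨w, hw⟩ := hF.preconnected.exists_adj_of_nontrivial v
  rcases lt_or_gt_of_ne hw.ne with hlt | hlt
  · exact ⟨_, mem_edgeImage.2 ⟨v, w, hlt, hw, rfl⟩, Or.inl rfl⟩
  · exact ⟨_, mem_edgeImage.2 ⟨w, v, hlt, hw.symm, rfl⟩, Or.inr rfl⟩

lemma mem_increasingTuples {a : Fin k → Fin n} : a ∈ increasingTuples n k ↔ StrictMono a := by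
  simp [increasingTuples]

open Classical in
/-- The increasing tuples with last vertex `m`. -/
noncomputable def tuplesEndingAt (n k : ℕ) (m : Fin n) : Finset (Fin k → Fin n) :=
  (increasingTuples n k).filter fun a => IsGreatest (Set.range a) m

lemma mem_tuplesEndingAt {a : Fin k → Fin n} {m : Fin n} :
    a ∈ tuplesEndingAt n k m ↔ StrictMono a ∧ IsGreatest (Set.range a) m := by
  simp [tuplesEndingAt, mem_increasingTuples]

lemma mem_image_of_mem_tuplesEndingAt {a : Fin k → Fin n} {m : Fin n}
    (h : a ∈ tuplesEndingAt n k m) : m ∈ Finset.univ.image a := by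
  obtain ⟨v, hv⟩ := (mem_tuplesEndingAt.1 h).2.1
  exact Finset.mem_image.2 ⟨v, Finset.mem_univ _, hv⟩

lemma sum_tuplesEndingAt (hk : k ≠ 0) (f : (Fin k → Fin n) → ℝ) :
    ∑ m, ∑ a ∈ tuplesEndingAt n k m, f a = ∑ a ∈ increasingTuples n k, f a := by
  classical
  have hk' : k - 1 < k := by omega
  have hgreat : ∀ a ∈ increasingTuples n k, IsGreatest (Set.range a) (a ⟨k - 1, hk'⟩) := by
    refine fun a ha => ⟨⟨_, rfl⟩, ?_⟩
    rintro _ ⟨v, rfl⟩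
    refine (mem_increasingTuples.1 ha).monotone ?_
    simp only [Fin.le_def]
    omega
  simp only [tuplesEndingAt, Finset.sum_filter]
  rw [Finset.sum_comm]
  refine Finset.sum_congr rfl fun a ha => ?_
  rw [Finset.sum_eq_single (a ⟨k - 1, hk'⟩)]
  · rw [if_pos]; exact hgreat a ha
  · intro m _ hm
    rw [if_neg]
    exact fun h => hm (h.unique (hgreat a ha))
  · simp

end Copies


/-! ### Centred families of statistics indexed by tuples of vertices -/

section Families

set_option linter.unusedSectionVars false

/-- The coordinates of the canonical space: one for each vertex, one for each pair of vertices. -/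
abbrev Coord (n : ℕ) := Fin n ⊕ (Fin n × Fin n)

variable {n : ℕ}

/-- The coordinates that belong to a copy of `F`. -/
def copyCoords {k : ℕ} (F : SimpleGraph (Fin k)) (a : Fin k → Fin n) : Set (Coord n) :=
  {j | Sum.elim (fun v => v ∈ Finset.univ.image a) (fun e => e ∈ edgeImage F a) j}

/-- The coordinates that belong to the vertex `m`. -/
def vertexCoords (m : Fin n) : Finset (Coord n) :=
  ({m} : Finset (Fin n)).disjSum (Finset.univ.filter fun e => e.1 = m ∨ e.2 = m)

@[simp] lemma inl_mem_copyCoords {k : ℕ} {F : SimpleGraph (Fin k)} {a : Fin k → Fin n}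
    {v : Fin n} : (Sum.inl v : Coord n) ∈ copyCoords F a ↔ v ∈ Finset.univ.image a := Iff.rfl

@[simp] lemma inr_mem_copyCoords {k : ℕ} {F : SimpleGraph (Fin k)} {a : Fin k → Fin n}
    {e : Fin n × Fin n} : (Sum.inr e : Coord n) ∈ copyCoords F a ↔ e ∈ edgeImage F a := Iff.rfl

@[simp] lemma inl_mem_vertexCoords {v m : Fin n} :
    (Sum.inl v : Coord n) ∈ vertexCoords m ↔ v = m := by simp [vertexCoords]

@[simp] lemma inr_mem_vertexCoords {e : Fin n × Fin n} {m : Fin n} :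
    (Sum.inr e : Coord n) ∈ vertexCoords m ↔ e.1 = m ∨ e.2 = m := by simp [vertexCoords]

/-- A family of bounded statistics, one for each copy of `F`, each depending only on the
coordinates of its copy and centred in every edge (in the vertex if there is only one). -/
structure CentredFamily (μ : Coord n → Measure I) {k : ℕ} (F : SimpleGraph (Fin k))
    (X : (Fin k → Fin n) → (Coord n → I) → ℝ) (K : ℝ) : Prop where
  measurable : ∀ a, StrictMono a → Measurable (X a)
  bound : ∀ a, StrictMono a → ∀ x, |X a x| ≤ K
  dependsOn : ∀ a, StrictMono a → DependsOn (X a) (copyCoords F a)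
  centred_edge : ∀ a, StrictMono a → ∀ e ∈ edgeImage F a, resample μ {Sum.inr e} (X a) = 0
  centred_vertex : k = 1 → ∀ a, StrictMono a → ∀ v, resample μ {Sum.inl (a v)} (X a) = 0

variable {μ : Coord n → Measure I} [∀ j, IsProbabilityMeasure (μ j)] {k l : ℕ}
  {F : SimpleGraph (Fin k)} {H : SimpleGraph (Fin l)}
  {X : (Fin k → Fin n) → (Coord n → I) → ℝ} {X' : (Fin l → Fin n) → (Coord n → I) → ℝ} {K : ℝ}

lemma integral_sum_sq_le {Ω ι : Type*} [MeasurableSpace Ω] (P : Measure Ω) [IsProbabilityMeasure P]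
    [DecidableEq ι]
    (s : Finset ι) (Y : ι → Ω → ℝ) (hY : ∀ p ∈ s, BddMeas (Y p)) {K : ℝ}
    (hK : ∀ p ∈ s, ∀ ω, |Y p ω| ≤ K) (bad : Finset (ι × ι))
    (hbad : ∀ p ∈ s, ∀ q ∈ s, ∫ ω, Y p ω * Y q ω ∂P ≠ 0 → (p, q) ∈ bad) :
    ∫ ω, (∑ p ∈ s, Y p ω) ^ 2 ∂P ≤ K ^ 2 * bad.card := by
  have h1 : ∫ ω, (∑ p ∈ s, Y p ω) ^ 2 ∂P = ∑ p ∈ s, ∑ q ∈ s, ∫ ω, Y p ω * Y q ω ∂P := by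
    simp only [sq, Finset.sum_mul_sum]
    rw [integral_finsetSum]
    · refine Finset.sum_congr rfl fun p hp => integral_finsetSum _ fun q hq => ?_
      exact ((hY p hp).mul (hY q hq)).integrable _
    · exact fun p hp => (BddMeas.sum s fun q hq => (hY p hp).mul (hY q hq)).integrable _
  rw [h1, ← Finset.sum_product']
  have h2 : ∀ r ∈ s ×ˢ s, ∫ ω, Y r.1 ω * Y r.2 ω ∂P ≤ if r ∈ bad then K ^ 2 else 0 := by
    intro r hr
    obtain ⟨hp, hq⟩ := Finset.mem_product.1 hr
    split_ifs with hb
    · have : ∀ ω, ‖Y r.1 ω * Y r.2 ω‖ ≤ K ^ 2 := fun ω => by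
        rw [Real.norm_eq_abs, abs_mul, sq]
        exact mul_le_mul (hK _ hp ω) (hK _ hq ω) (abs_nonneg _)
          ((abs_nonneg _).trans (hK _ hp ω))
      have := norm_integral_le_of_norm_le_const (μ := P) (.of_forall this)
      simp only [probReal_univ, mul_one] at this
      exact (le_abs_self _).trans this
    · by_contra hne
      exact hb (hbad _ hp _ hq (not_le.1 hne).ne')
  refine (Finset.sum_le_sum h2).trans ?_
  rw [← Finset.sum_filter, Finset.sum_const, nsmul_eq_mul, mul_comm]
  refine mul_le_mul_of_nonneg_left ?_ (sq_nonneg K)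
  exact_mod_cast Finset.card_le_card fun r hr => (Finset.mem_filter.1 hr).2

namespace CentredFamily

lemma bddMeas (hX : CentredFamily μ F X K) {a : Fin k → Fin n} (ha : StrictMono a) :
    BddMeas (X a) := ⟨hX.measurable a ha, K, hX.bound a ha⟩

lemma dependsOn_compl (hX : CentredFamily μ F X K) {a : Fin k → Fin n} (ha : StrictMono a)
    {e : Fin n × Fin n} (he : e ∉ edgeImage F a) :
    DependsOn (X a) ((({Sum.inr e} : Finset (Coord n)) : Set (Coord n))ᶜ) := by
  refine (hX.dependsOn a ha).mono fun j hj => ?_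
  simp only [Finset.coe_singleton, Set.mem_compl_iff, Set.mem_singleton_iff]
  rintro rfl
  exact he hj

/-- Averaging over the coordinates of a vertex annihilates the statistics of its copies. -/
lemma resample_vertexCoords (hX : CentredFamily μ F X K) (hF : F.Connected)
    {a : Fin k → Fin n} {m : Fin n} (ha : a ∈ tuplesEndingAt n k m) :
    resample μ (vertexCoords m) (X a) = 0 := by
  obtain ⟨hmono, ⟨v, rfl⟩, -⟩ := mem_tuplesEndingAt.1 ha
  by_cases hk : k = 1
  · exact resample_eq_zero_mono μ (hX.bddMeas hmono) (hX.centred_vertex hk a hmono v)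
      (by simp)
  · obtain ⟨e, he, hev⟩ := exists_edge_of_connected hF hk a v
    exact resample_eq_zero_mono μ (hX.bddMeas hmono) (hX.centred_edge a hmono e he)
      (by simpa using hev)

lemma integral_mul_sum_eq_zero (hX : CentredFamily μ F X K) (hF : F.Connected) (m : Fin n)
    {f : (Coord n → I) → ℝ} (hf : BddMeas f) (hfd : DependsOn f ((vertexCoords m : Set (Coord n))ᶜ)) :
    ∫ x, f x * ∑ a ∈ tuplesEndingAt n k m, X a x ∂(Measure.pi μ) = 0 := by
  simp only [mul_comm (f _)]
  have hb : ∀ a ∈ tuplesEndingAt n k m, BddMeas (X a) := fun a ha =>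
    hX.bddMeas (mem_tuplesEndingAt.1 ha).1
  refine integral_mul_eq_zero_of_resample μ (BddMeas.sum _ hb) hf ?_ hfd
  rw [resample_sum μ _ hb]
  funext x
  exact Finset.sum_eq_zero fun a ha => congrFun (hX.resample_vertexCoords hF ha) x

/-- The statistics of a copy do not depend on later vertices. -/
lemma dependsOn_vertexCoords_compl (hX : CentredFamily μ F X K) {m m' : Fin n} (hm : m' < m)
    {a : Fin k → Fin n} (ha : a ∈ tuplesEndingAt n k m') :
    DependsOn (X a) ((vertexCoords m : Set (Coord n))ᶜ) := by
  obtain ⟨hmono, -, hub⟩ := mem_tuplesEndingAt.1 ha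
  have hne : ∀ v ∈ Finset.univ.image a, v ≠ m := by
    intro v hv h
    obtain ⟨u, -, rfl⟩ := Finset.mem_image.1 hv
    exact absurd (hub ⟨u, rfl⟩) (by rw [h]; exact not_le.2 hm)
  refine (hX.dependsOn a hmono).mono fun j hj => ?_
  rcases j with v | e
  · simpa using hne v hj
  · have := mem_image_of_mem_edgeImage hj
    simpa using ⟨hne _ this.1, hne _ this.2⟩

/-- The product of the statistics of two copies, averaged over the coordinates of `m`
and centred. -/
noncomputable def pairResidual (μ : Coord n → Measure I)
    (X : (Fin k → Fin n) → (Coord n → I) → ℝ) (X' : (Fin l → Fin n) → (Coord n → I) → ℝ)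
    (m : Fin n) (p : (Fin k → Fin n) × (Fin l → Fin n)) (x : Coord n → I) : ℝ :=
  resample μ (vertexCoords m) (fun x => X p.1 x * X' p.2 x) x -
    ∫ x, X p.1 x * X' p.2 x ∂(Measure.pi μ)

section Pair

variable (hX : CentredFamily μ F X K) (hX' : CentredFamily μ H X' K)
  {p : (Fin k → Fin n) × (Fin l → Fin n)} (hp1 : StrictMono p.1) (hp2 : StrictMono p.2)

include hX hX' hp1 hp2

lemma bddMeas_pair : BddMeas (fun x => X p.1 x * X' p.2 x) :=
  (hX.bddMeas hp1).mul (hX'.bddMeas hp2)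

lemma abs_pair_le (x : Coord n → I) : |X p.1 x * X' p.2 x| ≤ K ^ 2 := by
  rw [abs_mul, sq]
  exact mul_le_mul (hX.bound _ hp1 x) (hX'.bound _ hp2 x) (abs_nonneg _)
    ((abs_nonneg _).trans (hX.bound _ hp1 x))

lemma bddMeas_pairResidual (m : Fin n) : BddMeas (pairResidual μ X X' m p) :=
  ((bddMeas_pair hX hX' hp1 hp2).resample μ _).sub (BddMeas.const _)

lemma abs_pairResidual_le (m : Fin n) (x : Coord n → I) :
    |pairResidual μ X X' m p x| ≤ 2 * K ^ 2 := by
  have h1 := abs_resample_le μ (vertexCoords m) (abs_pair_le hX hX' hp1 hp2) x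
  have h2 := norm_integral_le_of_norm_le_const (μ := Measure.pi μ)
    (.of_forall fun x => (Real.norm_eq_abs _).trans_le (abs_pair_le hX hX' hp1 hp2 x))
  simp only [probReal_univ, mul_one, Real.norm_eq_abs] at h2
  unfold pairResidual
  exact (abs_sub _ _).trans (by linarith)

lemma integral_pairResidual (m : Fin n) : ∫ x, pairResidual μ X X' m p x ∂(Measure.pi μ) = 0 := by
  unfold pairResidual
  rw [integral_sub (((bddMeas_pair hX hX' hp1 hp2).resample μ _).integrable _)
    (integrable_const _), integral_resample μ (bddMeas_pair hX hX' hp1 hp2)]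
  simp

lemma resample_pair_eq_zero {e : Fin n × Fin n}
    (he : ¬ (e ∈ edgeImage F p.1 ↔ e ∈ edgeImage H p.2)) :
    resample μ {Sum.inr e} (fun x => X p.1 x * X' p.2 x) = 0 := by
  by_cases h1 : e ∈ edgeImage F p.1
  · have h2 : e ∉ edgeImage H p.2 := by tauto
    exact resample_mul_eq_zero μ (hX.centred_edge _ hp1 e h1) (hX'.dependsOn_compl hp2 h2)
  · have h2 : e ∈ edgeImage H p.2 := by tauto
    simp only [mul_comm (X p.1 _)]
    exact resample_mul_eq_zero μ (hX'.centred_edge _ hp2 e h2) (hX.dependsOn_compl hp1 h1)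

lemma integral_pair_eq_zero {e : Fin n × Fin n}
    (he : ¬ (e ∈ edgeImage F p.1 ↔ e ∈ edgeImage H p.2)) :
    ∫ x, X p.1 x * X' p.2 x ∂(Measure.pi μ) = 0 :=
  integral_eq_zero_of_resample μ (bddMeas_pair hX hX' hp1 hp2)
    (resample_pair_eq_zero hX hX' hp1 hp2 he)

lemma resample_pairResidual_eq_zero (m : Fin n) {e : Fin n × Fin n}
    (he : ¬ (e ∈ edgeImage F p.1 ↔ e ∈ edgeImage H p.2)) :
    resample μ {Sum.inr e} (pairResidual μ X X' m p) = 0 := by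
  have : pairResidual μ X X' m p =
      resample μ (vertexCoords m) (fun x => X p.1 x * X' p.2 x) := by
    funext x
    rw [pairResidual, integral_pair_eq_zero hX hX' hp1 hp2 he, sub_zero]
  rw [this]
  exact resample_resample_eq_zero μ (bddMeas_pair hX hX' hp1 hp2) _
    (resample_pair_eq_zero hX hX' hp1 hp2 he)

lemma pairResidual_eq_zero (m : Fin n) {e : Fin n × Fin n} (hem : e.1 = m ∨ e.2 = m)
    (he : ¬ (e ∈ edgeImage F p.1 ↔ e ∈ edgeImage H p.2)) :
    pairResidual μ X X' m p = 0 := by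
  funext x
  rw [pairResidual, integral_pair_eq_zero hX hX' hp1 hp2 he, sub_zero,
    resample_eq_zero_mono μ (bddMeas_pair hX hX' hp1 hp2)
      (resample_pair_eq_zero hX hX' hp1 hp2 he) (by simpa using hem)]

lemma dependsOn_pair : DependsOn (fun x => X p.1 x * X' p.2 x)
    (copyCoords F p.1 ∪ copyCoords H p.2) := by
  intro x y h
  simp only
  rw [hX.dependsOn _ hp1 fun j hj => h j (Or.inl hj),
    hX'.dependsOn _ hp2 fun j hj => h j (Or.inr hj)]

lemma dependsOn_pairResidual (m : Fin n) : DependsOn (pairResidual μ X X' m p)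
    ((copyCoords F p.1 ∪ copyCoords H p.2) \ vertexCoords m) := by
  intro x y h
  unfold pairResidual
  rw [dependsOn_resample μ (dependsOn_pair hX hX' hp1 hp2) h]

end Pair

variable (hX : CentredFamily μ F X K) (hX' : CentredFamily μ H X' K)
  (hF : F.Connected) (hH : H.Connected) {m : Fin n}
  {p q : (Fin k → Fin n) × (Fin l → Fin n)}

/-- The vertex sets of the four copies. -/
def quadVertices (p q : (Fin k → Fin n) × (Fin l → Fin n)) : Fin 4 → Finset (Fin n) :=
  ![Finset.univ.image p.1, Finset.univ.image p.2, Finset.univ.image q.1, Finset.univ.image q.2]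

/-- The edge sets of the four copies. -/
noncomputable def quadEdges (F : SimpleGraph (Fin k)) (H : SimpleGraph (Fin l))
    (p q : (Fin k → Fin n) × (Fin l → Fin n)) : Fin 4 → Finset (Fin n × Fin n) :=
  ![edgeImage F p.1, edgeImage H p.2, edgeImage F q.1, edgeImage H q.2]

lemma biUnion_quadVertices (p q : (Fin k → Fin n) × (Fin l → Fin n)) :
    Finset.univ.biUnion (quadVertices p q) = quadSupport (p, q) := by
  ext v
  simp [quadVertices, quadSupport, Fin.exists_fin_succ]

lemma sum_card_quadVertices (h1 : StrictMono p.1) (h2 : StrictMono p.2) (h3 : StrictMono q.1)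
    (h4 : StrictMono q.2) : ∑ r, (quadVertices p q r).card = 2 * (k + l) := by
  simp [Fin.sum_univ_four, quadVertices, Finset.card_image_of_injective, h1.injective,
    h2.injective, h3.injective, h4.injective]
  ring

lemma quadEdges_endpoints (p q : (Fin k → Fin n) × (Fin l → Fin n)) :
    ∀ r, ∀ e ∈ quadEdges F H p q r, e.1 ∈ quadVertices p q r ∧ e.2 ∈ quadVertices p q r := by
  simp only [Fin.forall_fin_succ]
  refine ⟨?_, ?_, ?_, ?_, ?_⟩
  · exact fun e he => mem_image_of_mem_edgeImage he
  · exact fun e he => mem_image_of_mem_edgeImage he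
  · exact fun e he => mem_image_of_mem_edgeImage he
  · exact fun e he => mem_image_of_mem_edgeImage he
  · exact fun i => i.elim0

include hF hH in
lemma quadEdges_connected (hm : ∀ r, m ∈ quadVertices p q r) :
    ∀ r, ∀ T : Set (Fin n), m ∈ T → (∀ e ∈ quadEdges F H p q r, e.1 ∈ T ↔ e.2 ∈ T) →
      ∀ v ∈ quadVertices p q r, v ∈ T := by
  intro r
  fin_cases r
  · exact fun T hT h => mem_of_edgeImage_closed hF (hm 0) T hT h
  · exact fun T hT h => mem_of_edgeImage_closed hH (hm 1) T hT h
  · exact fun T hT h => mem_of_edgeImage_closed hF (hm 2) T hT h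
  · exact fun T hT h => mem_of_edgeImage_closed hH (hm 3) T hT h

lemma mem_quadVertices (hp : p ∈ tuplesEndingAt n k m ×ˢ tuplesEndingAt n l m)
    (hq : q ∈ tuplesEndingAt n k m ×ˢ tuplesEndingAt n l m) : ∀ r, m ∈ quadVertices p q r := by
  rw [Finset.mem_product] at hp hq
  intro r
  fin_cases r
  · exact mem_image_of_mem_tuplesEndingAt hp.1
  · exact mem_image_of_mem_tuplesEndingAt hp.2
  · exact mem_image_of_mem_tuplesEndingAt hq.1
  · exact mem_image_of_mem_tuplesEndingAt hq.2

include hX hX' hF hH in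
lemma card_quadSupport_of_pairResidual
    (hp : p ∈ tuplesEndingAt n k m ×ˢ tuplesEndingAt n l m)
    (hq : q ∈ tuplesEndingAt n k m ×ˢ tuplesEndingAt n l m)
    (hne : ∫ x, pairResidual μ X X' m p x * pairResidual μ X X' m q x ∂(Measure.pi μ) ≠ 0) :
    m ∈ quadSupport (p, q) ∧ (quadSupport (p, q)).card + 2 ≤ k + l := by
  have hm := mem_quadVertices hp hq
  rw [Finset.mem_product] at hp hq
  have hp1 := (mem_tuplesEndingAt.1 hp.1).1
  have hp2 := (mem_tuplesEndingAt.1 hp.2).1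
  have hq1 := (mem_tuplesEndingAt.1 hq.1).1
  have hq2 := (mem_tuplesEndingAt.1 hq.2).1
  refine ⟨by rw [← biUnion_quadVertices]; exact Finset.mem_biUnion.2 ⟨0, Finset.mem_univ _, hm 0⟩, ?_⟩
  have hmatch : ∀ e : Fin n × Fin n, (e.1 = m ∨ e.2 = m) →
      (e ∈ quadEdges F H p q 0 ↔ e ∈ quadEdges F H p q 1) := by
    intro e he
    by_contra hcon
    exact hne (by rw [pairResidual_eq_zero hX hX' hp1 hp2 m he hcon]; simp)
  -- an edge of exactly one of the first two copies occurs in the last two, and conversely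
  have key : ∀ p q : (Fin k → Fin n) × (Fin l → Fin n), StrictMono p.1 → StrictMono p.2 →
      StrictMono q.1 → StrictMono q.2 →
      ∫ x, pairResidual μ X X' m p x * pairResidual μ X X' m q x ∂(Measure.pi μ) ≠ 0 →
      ∀ e, ¬ (e ∈ edgeImage F p.1 ↔ e ∈ edgeImage H p.2) →
        e ∈ edgeImage F q.1 ∨ e ∈ edgeImage H q.2 := by
    intro p q hp1 hp2 hq1 hq2 hne e he
    by_contra hcon
    push Not at hcon
    refine hne (integral_mul_eq_zero_of_resample μ (bddMeas_pairResidual hX hX' hp1 hp2 m)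
      (bddMeas_pairResidual hX hX' hq1 hq2 m)
      (resample_pairResidual_eq_zero hX hX' hp1 hp2 m he)
      ((dependsOn_pairResidual hX hX' hq1 hq2 m).mono ?_))
    intro j hj
    simp only [Finset.coe_singleton, Set.mem_compl_iff, Set.mem_singleton_iff]
    rintro rfl
    rcases hj.1 with h | h
    · exact hcon.1 h
    · exact hcon.2 h
  have hne' : ∫ x, pairResidual μ X X' m q x * pairResidual μ X X' m p x ∂(Measure.pi μ) ≠ 0 := by
    simpa only [mul_comm] using hne
  have hrep : ∀ r, ∀ e ∈ quadEdges F H p q r, ∃ r' ≠ r, e ∈ quadEdges F H p q r' := by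
    intro r e he
    fin_cases r
    · by_cases h : e ∈ edgeImage H p.2
      · exact ⟨1, by decide, h⟩
      · rcases key p q hp1 hp2 hq1 hq2 hne e (fun h' => h (h'.1 he)) with h | h
        · exact ⟨2, by decide, h⟩
        · exact ⟨3, by decide, h⟩
    · by_cases h : e ∈ edgeImage F p.1
      · exact ⟨0, by decide, h⟩
      · rcases key p q hp1 hp2 hq1 hq2 hne e (fun h' => h (h'.2 he)) with h | h
        · exact ⟨2, by decide, h⟩
        · exact ⟨3, by decide, h⟩
    · by_cases h : e ∈ edgeImage H q.2
      · exact ⟨3, by decide, h⟩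
      · rcases key q p hq1 hq2 hp1 hp2 hne' e (fun h' => h (h'.1 he)) with h | h
        · exact ⟨0, by decide, h⟩
        · exact ⟨1, by decide, h⟩
    · by_cases h : e ∈ edgeImage F q.1
      · exact ⟨2, by decide, h⟩
      · rcases key q p hq1 hq2 hp1 hp2 hne' e (fun h' => h (h'.2 he)) with h | h
        · exact ⟨0, by decide, h⟩
        · exact ⟨1, by decide, h⟩
  have hshare : ∃ v, v ≠ m ∧ v ∈ quadVertices p q 0 ∪ quadVertices p q 1 ∧
      v ∈ quadVertices p q 2 ∪ quadVertices p q 3 := by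
    by_contra hcon
    push Not at hcon
    refine hne ?_
    rw [integral_mul_of_disjoint μ (bddMeas_pairResidual hX hX' hp1 hp2 m)
      (bddMeas_pairResidual hX hX' hq1 hq2 m) (dependsOn_pairResidual hX hX' hp1 hp2 m)
      (dependsOn_pairResidual hX hX' hq1 hq2 m), integral_pairResidual hX hX' hp1 hp2, zero_mul]
    rw [Set.disjoint_left]
    rintro j ⟨hj, hjm⟩ ⟨hj', -⟩
    rcases j with v | e
    · refine hcon v (by simpa using hjm) ?_ ?_
      · exact Finset.mem_union.2 hj
      · exact Finset.mem_union.2 hj'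
    · have hem : ¬ (e.1 = m ∨ e.2 = m) := by simpa using hjm
      refine hcon e.1 (fun h => hem (Or.inl h)) ?_ ?_
      · exact Finset.mem_union.2 (hj.imp (fun h => (mem_image_of_mem_edgeImage h).1)
          fun h => (mem_image_of_mem_edgeImage h).1)
      · exact Finset.mem_union.2 (hj'.imp (fun h => (mem_image_of_mem_edgeImage h).1)
          fun h => (mem_image_of_mem_edgeImage h).1)
  obtain ⟨v, hvm, hv01, hv23⟩ := hshare
  have := two_mul_card_biUnion_add_three_le_of_edges hm (quadEdges_endpoints p q)
    (quadEdges_connected hF hH hm) hrep hmatch hvm hv01 hv23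
  rw [biUnion_quadVertices, sum_card_quadVertices hp1 hp2 hq1 hq2] at this
  omega

include hX hF in
lemma card_quadSupport_of_fourth_moment {p q : (Fin k → Fin n) × (Fin k → Fin n)}
    (hp : p ∈ tuplesEndingAt n k m ×ˢ tuplesEndingAt n k m)
    (hq : q ∈ tuplesEndingAt n k m ×ˢ tuplesEndingAt n k m)
    (hne : ∫ x, (X p.1 x * X p.2 x) * (X q.1 x * X q.2 x) ∂(Measure.pi μ) ≠ 0) :
    m ∈ quadSupport (p, q) ∧ (quadSupport (p, q)).card + 1 ≤ 2 * k := by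
  have hm := mem_quadVertices hp hq
  rw [Finset.mem_product] at hp hq
  have hp1 := (mem_tuplesEndingAt.1 hp.1).1
  have hp2 := (mem_tuplesEndingAt.1 hp.2).1
  have hq1 := (mem_tuplesEndingAt.1 hq.1).1
  have hq2 := (mem_tuplesEndingAt.1 hq.2).1
  refine ⟨by rw [← biUnion_quadVertices]; exact Finset.mem_biUnion.2 ⟨0, Finset.mem_univ _, hm 0⟩, ?_⟩
  have key : ∀ a b c d : Fin k → Fin n, StrictMono a → StrictMono b → StrictMono c →
      StrictMono d → ∫ x, (X a x * X b x) * (X c x * X d x) ∂(Measure.pi μ) ≠ 0 →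
      ∀ e ∈ edgeImage F a, e ∈ edgeImage F b ∨ e ∈ edgeImage F c ∨ e ∈ edgeImage F d := by
    intro a b c d ha hb hc hd hne e he
    by_contra hcon
    push Not at hcon
    refine hne ?_
    simp only [mul_assoc]
    refine integral_mul_eq_zero_of_resample μ (hX.bddMeas ha)
      ((hX.bddMeas hb).mul ((hX.bddMeas hc).mul (hX.bddMeas hd)))
      (hX.centred_edge a ha e he) ?_
    intro x y h
    simp only
    rw [hX.dependsOn_compl hb hcon.1 h, hX.dependsOn_compl hc hcon.2.1 h,
      hX.dependsOn_compl hd hcon.2.2 h]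
  have hrep : ∀ r, ∀ e ∈ quadEdges F F p q r, ∃ r' ≠ r, e ∈ quadEdges F F p q r' := by
    intro r e he
    fin_cases r
    · rcases key _ _ _ _ hp1 hp2 hq1 hq2 hne e he with h | h | h
      exacts [⟨1, by decide, h⟩, ⟨2, by decide, h⟩, ⟨3, by decide, h⟩]
    · rcases key _ _ _ _ hp2 hp1 hq1 hq2 (by simpa only [mul_comm (X p.2 _)] using hne) e he
        with h | h | h
      exacts [⟨0, by decide, h⟩, ⟨2, by decide, h⟩, ⟨3, by decide, h⟩]
    · rcases key _ _ _ _ hq1 hq2 hp1 hp2 (by simpa only [mul_comm (X q.1 _ * _)] using hne) e he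
        with h | h | h
      exacts [⟨3, by decide, h⟩, ⟨0, by decide, h⟩, ⟨1, by decide, h⟩]
    · rcases key _ _ _ _ hq2 hq1 hp1 hp2
        (by simpa only [mul_comm (X q.2 _), mul_comm (X q.1 _ * _)] using hne) e he with h | h | h
      exacts [⟨2, by decide, h⟩, ⟨0, by decide, h⟩, ⟨1, by decide, h⟩]
  have := two_mul_card_biUnion_add_two_le hm
    (exists_ne_mem_of_edges (quadEdges_endpoints p q) (quadEdges_connected hF hF hm) hrep)
  rw [biUnion_quadVertices, sum_card_quadVertices hp1 hp2 hq1 hq2] at this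
  omega

include hX hF in
/-- The fourth moment of the sum over the copies with last vertex `m`. -/
lemma integral_sum_pow_four_le (m : Fin n) :
    ∫ x, (∑ a ∈ tuplesEndingAt n k m, X a x) ^ 4 ∂(Measure.pi μ) ≤
      K ^ 4 * ((2 * k) ^ (4 * k)) * ((n : ℝ) ^ (2 * k) / n ^ 2) := by
  classical
  have hn : (0 : ℝ) < n := by exact_mod_cast m.pos
  have hk : 0 < k := Fin.pos_iff_nonempty.2 hF.nonempty
  have h1 : ∀ x, (∑ a ∈ tuplesEndingAt n k m, X a x) ^ 4 =
      (∑ p ∈ tuplesEndingAt n k m ×ˢ tuplesEndingAt n k m, X p.1 x * X p.2 x) ^ 2 := by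
    intro x
    rw [Finset.sum_product]
    simp only [← Finset.mul_sum, ← Finset.sum_mul]
    ring
  simp only [h1]
  have hmono : ∀ p ∈ tuplesEndingAt n k m ×ˢ tuplesEndingAt n k m,
      StrictMono p.1 ∧ StrictMono p.2 := fun p hp => by
    rw [Finset.mem_product] at hp
    exact ⟨(mem_tuplesEndingAt.1 hp.1).1, (mem_tuplesEndingAt.1 hp.2).1⟩
  refine (integral_sum_sq_le (Measure.pi μ) _ (fun p x => X p.1 x * X p.2 x) (K := K ^ 2)
    (fun p hp => bddMeas_pair hX hX (hmono p hp).1 (hmono p hp).2)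
    (fun p hp => abs_pair_le hX hX (hmono p hp).1 (hmono p hp).2)
    (Finset.univ.filter fun q => m ∈ quadSupport q ∧ (quadSupport q).card ≤ 2 * k - 2 + 1)
    (fun p hp q hq hne => ?_)).trans ?_
  · have := card_quadSupport_of_fourth_moment hX hF hp hq hne
    simp only [Finset.mem_filter, Finset.mem_univ, true_and]
    exact ⟨this.1, by omega⟩
  · have h2 : ((Finset.univ.filter fun q : ((Fin k → Fin n) × (Fin k → Fin n)) ×
        ((Fin k → Fin n) × (Fin k → Fin n)) =>
        m ∈ quadSupport q ∧ (quadSupport q).card ≤ 2 * k - 2 + 1).card : ℝ) ≤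
        (2 * k) ^ (4 * k) * ((n : ℝ) ^ (2 * k) / n ^ 2) := by
      have h3 := card_filter_quadSupport_le (k := k) (l := k) m (2 * k - 2)
      have h4 : (2 * k - 2 + 1) ^ (2 * (k + k)) ≤ (2 * k) ^ (4 * k) := by
        rw [show 2 * (k + k) = 4 * k by ring]
        exact Nat.pow_le_pow_left (by omega) _
      have h5 : (n : ℝ) ^ (2 * k) / n ^ 2 = (n : ℝ) ^ (2 * k - 2) := by
        rw [div_eq_iff (by positivity), ← pow_add]
        congr 1; omega
      rw [h5]
      have h6 := h3.trans (Nat.mul_le_mul_right _ h4)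
      rw [Fintype.card_fin] at h6
      exact_mod_cast h6
    calc (K ^ 2) ^ 2 * _ ≤ (K ^ 2) ^ 2 * ((2 * k) ^ (4 * k) * ((n : ℝ) ^ (2 * k) / n ^ 2)) :=
          mul_le_mul_of_nonneg_left h2 (by positivity)
      _ = _ := by ring

include hX hX' hF hH in
lemma integral_sum_pairResidual_sq_le (m : Fin n) :
    ∫ x, (∑ p ∈ tuplesEndingAt n k m ×ˢ tuplesEndingAt n l m, pairResidual μ X X' m p x) ^ 2
      ∂(Measure.pi μ) ≤
      4 * K ^ 4 * ((k + l) ^ (2 * (k + l))) * ((n : ℝ) ^ (k + l) / n ^ 3) := by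
  classical
  have hn : (0 : ℝ) < n := by exact_mod_cast m.pos
  have hmono : ∀ p ∈ tuplesEndingAt n k m ×ˢ tuplesEndingAt n l m,
      StrictMono p.1 ∧ StrictMono p.2 := fun p hp => by
    rw [Finset.mem_product] at hp
    exact ⟨(mem_tuplesEndingAt.1 hp.1).1, (mem_tuplesEndingAt.1 hp.2).1⟩
  by_cases hkl : 3 ≤ k + l
  · refine (integral_sum_sq_le (Measure.pi μ) _ (pairResidual μ X X' m) (K := 2 * K ^ 2)
      (fun p hp => bddMeas_pairResidual hX hX' (hmono p hp).1 (hmono p hp).2 m)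
      (fun p hp => abs_pairResidual_le hX hX' (hmono p hp).1 (hmono p hp).2 m)
      (Finset.univ.filter fun q => m ∈ quadSupport q ∧ (quadSupport q).card ≤ k + l - 3 + 1)
      (fun p hp q hq hne => ?_)).trans ?_
    · have := card_quadSupport_of_pairResidual hX hX' hF hH hp hq hne
      simp only [Finset.mem_filter, Finset.mem_univ, true_and]
      exact ⟨this.1, by omega⟩
    · have h2 : ((Finset.univ.filter fun q : ((Fin k → Fin n) × (Fin l → Fin n)) ×
          ((Fin k → Fin n) × (Fin l → Fin n)) =>
          m ∈ quadSupport q ∧ (quadSupport q).card ≤ k + l - 3 + 1).card : ℝ) ≤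
          (k + l) ^ (2 * (k + l)) * ((n : ℝ) ^ (k + l) / n ^ 3) := by
        have h3 := card_filter_quadSupport_le (k := k) (l := l) m (k + l - 3)
        have h4 : (k + l - 3 + 1) ^ (2 * (k + l)) ≤ (k + l) ^ (2 * (k + l)) :=
          Nat.pow_le_pow_left (by omega) _
        have h5 : (n : ℝ) ^ (k + l) / n ^ 3 = (n : ℝ) ^ (k + l - 3) := by
          rw [div_eq_iff (by positivity), ← pow_add]
          congr 1; omega
        rw [h5]
        have h6 := h3.trans (Nat.mul_le_mul_right _ h4)
        rw [Fintype.card_fin] at h6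
        exact_mod_cast h6
      calc (2 * K ^ 2) ^ 2 * _ ≤
            (2 * K ^ 2) ^ 2 * ((k + l) ^ (2 * (k + l)) * ((n : ℝ) ^ (k + l) / n ^ 3)) :=
            mul_le_mul_of_nonneg_left h2 (by positivity)
        _ = _ := by ring
  · refine (integral_sum_sq_le (Measure.pi μ) _ (pairResidual μ X X' m) (K := 2 * K ^ 2)
      (fun p hp => bddMeas_pairResidual hX hX' (hmono p hp).1 (hmono p hp).2 m)
      (fun p hp => abs_pairResidual_le hX hX' (hmono p hp).1 (hmono p hp).2 m) ∅
      (fun p hp q hq hne => ?_)).trans ?_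
    · have := card_quadSupport_of_pairResidual hX hX' hF hH hp hq hne
      have := Finset.card_pos.2 ⟨m, this.1⟩
      omega
    · simp only [Finset.card_empty, Nat.cast_zero, mul_zero]
      positivity

include hX hX' hF hH in
/-- The product of two layer sums is nearly uncorrelated with functions of the other
coordinates. -/
lemma sq_integral_mul_layer_le (m : Fin n) {f : (Coord n → I) → ℝ} (hf : Measurable f) {M : ℝ}
    (hM : ∀ x, |f x| ≤ M) (hfd : DependsOn f ((vertexCoords m : Set (Coord n))ᶜ)) :
    (∫ x, f x * ((∑ a ∈ tuplesEndingAt n k m, X a x) * (∑ a ∈ tuplesEndingAt n l m, X' a x) -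
      ∫ y, (∑ a ∈ tuplesEndingAt n k m, X a y) * (∑ a ∈ tuplesEndingAt n l m, X' a y)
        ∂(Measure.pi μ)) ∂(Measure.pi μ)) ^ 2 ≤
      M ^ 2 * (4 * K ^ 4 * ((k + l) ^ (2 * (k + l))) * ((n : ℝ) ^ (k + l) / n ^ 3)) := by
  set s := tuplesEndingAt n k m ×ˢ tuplesEndingAt n l m with hs
  have hmono : ∀ p ∈ s, StrictMono p.1 ∧ StrictMono p.2 := fun p hp => by
    rw [hs, Finset.mem_product] at hp
    exact ⟨(mem_tuplesEndingAt.1 hp.1).1, (mem_tuplesEndingAt.1 hp.2).1⟩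
  have hbp : ∀ p ∈ s, BddMeas (fun x => X p.1 x * X' p.2 x) := fun p hp =>
    bddMeas_pair hX hX' (hmono p hp).1 (hmono p hp).2
  have hprod : ∀ x, (∑ a ∈ tuplesEndingAt n k m, X a x) * (∑ a ∈ tuplesEndingAt n l m, X' a x) =
      ∑ p ∈ s, X p.1 x * X' p.2 x := by
    intro x
    rw [hs, Finset.sum_product]
    simp only [← Finset.mul_sum, ← Finset.sum_mul]
  have hfb : BddMeas f := ⟨hf, M, hM⟩
  set R := fun x => ∑ p ∈ s, pairResidual μ X X' m p x with hR
  have hRb : BddMeas R := BddMeas.sum s fun p hp =>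
    bddMeas_pairResidual hX hX' (hmono p hp).1 (hmono p hp).2 m
  have hres : resample μ (vertexCoords m) (fun x => (∑ p ∈ s, X p.1 x * X' p.2 x) -
      ∫ y, ∑ p ∈ s, X p.1 y * X' p.2 y ∂(Measure.pi μ)) = R := by
    rw [resample_sub_const μ (BddMeas.sum s hbp), resample_sum μ s hbp]
    funext x
    rw [integral_finsetSum _ fun p hp => (hbp p hp).integrable _, ← Finset.sum_sub_distrib]
    rfl
  simp only [hprod]
  have h1 : ∫ x, f x * ((∑ p ∈ s, X p.1 x * X' p.2 x) -
      ∫ y, ∑ p ∈ s, X p.1 y * X' p.2 y ∂(Measure.pi μ)) ∂(Measure.pi μ) =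
      ∫ x, R x * f x ∂(Measure.pi μ) := by
    simp only [mul_comm (f _)]
    rw [integral_mul_resample μ ((BddMeas.sum s hbp).sub (BddMeas.const _)) hfb hfd, hres]
  rw [h1]
  have hM0 : ∀ x, (R x * f x) ^ 2 ≤ M ^ 2 * R x ^ 2 := fun x => by
    rw [mul_pow, mul_comm]
    exact mul_le_mul_of_nonneg_right (sq_le_sq' (by linarith [(abs_le.1 (hM x)).1])
      (abs_le.1 (hM x)).2) (sq_nonneg _)
  have hvar : (∫ x, R x * f x ∂(Measure.pi μ)) ^ 2 ≤ ∫ x, (R x * f x) ^ 2 ∂(Measure.pi μ) := by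
    have hG := hRb.mul hfb
    have h := integral_nonneg (μ := Measure.pi μ)
      (f := fun x => (R x * f x - ∫ y, R y * f y ∂(Measure.pi μ)) ^ 2) (fun x => sq_nonneg _)
    set c := ∫ y, R y * f y ∂(Measure.pi μ) with hc
    have h2 : ∫ x, (R x * f x - c) ^ 2 ∂(Measure.pi μ) =
        ∫ x, (R x * f x) ^ 2 ∂(Measure.pi μ) - c ^ 2 := by
      have : ∀ x, (R x * f x - c) ^ 2 = ((R x * f x) * (R x * f x)) - (2 * c * (R x * f x) - c ^ 2) :=
        fun x => by ring
      simp only [this]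
      rw [integral_sub ((hG.mul hG).integrable _) ((((BddMeas.const (2 * c)).mul hG).sub
        (BddMeas.const _)).integrable _), integral_sub (((BddMeas.const (2 * c)).mul hG).integrable _)
        (integrable_const _), integral_const_mul]
      simp only [← hc, integral_const, probReal_univ, smul_eq_mul, ← sq]
      ring
    rw [h2] at h
    linarith
  calc _ ≤ ∫ x, (R x * f x) ^ 2 ∂(Measure.pi μ) := hvar
    _ ≤ ∫ x, M ^ 2 * R x ^ 2 ∂(Measure.pi μ) := by
        refine integral_mono ?_ ?_ hM0
        · simp only [sq]; exact ((hRb.mul hfb).mul (hRb.mul hfb)).integrable _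
        · simp only [sq (R _)]; exact ((BddMeas.const _).mul (hRb.mul hRb)).integrable _
    _ = M ^ 2 * ∫ x, R x ^ 2 ∂(Measure.pi μ) := integral_const_mul _ _
    _ ≤ _ := mul_le_mul_of_nonneg_left
        (integral_sum_pairResidual_sq_le hX hX' hF hH m) (sq_nonneg _)

end CentredFamily

end Families


/-! ### Centred Gaussian measures -/

section Gaussian

variable {d : ℕ}

lemma multivariateGaussian_conv {S Q : Matrix (Fin d) (Fin d) ℝ} (hS : S.PosSemidef)
    (hQ : Q.PosSemidef) :
    (multivariateGaussian 0 S).conv (multivariateGaussian 0 Q) = multivariateGaussian 0 (S + Q) := by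
  refine Measure.ext_of_charFun ?_
  funext t
  rw [charFun_conv, charFun_multivariateGaussian hS, charFun_multivariateGaussian hQ,
    charFun_multivariateGaussian (hS.add hQ), ← Complex.exp_add]
  congr 1
  simp only [inner_zero_right, Complex.ofReal_zero, zero_mul, zero_sub, Matrix.add_mulVec,
    dotProduct_add, Complex.ofReal_add]
  ring

lemma multivariateGaussian_zero :
    multivariateGaussian 0 (0 : Matrix (Fin d) (Fin d) ℝ) = Measure.dirac 0 := by
  simp [multivariateGaussian]

variable {S : Matrix (Fin d) (Fin d) ℝ} (hS : S.PosSemidef)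

include hS

lemma memLp_eval_multivariateGaussian (i : Fin d) (p : ENNReal) (hp : p ≠ ⊤) :
    MemLp (fun y : EuclideanSpace ℝ (Fin d) => y i) p (multivariateGaussian 0 S) :=
  (memLp_id_gaussianReal' p hp).comp_measurePreserving
    (measurePreserving_eval_multivariateGaussian (μ := 0) hS (i := i))

lemma integral_eval_multivariateGaussian (i : Fin d) :
    ∫ y, y i ∂(multivariateGaussian 0 S) = 0 := by
  have := integral_comp_measurePreserving
    (measurePreserving_eval_multivariateGaussian (μ := 0) hS (i := i)) (g := id) measurable_id
  simp only [id] at this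
  rw [this]
  simp [integral_id_gaussianReal]

lemma integral_eval_mul_multivariateGaussian (i j : Fin d) :
    ∫ y, y i * y j ∂(multivariateGaussian 0 S) = S i j := by
  have h := covariance_eval_multivariateGaussian (μ := 0) hS i j
  rw [covariance_eq_sub (memLp_eval_multivariateGaussian hS i 2 (by simp))
    (memLp_eval_multivariateGaussian hS j 2 (by simp))] at h
  simp only [integral_eval_multivariateGaussian hS, mul_zero, sub_zero] at h
  exact h

/-- The fourth moment of the standard normal law. -/
noncomputable def gaussianFourthMoment : ℝ := ∫ x, x ^ 4 ∂(gaussianReal 0 1)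

omit hS in
lemma gaussianFourthMoment_nonneg : 0 ≤ gaussianFourthMoment :=
  integral_nonneg fun x => by positivity

lemma integral_eval_pow_four_multivariateGaussian (i : Fin d) :
    ∫ y, (y i) ^ 4 ∂(multivariateGaussian 0 S) = gaussianFourthMoment * (S i i) ^ 2 := by
  have := integral_comp_measurePreserving
    (measurePreserving_eval_multivariateGaussian (μ := 0) hS (i := i))
    (g := fun x => x ^ 4) (by fun_prop)
  rw [this]
  have hmap := gaussianReal_map_const_mul (μ := 0) (v := 1) (√(S i i))
  have hv : NNReal.mk ((√(S i i)) ^ 2) (sq_nonneg _) * 1 = (S i i).toNNReal := by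
    ext
    simp [Real.sq_sqrt hS.diag_nonneg, hS.diag_nonneg]
  rw [mul_zero, hv] at hmap
  have h0 : (0 : EuclideanSpace ℝ (Fin d)) i = 0 := rfl
  rw [h0, ← hmap, integral_map (by fun_prop) (by fun_prop)]
  simp only [mul_pow, integral_const_mul]
  rw [show (√(S i i)) ^ 4 = ((√(S i i)) ^ 2) ^ 2 by ring, Real.sq_sqrt hS.diag_nonneg,
    gaussianFourthMoment, mul_comm]

end Gaussian

/-! ### The Lindeberg step -/

section Lindeberg

variable {d : ℕ}

/-- The remainder in a second order Taylor expansion with the given coefficient functions. -/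
def taylorRem (h : EuclideanSpace ℝ (Fin d) → ℝ) (h1 : Fin d → EuclideanSpace ℝ (Fin d) → ℝ)
    (h2 : Fin d → Fin d → EuclideanSpace ℝ (Fin d) → ℝ) (x y : EuclideanSpace ℝ (Fin d)) : ℝ :=
  h (x + y) - h x - ∑ i, h1 i x * y i - ∑ i, ∑ j, h2 i j x * (y i * y j)

variable {h : EuclideanSpace ℝ (Fin d) → ℝ} {h1 : Fin d → EuclideanSpace ℝ (Fin d) → ℝ}
  {h2 : Fin d → Fin d → EuclideanSpace ℝ (Fin d) → ℝ}

lemma measurable_taylorRem (hm : Measurable h) (hm1 : ∀ i, Measurable (h1 i))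
    (hm2 : ∀ i j, Measurable (h2 i j)) :
    Measurable (fun q : EuclideanSpace ℝ (Fin d) × EuclideanSpace ℝ (Fin d) =>
      taylorRem h h1 h2 q.1 q.2) := by
  unfold taylorRem
  refine ((((hm.comp (measurable_fst.add measurable_snd)).sub (hm.comp measurable_fst)).sub ?_).sub
    ?_)
  · exact Finset.measurable_sum _ fun i _ => ((hm1 i).comp measurable_fst).mul (by fun_prop)
  · exact Finset.measurable_sum _ fun i _ => Finset.measurable_sum _ fun j _ =>
      ((hm2 i j).comp measurable_fst).mul (by fun_prop)

variable {Ω : Type*} [MeasurableSpace Ω]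

/-- Adding a centred square integrable increment: the expansion of the expectation. -/
lemma integral_add_eq_taylor (P : Measure Ω) [IsProbabilityMeasure P]
    {T D : Ω → EuclideanSpace ℝ (Fin d)} (hT : Measurable T) (hD : Measurable D)
    (hDL : ∀ i, MemLp (fun ω => D ω i) 2 P)
    (hb : BddMeas h) (hb1 : ∀ i, BddMeas (h1 i)) (hb2 : ∀ i j, BddMeas (h2 i j)) :
    Integrable (fun ω => taylorRem h h1 h2 (T ω) (D ω)) P ∧
    ∫ ω, h (T ω + D ω) ∂P = ∫ ω, h (T ω) ∂P + ∑ i, ∫ ω, h1 i (T ω) * D ω i ∂P +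
      ∑ i, ∑ j, ∫ ω, h2 i j (T ω) * (D ω i * D ω j) ∂P +
      ∫ ω, taylorRem h h1 h2 (T ω) (D ω) ∂P := by
  have hbm : ∀ {g : EuclideanSpace ℝ (Fin d) → ℝ}, BddMeas g → ∀ {u : Ω → ℝ}, Integrable u P →
      Integrable (fun ω => g (T ω) * u ω) P := by
    intro g hg u hu
    obtain ⟨K, hK⟩ := hg.bounded
    exact hu.bdd_mul (hg.measurable.comp hT).aestronglyMeasurable (.of_forall fun ω => hK _)
  have i0 : Integrable (fun ω => h (T ω + D ω)) P := (hb.comp (hT.add hD)).integrable P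
  have i1 : Integrable (fun ω => h (T ω)) P := (hb.comp hT).integrable P
  have i2 : ∀ i, Integrable (fun ω => h1 i (T ω) * D ω i) P := fun i =>
    hbm (hb1 i) ((hDL i).integrable (by norm_num))
  have i3 : ∀ i j, Integrable (fun ω => h2 i j (T ω) * (D ω i * D ω j)) P := fun i j =>
    hbm (hb2 i j) ((hDL i).integrable_mul (hDL j))
  have i2' := integrable_finsetSum Finset.univ fun i _ => i2 i
  have i3' := integrable_finsetSum Finset.univ fun i _ =>
    integrable_finsetSum Finset.univ fun j _ => i3 i j
  have j1 : Integrable (fun ω => h (T ω + D ω) - h (T ω)) P := i0.sub i1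
  have j2 : Integrable (fun ω => h (T ω + D ω) - h (T ω) - ∑ i, h1 i (T ω) * D ω i) P :=
    j1.sub i2'
  have iR : Integrable (fun ω => taylorRem h h1 h2 (T ω) (D ω)) P := j2.sub i3'
  refine ⟨iR, ?_⟩
  have hR : ∫ ω, taylorRem h h1 h2 (T ω) (D ω) ∂P = ∫ ω, h (T ω + D ω) ∂P - ∫ ω, h (T ω) ∂P -
      ∑ i, ∫ ω, h1 i (T ω) * D ω i ∂P - ∑ i, ∑ j, ∫ ω, h2 i j (T ω) * (D ω i * D ω j) ∂P := by
    unfold taylorRem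
    rw [integral_sub j2 i3', integral_sub j1 i2', integral_sub i0 i1,
      integral_finsetSum _ fun i _ => i2 i, integral_finsetSum _ fun i _ =>
        integrable_finsetSum _ fun j _ => i3 i j]
    congr 1
    exact Finset.sum_congr rfl fun i _ => integral_finsetSum _ fun j _ => i3 i j
  rw [hR]; ring

/-- Replacing one martingale increment by a Gaussian one. -/
lemma lindeberg_step (P : Measure Ω) [IsProbabilityMeasure P]
    {T D : Ω → EuclideanSpace ℝ (Fin d)} (hT : Measurable T) (hD : ∀ i, BddMeas (fun ω => D ω i))
    {S Q : Matrix (Fin d) (Fin d) ℝ} (hS : S.PosSemidef) (hQ : Q.PosSemidef)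
    (hb : BddMeas h) (hb1 : ∀ i, BddMeas (h1 i)) (hb2 : ∀ i j, BddMeas (h2 i j))
    (hfirst : ∀ z i, ∫ ω, h1 i (T ω + z) * D ω i ∂P = 0) {η : ℝ}
    (hsecond : ∀ z i j, |∫ ω, h2 i j (T ω + z) * (D ω i * D ω j - S i j) ∂P| ≤ η) :
    |∫ q, h (T q.1 + D q.1 + q.2) ∂(P.prod (multivariateGaussian 0 Q)) -
      ∫ q, h (T q.1 + q.2) ∂(P.prod (multivariateGaussian 0 (S + Q)))| ≤
    ∫ q, |taylorRem h h1 h2 (T q.1 + q.2) (D q.1)| ∂(P.prod (multivariateGaussian 0 Q)) +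
    ∫ q, |taylorRem h h1 h2 (T q.1.1 + q.1.2) q.2|
      ∂((P.prod (multivariateGaussian 0 Q)).prod (multivariateGaussian 0 S)) +
    d * d * η := by
  set γ := multivariateGaussian 0 Q with hγ
  set ν := multivariateGaussian 0 S with hν
  have hDm : Measurable D := by
    have : D = fun ω => WithLp.toLp 2 (fun i => D ω i) := by ext; simp
    rw [this]
    exact (PiLp.continuous_toLp 2 _).measurable.comp
      (measurable_pi_lambda _ fun i => (hD i).measurable)
  have hTz : Measurable (fun q : Ω × EuclideanSpace ℝ (Fin d) => T q.1 + q.2) :=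
    (hT.comp measurable_fst).add measurable_snd
  have hTzy : Measurable (fun q : (Ω × EuclideanSpace ℝ (Fin d)) × EuclideanSpace ℝ (Fin d) =>
      T q.1.1 + q.1.2 + q.2) := (hTz.comp measurable_fst).add measurable_snd
  -- the increment `D`
  obtain ⟨iA, hA⟩ := integral_add_eq_taylor (P.prod γ) (T := fun q => T q.1 + q.2)
    (D := fun q => D q.1) hTz (hDm.comp measurable_fst) (fun i => by
      obtain ⟨K, hK⟩ := (hD i).bounded
      exact MemLp.of_bound (((hD i).measurable.comp measurable_fst).aestronglyMeasurable) K
        (.of_forall fun q => hK q.1)) hb hb1 hb2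
  -- the Gaussian increment
  obtain ⟨iB, hB⟩ := integral_add_eq_taylor ((P.prod γ).prod ν) (T := fun q => T q.1.1 + q.1.2)
    (D := fun q => q.2) (hTz.comp measurable_fst) measurable_snd (fun i =>
      (memLp_eval_multivariateGaussian hS i 2 (by simp)).comp_measurePreserving
        measurePreserving_snd) hb hb1 hb2
  have e0 : ∫ q, h (T q.1 + D q.1 + q.2) ∂(P.prod γ) = ∫ q, h (T q.1 + q.2 + D q.1) ∂(P.prod γ) := by
    simp only [add_right_comm]
  have e1 : ∫ q, h (T q.1 + q.2) ∂(P.prod (multivariateGaussian 0 (S + Q))) =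
      ∫ q, h (T q.1.1 + q.1.2 + q.2) ∂((P.prod γ).prod ν) := by
    rw [add_comm S Q, ← multivariateGaussian_conv hQ hS,
      integral_prod _ ((hb.comp hTz).integrable _), integral_prod _
        ((hb.comp hTzy).integrable _), integral_prod]
    · refine integral_congr_ae (.of_forall fun ω => ?_)
      simp only [← hγ, ← hν]
      rw [integral_conv (f := fun y => h (T ω + y))
        ((hb.comp (measurable_const_add (T ω))).integrable _)]
      simp only [add_assoc]
    · obtain ⟨K, hK⟩ := hb.bounded
      have hbm : StronglyMeasurable (Function.uncurry
          fun (x : Ω × EuclideanSpace ℝ (Fin d)) (y : EuclideanSpace ℝ (Fin d)) =>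
            h (T x.1 + x.2 + y)) :=
        (hb.measurable.comp ((hTz.comp measurable_fst).add measurable_snd)).stronglyMeasurable
      refine Integrable.of_bound hbm.integral_prod_right.aestronglyMeasurable K
        (.of_forall fun x => ?_)
      have := norm_integral_le_of_norm_le_const (μ := ν) (.of_forall fun y =>
        (Real.norm_eq_abs _).trans_le (hK (T x.1 + x.2 + y)))
      simpa using this
  have f1 : ∀ i, ∫ q, h1 i (T q.1 + q.2) * D q.1 i ∂(P.prod γ) = 0 := by
    intro i
    rw [integral_prod_symm _ ((((hb1 i).comp hTz).mul ((hD i).comp measurable_fst)).integrable _)]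
    simp [hfirst]
  have f2 : ∀ i, ∫ q, h1 i (T q.1.1 + q.1.2) * q.2 i ∂((P.prod γ).prod ν) = 0 := by
    intro i
    rw [integral_prod_mul (fun q : Ω × EuclideanSpace ℝ (Fin d) => h1 i (T q.1 + q.2))
      (fun y : EuclideanSpace ℝ (Fin d) => y i), hν, integral_eval_multivariateGaussian hS, mul_zero]
  have s2 : ∀ i j, ∫ q, h2 i j (T q.1.1 + q.1.2) * (q.2 i * q.2 j) ∂((P.prod γ).prod ν) =
      ∫ q, h2 i j (T q.1 + q.2) * S i j ∂(P.prod γ) := by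
    intro i j
    rw [integral_prod_mul (fun q : Ω × EuclideanSpace ℝ (Fin d) => h2 i j (T q.1 + q.2))
      (fun y : EuclideanSpace ℝ (Fin d) => y i * y j), hν, integral_eval_mul_multivariateGaussian hS, integral_mul_const]
  have s1 : ∀ i j, |∫ q, h2 i j (T q.1 + q.2) * (D q.1 i * D q.1 j) ∂(P.prod γ) -
      ∫ q, h2 i j (T q.1 + q.2) * S i j ∂(P.prod γ)| ≤ η := by
    intro i j
    have b1 := ((hb2 i j).comp hTz).mul (((hD i).comp measurable_fst).mul
      ((hD j).comp (β := Ω × EuclideanSpace ℝ (Fin d)) measurable_fst))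
    have b2 := ((hb2 i j).comp hTz).mul (BddMeas.const (S i j))
    rw [← integral_sub (b1.integrable _) (b2.integrable _)]
    simp only [← mul_sub]
    rw [integral_prod_symm _ (by simpa only [mul_sub] using (b1.sub b2).integrable (P.prod γ))]
    have := norm_integral_le_of_norm_le_const (μ := γ) (.of_forall fun z =>
      (Real.norm_eq_abs _).trans_le (hsecond z i j))
    simpa using this
  rw [e0, e1, hA, hB]
  have hd1 : |∑ i, ∑ j, (∫ q, h2 i j (T q.1 + q.2) * (D q.1 i * D q.1 j) ∂(P.prod γ) -
      ∫ q, h2 i j (T q.1 + q.2) * S i j ∂(P.prod γ))| ≤ d * d * η := by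
    refine (Finset.abs_sum_le_sum_abs _ _).trans ?_
    refine (Finset.sum_le_sum fun i _ => (Finset.abs_sum_le_sum_abs _ _).trans
      (Finset.sum_le_sum fun j _ => s1 i j)).trans ?_
    simp [mul_assoc]
  have e2 : ∫ q, h (T q.1.1 + q.1.2) ∂((P.prod γ).prod ν) = ∫ q, h (T q.1 + q.2) ∂(P.prod γ) := by
    have := integral_prod_mul (μ := P.prod γ) (ν := ν)
      (fun q : Ω × EuclideanSpace ℝ (Fin d) => h (T q.1 + q.2)) (fun _ => (1 : ℝ))
    simpa using this
  simp only [f1, f2, s2, e2, Finset.sum_const_zero, add_zero]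
  simp only [Finset.sum_sub_distrib] at hd1
  have r1 := abs_integral_le_integral_abs (μ := P.prod γ)
    (f := fun q => taylorRem h h1 h2 (T q.1 + q.2) (D q.1))
  have r2 := abs_integral_le_integral_abs (μ := (P.prod γ).prod ν)
    (f := fun q => taylorRem h h1 h2 (T q.1.1 + q.1.2) q.2)
  rw [abs_le] at hd1 r1 r2 ⊢
  constructor <;> linarith [hd1.1, hd1.2, r1.1, r1.2, r2.1, r2.2]

end Lindeberg


/-! ### Taylor expansion of partially differentiable functions -/

section Taylor

/-- A function with bounded measurable coefficients of a second order Taylor expansion, whose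
remainder is cubic. -/
structure IsTaylorThree {d : ℕ} (h : EuclideanSpace ℝ (Fin d) → ℝ)
    (h1 : Fin d → EuclideanSpace ℝ (Fin d) → ℝ)
    (h2 : Fin d → Fin d → EuclideanSpace ℝ (Fin d) → ℝ) (M : ℝ) : Prop where
  measurable : Measurable h
  measurable1 : ∀ i, Measurable (h1 i)
  measurable2 : ∀ i j, Measurable (h2 i j)
  bound : ∃ K, ∀ x, |h x| ≤ K
  bound1 : ∃ K, ∀ i x, |h1 i x| ≤ K
  bound2 : ∀ i j x, |h2 i j x| ≤ M
  rem_le : ∀ x y, |taylorRem h h1 h2 x y| ≤ M * (∑ i, |y i|) ^ 3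

variable {d : ℕ} {g h : EuclideanSpace ℝ (Fin d) → ℝ} {M : ℝ}

lemma multiPartial_count (L : List (Fin d)) (hL : L.Pairwise (· ≤ ·))
    (g : EuclideanSpace ℝ (Fin d) → ℝ) :
    multiPartial (fun i => L.count i) g = iterPartial L g ∧ ∑ i, L.count i = L.length := by
  have hcount : ∀ a, ((List.finRange d).flatMap fun i => List.replicate (L.count i) i).count a =
      L.count a := by
    intro a
    rw [List.count_flatMap]
    simp only [Function.comp_def, List.count_replicate]
    rw [← List.ofFn_eq_map, List.sum_ofFn]
    simp
  have hperm : ((List.finRange d).flatMap fun i => List.replicate (L.count i) i).Perm L :=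
    List.perm_iff_count.2 hcount
  have hsort : ((List.finRange d).flatMap fun i => List.replicate (L.count i) i).Pairwise
      (· ≤ ·) := by
    rw [List.pairwise_flatMap]
    refine ⟨fun i _ => ?_, ?_⟩
    · exact List.pairwise_replicate.2 (Or.inr le_rfl)
    · refine (List.pairwise_lt_finRange d).imp fun hij x hx y hy => ?_
      rw [List.eq_of_mem_replicate hx, List.eq_of_mem_replicate hy]
      exact hij.le
  have heq := hperm.eq_of_pairwise' hsort hL
  constructor
  · rw [multiPartial, heq]
  · rw [← hperm.length_eq, List.length_flatMap]
    simp only [List.length_replicate]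
    rw [← List.ofFn_eq_map, List.sum_ofFn]

lemma abs_sub_le_of_hasDerivAt {f f' : ℝ → ℝ} (hf : ∀ s, HasDerivAt f (f' s) s) {t c : ℝ}
    (hc : ∀ s, |s| ≤ |t| → |f' s| ≤ c) : |f t - f 0| ≤ c * |t| := by
  have := (convex_uIcc (0 : ℝ) t).norm_image_sub_le_of_norm_hasDerivWithin_le (f := f) (f' := f')
    (C := c) (fun s _ => (hf s).hasDerivWithinAt) (fun s hs => by
      refine hc s ?_
      have := Set.abs_sub_left_of_mem_uIcc hs
      simpa using this) Set.left_mem_uIcc Set.right_mem_uIcc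
  simpa using this

lemma hasDerivAt_line {i : Fin d}
    (hg : ∀ x, LineDifferentiableAt ℝ g x (EuclideanSpace.single i 1))
    (x : EuclideanSpace ℝ (Fin d)) (s : ℝ) :
    HasDerivAt (fun s : ℝ => g (x + s • EuclideanSpace.single i (1 : ℝ)))
      (partialDeriv i g (x + s • EuclideanSpace.single i (1 : ℝ))) s := by
  have h := (hg (x + s • EuclideanSpace.single i (1 : ℝ))).hasLineDerivAt
  unfold HasLineDerivAt at h
  have h2 : HasDerivAt (fun t : ℝ => t - s) 1 s := (hasDerivAt_id s).sub_const s
  have h3 := h.comp_of_eq s h2 (sub_self s).symm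
  simp only [mul_one] at h3
  refine h3.congr_of_eventuallyEq (.of_forall fun t => ?_)
  simp only [Function.comp]
  congr 1
  rw [add_assoc, ← add_smul]
  congr 2
  ring

lemma abs_line_sub_le {i : Fin d} (hg : ∀ x, LineDifferentiableAt ℝ g x (EuclideanSpace.single i 1))
    (hM : ∀ x, |partialDeriv i g x| ≤ M) (x : EuclideanSpace ℝ (Fin d)) (t : ℝ) :
    |g (x + t • EuclideanSpace.single i (1 : ℝ)) - g x| ≤ M * |t| := by
  have := abs_sub_le_of_hasDerivAt (hasDerivAt_line hg x) (t := t) (c := M) fun s _ => hM _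
  simpa using this

lemma abs_line_taylor_one_le {i : Fin d}
    (hg : ∀ x, LineDifferentiableAt ℝ g x (EuclideanSpace.single i 1))
    (hg2 : ∀ x, LineDifferentiableAt ℝ (partialDeriv i g) x (EuclideanSpace.single i 1))
    (hM : ∀ x, |partialDeriv i (partialDeriv i g) x| ≤ M) (x : EuclideanSpace ℝ (Fin d)) (t : ℝ) :
    |g (x + t • EuclideanSpace.single i (1 : ℝ)) - g x - t * partialDeriv i g x| ≤ M * |t| ^ 2 := by
  have hM0 : 0 ≤ M := (abs_nonneg _).trans (hM x)
  have := abs_sub_le_of_hasDerivAt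
    (fun s => (hasDerivAt_line hg x s).sub ((hasDerivAt_id s).mul_const (partialDeriv i g x)))
    (t := t) (c := M * |t|) fun s hs => by
      rw [one_mul]
      exact (abs_line_sub_le hg2 hM x s).trans (mul_le_mul_of_nonneg_left hs hM0)
  simp only [id, Pi.sub_apply, zero_smul, add_zero, zero_mul, sub_zero] at this
  convert this using 1
  · congr 1; ring
  · ring

lemma abs_line_taylor_two_le {i : Fin d}
    (hg : ∀ x, LineDifferentiableAt ℝ g x (EuclideanSpace.single i 1))
    (hg2 : ∀ x, LineDifferentiableAt ℝ (partialDeriv i g) x (EuclideanSpace.single i 1))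
    (hg3 : ∀ x, LineDifferentiableAt ℝ (partialDeriv i (partialDeriv i g)) x
      (EuclideanSpace.single i 1))
    (hM : ∀ x, |partialDeriv i (partialDeriv i (partialDeriv i g)) x| ≤ M)
    (x : EuclideanSpace ℝ (Fin d)) (t : ℝ) :
    |g (x + t • EuclideanSpace.single i (1 : ℝ)) - g x - t * partialDeriv i g x -
      t ^ 2 / 2 * partialDeriv i (partialDeriv i g) x| ≤ M * |t| ^ 3 := by
  have hM0 : 0 ≤ M := (abs_nonneg _).trans (hM x)
  have := abs_sub_le_of_hasDerivAt
    (fun s => ((hasDerivAt_line hg x s).sub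
      ((hasDerivAt_id s).mul_const (partialDeriv i g x))).sub
      ((((hasDerivAt_id s).pow 2).div_const 2).mul_const (partialDeriv i (partialDeriv i g) x)))
    (t := t) (c := M * |t| ^ 2) fun s hs => by
      have h1 := abs_line_taylor_one_le hg2 hg3 hM x s
      have h2 : M * |s| ^ 2 ≤ M * |t| ^ 2 :=
        mul_le_mul_of_nonneg_left (pow_le_pow_left₀ (abs_nonneg _) hs 2) hM0
      refine (le_of_eq ?_).trans (h1.trans h2)
      congr 1
      simp
  simp only [id, Pi.sub_apply, zero_smul, add_zero, zero_mul, sub_zero, Pi.pow_apply] at this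
  convert this using 1
  · congr 1; ring
  · ring

/-- The point reached from `x` after the first `m` coordinates have been increased by those
of `y`. -/
noncomputable def coordPath (x y : EuclideanSpace ℝ (Fin d)) (m : ℕ) : EuclideanSpace ℝ (Fin d) :=
  WithLp.toLp 2 fun l => if (l : ℕ) < m then x l + y l else x l

lemma coordPath_zero (x y : EuclideanSpace ℝ (Fin d)) : coordPath x y 0 = x := by
  ext l; simp [coordPath]

lemma coordPath_last (x y : EuclideanSpace ℝ (Fin d)) : coordPath x y d = x + y := by
  ext l; simp [coordPath]

lemma coordPath_succ (x y : EuclideanSpace ℝ (Fin d)) {m : ℕ} (hm : m < d) :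
    coordPath x y (m + 1) =
      coordPath x y m + y ⟨m, hm⟩ • EuclideanSpace.single ⟨m, hm⟩ (1 : ℝ) := by
  ext l
  by_cases hl : l = ⟨m, hm⟩
  · subst hl; simp [coordPath]
  · have hl' : (l : ℕ) ≠ m := fun h => hl (Fin.ext h)
    have : (l : ℕ) ≤ m ↔ (l : ℕ) < m := by omega
    simp [coordPath, hl, this]

lemma sum_ite_lt_succ {A : Type*} [AddCommMonoid A] (f : Fin d → A) {m : ℕ} (hm : m < d) :
    ∑ l : Fin d, (if (l : ℕ) < m + 1 then f l else 0) =
      ∑ l : Fin d, (if (l : ℕ) < m then f l else 0) + f ⟨m, hm⟩ := by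
  have : f ⟨m, hm⟩ = ∑ l : Fin d, if l = ⟨m, hm⟩ then f l else 0 := by simp
  rw [this, ← Finset.sum_add_distrib]
  refine Finset.sum_congr rfl fun l _ => ?_
  by_cases hl : l = ⟨m, hm⟩
  · subst hl; simp
  · have hl' : (l : ℕ) ≠ m := fun h => hl (Fin.ext h)
    have : (l : ℕ) < m + 1 ↔ (l : ℕ) < m := by omega
    simp [hl, this]

lemma sum_ite_le_sum_abs (y : EuclideanSpace ℝ (Fin d)) (m : ℕ) :
    ∑ l : Fin d, (if (l : ℕ) < m then |y l| else 0) ≤ ∑ l, |y l| := by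
  refine Finset.sum_le_sum fun l _ => ?_
  split_ifs <;> simp

lemma abs_coordPath_sub_le (hM0 : 0 ≤ M) {m : ℕ} (hm : m ≤ d)
    (hg : ∀ l : Fin d, (l : ℕ) < m → ∀ x, LineDifferentiableAt ℝ g x (EuclideanSpace.single l 1))
    (hM : ∀ l : Fin d, (l : ℕ) < m → ∀ x, |partialDeriv l g x| ≤ M)
    (x y : EuclideanSpace ℝ (Fin d)) :
    |g (coordPath x y m) - g x| ≤ M * ∑ l, |y l| := by
  have key : ∀ r ≤ m, |g (coordPath x y r) - g x| ≤
      M * ∑ l : Fin d, (if (l : ℕ) < r then |y l| else 0) := by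
    intro r hr
    induction r with
    | zero => simp [coordPath_zero]
    | succ r ih =>
      have hrd : r < d := by omega
      rw [coordPath_succ x y hrd, sum_ite_lt_succ _ hrd, mul_add]
      have h1 := abs_line_sub_le (hg ⟨r, hrd⟩ (by simp; omega)) (hM ⟨r, hrd⟩ (by simp; omega))
        (coordPath x y r) (y ⟨r, hrd⟩)
      have h2 := ih (by omega)
      refine (abs_sub_le _ (g (coordPath x y r)) _).trans ?_
      linarith
  exact (key m le_rfl).trans (mul_le_mul_of_nonneg_left (sum_ite_le_sum_abs y m) hM0)

lemma abs_coordPath_taylor_one_le (hM0 : 0 ≤ M) {m : ℕ} (hm : m ≤ d)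
    (hg : ∀ l : Fin d, (l : ℕ) < m → ∀ x, LineDifferentiableAt ℝ g x (EuclideanSpace.single l 1))
    (hg2 : ∀ l r : Fin d, (l : ℕ) < m → r ≤ l → ∀ x,
      LineDifferentiableAt ℝ (partialDeriv l g) x (EuclideanSpace.single r 1))
    (hM : ∀ l r : Fin d, (l : ℕ) < m → r ≤ l → ∀ x, |partialDeriv r (partialDeriv l g) x| ≤ M)
    (x y : EuclideanSpace ℝ (Fin d)) :
    |g (coordPath x y m) - g x -
      ∑ l : Fin d, (if (l : ℕ) < m then partialDeriv l g x * y l else 0)| ≤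
      2 * M * (∑ l, |y l|) ^ 2 := by
  set Y := ∑ l, |y l| with hY
  have hY0 : 0 ≤ Y := Finset.sum_nonneg fun _ _ => abs_nonneg _
  have hyY : ∀ l, |y l| ≤ Y := fun l =>
    Finset.single_le_sum (f := fun l => |y l|) (fun _ _ => abs_nonneg _) (Finset.mem_univ l)
  have key : ∀ r ≤ m, |g (coordPath x y r) - g x -
      ∑ l : Fin d, (if (l : ℕ) < r then partialDeriv l g x * y l else 0)| ≤
      2 * M * Y * ∑ l : Fin d, (if (l : ℕ) < r then |y l| else 0) := by
    intro r hr
    induction r with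
    | zero => simp [coordPath_zero]
    | succ r ih =>
      have hrd : r < d := by omega
      set i : Fin d := ⟨r, hrd⟩ with hi
      have hir : (i : ℕ) < m := by simp [hi]; omega
      rw [coordPath_succ x y hrd, sum_ite_lt_succ _ hrd, sum_ite_lt_succ _ hrd, mul_add]
      have h1 := abs_line_taylor_one_le (hg i hir) (hg2 i i hir le_rfl) (hM i i hir le_rfl)
        (coordPath x y r) (y i)
      have h2 := ih (by omega)
      have h3 := abs_coordPath_sub_le (g := partialDeriv i g) hM0 (m := r) hrd.le
        (fun l hl => hg2 i l hir (by simp [hi, Fin.le_def]; omega))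
        (fun l hl => hM i l hir (by simp [hi, Fin.le_def]; omega)) x y
      have h4 : |y i * (partialDeriv i g (coordPath x y r) - partialDeriv i g x)| ≤
          |y i| * (M * Y) := by
        rw [abs_mul]; exact mul_le_mul_of_nonneg_left h3 (abs_nonneg _)
      have h5 : M * |y i| ^ 2 ≤ M * (Y * |y i|) := by
        refine mul_le_mul_of_nonneg_left ?_ hM0
        rw [sq]; exact mul_le_mul_of_nonneg_right (hyY i) (abs_nonneg _)
      rw [abs_le] at h1 h2 h4 ⊢
      constructor <;> linarith [h1.1, h1.2, h2.1, h2.2, h4.1, h4.2]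
  refine (key m le_rfl).trans ?_
  have := mul_le_mul_of_nonneg_left (sum_ite_le_sum_abs y m) (show 0 ≤ 2 * M * Y by positivity)
  calc _ ≤ _ := this
    _ = _ := by rw [← hY]; ring

/-- The second order coefficients of the expansion of `h` along the coordinates, in increasing
order. -/
noncomputable def secondCoeff (h : EuclideanSpace ℝ (Fin d) → ℝ) (i j : Fin d)
    (x : EuclideanSpace ℝ (Fin d)) : ℝ :=
  if i < j then partialDeriv i (partialDeriv j h) x
  else if i = j then partialDeriv i (partialDeriv i h) x / 2 else 0

/-- Only the derivatives `∂ᵣ ∂ₗ ∂ᵢ h` with `r ≤ l ≤ i` are needed for the expansion. -/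
lemma abs_taylorRem_le (hM0 : 0 ≤ M)
    (hd1 : ∀ i x, LineDifferentiableAt ℝ h x (EuclideanSpace.single i 1))
    (hd2 : ∀ i l x, LineDifferentiableAt ℝ (partialDeriv i h) x (EuclideanSpace.single l 1))
    (hd3 : ∀ i l r x, LineDifferentiableAt ℝ (partialDeriv l (partialDeriv i h)) x
      (EuclideanSpace.single r 1))
    (hM : ∀ i l r, l ≤ i → r ≤ l → ∀ x,
      |partialDeriv r (partialDeriv l (partialDeriv i h)) x| ≤ M)
    (x y : EuclideanSpace ℝ (Fin d)) :
    |taylorRem h (fun i => partialDeriv i h) (secondCoeff h) x y| ≤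
      4 * M * (∑ i, |y i|) ^ 3 := by
  set Y := ∑ l, |y l| with hY
  have hY0 : 0 ≤ Y := Finset.sum_nonneg fun _ _ => abs_nonneg _
  have hyY : ∀ l, |y l| ≤ Y := fun l =>
    Finset.single_le_sum (f := fun l => |y l|) (fun _ _ => abs_nonneg _) (Finset.mem_univ l)
  -- the coefficient of the step in direction `i`
  set c : Fin d → ℝ := fun i => partialDeriv i h x * y i +
    (∑ l : Fin d, if (l : ℕ) < i then partialDeriv l (partialDeriv i h) x * y l else 0) * y i +
    y i ^ 2 / 2 * partialDeriv i (partialDeriv i h) x with hc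
  have key : ∀ r ≤ d, |h (coordPath x y r) - h x -
      ∑ i : Fin d, (if (i : ℕ) < r then c i else 0)| ≤
      4 * M * Y ^ 2 * ∑ l : Fin d, (if (l : ℕ) < r then |y l| else 0) := by
    intro r hr
    induction r with
    | zero => simp [coordPath_zero]
    | succ r ih =>
      have hrd : r < d := by omega
      set i : Fin d := ⟨r, hrd⟩ with hi
      rw [coordPath_succ x y hrd, sum_ite_lt_succ _ hrd, sum_ite_lt_succ _ hrd, mul_add]
      have h1 := abs_line_taylor_two_le (hd1 i) (hd2 i i) (hd3 i i i)
        (hM i i i le_rfl le_rfl) (coordPath x y r) (y i)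
      have h2 := ih (by omega)
      have h3 := abs_coordPath_taylor_one_le (g := partialDeriv i h) hM0 (m := r) hrd.le
        (fun l _ => hd2 i l) (fun l r _ _ => hd3 i l r)
        (fun l r hl hrl => hM i l r (by simp [hi, Fin.le_def]; omega) hrl) x y
      have h4 := abs_coordPath_sub_le (g := partialDeriv i (partialDeriv i h)) hM0 (m := r) hrd.le
        (fun l _ => hd3 i i l) (fun l hl => hM i i l le_rfl (by simp [hi, Fin.le_def]; omega)) x y
      have h3' : |y i * (partialDeriv i h (coordPath x y r) - partialDeriv i h x -
          ∑ l : Fin d, (if (l : ℕ) < r then partialDeriv l (partialDeriv i h) x * y l else 0))| ≤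
          |y i| * (2 * M * Y ^ 2) := by
        rw [abs_mul]; exact mul_le_mul_of_nonneg_left h3 (abs_nonneg _)
      have h4' : |y i ^ 2 / 2 * (partialDeriv i (partialDeriv i h) (coordPath x y r) -
          partialDeriv i (partialDeriv i h) x)| ≤ |y i| ^ 2 * (M * Y) := by
        rw [abs_mul, abs_div, abs_pow, abs_two]
        refine mul_le_mul ?_ h4 (abs_nonneg _) (by positivity)
        linarith [sq_nonneg |y i|]
      have h5 : |y i| ^ 2 * (M * Y) ≤ |y i| * Y * (M * Y) := by
        refine mul_le_mul_of_nonneg_right ?_ (by positivity)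
        rw [sq]; exact mul_le_mul_of_nonneg_left (hyY i) (abs_nonneg _)
      have h6 : M * |y i| ^ 3 ≤ M * (Y ^ 2 * |y i|) := by
        refine mul_le_mul_of_nonneg_left ?_ hM0
        rw [pow_succ]
        exact mul_le_mul_of_nonneg_right (pow_le_pow_left₀ (abs_nonneg _) (hyY i) 2) (abs_nonneg _)
      have h7 : c i = partialDeriv i h x * y i + (∑ l : Fin d,
          if (l : ℕ) < r then partialDeriv l (partialDeriv i h) x * y l else 0) * y i +
          y i ^ 2 / 2 * partialDeriv i (partialDeriv i h) x := rfl
      rw [h7]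
      rw [abs_le] at h1 h2 h3' h4' ⊢
      constructor <;> linarith [h1.1, h1.2, h2.1, h2.2, h3'.1, h3'.2, h4'.1, h4'.2]
  have hfin := key d le_rfl
  have e1 : ∑ i : Fin d, (if (i : ℕ) < d then c i else 0) =
      ∑ i, partialDeriv i h x * y i + ∑ i, ∑ j, secondCoeff h i j x * (y i * y j) := by
    simp only [Fin.is_lt, if_true, hc]
    rw [Finset.sum_comm (γ := Fin d), ← Finset.sum_add_distrib]
    refine Finset.sum_congr rfl fun i _ => ?_
    rw [add_assoc]
    congr 1
    have : ∀ l, secondCoeff h l i x * (y l * y i) =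
        (if (l : ℕ) < i then partialDeriv l (partialDeriv i h) x * y l else 0) * y i +
        if l = i then y i ^ 2 / 2 * partialDeriv i (partialDeriv i h) x else 0 := by
      intro l
      unfold secondCoeff
      rcases lt_trichotomy l i with hl | hl | hl
      · simp [hl, hl.ne]; ring
      · subst hl; simp; ring
      · simp [not_lt.2 hl.le, hl.ne']
    simp only [this, Finset.sum_add_distrib, Finset.sum_mul, Finset.sum_ite_eq', Finset.mem_univ,
      if_true]
  rw [e1, coordPath_last] at hfin
  have e2 : ∑ l : Fin d, (if (l : ℕ) < d then |y l| else 0) = Y := by simp [hY]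
  rw [e2] at hfin
  unfold taylorRem
  calc _ = |h (x + y) - h x - (∑ i, partialDeriv i h x * y i +
        ∑ i, ∑ j, secondCoeff h i j x * (y i * y j))| := by congr 1; ring
    _ ≤ 4 * M * Y ^ 2 * Y := hfin
    _ = _ := by ring

lemma measurable_partialDeriv (hg : Measurable g) (i : Fin d)
    (hd : ∀ x, LineDifferentiableAt ℝ g x (EuclideanSpace.single i 1)) :
    Measurable (partialDeriv i g) := by
  have hlim : Filter.Tendsto (fun n : ℕ => (1 : ℝ) / ((n : ℝ) + 1)) Filter.atTop
      (nhdsWithin 0 {0}ᶜ) := by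
    refine tendsto_nhdsWithin_iff.2 ⟨tendsto_one_div_add_atTop_nhds_zero_nat, .of_forall fun n => ?_⟩
    have : (0 : ℝ) < (n : ℝ) + 1 := by positivity
    simpa using this.ne'
  refine measurable_of_tendsto_metrizable (f := fun (n : ℕ) x => ((1 : ℝ) / ((n : ℝ) + 1))⁻¹ *
    (g (x + ((1 : ℝ) / ((n : ℝ) + 1)) • EuclideanSpace.single i (1 : ℝ)) - g x)) (fun n => ?_)
    (tendsto_pi_nhds.2 fun x => ?_)
  · exact ((hg.comp (measurable_id.add_const _)).sub hg).const_mul _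
  · have := hasDerivAt_iff_tendsto_slope.1 (hd x).hasLineDerivAt
    refine (this.comp hlim).congr fun n => ?_
    simp [slope_def_field, Function.comp, div_eq_inv_mul]

lemma isTaylorThree_of_partiallyDifferentiable {m : ℕ} (hm : 3 ≤ m)
    (hd : PartiallyDifferentiable m h)
    (hM : ∀ α : Fin d → ℕ, ∑ i, α i ≤ m → ∀ x, |multiPartial α h x| ≤ M) :
    IsTaylorThree h (fun i => partialDeriv i h) (secondCoeff h) (4 * M) := by
  have hb : ∀ L : List (Fin d), L.Pairwise (· ≤ ·) → L.length ≤ 3 → ∀ x, |iterPartial L h x| ≤ M := by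
    intro L hL hlen x
    obtain ⟨h1, h2⟩ := multiPartial_count L hL h
    rw [← h1]
    exact hM _ (by omega) x
  have hM0 : 0 ≤ M := (abs_nonneg _).trans (hb [] List.Pairwise.nil (by simp) 0)
  have hd1 : ∀ i x, LineDifferentiableAt ℝ h x (EuclideanSpace.single i 1) :=
    fun i x => hd [] (by simpa using by omega) i x
  have hd2 : ∀ i l x, LineDifferentiableAt ℝ (partialDeriv i h) x (EuclideanSpace.single l 1) :=
    fun i l x => hd [i] (by simpa using by omega) l x
  have hd3 : ∀ i l r x, LineDifferentiableAt ℝ (partialDeriv l (partialDeriv i h)) x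
      (EuclideanSpace.single r 1) :=
    fun i l r x => hd [l, i] (by simpa using by omega) r x
  have hb1 : ∀ i x, |partialDeriv i h x| ≤ M := fun i x =>
    hb [i] (List.pairwise_singleton _ _) (by simp) x
  have hb2 : ∀ i l, l ≤ i → ∀ x, |partialDeriv l (partialDeriv i h) x| ≤ M := fun i l hl x =>
    hb [l, i] (by simpa using hl) (by simp) x
  have hb3 : ∀ i l r, l ≤ i → r ≤ l → ∀ x,
      |partialDeriv r (partialDeriv l (partialDeriv i h)) x| ≤ M := fun i l r hl hr x =>
    hb [r, l, i] (by simpa using ⟨⟨hr, hr.trans hl⟩, hl⟩) (by simp) x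
  have hcont : Continuous h := by
    refine continuous_iff_continuousAt.2 fun x => ?_
    have hle : ∀ x', |h x' - h x| ≤ M * ∑ l, |(x' - x) l| := fun x' => by
      have := abs_coordPath_sub_le hM0 le_rfl (fun l _ => hd1 l) (fun l _ => hb1 l) x (x' - x)
      rwa [coordPath_last, add_sub_cancel] at this
    have hlim : Filter.Tendsto (fun x' => M * ∑ l, |(x' - x) l|) (nhds x) (nhds 0) := by
      have : Continuous fun x' : EuclideanSpace ℝ (Fin d) => M * ∑ l, |(x' - x) l| := by fun_prop
      simpa using this.tendsto x
    exact tendsto_iff_dist_tendsto_zero.2 (squeeze_zero (fun _ => dist_nonneg)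
      (fun x' => by rw [Real.dist_eq]; exact hle x') hlim)
  have hmeas1 : ∀ i, Measurable (partialDeriv i h) := fun i =>
    measurable_partialDeriv hcont.measurable i (hd1 i)
  have hmeas2 : ∀ i l, Measurable (partialDeriv l (partialDeriv i h)) := fun i l =>
    measurable_partialDeriv (hmeas1 i) l (hd2 i l)
  refine ⟨hcont.measurable, hmeas1, fun i j => ?_, ⟨M, hb [] List.Pairwise.nil (by simp)⟩,
    ⟨M, hb1⟩, fun i j x => ?_, abs_taylorRem_le hM0 hd1 hd2 hd3 hb3⟩
  · unfold secondCoeff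
    split_ifs with h1 h2
    · exact hmeas2 _ _
    · exact (hmeas2 _ _).div_const 2
    · exact measurable_const
  · unfold secondCoeff
    split_ifs with h1 h2
    · exact (hb2 j i h1.le x).trans (by linarith)
    · rw [abs_div, abs_two]
      linarith [hb2 i i le_rfl x]
    · simpa using hM0

end Taylor


/-! ### The central limit theorem for arrays of nearly uncorrelated increments -/

section Increments

set_option linter.unusedSectionVars false

variable {d n : ℕ} {Ω : Type*} [MeasurableSpace Ω]

/-- The sum of the first `m` increments. -/
def partialSum (D : Fin n → Ω → EuclideanSpace ℝ (Fin d)) (m : ℕ) (ω : Ω) :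
    EuclideanSpace ℝ (Fin d) := ∑ l : Fin n, if (l : ℕ) < m then D l ω else 0

/-- The sum of the covariance matrices of the increments from the `m`-th one on. -/
def tailCov (Sg : Fin n → Matrix (Fin d) (Fin d) ℝ) (m : ℕ) : Matrix (Fin d) (Fin d) ℝ :=
  ∑ l : Fin n, if m ≤ (l : ℕ) then Sg l else 0

/-- Increments with covariance matrices `Sg l`, centred given the preceding partial sum, with
controlled conditional second and fourth moments. -/
structure IncrementBounds (P : Measure Ω) (D : Fin n → Ω → EuclideanSpace ℝ (Fin d))
    (Sg : Fin n → Matrix (Fin d) (Fin d) ℝ) (C η : ℝ) : Prop where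
  bddMeas : ∀ m i, BddMeas (fun ω => D m ω i)
  cov : ∀ m i j, ∫ ω, D m ω i * D m ω j ∂P = Sg m i j
  first : ∀ (m : Fin n) (f : EuclideanSpace ℝ (Fin d) → ℝ), BddMeas f → ∀ i,
    ∫ ω, f (partialSum D m ω) * D m ω i ∂P = 0
  second : ∀ (m : Fin n) (f : EuclideanSpace ℝ (Fin d) → ℝ), Measurable f → ∀ M : ℝ,
    (∀ x, |f x| ≤ M) → ∀ i j,
    |∫ ω, f (partialSum D m ω) * (D m ω i * D m ω j - Sg m i j) ∂P| ≤ M * η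
  fourth : ∀ m i, ∫ ω, (D m ω i) ^ 4 ∂P ≤ C / (n : ℝ) ^ 2

lemma partialSum_zero (D : Fin n → Ω → EuclideanSpace ℝ (Fin d)) (ω : Ω) :
    partialSum D 0 ω = 0 := by simp [partialSum]

lemma partialSum_succ (D : Fin n → Ω → EuclideanSpace ℝ (Fin d)) (m : Fin n) (ω : Ω) :
    partialSum D (m + 1) ω = partialSum D m ω + D m ω := by
  simpa [partialSum] using sum_ite_lt_succ (fun l => D l ω) m.2

lemma partialSum_last (D : Fin n → Ω → EuclideanSpace ℝ (Fin d)) (ω : Ω) :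
    partialSum D n ω = ∑ l, D l ω := by simp [partialSum]

lemma tailCov_zero (Sg : Fin n → Matrix (Fin d) (Fin d) ℝ) : tailCov Sg 0 = ∑ l, Sg l := by
  simp [tailCov]

lemma tailCov_last (Sg : Fin n → Matrix (Fin d) (Fin d) ℝ) : tailCov Sg n = 0 :=
  Finset.sum_eq_zero fun l _ => if_neg (by omega)

lemma tailCov_eq (Sg : Fin n → Matrix (Fin d) (Fin d) ℝ) (m : Fin n) :
    tailCov Sg m = Sg m + tailCov Sg (m + 1) := by
  unfold tailCov
  have : Sg m = ∑ l, if l = m then Sg l else 0 := by simp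
  rw [this, ← Finset.sum_add_distrib]
  refine Finset.sum_congr rfl fun l _ => ?_
  by_cases hl : l = m
  · subst hl; simp
  · have hl' : (l : ℕ) ≠ m := fun h => hl (Fin.ext h)
    have : (m : ℕ) ≤ l ↔ (m : ℕ) + 1 ≤ l := by omega
    simp only [hl, this, if_false, zero_add]

lemma sum_abs_pow_three_le (y : Fin d → ℝ) {s : ℝ} (hs : 0 < s) :
    (∑ i, |y i|) ^ 3 ≤ d ^ 2 * ∑ i, (s ^ 3 + y i ^ 4 / s) := by
  have h1 : (∑ i, |y i|) ^ 3 ≤ d ^ 2 * ∑ i, |y i| ^ 3 := by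
    rcases Nat.eq_zero_or_pos d with rfl | hd
    · simp
    have h := pow_sum_div_card_le_sum_pow (s := (Finset.univ : Finset (Fin d)))
      (f := fun i => |y i|) (fun i _ => abs_nonneg _) 2
    rw [div_le_iff₀ (by simp; positivity)] at h
    simp only [Finset.card_univ, Fintype.card_fin] at h
    rw [mul_comm] at h; exact h
  refine h1.trans (mul_le_mul_of_nonneg_left (Finset.sum_le_sum fun i _ => ?_) (by positivity))
  rcases le_total |y i| s with h | h
  · have := pow_le_pow_left₀ (abs_nonneg _) h 3
    have : 0 ≤ y i ^ 4 / s := by positivity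
    linarith
  · have h2 : |y i| ^ 3 ≤ y i ^ 4 / s := by
      rw [le_div_iff₀ hs, ← Even.pow_abs (by decide : Even 4), pow_succ |y i| 3]
      exact mul_le_mul_of_nonneg_left h (by positivity)
    have : 0 ≤ s ^ 3 := by positivity
    linarith

lemma integral_sum_abs_pow_three_le {Ω' : Type*} [MeasurableSpace Ω'] (P : Measure Ω')
    [IsProbabilityMeasure P] {Y : Ω' → Fin d → ℝ} {c : ℝ} (hn : 0 < n)
    (hint : ∀ i, Integrable (fun ω => Y ω i ^ 4) P)
    (hY : ∀ i, ∫ ω, Y ω i ^ 4 ∂P ≤ c / (n : ℝ) ^ 2) {u : Ω' → ℝ} {M : ℝ} (hM : 0 ≤ M)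
    (hu : ∀ ω, |u ω| ≤ M * (∑ i, |Y ω i|) ^ 3) :
    ∫ ω, |u ω| ∂P ≤ M * (d ^ 3 * (1 + c) / (n * √n)) := by
  have hn' : (0 : ℝ) < n := by exact_mod_cast hn
  set s : ℝ := (√n)⁻¹ with hs
  have hs0 : 0 < s := by positivity
  have hsq : √(n : ℝ) * √n = n := Real.mul_self_sqrt hn'.le
  have e1 : s ^ 3 = 1 / (n * √n) := by
    rw [hs, inv_pow, pow_succ, sq, hsq, one_div]
  have e2 : c / (n : ℝ) ^ 2 / s = c / (n * √n) := by
    rw [hs, div_inv_eq_mul, div_mul_eq_mul_div, div_eq_div_iff (by positivity) (by positivity)]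
    calc c * √n * (n * √n) = c * (√n * √n) * n := by ring
      _ = _ := by rw [hsq]; ring
  have hint2 : ∀ i, Integrable (fun ω => s ^ 3 + Y ω i ^ 4 / s) P := fun i =>
    (integrable_const _).add ((hint i).div_const _)
  have hint3 : Integrable (fun ω => M * (d ^ 2 * ∑ i, (s ^ 3 + Y ω i ^ 4 / s))) P :=
    ((integrable_finsetSum _ fun i _ => hint2 i).const_mul _).const_mul _
  calc ∫ ω, |u ω| ∂P ≤ ∫ ω, M * (d ^ 2 * ∑ i, (s ^ 3 + Y ω i ^ 4 / s)) ∂P := by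
        refine integral_mono_of_nonneg (.of_forall fun _ => abs_nonneg _) hint3
          (.of_forall fun ω => (hu ω).trans ?_)
        exact mul_le_mul_of_nonneg_left (sum_abs_pow_three_le _ hs0) hM
    _ = M * (d ^ 2 * ∑ i, (s ^ 3 + (∫ ω, Y ω i ^ 4 ∂P) / s)) := by
        rw [integral_const_mul, integral_const_mul, integral_finsetSum _ fun i _ => hint2 i]
        congr 2
        refine Finset.sum_congr rfl fun i _ => ?_
        rw [integral_add (integrable_const _) ((hint i).div_const _), integral_div]
        simp
    _ ≤ M * (d ^ 2 * ∑ i : Fin d, (1 / (n * √n) + c / (n * √n))) := by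
        refine mul_le_mul_of_nonneg_left (mul_le_mul_of_nonneg_left (Finset.sum_le_sum
          fun i _ => ?_) (by positivity)) hM
        rw [e1, ← e2]
        gcongr
        exact hY i
    _ = _ := by
        simp only [Finset.sum_const, Finset.card_univ, Fintype.card_fin, nsmul_eq_mul]
        ring

namespace IncrementBounds

variable {P : Measure Ω} [IsProbabilityMeasure P] {D : Fin n → Ω → EuclideanSpace ℝ (Fin d)}
  {Sg : Fin n → Matrix (Fin d) (Fin d) ℝ} {C η : ℝ} (H : IncrementBounds P D Sg C η)

include H

lemma posSemidef (m : Fin n) : (Sg m).PosSemidef := by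
  refine Matrix.PosSemidef.of_dotProduct_mulVec_nonneg ?_ fun x => ?_
  · ext i j
    simp only [Matrix.conjTranspose_apply, star_trivial, ← H.cov, mul_comm]
  · have hb := BddMeas.sum Finset.univ fun i _ => (BddMeas.const (x i)).mul (H.bddMeas m i)
    have : star x ⬝ᵥ (Sg m).mulVec x = ∫ ω, (∑ i, x i * D m ω i) * (∑ i, x i * D m ω i) ∂P := by
      simp only [Finset.sum_mul_sum]
      rw [integral_finsetSum _ fun i _ => (BddMeas.sum _ fun j _ =>
        ((BddMeas.const (x i)).mul (H.bddMeas m i)).mul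
          ((BddMeas.const (x j)).mul (H.bddMeas m j))).integrable _]
      simp only [dotProduct, Matrix.mulVec, Pi.star_apply, star_trivial, Finset.mul_sum]
      refine Finset.sum_congr rfl fun i _ => ?_
      rw [integral_finsetSum _ fun j _ => (((BddMeas.const (x i)).mul (H.bddMeas m i)).mul
          ((BddMeas.const (x j)).mul (H.bddMeas m j))).integrable _]
      refine Finset.sum_congr rfl fun j _ => ?_
      rw [← H.cov, mul_comm (∫ ω, _ ∂P), ← mul_assoc, ← integral_const_mul]
      refine integral_congr_ae (.of_forall fun ω => ?_)
      simp only
      ring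
    rw [this]
    exact integral_nonneg fun ω => mul_self_nonneg _

lemma posSemidef_tailCov (m : ℕ) : (tailCov Sg m).PosSemidef := by
  refine Matrix.posSemidef_sum _ fun l _ => ?_
  split_ifs
  · exact H.posSemidef l
  · exact Matrix.PosSemidef.zero

lemma measurable (m : Fin n) : Measurable (D m) := by
  have : D m = fun ω => WithLp.toLp 2 (fun i => D m ω i) := by ext; simp
  rw [this]
  exact (PiLp.continuous_toLp 2 _).measurable.comp
    (measurable_pi_lambda _ fun i => (H.bddMeas m i).measurable)

lemma measurable_partialSum (m : ℕ) : Measurable (partialSum D m) := by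
  refine Finset.measurable_sum _ fun l _ => ?_
  split_ifs
  · exact H.measurable l
  · exact measurable_const

lemma integrable_pow_four (m : Fin n) (i : Fin d) : Integrable (fun ω => D m ω i ^ 4) P := by
  have := ((H.bddMeas m i).mul (H.bddMeas m i)).mul ((H.bddMeas m i).mul (H.bddMeas m i))
  refine (this.integrable P).congr (.of_forall fun ω => ?_)
  simp only
  ring

lemma cov_diag_sq_le (m : Fin n) (i : Fin d) : Sg m i i ^ 2 ≤ C / (n : ℝ) ^ 2 := by
  refine le_trans ?_ (H.fourth m i)
  have h2 := (H.bddMeas m i).mul (H.bddMeas m i)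
  have h := integral_nonneg (μ := P) (f := fun ω => (D m ω i * D m ω i - Sg m i i) ^ 2)
    (fun ω => sq_nonneg _)
  have h3 : ∫ ω, (D m ω i * D m ω i - Sg m i i) ^ 2 ∂P =
      ∫ ω, D m ω i ^ 4 ∂P - Sg m i i ^ 2 := by
    have : ∀ ω, (D m ω i * D m ω i - Sg m i i) ^ 2 =
        D m ω i ^ 4 - (2 * Sg m i i * (D m ω i * D m ω i) - Sg m i i ^ 2) := fun ω => by ring
    simp only [this]
    have j1 : Integrable (fun ω => 2 * Sg m i i * (D m ω i * D m ω i)) P :=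
      ((BddMeas.const (2 * Sg m i i)).mul h2).integrable P
    have j2 : Integrable (fun ω => 2 * Sg m i i * (D m ω i * D m ω i) - Sg m i i ^ 2) P :=
      j1.sub (integrable_const _)
    rw [integral_sub (H.integrable_pow_four m i) j2,
      integral_sub j1 (integrable_const _), integral_const_mul, H.cov]
    simp only [integral_const, probReal_univ, smul_eq_mul]
    ring
  rw [h3] at h
  linarith

lemma gaussian_fourth (m : Fin n) (i : Fin d) :
    ∫ y, (y i) ^ 4 ∂(multivariateGaussian 0 (Sg m)) ≤
      gaussianFourthMoment * C / (n : ℝ) ^ 2 := by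
  rw [integral_eval_pow_four_multivariateGaussian (H.posSemidef m), mul_div_assoc]
  exact mul_le_mul_of_nonneg_left (H.cov_diag_sq_le m i) gaussianFourthMoment_nonneg

lemma integrable_gaussian_fourth (m : Fin n) (i : Fin d) :
    Integrable (fun y : EuclideanSpace ℝ (Fin d) => (y i) ^ 4)
      (multivariateGaussian 0 (Sg m)) := by
  have := (memLp_eval_multivariateGaussian (H.posSemidef m) i 4 (by simp)).integrable_norm_pow
    (by norm_num)
  refine this.congr (.of_forall fun y => ?_)
  simp only [Real.norm_eq_abs]
  exact Even.pow_abs (by decide) _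

omit [IsProbabilityMeasure P] H in
lemma _root_.integral_zero_add_tailCov [IsProbabilityMeasure P]
    {h : EuclideanSpace ℝ (Fin d) → ℝ} :
    ∫ q, h (partialSum D 0 q.1 + q.2) ∂(P.prod (multivariateGaussian 0 (tailCov Sg 0))) =
      ∫ z, h z ∂(multivariateGaussian 0 (∑ l, Sg l)) := by
  simp only [partialSum_zero, zero_add, tailCov_zero]
  have := integral_prod_mul (μ := P) (ν := multivariateGaussian 0 (∑ l, Sg l))
    (fun _ => (1 : ℝ)) h
  simpa using this

omit [IsProbabilityMeasure P] H in
lemma _root_.integral_add_tailCov_last [IsProbabilityMeasure P] (hD : Measurable (partialSum D n))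
    {h : EuclideanSpace ℝ (Fin d) → ℝ} (hh : BddMeas h) :
    ∫ q, h (partialSum D n q.1 + q.2) ∂(P.prod (multivariateGaussian 0 (tailCov Sg n))) =
      ∫ ω, h (∑ l, D l ω) ∂P := by
  rw [tailCov_last, multivariateGaussian_zero, integral_prod]
  · refine integral_congr_ae (.of_forall fun ω => ?_)
    simp only
    rw [integral_dirac]
    simp [partialSum_last]
  · exact (hh.comp ((hD.comp measurable_fst).add measurable_snd)).integrable _

lemma step {h : EuclideanSpace ℝ (Fin d) → ℝ} {h1 : Fin d → EuclideanSpace ℝ (Fin d) → ℝ}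
    {h2 : Fin d → Fin d → EuclideanSpace ℝ (Fin d) → ℝ} {M : ℝ}
    (hT : IsTaylorThree h h1 h2 M) (m : Fin n) :
    |∫ q, h (partialSum D (m + 1) q.1 + q.2)
        ∂(P.prod (multivariateGaussian 0 (tailCov Sg (m + 1)))) -
      ∫ q, h (partialSum D m q.1 + q.2) ∂(P.prod (multivariateGaussian 0 (tailCov Sg m)))| ≤
    ∫ q, |taylorRem h h1 h2 (partialSum D m q.1 + q.2) (D m q.1)|
      ∂(P.prod (multivariateGaussian 0 (tailCov Sg (m + 1)))) +
    ∫ q, |taylorRem h h1 h2 (partialSum D m q.1.1 + q.1.2) q.2|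
      ∂((P.prod (multivariateGaussian 0 (tailCov Sg (m + 1)))).prod
        (multivariateGaussian 0 (Sg m))) +
    d * d * (M * η) := by
  obtain ⟨K1, hK1⟩ := hT.bound1
  have := lindeberg_step P (H.measurable_partialSum m) (H.bddMeas m) (H.posSemidef m)
    (H.posSemidef_tailCov (m + 1)) ⟨hT.measurable, hT.bound⟩
    (fun i => ⟨hT.measurable1 i, K1, hK1 i⟩) (fun i j => ⟨hT.measurable2 i j, M, hT.bound2 i j⟩)
    (fun z i => H.first m (fun x => h1 i (x + z))
      ⟨(hT.measurable1 i).comp (measurable_id.add_const z), K1, fun x => hK1 i _⟩ i)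
    (η := M * η)
    (fun z i j => H.second m (fun x => h2 i j (x + z))
      ((hT.measurable2 i j).comp (measurable_id.add_const z)) M (fun x => hT.bound2 i j _) i j)
  rw [← tailCov_eq] at this
  simpa only [partialSum_succ] using this

/-- The central limit theorem with a rate for smooth test functions. -/
theorem smooth_bound (hn : 0 < n) (hη : η ≤ C / (n * √n))
    {h : EuclideanSpace ℝ (Fin d) → ℝ} {h1 : Fin d → EuclideanSpace ℝ (Fin d) → ℝ}
    {h2 : Fin d → Fin d → EuclideanSpace ℝ (Fin d) → ℝ} {M : ℝ} (hM : 0 ≤ M)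
    (hT : IsTaylorThree h h1 h2 M) :
    |∫ ω, h (∑ l, D l ω) ∂P - ∫ z, h z ∂(multivariateGaussian 0 (∑ l, Sg l))| ≤
      (d ^ 3 * (1 + C) + d ^ 3 * (1 + gaussianFourthMoment * C) + d * d * C) * M / √n := by
  have hn' : (0 : ℝ) < n := by exact_mod_cast hn
  set Φ : ℕ → ℝ := fun m => ∫ q, h (partialSum D m q.1 + q.2)
    ∂(P.prod (multivariateGaussian 0 (tailCov Sg m))) with hΦ
  set A := (d ^ 3 * (1 + C) + d ^ 3 * (1 + gaussianFourthMoment * C) + d * d * C) with hA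
  have hstep : ∀ m : Fin n, |Φ (m + 1) - Φ m| ≤ A * M / (n * √n) := by
    intro m
    refine (H.step hT m).trans ?_
    have r1 := integral_sum_abs_pow_three_le
      (P.prod (multivariateGaussian 0 (tailCov Sg (m + 1))))
      (Y := fun q i => D m q.1 i) (c := C) hn
      (fun i => (H.integrable_pow_four m i).comp_fst _)
      (fun i => by
        have := integral_prod_mul (μ := P) (ν := multivariateGaussian 0 (tailCov Sg (m + 1)))
          (fun ω => D m ω i ^ 4) (fun _ => (1 : ℝ))
        simp only [mul_one, integral_const, probReal_univ, smul_eq_mul] at this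
        rw [this]; exact H.fourth m i) hM
      (u := fun q => taylorRem h h1 h2 (partialSum D m q.1 + q.2) (D m q.1))
      (fun q => hT.rem_le _ _)
    have r2 := integral_sum_abs_pow_three_le
      ((P.prod (multivariateGaussian 0 (tailCov Sg (m + 1)))).prod
        (multivariateGaussian 0 (Sg m)))
      (Y := fun q i => q.2 i) (c := gaussianFourthMoment * C) hn
      (fun i => (H.integrable_gaussian_fourth m i).comp_snd _)
      (fun i => by
        have := integral_prod_mul (μ := P.prod (multivariateGaussian 0 (tailCov Sg (m + 1))))
          (ν := multivariateGaussian 0 (Sg m)) (fun _ => (1 : ℝ))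
          (fun y : EuclideanSpace ℝ (Fin d) => y i ^ 4)
        simp only [one_mul, integral_const, probReal_univ, smul_eq_mul] at this
        rw [this]; exact H.gaussian_fourth m i) hM
      (u := fun q => taylorRem h h1 h2 (partialSum D m q.1.1 + q.1.2) q.2)
      (fun q => hT.rem_le _ _)
    have r3 : d * d * (M * η) ≤ d * d * (M * (C / (n * √n))) := by gcongr
    refine (add_le_add (add_le_add r1 r2) r3).trans (le_of_eq ?_)
    rw [hA]; ring
  have htel : Φ n - Φ 0 = ∑ m : Fin n, (Φ (m + 1) - Φ m) := by
    rw [Fin.sum_univ_eq_sum_range (fun m => Φ (m + 1) - Φ m), Finset.sum_range_sub]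
  have e0 : Φ 0 = ∫ z, h z ∂(multivariateGaussian 0 (∑ l, Sg l)) := integral_zero_add_tailCov
  have e1 : Φ n = ∫ ω, h (∑ l, D l ω) ∂P :=
    integral_add_tailCov_last (H.measurable_partialSum n) ⟨hT.measurable, hT.bound⟩
  rw [← e0, ← e1, htel]
  refine (Finset.abs_sum_le_sum_abs _ _).trans ((Finset.sum_le_sum fun m _ => hstep m).trans ?_)
  rw [Finset.sum_const, Finset.card_univ, Fintype.card_fin, nsmul_eq_mul]
  refine le_of_eq ?_
  field_simp

end IncrementBounds

end Increments


/-! ### The increments of normalised sums over tuples -/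

section Layers

set_option linter.unusedSectionVars false

variable {n d : ℕ} {k : Fin d → ℕ}

lemma pow_le_choose_mul {n k : ℕ} (hk : 1 ≤ k) (hkn : k ≤ n) :
    n ^ k ≤ k ^ k * k.factorial * n.choose k := by
  have h1 : n ≤ k * (n + 1 - k) := by
    obtain ⟨r, rfl⟩ := Nat.exists_eq_add_of_le hkn
    obtain ⟨s, rfl⟩ := Nat.exists_eq_add_of_le hk
    rw [show 1 + s + r + 1 - (1 + s) = r + 1 by omega]
    nlinarith [Nat.zero_le (s * r)]
  calc n ^ k ≤ (k * (n + 1 - k)) ^ k := Nat.pow_le_pow_left h1 k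
    _ = k ^ k * (n + 1 - k) ^ k := mul_pow _ _ _
    _ ≤ k ^ k * n.descFactorial k := Nat.mul_le_mul_left _ (n.pow_sub_le_descFactorial k)
    _ = _ := by rw [Nat.descFactorial_eq_factorial_mul_choose, mul_assoc]

lemma inv_choose_mul_pow_le {n k p : ℕ} (hk : 1 ≤ k) (hkp : k ≤ p) :
    ((√(n.choose k : ℝ))⁻¹) ^ 2 * (n : ℝ) ^ k ≤ p ^ p * p.factorial := by
  rw [inv_pow, Real.sq_sqrt (by positivity)]
  by_cases hkn : k ≤ n
  · have hc : (0 : ℝ) < n.choose k := by exact_mod_cast Nat.choose_pos hkn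
    rw [inv_mul_le_iff₀ hc]
    have h1 := pow_le_choose_mul hk hkn
    have h2 : k ^ k * k.factorial * n.choose k ≤ n.choose k * (p ^ p * p.factorial) := by
      rw [mul_comm]
      refine Nat.mul_le_mul_left _ (Nat.mul_le_mul ?_ (Nat.factorial_le hkp))
      exact (Nat.pow_le_pow_left hkp k).trans (Nat.pow_le_pow_right (by omega) hkp)
    exact_mod_cast h1.trans h2
  · rw [Nat.choose_eq_zero_of_lt (not_le.1 hkn)]
    simp only [Nat.cast_zero, inv_zero, zero_mul]
    positivity

/-- The increments, vertex by vertex, of the normalised sums over increasing tuples. -/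
noncomputable def layer (X : ∀ i, (Fin (k i) → Fin n) → (Coord n → I) → ℝ) (m : Fin n)
    (x : Coord n → I) : EuclideanSpace ℝ (Fin d) :=
  WithLp.toLp 2 fun i => (√(n.choose (k i) : ℝ))⁻¹ * ∑ a ∈ tuplesEndingAt n (k i) m, X i a x

/-- The covariance matrices of the increments. -/
noncomputable def layerCov (μ : Coord n → Measure I)
    (X : ∀ i, (Fin (k i) → Fin n) → (Coord n → I) → ℝ) (m : Fin n) :
    Matrix (Fin d) (Fin d) ℝ :=
  Matrix.of fun i j => ∫ x, layer X m x i * layer X m x j ∂(Measure.pi μ)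

/-- The constant in the bounds for the increments. -/
noncomputable def layerConst (p : ℕ) (K : ℝ) : ℝ :=
  (p ^ p * p.factorial) ^ 2 * K ^ 4 * (2 * p) ^ (4 * p) +
    2 * (p ^ p * p.factorial) * K ^ 2 * (2 * p) ^ (2 * p)

variable {μ : Coord n → Measure I} [∀ j, IsProbabilityMeasure (μ j)]
  {F : ∀ i, SimpleGraph (Fin (k i))} {X : ∀ i, (Fin (k i) → Fin n) → (Coord n → I) → ℝ}
  {K : ℝ} {p : ℕ}

lemma sum_layer (hk : ∀ i, k i ≠ 0) (x : Coord n → I) (i : Fin d) :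
    (∑ m, layer X m x) i = (√(n.choose (k i) : ℝ))⁻¹ * ∑ a ∈ increasingTuples n (k i), X i a x := by
  rw [← sum_tuplesEndingAt (hk i) (fun a => X i a x), Finset.mul_sum]
  simp [layer]

lemma dependsOn_partialSum_layer (hX : ∀ i, CentredFamily μ (F i) (X i) K) (m : Fin n) :
    DependsOn (partialSum (layer X) m) ((vertexCoords m : Set (Coord n))ᶜ) := by
  intro x y h
  unfold partialSum
  refine Finset.sum_congr rfl fun l _ => ?_
  split_ifs with hl
  · unfold layer
    congr 1
    funext i
    congr 1
    exact Finset.sum_congr rfl fun a ha =>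
      (hX i).dependsOn_vertexCoords_compl (m := m) (Fin.lt_def.2 hl) ha h
  · rfl

lemma bddMeas_layer (hX : ∀ i, CentredFamily μ (F i) (X i) K) (m : Fin n) (i : Fin d) :
    BddMeas (fun x => layer X m x i) :=
  (BddMeas.const _).mul (BddMeas.sum _ fun _ ha => (hX i).bddMeas (mem_tuplesEndingAt.1 ha).1)

lemma measurable_partialSum_layer (hX : ∀ i, CentredFamily μ (F i) (X i) K) (m : ℕ) :
    Measurable (partialSum (layer X) m) := by
  refine Finset.measurable_sum _ fun l _ => ?_
  split_ifs
  · exact (PiLp.continuous_toLp 2 _).measurable.comp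
      (measurable_pi_lambda _ fun i => (bddMeas_layer hX l i).measurable)
  · exact measurable_const

lemma layer_first (hF : ∀ i, (F i).Connected) (hX : ∀ i, CentredFamily μ (F i) (X i) K)
    (m : Fin n) (i : Fin d) {f : (Coord n → I) → ℝ} (hf : BddMeas f)
    (hfd : DependsOn f ((vertexCoords m : Set (Coord n))ᶜ)) :
    ∫ x, f x * layer X m x i ∂(Measure.pi μ) = 0 := by
  have h0 := (hX i).integral_mul_sum_eq_zero (hF i) m hf hfd
  have : ∀ x, f x * layer X m x i = (√(n.choose (k i) : ℝ))⁻¹ *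
      (f x * ∑ a ∈ tuplesEndingAt n (k i) m, X i a x) := fun x => by
    simp only [layer]; ring
  simp only [this]
  rw [integral_const_mul, h0, mul_zero]

lemma layer_fourth (hF : ∀ i, (F i).Connected) (hk : ∀ i, k i ≤ p)
    (hX : ∀ i, CentredFamily μ (F i) (X i) K) (m : Fin n) (i : Fin d) :
    ∫ x, (layer X m x i) ^ 4 ∂(Measure.pi μ) ≤
      (p ^ p * p.factorial) ^ 2 * K ^ 4 * (2 * p) ^ (4 * p) / (n : ℝ) ^ 2 := by
  have hn : (0 : ℝ) < n := by exact_mod_cast m.pos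
  have hki : 1 ≤ k i := Fin.pos_iff_nonempty.2 (hF i).nonempty
  set c := (√(n.choose (k i) : ℝ))⁻¹ with hc
  have hA := inv_choose_mul_pow_le (n := n) hki (hk i)
  have h4 := (hX i).integral_sum_pow_four_le (hF i) m
  have hp : 1 ≤ p := hki.trans (hk i)
  have hpow : ((2 * (k i : ℝ)) ^ (4 * k i)) ≤ (2 * (p : ℝ)) ^ (4 * p) := by
    have : (2 * k i) ^ (4 * k i) ≤ (2 * p) ^ (4 * p) :=
      (Nat.pow_le_pow_left (Nat.mul_le_mul_left 2 (hk i)) _).trans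
        (Nat.pow_le_pow_right (by omega) (Nat.mul_le_mul_left 4 (hk i)))
    exact_mod_cast this
  have e : ∀ x, (layer X m x i) ^ 4 = c ^ 4 * (∑ a ∈ tuplesEndingAt n (k i) m, X i a x) ^ 4 :=
    fun x => mul_pow _ _ _
  simp only [e]
  rw [integral_const_mul]
  calc _ ≤ c ^ 4 * (K ^ 4 * (2 * k i) ^ (4 * k i) * ((n : ℝ) ^ (2 * k i) / n ^ 2)) :=
        mul_le_mul_of_nonneg_left h4 (by positivity)
    _ = (c ^ 2 * (n : ℝ) ^ k i) ^ 2 * K ^ 4 * (2 * k i) ^ (4 * k i) / (n : ℝ) ^ 2 := by ring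
    _ ≤ _ := by gcongr

lemma layer_second (hF : ∀ i, (F i).Connected) (hk : ∀ i, k i ≤ p)
    (hX : ∀ i, CentredFamily μ (F i) (X i) K) (m : Fin n) (i j : Fin d)
    {f : (Coord n → I) → ℝ} (hf : Measurable f) {M : ℝ} (hM : ∀ x, |f x| ≤ M)
    (hfd : DependsOn f ((vertexCoords m : Set (Coord n))ᶜ)) :
    |∫ x, f x * (layer X m x i * layer X m x j - layerCov μ X m i j) ∂(Measure.pi μ)| ≤
      M * (2 * (p ^ p * p.factorial) * K ^ 2 * (2 * p) ^ (2 * p) / (n * √n)) := by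
  have hn : (0 : ℝ) < n := by exact_mod_cast m.pos
  have hki : 1 ≤ k i := Fin.pos_iff_nonempty.2 (hF i).nonempty
  have hkj : 1 ≤ k j := Fin.pos_iff_nonempty.2 (hF j).nonempty
  have hM0 : 0 ≤ M := (abs_nonneg _).trans (hM (fun _ => 0))
  have hp : 1 ≤ p := hki.trans (hk i)
  set c := (√(n.choose (k i) : ℝ))⁻¹ with hc
  set c' := (√(n.choose (k j) : ℝ))⁻¹ with hc'
  have hA := inv_choose_mul_pow_le (n := n) hki (hk i)
  have hA' := inv_choose_mul_pow_le (n := n) hkj (hk j)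
  have h2 := (hX i).sq_integral_mul_layer_le (hX j) (hF i) (hF j) m hf hM hfd
  have hpow : (((k i : ℝ) + k j) ^ (2 * (k i + k j))) ≤ (2 * (p : ℝ)) ^ (4 * p) := by
    have : (k i + k j) ^ (2 * (k i + k j)) ≤ (2 * p) ^ (4 * p) :=
      (Nat.pow_le_pow_left (by linarith [hk i, hk j]) _).trans
        (Nat.pow_le_pow_right (by omega) (by linarith [hk i, hk j]))
    exact_mod_cast this
  have e : ∀ x, layer X m x i * layer X m x j = (c * c') *
      ((∑ a ∈ tuplesEndingAt n (k i) m, X i a x) * (∑ a ∈ tuplesEndingAt n (k j) m, X j a x)) :=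
    fun x => mul_mul_mul_comm _ _ _ _
  have e2 : ∀ x, f x * (layer X m x i * layer X m x j - layerCov μ X m i j) = (c * c') *
      (f x * ((∑ a ∈ tuplesEndingAt n (k i) m, X i a x) *
        (∑ a ∈ tuplesEndingAt n (k j) m, X j a x) -
      ∫ y, (∑ a ∈ tuplesEndingAt n (k i) m, X i a y) *
        (∑ a ∈ tuplesEndingAt n (k j) m, X j a y) ∂(Measure.pi μ))) := by
    intro x
    have : layerCov μ X m i j = (c * c') * ∫ y, (∑ a ∈ tuplesEndingAt n (k i) m, X i a y) *
        (∑ a ∈ tuplesEndingAt n (k j) m, X j a y) ∂(Measure.pi μ) := by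
      simp only [layerCov, Matrix.of_apply, e]
      rw [integral_const_mul]
    rw [this, e]; ring
  simp only [e2]
  rw [integral_const_mul]
  refine abs_le_of_sq_le_sq ?_ (by positivity)
  have hsq : √(n : ℝ) ^ 2 = n := Real.sq_sqrt hn.le
  calc _ = (c * c') ^ 2 * (∫ x, f x * ((∑ a ∈ tuplesEndingAt n (k i) m, X i a x) *
        (∑ a ∈ tuplesEndingAt n (k j) m, X j a x) -
      ∫ y, (∑ a ∈ tuplesEndingAt n (k i) m, X i a y) *
        (∑ a ∈ tuplesEndingAt n (k j) m, X j a y) ∂(Measure.pi μ)) ∂(Measure.pi μ)) ^ 2 :=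
        mul_pow _ _ _
    _ ≤ (c * c') ^ 2 * (M ^ 2 * (4 * K ^ 4 * ((k i + k j) ^ (2 * (k i + k j))) *
          ((n : ℝ) ^ (k i + k j) / n ^ 3))) := mul_le_mul_of_nonneg_left h2 (sq_nonneg _)
    _ = M ^ 2 * (4 * ((c ^ 2 * (n : ℝ) ^ k i) * (c' ^ 2 * (n : ℝ) ^ k j)) * K ^ 4 *
          ((k i + k j) ^ (2 * (k i + k j))) / n ^ 3) := by ring
    _ ≤ M ^ 2 * (4 * ((p ^ p * p.factorial) * (p ^ p * p.factorial)) * K ^ 4 *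
          (2 * p) ^ (4 * p) / n ^ 3) := by gcongr
    _ = (M * (2 * (p ^ p * p.factorial) * K ^ 2 * (2 * p) ^ (2 * p) / (n * √n))) ^ 2 := by
        simp only [mul_pow, div_pow]
        rw [hsq]
        ring

lemma incrementBounds_layer (hF : ∀ i, (F i).Connected) (hk : ∀ i, k i ≤ p)
    (hX : ∀ i, CentredFamily μ (F i) (X i) K) (hn : 0 < n) :
    IncrementBounds (Measure.pi μ) (layer X) (layerCov μ X) (layerConst p K)
      (layerConst p K / (n * √n)) where
  bddMeas := bddMeas_layer hX
  cov _ _ _ := rfl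
  first m f hf i := layer_first hF hX m i (hf.comp (measurable_partialSum_layer hX m))
    (fun _ _ h => congrArg f (dependsOn_partialSum_layer hX m h))
  second m f hf M hM i j := by
    have hM0 : 0 ≤ M := (abs_nonneg _).trans (hM 0)
    refine (layer_second hF hk hX m i j (hf.comp (measurable_partialSum_layer hX m))
      (fun x => hM _) (fun _ _ h => congrArg f (dependsOn_partialSum_layer hX m h))).trans ?_
    refine mul_le_mul_of_nonneg_left ?_ hM0
    gcongr
    exact le_add_of_nonneg_left (by positivity)
  fourth m i := by
    refine (layer_fourth hF hk hX m i).trans ?_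
    gcongr
    exact le_add_of_nonneg_right (by positivity)

section OneVertex

variable (hk1 : ∀ i, k i = 1)

include hk1

lemma tuplesEndingAt_subsingleton (m : Fin n) (i : Fin d) :
    (tuplesEndingAt n (k i) m).card ≤ 1 := by
  refine Finset.card_le_one.2 fun a ha b hb => ?_
  have : Subsingleton (Fin (k i)) := by rw [hk1 i]; infer_instance
  obtain ⟨v, hv⟩ := (mem_tuplesEndingAt.1 ha).2.1
  obtain ⟨w, hw⟩ := (mem_tuplesEndingAt.1 hb).2.1
  funext u
  rw [Subsingleton.elim u v, hv, Subsingleton.elim v w, hw]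

lemma abs_layer_le (hX : ∀ i, CentredFamily μ (F i) (X i) K) (hK : 0 ≤ K) (m : Fin n)
    (x : Coord n → I) (i : Fin d) : |layer X m x i| ≤ K / √n := by
  have h1 : |∑ a ∈ tuplesEndingAt n (k i) m, X i a x| ≤ K := by
    refine (Finset.abs_sum_le_sum_abs _ _).trans ?_
    refine (Finset.sum_le_card_nsmul _ _ K fun a ha =>
      (hX i).bound a (mem_tuplesEndingAt.1 ha).1 x).trans ?_
    rw [nsmul_eq_mul]
    have : ((tuplesEndingAt n (k i) m).card : ℝ) ≤ 1 := by
      exact_mod_cast tuplesEndingAt_subsingleton hk1 m i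
    nlinarith
  have hc : n.choose (k i) = n := by rw [hk1 i, Nat.choose_one_right]
  simp only [layer, abs_mul]
  rw [hc, abs_of_nonneg (by positivity), div_eq_inv_mul]
  exact mul_le_mul_of_nonneg_left h1 (by positivity)

lemma dependsOn_layer (hX : ∀ i, CentredFamily μ (F i) (X i) K) (m : Fin n) (i : Fin d) :
    DependsOn (fun x => layer X m x i) (vertexCoords m : Set (Coord n)) := by
  have : Subsingleton (Fin (k i)) := by rw [hk1 i]; infer_instance
  intro x y h
  simp only [layer]
  congr 1
  refine Finset.sum_congr rfl fun a ha => ?_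
  obtain ⟨hmono, ⟨v, hv⟩, -⟩ := mem_tuplesEndingAt.1 ha
  refine (hX i).dependsOn a hmono fun j hj => h j ?_
  rcases j with w | e
  · obtain ⟨u, -, rfl⟩ := Finset.mem_image.1 (inl_mem_copyCoords.1 hj)
    rw [Subsingleton.elim u v, hv]
    simp
  · obtain ⟨u, w, huw, -⟩ := mem_edgeImage.1 (inr_mem_copyCoords.1 hj)
    exact absurd (Subsingleton.elim u w) huw.ne

lemma incrementBounds_layer_one (hF : ∀ i, (F i).Connected) (hk : ∀ i, k i ≤ p)
    (hX : ∀ i, CentredFamily μ (F i) (X i) K) (hn : 0 < n) :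
    IncrementBounds (Measure.pi μ) (layer X) (layerCov μ X) (layerConst p K) 0 := by
  have H := incrementBounds_layer hF hk hX hn
  refine ⟨H.bddMeas, H.cov, H.first, fun m f hf M hM i j => ?_, H.fourth⟩
  have hb := ((H.bddMeas m i).mul (H.bddMeas m j)).sub (BddMeas.const (layerCov μ X m i j))
  rw [integral_mul_of_disjoint μ (F := fun x => f (partialSum (layer X) m x))
    (G := fun x => layer X m x i * layer X m x j - layerCov μ X m i j)
    ((BddMeas.mk hf ⟨M, hM⟩).comp (measurable_partialSum_layer hX m)) hb
    (fun _ _ h => congrArg f (dependsOn_partialSum_layer hX m h)) (t := vertexCoords m) ?_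
    (Set.disjoint_left.2 fun j hj hj' => hj hj'),
    integral_sub (((H.bddMeas m i).mul (H.bddMeas m j)).integrable _) (integrable_const _), H.cov]
  · simp
  · intro x y h
    simp only
    have hi := dependsOn_layer hk1 hX m i h
    have hj := dependsOn_layer hk1 hX m j h
    simp only at hi hj
    rw [hi, hj]

end OneVertex

end Layers


/-! ### Centred graph counts on the canonical space -/

section Statistics

set_option linter.unusedSectionVars false

variable {n : ℕ} {k l : ℕ}

/-- The contribution of the tuple `a` to a centred count, as a function of the labels `u` and the
centred edge variables `η`; the constants `c` centre the contributions of single vertices. -/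
noncomputable def tupleStat (F : SimpleGraph (Fin k)) (φ : (Fin k → ℝ) → ℝ) (ψ : (Fin k → I) → ℝ)
    (c : (Fin k → Fin n) → ℝ) (a : Fin k → Fin n) (u : Fin n → I) (η : Fin n × Fin n → ℝ) : ℝ :=
  if k = 1 then φ (latticePoint a) * (ψ (fun v => u (a v)) - c a)
  else φ (latticePoint a) * ψ (fun v => u (a v)) * ∏ e ∈ orderedEdges F, η (a e.1, a e.2)

/-- The centred edge variables on the canonical space. -/
def edgeNoise (ε : Fin n → Fin n → I → I → I → ℝ) (x : Coord n → I) (e : Fin n × Fin n) : ℝ :=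
  ε e.1 e.2 (x (Sum.inl e.1)) (x (Sum.inl e.2)) (x (Sum.inr e))

/-- Centred and bounded edge variables, given as functions of the labels and of independent
noise. -/
structure IsCentredNoise (μ : Coord n → Measure I) (ε : Fin n → Fin n → I → I → I → ℝ)
    (L : ℝ) : Prop where
  measurable : ∀ v w, Measurable fun q : (I × I) × I => ε v w q.1.1 q.1.2 q.2
  bound : ∀ v w s t z, |ε v w s t z| ≤ L
  mean : ∀ v w s t, ∫ z, ε v w s t z ∂(μ (Sum.inr (v, w))) = 0

/-- The expectation of the single vertex weight. -/
noncomputable def weightMean (μ : Coord n → Measure I) (ψ : (Fin k → I) → ℝ)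
    (a : Fin k → Fin n) : ℝ := ∫ y, ψ (fun v => y (Sum.inl (a v))) ∂(Measure.pi μ)

/-- The contributions of the tuples on the canonical space. -/
noncomputable def canonStat (μ : Coord n → Measure I) (ε : Fin n → Fin n → I → I → I → ℝ)
    (F : SimpleGraph (Fin k)) (φ : (Fin k → ℝ) → ℝ) (ψ : (Fin k → I) → ℝ)
    (a : Fin k → Fin n) (x : Coord n → I) : ℝ :=
  tupleStat F φ ψ (weightMean μ ψ) a (fun v => x (Sum.inl v)) (edgeNoise ε x)

lemma latticePoint_mem {a : Fin k → Fin n} (ha : StrictMono a) :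
    latticePoint a ∈ orderedSimplex k := by
  refine ⟨fun v => ?_, fun v w hvw => ?_⟩
  · have hn : (0 : ℝ) < n := by exact_mod_cast (a v).pos
    refine ⟨by unfold latticePoint; positivity, ?_⟩
    unfold latticePoint
    rw [div_le_one hn]
    exact_mod_cast (a v).2
  · unfold latticePoint
    have : ((a v : ℕ) : ℝ) ≤ ((a w : ℕ) : ℝ) := by exact_mod_cast ha.monotone hvw
    gcongr

variable {μ : Coord n → Measure I} [∀ j, IsProbabilityMeasure (μ j)]
  {ε : Fin n → Fin n → I → I → I → ℝ} {L B : ℝ}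
  {F : SimpleGraph (Fin k)} {φ : (Fin k → ℝ) → ℝ} {ψ : (Fin k → I) → ℝ}

lemma IsCentredNoise.measurable_edgeNoise (hε : IsCentredNoise μ ε L) (e : Fin n × Fin n) :
    Measurable fun x => edgeNoise ε x e := by
  have : Measurable fun x : Coord n → I => ((x (Sum.inl e.1), x (Sum.inl e.2)), x (Sum.inr e)) := by
    fun_prop
  exact (hε.measurable e.1 e.2).comp this

lemma IsCentredNoise.bddMeas (hε : IsCentredNoise μ ε L) (e : Fin n × Fin n) :
    BddMeas fun x => edgeNoise ε x e :=
  ⟨hε.measurable_edgeNoise e, L, fun _ => hε.bound _ _ _ _ _⟩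

lemma dependsOn_edgeNoise (e : Fin n × Fin n) :
    DependsOn (fun x => edgeNoise ε x e)
      {Sum.inl e.1, Sum.inl e.2, Sum.inr e} := by
  intro x y h
  simp only [edgeNoise]
  rw [h _ (by simp), h _ (by simp), h _ (by simp)]

lemma IsCentredNoise.resample_edgeNoise (hε : IsCentredNoise μ ε L) (e : Fin n × Fin n) :
    resample μ {Sum.inr e} (fun x => edgeNoise ε x e) = 0 := by
  funext x
  rw [resample_singleton μ _ (hε.measurable_edgeNoise e)]
  simpa [edgeNoise, Function.update] using hε.mean e.1 e.2 (x (Sum.inl e.1)) (x (Sum.inl e.2))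

lemma bddMeas_weight (hψm : Measurable ψ) (hψ : ∀ u, |ψ u| ≤ B) (a : Fin k → Fin n) :
    BddMeas fun x : Coord n → I => ψ (fun v => x (Sum.inl (a v))) :=
  (BddMeas.mk hψm ⟨B, hψ⟩).comp (by fun_prop)

lemma dependsOn_weight (a : Fin k → Fin n) :
    DependsOn (fun x : Coord n → I => ψ (fun v => x (Sum.inl (a v))))
      {j | ∃ v, j = Sum.inl (a v)} := by
  intro x y h
  simp only
  congr 1
  funext v
  exact h _ ⟨v, rfl⟩

lemma centredFamily_canonStat (hε : IsCentredNoise μ ε L) (hL : 1 ≤ L) (hB : 0 ≤ B)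
    (hφ : ∀ t ∈ orderedSimplex k, |φ t| ≤ B) (hψm : Measurable ψ) (hψ : ∀ u, |ψ u| ≤ B)
    {p : ℕ} (hkp : k ≤ p) :
    CentredFamily μ F (canonStat μ ε F φ ψ) (2 * B ^ 2 * L ^ (p * p)) := by
  have hw : ∀ a : Fin k → Fin n, |weightMean μ ψ a| ≤ B := fun a => by
    have := norm_integral_le_of_norm_le_const (μ := Measure.pi μ)
      (f := fun y : Coord n → I => ψ (fun v => y (Sum.inl (a v)))) (C := B)
      (.of_forall fun y => (Real.norm_eq_abs _).trans_le (hψ _))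
    simpa [weightMean] using this
  have hLp : 1 ≤ L ^ (p * p) := one_le_pow₀ hL
  by_cases hk : k = 1
  · have hX : ∀ a x, canonStat μ ε F φ ψ a x =
        φ (latticePoint a) * (ψ (fun v => x (Sum.inl (a v))) - weightMean μ ψ a) :=
      fun a x => if_pos hk
    have hsub : Subsingleton (Fin k) := by rw [hk]; infer_instance
    refine ⟨fun a _ => ?_, fun a ha x => ?_, fun a _ x y h => ?_, fun a _ e he => ?_,
      fun _ a _ v => ?_⟩
    · rw [funext (hX a)]
      exact ((bddMeas_weight hψm hψ a).measurable.sub_const _).const_mul _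
    · rw [hX, abs_mul]
      have h1 := hφ _ (latticePoint_mem ha)
      have h2 : |ψ (fun v => x (Sum.inl (a v))) - weightMean μ ψ a| ≤ 2 * B :=
        (abs_sub _ _).trans (by linarith [hψ (fun v => x (Sum.inl (a v))), hw a])
      calc _ ≤ B * (2 * B) := mul_le_mul h1 h2 (abs_nonneg _) hB
        _ = 2 * B ^ 2 * 1 := by ring
        _ ≤ _ := by gcongr
    · rw [hX, hX]
      have := dependsOn_weight (ψ := ψ) a (x := x) (y := y) (by
        rintro _ ⟨v, rfl⟩
        exact h _ (by simp))
      simp only at this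
      rw [this]
    · obtain ⟨u, w, huw, -⟩ := mem_edgeImage.1 he
      exact absurd (Subsingleton.elim u w) huw.ne
    · funext x
      rw [funext (hX a), resample_const_mul, resample_sub_const μ (bddMeas_weight hψm hψ a)]
      have : resample μ {Sum.inl (a v)} (fun x => ψ (fun v => x (Sum.inl (a v)))) x =
          weightMean μ ψ a := by
        refine integral_congr_ae (.of_forall fun y => ?_)
        simp only
        congr 1
        funext w
        rw [Subsingleton.elim w v]
        simp
      simp [this]
  · have hX : ∀ a x, canonStat μ ε F φ ψ a x = φ (latticePoint a) *
        ψ (fun v => x (Sum.inl (a v))) * ∏ e ∈ orderedEdges F, edgeNoise ε x (a e.1, a e.2) :=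
      fun a x => if_neg hk
    have hcard : (orderedEdges F).card ≤ p * p := by
      refine (Finset.card_le_univ _).trans ?_
      simpa using Nat.mul_le_mul hkp hkp
    refine ⟨fun a _ => ?_, fun a ha x => ?_, fun a _ x y h => ?_, fun a ha e he => ?_,
      fun h => absurd h hk⟩
    · rw [funext (hX a)]
      exact (((bddMeas_weight hψm hψ a).measurable.const_mul _).mul
        (Finset.measurable_prod _ fun e _ => hε.measurable_edgeNoise _))
    · rw [hX, abs_mul, abs_mul, Finset.abs_prod]
      have h1 := hφ _ (latticePoint_mem ha)
      have h3 : ∏ e ∈ orderedEdges F, |edgeNoise ε x (a e.1, a e.2)| ≤ L ^ (p * p) :=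
        calc _ ≤ ∏ _e ∈ orderedEdges F, L :=
              Finset.prod_le_prod (fun _ _ => abs_nonneg _) fun _ _ => hε.bound _ _ _ _ _
          _ = L ^ (orderedEdges F).card := Finset.prod_const _
          _ ≤ _ := pow_le_pow_right₀ hL hcard
      calc _ ≤ B * B * L ^ (p * p) := by
            refine mul_le_mul (mul_le_mul h1 (hψ _) (abs_nonneg _) hB) h3
              (Finset.prod_nonneg fun _ _ => abs_nonneg _) (by positivity)
        _ ≤ _ := by
            have : 0 ≤ B ^ 2 * L ^ (p * p) := by positivity
            linarith
    · rw [hX, hX]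
      have h1 := dependsOn_weight (ψ := ψ) a (x := x) (y := y) (by
        rintro _ ⟨v, rfl⟩
        exact h _ (by simp))
      simp only at h1
      rw [h1]
      congr 1
      refine Finset.prod_congr rfl fun e he => dependsOn_edgeNoise _ fun j hj => h j ?_
      have hmem : (a e.1, a e.2) ∈ edgeImage F a := Finset.mem_image.2 ⟨e, he, rfl⟩
      rcases hj with rfl | rfl | rfl
      · simp
      · simp
      · exact hmem
    · obtain ⟨e', he', rfl⟩ := Finset.mem_image.1 he
      have hfac : canonStat μ ε F φ ψ a = fun x => edgeNoise ε x (a e'.1, a e'.2) *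
          (φ (latticePoint a) * ψ (fun v => x (Sum.inl (a v))) *
            ∏ e ∈ (orderedEdges F).erase e', edgeNoise ε x (a e.1, a e.2)) := by
        funext x
        rw [hX, ← Finset.mul_prod_erase _ _ he']
        ring
      rw [hfac]
      refine resample_mul_eq_zero μ (hε.resample_edgeNoise _) fun x y h => ?_
      have h1 := dependsOn_weight (ψ := ψ) a (x := x) (y := y) (by
        rintro _ ⟨v, rfl⟩
        exact h _ (by simp))
      simp only at h1 ⊢
      rw [h1]
      congr 1
      refine Finset.prod_congr rfl fun e hee => dependsOn_edgeNoise _ fun j hj => h j ?_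
      rcases hj with rfl | rfl | rfl
      · simp
      · simp
      · simp only [Finset.coe_singleton, Set.mem_compl_iff, Set.mem_singleton_iff, Sum.inr.injEq,
          Prod.mk.injEq, not_and]
        intro h1 h2
        exact (Finset.mem_erase.1 hee).1 (Prod.ext (ha.injective h1) (ha.injective h2))

/-- The variance of the edge noise given the labels. -/
noncomputable def noiseVar (μ : Coord n → Measure I) (ε : Fin n → Fin n → I → I → I → ℝ)
    (v w : Fin n) (s t : I) : ℝ := ∫ z, ε v w s t z ^ 2 ∂(μ (Sum.inr (v, w)))

lemma IsCentredNoise.bddMeas_noiseVar (hε : IsCentredNoise μ ε L) (e : Fin n × Fin n) :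
    BddMeas fun x : Coord n → I =>
      noiseVar μ ε e.1 e.2 (x (Sum.inl e.1)) (x (Sum.inl e.2)) := by
  refine ⟨?_, L ^ 2, fun x => ?_⟩
  · have h1 : StronglyMeasurable (Function.uncurry fun (q : I × I) (z : I) =>
        ε e.1 e.2 q.1 q.2 z ^ 2) := ((hε.measurable e.1 e.2).pow_const 2).stronglyMeasurable
    have h2 : Measurable fun x : Coord n → I => (x (Sum.inl e.1), x (Sum.inl e.2)) := by fun_prop
    exact h1.integral_prod_right.measurable.comp h2
  · have := norm_integral_le_of_norm_le_const (μ := μ (Sum.inr (e.1, e.2)))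
      (f := fun z => ε e.1 e.2 (x (Sum.inl e.1)) (x (Sum.inl e.2)) z ^ 2) (C := L ^ 2)
      (.of_forall fun z => by
        rw [Real.norm_eq_abs, abs_pow]
        exact pow_le_pow_left₀ (abs_nonneg _) (hε.bound _ _ _ _ _) 2)
    simpa [noiseVar] using this

/-- Squares of distinct edge variables may be replaced by their conditional variances. -/
lemma IsCentredNoise.integral_mul_prod_sq (hε : IsCentredNoise μ ε L) (s : Finset (Fin n × Fin n))
    {G : (Coord n → I) → ℝ} (hG : BddMeas G) (hGd : DependsOn G (Set.range Sum.inl)) :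
    ∫ x, G x * ∏ e ∈ s, edgeNoise ε x e ^ 2 ∂(Measure.pi μ) =
      ∫ x, G x * ∏ e ∈ s, noiseVar μ ε e.1 e.2 (x (Sum.inl e.1)) (x (Sum.inl e.2))
        ∂(Measure.pi μ) := by
  classical
  induction s using Finset.induction_on generalizing G with
  | empty => simp
  | insert e s he ih =>
    have hsq : ∀ e, BddMeas fun x => edgeNoise ε x e ^ 2 := fun e => by
      simpa only [sq] using (hε.bddMeas e).mul (hε.bddMeas e)
    have hH : BddMeas fun x => G x * ∏ e ∈ s, edgeNoise ε x e ^ 2 :=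
      hG.mul (BddMeas.prod s fun e _ => hsq e)
    have hHd : DependsOn (fun x => G x * ∏ e ∈ s, edgeNoise ε x e ^ 2)
        ((({Sum.inr e} : Finset (Coord n)) : Set (Coord n))ᶜ) := by
      intro x y h
      simp only
      congr 1
      · refine hGd fun j hj => h j ?_
        obtain ⟨v, rfl⟩ := hj
        simp
      · refine Finset.prod_congr rfl fun e' he' => ?_
        congr 1
        refine dependsOn_edgeNoise _ fun j hj => h j ?_
        rcases hj with rfl | rfl | rfl
        · simp
        · simp
        · simp only [Finset.coe_singleton, Set.mem_compl_iff, Set.mem_singleton_iff,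
            Sum.inr.injEq]
          rintro rfl
          exact he he'
    have hres : resample μ {Sum.inr e} (fun x => edgeNoise ε x e ^ 2) =
        fun x => noiseVar μ ε e.1 e.2 (x (Sum.inl e.1)) (x (Sum.inl e.2)) := by
      funext x
      rw [resample_singleton μ _ (hsq e).measurable]
      simp [edgeNoise, Function.update, noiseVar]
    calc ∫ x, G x * ∏ e ∈ insert e s, edgeNoise ε x e ^ 2 ∂(Measure.pi μ)
        = ∫ x, edgeNoise ε x e ^ 2 * (G x * ∏ e ∈ s, edgeNoise ε x e ^ 2) ∂(Measure.pi μ) := by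
          refine integral_congr_ae (.of_forall fun x => ?_)
          simp only [Finset.prod_insert he]
          ring
      _ = ∫ x, (G x * noiseVar μ ε e.1 e.2 (x (Sum.inl e.1)) (x (Sum.inl e.2))) *
            ∏ e ∈ s, edgeNoise ε x e ^ 2 ∂(Measure.pi μ) := by
          rw [integral_mul_resample μ (hsq e) hH hHd, hres]
          refine integral_congr_ae (.of_forall fun x => ?_)
          simp only
          ring
      _ = _ := by
          rw [ih (hG.mul (hε.bddMeas_noiseVar e)) ?_]
          · refine integral_congr_ae (.of_forall fun x => ?_)
            simp only [Finset.prod_insert he]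
            ring
          · intro x y h
            simp only
            rw [hGd h, h _ ⟨_, rfl⟩, h _ ⟨_, rfl⟩]

end Statistics


/-! ### Means and covariances on the canonical space -/

section CanonicalCovariance

set_option linter.unusedSectionVars false

variable {n : ℕ} {k l : ℕ}

lemma range_eq_of_edgeImage_subset {F : SimpleGraph (Fin k)} {H : SimpleGraph (Fin l)}
    (hF : F.Connected) (hk : k ≠ 1) {a : Fin k → Fin n} {b : Fin l → Fin n}
    (h : edgeImage F a ⊆ edgeImage H b) : Set.range a ⊆ Set.range b := by
  rintro _ ⟨v, rfl⟩
  obtain ⟨e, he, hev⟩ := exists_edge_of_connected hF hk a v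
  have hm := mem_image_of_mem_edgeImage (h he)
  simp only [Finset.mem_image, Finset.mem_univ, true_and] at hm
  rcases hev with hev | hev
  · rw [← hev]; exact hm.1
  · rw [← hev]; exact hm.2

lemma ne_one_of_edgeImage_eq {F : SimpleGraph (Fin k)} {H : SimpleGraph (Fin l)}
    (hF : F.Connected) (hk : k ≠ 1) {a : Fin k → Fin n} {b : Fin l → Fin n}
    (h : edgeImage F a = edgeImage H b) : l ≠ 1 := by
  have : 0 < k := Fin.pos_iff_nonempty.2 hF.nonempty
  obtain ⟨e, he, -⟩ := exists_edge_of_connected hF hk a ⟨0, this⟩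
  rintro rfl
  obtain ⟨u, w, huw, -⟩ := mem_edgeImage.1 (h ▸ he)
  exact absurd (Subsingleton.elim u w) huw.ne

/-- A copy of a connected graph that is not a single vertex is determined by its edges. -/
lemma sameGraph_of_edgeImage_eq {F : SimpleGraph (Fin k)} {H : SimpleGraph (Fin l)}
    (hF : F.Connected) (hH : H.Connected) (hkl : ¬ (k = 1 ∧ l = 1)) {a : Fin k → Fin n}
    {b : Fin l → Fin n} (ha : StrictMono a) (hb : StrictMono b)
    (h : edgeImage F a = edgeImage H b) : ∃ h : SameGraph H F, b = fun v => a (Fin.cast h.1 v) := by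
  have hk : k ≠ 1 := fun hk => by
    by_cases hl : l = 1
    · exact hkl ⟨hk, hl⟩
    · exact ne_one_of_edgeImage_eq hH hl h.symm hk
  have hl : l ≠ 1 := ne_one_of_edgeImage_eq hF hk h
  have hr : Set.range a = Set.range b :=
    (range_eq_of_edgeImage_subset hF hk h.le).antisymm (range_eq_of_edgeImage_subset hH hl h.ge)
  have hkl' : k = l := by
    have h1 := Set.ncard_range_of_injective ha.injective
    have h2 := Set.ncard_range_of_injective hb.injective
    rw [hr, h2] at h1
    simpa using h1.symm
  subst hkl'
  obtain rfl := (ha.range_inj hb).1 hr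
  have key : ∀ {F H : SimpleGraph (Fin k)}, edgeImage F a = edgeImage H a →
      ∀ v w, F.Adj v w → H.Adj v w := by
    intro F H h v w hvw
    have aux : ∀ v w, v < w → F.Adj v w → H.Adj v w := fun v w hlt hvw => by
      have : (a v, a w) ∈ edgeImage H a := h ▸ mem_edgeImage.2 ⟨v, w, hlt, hvw, rfl⟩
      obtain ⟨v', w', -, hadj, he⟩ := mem_edgeImage.1 this
      rw [Prod.mk.injEq] at he
      rwa [ha.injective he.1, ha.injective he.2]
    rcases lt_or_gt_of_ne hvw.ne with hlt | hlt
    · exact aux v w hlt hvw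
    · exact (aux w v hlt hvw.symm).symm
  exact ⟨⟨rfl, fun v w => ⟨key h.symm v w, key h v w⟩⟩, rfl⟩

lemma sum_increasingTuples_one (f : (Fin 1 → Fin n) → ℝ) :
    ∑ a ∈ increasingTuples n 1, f a = ∑ v : Fin n, f fun _ => v := by
  have : increasingTuples n 1 = Finset.univ := by
    ext a
    simp only [mem_increasingTuples, Finset.mem_univ, iff_true]
    exact fun v w hvw => absurd (Subsingleton.elim v w) hvw.ne
  rw [this]
  exact (Fintype.sum_equiv (Equiv.funUnique (Fin 1) (Fin n)).symm _ _ fun _ => rfl).symm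

/-- The normalised centred count on the canonical space. -/
noncomputable def canonCount (μ : Coord n → Measure I) (ε : Fin n → Fin n → I → I → I → ℝ)
    (F : SimpleGraph (Fin k)) (φ : (Fin k → ℝ) → ℝ) (ψ : (Fin k → I) → ℝ)
    (x : Coord n → I) : ℝ :=
  (√(n.choose k : ℝ))⁻¹ * ∑ a ∈ increasingTuples n k, canonStat μ ε F φ ψ a x

variable {μ : Coord n → Measure I} [∀ j, IsProbabilityMeasure (μ j)]
  {ε : Fin n → Fin n → I → I → I → ℝ} {L B K : ℝ}
  {F : SimpleGraph (Fin k)} {φ : (Fin k → ℝ) → ℝ} {ψ : (Fin k → I) → ℝ}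
  {H : SimpleGraph (Fin l)} {φ' : (Fin l → ℝ) → ℝ} {ψ' : (Fin l → I) → ℝ}

lemma integral_sum_mul_sum (X : (Fin k → Fin n) → (Coord n → I) → ℝ)
    (X' : (Fin l → Fin n) → (Coord n → I) → ℝ)
    (hX : CentredFamily μ F X K) (hX' : CentredFamily μ H X' K) (c c' : ℝ) :
    ∫ x, (c * ∑ a ∈ increasingTuples n k, X a x) * (c' * ∑ b ∈ increasingTuples n l, X' b x)
        ∂(Measure.pi μ) =
      c * c' * ∑ a ∈ increasingTuples n k, ∑ b ∈ increasingTuples n l,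
        ∫ x, X a x * X' b x ∂(Measure.pi μ) := by
  have h : ∀ x, (c * ∑ a ∈ increasingTuples n k, X a x) *
      (c' * ∑ b ∈ increasingTuples n l, X' b x) =
      c * c' * ∑ a ∈ increasingTuples n k, ∑ b ∈ increasingTuples n l, X a x * X' b x := fun x => by
    rw [← Finset.sum_mul_sum]; ring
  simp only [h]
  have hb : ∀ a ∈ increasingTuples n k, ∀ b ∈ increasingTuples n l,
      BddMeas fun x => X a x * X' b x := fun a ha b hb =>
    (hX.bddMeas (mem_increasingTuples.1 ha)).mul (hX'.bddMeas (mem_increasingTuples.1 hb))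
  rw [integral_const_mul, integral_finsetSum]
  · congr 1
    refine Finset.sum_congr rfl fun a ha => integral_finsetSum _ fun b hb' => ?_
    exact (hb a ha b hb').integrable _
  · exact fun a ha => (BddMeas.sum _ fun b hb' => hb a ha b hb').integrable _

lemma integral_canonStat_mul_one {F H : SimpleGraph (Fin 1)} {φ φ' : (Fin 1 → ℝ) → ℝ}
    {ψ ψ' : (Fin 1 → I) → ℝ} (hψm : Measurable ψ) (hψ : ∀ u, |ψ u| ≤ B)
    (hψm' : Measurable ψ') (hψ' : ∀ u, |ψ' u| ≤ B) (a b : Fin n) :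
    ∫ x, canonStat μ ε F φ ψ (fun _ => a) x * canonStat μ ε H φ' ψ' (fun _ => b) x
        ∂(Measure.pi μ) =
      if a = b then φ (latticePoint fun _ => a) * φ' (latticePoint fun _ => a) *
        cov[fun x : Coord n → I => ψ fun _ => x (Sum.inl a),
          fun x : Coord n → I => ψ' fun _ => x (Sum.inl a); Measure.pi μ] else 0 := by
  have hX : ∀ (F : SimpleGraph (Fin 1)) φ (ψ : (Fin 1 → I) → ℝ) (a : Fin n) x,
      canonStat μ ε F φ ψ (fun _ => a) x = φ (latticePoint fun _ => a) *
        (ψ (fun _ => x (Sum.inl a)) - weightMean μ ψ fun _ => a) := fun F φ ψ a x => by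
    simp [canonStat, tupleStat]
  simp only [hX]
  split_ifs with hab
  · subst hab
    rw [covariance, ← integral_const_mul]
    refine integral_congr_ae (.of_forall fun x => ?_)
    simp only [weightMean]
    ring
  · have hB := fun (a : Fin n) => bddMeas_weight (n := n) hψm hψ fun _ => a
    have hB' := fun (a : Fin n) => bddMeas_weight (n := n) hψm' hψ' fun _ => a
    rw [integral_mul_of_disjoint (s := {Sum.inl a}) (t := {Sum.inl b}) μ
      ((BddMeas.const _).mul ((hB a).sub (.const _)))
      ((BddMeas.const _).mul ((hB' b).sub (.const _)))]
    · rw [integral_const_mul, integral_sub ((hB a).integrable _) (integrable_const _)]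
      simp [weightMean]
    · intro x y h
      simp only [h (Sum.inl a) rfl]
    · intro x y h
      simp only [h (Sum.inl b) rfl]
    · simpa using hab

lemma integral_canonCount_mul_one (hk : k = 1) (hl : l = 1)
    (hX : CentredFamily μ F (canonStat μ ε F φ ψ) K)
    (hX' : CentredFamily μ H (canonStat μ ε H φ' ψ') K)
    (hψm : Measurable ψ) (hψ : ∀ u, |ψ u| ≤ B)
    (hψm' : Measurable ψ') (hψ' : ∀ u, |ψ' u| ≤ B) :
    ∫ x, canonCount μ ε F φ ψ x * canonCount μ ε H φ' ψ' x ∂(Measure.pi μ) =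
      (n : ℝ)⁻¹ * ∑ a : Fin n, φ (latticePoint fun _ => a) * φ' (latticePoint fun _ => a) *
        cov[fun x : Coord n → I => ψ fun _ => x (Sum.inl a),
          fun x : Coord n → I => ψ' fun _ => x (Sum.inl a); Measure.pi μ] := by
  subst hk hl
  unfold canonCount
  rw [integral_sum_mul_sum _ _ hX hX', sum_increasingTuples_one, ← mul_inv]
  simp only [sum_increasingTuples_one, integral_canonStat_mul_one hψm hψ hψm' hψ',
    Finset.sum_ite_eq, Finset.mem_univ, if_true, Nat.choose_one_right]
  rw [Real.mul_self_sqrt (Nat.cast_nonneg _)]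

lemma integral_canonCount_mul_same (hε : IsCentredNoise μ ε L) (hF : F.Connected)
    (hH : H.Connected) (hkl : ¬ (k = 1 ∧ l = 1)) (hs : SameGraph H F)
    (hX : CentredFamily μ F (canonStat μ ε F φ ψ) K)
    (hX' : CentredFamily μ H (canonStat μ ε H φ' ψ') K)
    (hψm : Measurable ψ) (hψ : ∀ u, |ψ u| ≤ B)
    (hψm' : Measurable ψ') (hψ' : ∀ u, |ψ' u| ≤ B) :
    ∫ x, canonCount μ ε F φ ψ x * canonCount μ ε H φ' ψ' x ∂(Measure.pi μ) =
      (n.choose k : ℝ)⁻¹ * ∑ a ∈ increasingTuples n k,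
        φ (latticePoint a) * φ' (latticePoint fun v => a (Fin.cast hs.1 v)) *
          ∫ x, ψ (fun v => x (Sum.inl (a v))) *
            ψ' (fun v => x (Sum.inl (a (Fin.cast hs.1 v)))) *
            ∏ e ∈ orderedEdges F, noiseVar μ ε (a e.1) (a e.2) (x (Sum.inl (a e.1)))
              (x (Sum.inl (a e.2))) ∂(Measure.pi μ) := by
  obtain ⟨rfl, hadj⟩ := id hs
  have hk : l ≠ 1 := fun h => hkl ⟨h, h⟩
  obtain rfl : H = F := by
    ext v w
    exact hadj v w
  unfold canonCount
  rw [integral_sum_mul_sum _ _ hX hX', ← mul_inv, Real.mul_self_sqrt (Nat.cast_nonneg _)]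
  congr 1
  refine Finset.sum_congr rfl fun a ha => ?_
  have ha' := mem_increasingTuples.1 ha
  rw [Finset.sum_eq_single_of_mem a ha]
  · have hXa : ∀ (φ : (Fin l → ℝ) → ℝ) (ψ : (Fin l → I) → ℝ) x, canonStat μ ε H φ ψ a x =
        φ (latticePoint a) * ψ (fun v => x (Sum.inl (a v))) *
          ∏ e ∈ orderedEdges H, edgeNoise ε x (a e.1, a e.2) := fun φ ψ x => if_neg hk
    have hinj : Set.InjOn (fun e : Fin l × Fin l => (a e.1, a e.2)) (orderedEdges H) := by
      intro e _ e' _ hee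
      simp only [Prod.mk.injEq] at hee
      exact Prod.ext (ha'.injective hee.1) (ha'.injective hee.2)
    have himg : ∀ f : Fin n × Fin n → ℝ, ∏ e ∈ orderedEdges H, f (a e.1, a e.2) =
        ∏ e ∈ edgeImage H a, f e := fun f => (Finset.prod_image hinj).symm
    have h1 := hε.integral_mul_prod_sq (edgeImage H a)
      ((bddMeas_weight hψm hψ a).mul (bddMeas_weight hψm' hψ' a)) (by
        intro x y h
        simp only
        congr 2 <;> funext v <;> exact h _ ⟨_, rfl⟩)
    have h2 : ∀ x, canonStat μ ε H φ ψ a x * canonStat μ ε H φ' ψ' a x =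
        φ (latticePoint a) * φ' (latticePoint a) *
          (ψ (fun v => x (Sum.inl (a v))) * ψ' (fun v => x (Sum.inl (a v))) *
            ∏ e ∈ edgeImage H a, edgeNoise ε x e ^ 2) := fun x => by
      rw [hXa, hXa, ← himg, Finset.prod_pow]
      ring
    simp only [h2]
    rw [integral_const_mul, h1]
    simp only [← himg]
    rfl
  · intro b hb hba
    by_contra hne
    refine hba ?_
    have : edgeImage H a = edgeImage H b := by
      ext e
      by_contra he
      exact hne (CentredFamily.integral_pair_eq_zero hX hX' (p := (a, b)) ha'
        (mem_increasingTuples.1 hb) he)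
    obtain ⟨h, hb'⟩ := sameGraph_of_edgeImage_eq hH hH hkl ha' (mem_increasingTuples.1 hb) this
    exact hb'

lemma integral_canonCount_mul_zero (hF : F.Connected)
    (hH : H.Connected) (hkl : ¬ (k = 1 ∧ l = 1)) (hs : ¬ SameGraph H F)
    (hX : CentredFamily μ F (canonStat μ ε F φ ψ) K)
    (hX' : CentredFamily μ H (canonStat μ ε H φ' ψ') K) :
    ∫ x, canonCount μ ε F φ ψ x * canonCount μ ε H φ' ψ' x ∂(Measure.pi μ) = 0 := by
  unfold canonCount
  rw [integral_sum_mul_sum _ _ hX hX']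
  rw [Finset.sum_eq_zero fun a ha => Finset.sum_eq_zero fun b hb => ?_, mul_zero]
  by_contra hne
  have ha' := mem_increasingTuples.1 ha
  have hb' := mem_increasingTuples.1 hb
  have : edgeImage F a = edgeImage H b := by
    ext e
    by_contra he
    exact hne (CentredFamily.integral_pair_eq_zero hX hX' (p := (a, b)) ha' hb' he)
  exact hs (sameGraph_of_edgeImage_eq hF hH hkl ha' hb' this).1

variable {d : ℕ} {k : Fin d → ℕ} {F : ∀ i, SimpleGraph (Fin (k i))}
  {φ : ∀ i, (Fin (k i) → ℝ) → ℝ} {ψ : ∀ i, (Fin (k i) → I) → ℝ}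

/-- The covariances of the normalised centred counts on the canonical space. -/
theorem integral_canonCount_mul (hε : IsCentredNoise μ ε L) (hF : ∀ i, (F i).Connected)
    (hX : ∀ i, CentredFamily μ (F i) (canonStat μ ε (F i) (φ i) (ψ i)) K)
    (hψm : ∀ i, Measurable (ψ i)) (hψ : ∀ i u, |ψ i u| ≤ B) (i j : Fin d) :
    ∫ x, canonCount μ ε (F i) (φ i) (ψ i) x * canonCount μ ε (F j) (φ j) (ψ j) x
        ∂(Measure.pi μ) =
      countCov (Measure.pi μ) (fun v x => x (Sum.inl v))
        (fun v w x => noiseVar μ ε v w (x (Sum.inl v)) (x (Sum.inl w))) F φ ψ i j := by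
  simp only [countCov, Matrix.of_apply]
  split_ifs with h1 h2
  · exact integral_canonCount_mul_one h1.1 h1.2 (hX i) (hX j) (hψm i) (hψ i) (hψm j) (hψ j)
  · exact integral_canonCount_mul_same hε (hF i) (hF j) h1 h2 (hX i) (hX j) (hψm i) (hψ i)
      (hψm j) (hψ j)
  · exact integral_canonCount_mul_zero (hF i) (hF j) h1 h2 (hX i) (hX j)

section Layers

variable {X : ∀ i, (Fin (k i) → Fin n) → (Coord n → I) → ℝ}

lemma integral_sum_layer (hF : ∀ i, (F i).Connected)
    (hX : ∀ i, CentredFamily μ (F i) (X i) K) (i : Fin d) :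
    ∫ x, (∑ m, layer X m x) i ∂(Measure.pi μ) = 0 := by
  simp only [WithLp.ofLp_sum, Finset.sum_apply]
  rw [integral_finsetSum _ fun m _ => (bddMeas_layer hX m i).integrable _]
  refine Finset.sum_eq_zero fun m _ => ?_
  simpa using layer_first hF hX m i (BddMeas.const 1) (fun _ _ _ => rfl)

lemma integral_sum_layer_mul (hF : ∀ i, (F i).Connected)
    (hX : ∀ i, CentredFamily μ (F i) (X i) K) (i j : Fin d) :
    ∫ x, (∑ m, layer X m x) i * (∑ m, layer X m x) j ∂(Measure.pi μ) =
      (∑ m, layerCov μ X m) i j := by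
  simp only [WithLp.ofLp_sum, Finset.sum_apply, Finset.sum_mul_sum, Matrix.sum_apply]
  have hb : ∀ m m', BddMeas fun x => layer X m x i * layer X m' x j := fun m m' =>
    (bddMeas_layer hX m i).mul (bddMeas_layer hX m' j)
  have hdep : ∀ {m m' : Fin n} (i : Fin d), m' < m → DependsOn (fun x => layer X m' x i)
      ((vertexCoords m : Set (Coord n))ᶜ) := by
    intro m m' i hm x y h
    simp only [layer]
    congr 1
    exact Finset.sum_congr rfl fun a ha => (hX i).dependsOn_vertexCoords_compl hm ha h
  rw [integral_finsetSum _ fun m _ => (BddMeas.sum _ fun m' _ => hb m m').integrable _]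
  refine Finset.sum_congr rfl fun m _ => ?_
  rw [integral_finsetSum _ fun m' _ => (hb m m').integrable _, Finset.sum_eq_single m]
  · rfl
  · intro m' _ hne
    rcases lt_or_gt_of_ne hne with h | h
    · have := layer_first hF hX m i (bddMeas_layer hX m' j) (hdep j h)
      simpa only [mul_comm] using this
    · exact layer_first hF hX m' j (bddMeas_layer hX m i) (hdep i h)
  · simp

end Layers

end CanonicalCovariance


/-! ### Representing a graphon sample on the canonical space -/

section Representation

set_option linter.unusedSectionVars false

lemma Measure.ext_prod_pi {α ι β : Type*} [Finite ι] [MeasurableSpace α] [MeasurableSpace β]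
    {μ ν : Measure (α × (ι → β))} [IsProbabilityMeasure μ] [IsProbabilityMeasure ν]
    (h : ∀ s : Set α, MeasurableSet s → ∀ t : ι → Set β, (∀ i, MeasurableSet (t i)) →
      μ (s ×ˢ Set.univ.pi t) = ν (s ×ˢ Set.univ.pi t)) : μ = ν := by
  refine ext_of_generate_finite (Set.image2 (fun x1 x2 => x1 ×ˢ x2) {s : Set α | MeasurableSet s}
    (Set.univ.pi '' Set.univ.pi fun _ : ι => {s : Set β | MeasurableSet s})) ?_ ?_ ?_ (by simp)
  · refine (generateFrom_eq_prod MeasurableSpace.generateFrom_measurableSet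
      generateFrom_pi isCountablySpanning_measurableSet ?_).symm
    exact ⟨fun _ => Set.univ, fun _ => ⟨fun _ => Set.univ, by simp, by simp⟩,
      Set.iUnion_const _⟩
  · exact MeasurableSpace.isPiSystem_measurableSet.prod isPiSystem_pi
  · rintro _ ⟨s, hs, _, ⟨t, ht, rfl⟩, rfl⟩
    exact h s hs t fun i => ht i trivial

variable {n : ℕ} {Ω : Type*} [MeasurableSpace Ω] {P : Measure Ω} [IsProbabilityMeasure P]
  {κ : Graphon} {U : Fin n → Ω → I} {Y : Fin n → Fin n → Ω → ℝ}

/-- The laws of the coordinates: the laws of the labels, and uniform laws for the edge noise. -/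
noncomputable def canonLaw (P : Measure Ω) (U : Fin n → Ω → I) : Coord n → Measure I :=
  Sum.elim (fun v => P.map (U v)) fun _ => volume

lemma isProbabilityMeasure_canonLaw (hU : ∀ v, Measurable (U v)) (j : Coord n) :
    IsProbabilityMeasure (canonLaw P U j) := by
  rcases j with v | e
  · exact Measure.isProbabilityMeasure_map (hU v).aemeasurable
  · exact inferInstanceAs (IsProbabilityMeasure (volume : Measure I))

/-- Pairs of vertices in increasing order. -/
abbrev EdgeIndex (n : ℕ) := {e : Fin n × Fin n // e.1 < e.2}

namespace IsGraphonSample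

lemma labelSigma_le (hS : IsGraphonSample P κ U Y) : labelSigma U ≤ ‹MeasurableSpace Ω› :=
  (measurable_pi_lambda _ hS.measurable_label).comap_le

lemma map_label (hS : IsGraphonSample P κ U Y) :
    P.map (fun ω v => U v ω) = Measure.pi fun v => P.map (U v) :=
  (iIndepFun_iff_map_fun_eq_pi_map fun v => (hS.measurable_label v).aemeasurable).1 hS.indep_label

lemma prob_label_edge (hS : IsGraphonSample P κ U Y) {s : Set (Fin n → I)} (hs : MeasurableSet s)
    {A : Fin n → Fin n → Set ℝ} (hA : ∀ v w, MeasurableSet (A v w)) :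
    P.real ((fun ω v => U v ω) ⁻¹' s ∩ ⋂ (v : Fin n) (w : Fin n) (_ : v < w), Y v w ⁻¹' A v w) =
      ∫ u, s.indicator 1 u * ∏ e : Fin n × Fin n with e.1 < e.2,
        (condDistrib (Y e.1 e.2) (fun ω => (U e.1 ω, U e.2 ω)) P (u e.1, u e.2)).real (A e.1 e.2)
          ∂(Measure.pi fun v => P.map (U v)) := by
  have hU : Measurable fun ω v => U v ω := measurable_pi_lambda _ hS.measurable_label
  set T := ⋂ (v : Fin n) (w : Fin n) (_ : v < w), Y v w ⁻¹' A v w with hT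
  have hTm : MeasurableSet T := .iInter fun v => .iInter fun w => .iInter fun h =>
    hS.measurable_edge v w h (hA v w)
  have hprod : P⟦T | labelSigma U⟧ =ᵐ[P] fun ω => ∏ e : Fin n × Fin n with e.1 < e.2,
      (condDistrib (Y e.1 e.2) (fun ω => (U e.1 ω, U e.2 ω)) P (U e.1 ω, U e.2 ω)).real
        (A e.1 e.2) := by
    refine (hS.condIndep_edge A hA).trans ?_
    have : ∀ e ∈ (Finset.univ.filter fun e : Fin n × Fin n => e.1 < e.2),
        ∀ᵐ ω ∂P, (P⟦Y e.1 e.2 ⁻¹' A e.1 e.2 | labelSigma U⟧) ω =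
          (condDistrib (Y e.1 e.2) (fun ω => (U e.1 ω, U e.2 ω)) P (U e.1 ω, U e.2 ω)).real
            (A e.1 e.2) := fun e he => by
      have he' := (Finset.mem_filter.1 he).2
      exact (hS.condLaw_edge _ _ he' _ (hA _ _)).trans
        (condDistrib_ae_eq_condExp ((hS.measurable_label _).prodMk (hS.measurable_label _))
          (hS.measurable_edge _ _ he') (hA _ _)).symm
    filter_upwards [(Finset.eventually_all _).2 this] with ω hω
    exact Finset.prod_congr rfl hω
  have hms : MeasurableSet[labelSigma U] ((fun ω v => U v ω) ⁻¹' s) := ⟨s, hs, rfl⟩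
  calc P.real ((fun ω v => U v ω) ⁻¹' s ∩ T)
      = ∫ ω in (fun ω v => U v ω) ⁻¹' s, T.indicator (fun _ => 1) ω ∂P := by
        rw [integral_indicator hTm, Measure.restrict_restrict hTm, Set.inter_comm]
        simp
    _ = ∫ ω in (fun ω v => U v ω) ⁻¹' s, (P⟦T | labelSigma U⟧) ω ∂P :=
        (setIntegral_condExp hS.labelSigma_le ((integrable_const _).indicator hTm) hms).symm
    _ = ∫ ω in (fun ω v => U v ω) ⁻¹' s, ∏ e : Fin n × Fin n with e.1 < e.2,
          (condDistrib (Y e.1 e.2) (fun ω => (U e.1 ω, U e.2 ω)) P (U e.1 ω, U e.2 ω)).real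
            (A e.1 e.2) ∂P := integral_congr_ae (ae_restrict_of_ae hprod)
    _ = _ := by
        rw [← hS.map_label, integral_map hU.aemeasurable, ← integral_indicator (hU hs)]
        · refine integral_congr_ae (.of_forall fun ω => ?_)
          by_cases h : (fun v => U v ω) ∈ s
          · rw [Set.indicator_of_mem (show ω ∈ (fun ω v => U v ω) ⁻¹' s from h)]
            simp [h]
          · rw [Set.indicator_of_notMem (show ω ∉ (fun ω v => U v ω) ⁻¹' s from h)]
            simp [h]
        · refine (((measurable_const.indicator hs).mul
            (Finset.measurable_prod _ fun e _ => ?_))).aestronglyMeasurable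
          have := (Kernel.measurable_coe (condDistrib (Y e.1 e.2)
            (fun ω => (U e.1 ω, U e.2 ω)) P) (hA e.1 e.2)).ennreal_toReal
          exact this.comp (by fun_prop)

variable (q : Fin n → Fin n → I × I → I → ℝ)

lemma prob_canon (hU : ∀ v, Measurable (U v)) (hq : ∀ v w, Measurable (Function.uncurry (q v w)))
    (hq' : ∀ v w st, (volume : Measure I).map (q v w st) =
      condDistrib (Y v w) (fun ω => (U v ω, U w ω)) P st)
    {s : Set (Fin n → I)} (hs : MeasurableSet s)
    {A : Fin n → Fin n → Set ℝ} (hA : ∀ v w, MeasurableSet (A v w)) :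
    (Measure.pi (canonLaw P U)).real {x | (fun v => x (Sum.inl v)) ∈ s ∧ ∀ e : Fin n × Fin n,
        e.1 < e.2 → q e.1 e.2 (x (Sum.inl e.1), x (Sum.inl e.2)) (x (Sum.inr e)) ∈ A e.1 e.2} =
      ∫ u, s.indicator 1 u * ∏ e : Fin n × Fin n with e.1 < e.2,
        (condDistrib (Y e.1 e.2) (fun ω => (U e.1 ω, U e.2 ω)) P (u e.1, u e.2)).real (A e.1 e.2)
          ∂(Measure.pi fun v => P.map (U v)) := by
  have := isProbabilityMeasure_canonLaw (P := P) hU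
  have hl : ∀ v, IsProbabilityMeasure (P.map (U v)) := fun v => this (Sum.inl v)
  have hqx : ∀ e : Fin n × Fin n, Measurable fun p : (Fin n → I) × (Fin n × Fin n → I) =>
      q e.1 e.2 (p.1 e.1, p.1 e.2) (p.2 e) := fun e => by
    have h2 : Measurable fun p : (Fin n → I) × (Fin n × Fin n → I) =>
      ((p.1 e.1, p.1 e.2), p.2 e) := by fun_prop
    exact (hq e.1 e.2).comp h2
  let f : (Fin n → I) × (Fin n × Fin n → I) → ℝ := fun p => s.indicator 1 p.1 *
    ∏ e : Fin n × Fin n, if e.1 < e.2 then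
      (A e.1 e.2).indicator (fun _ => (1 : ℝ)) (q e.1 e.2 (p.1 e.1, p.1 e.2) (p.2 e)) else 1
  have hfm : Measurable f := by
    refine ((measurable_const.indicator hs).comp measurable_fst).mul
      (Finset.measurable_prod _ fun e _ => ?_)
    split_ifs
    · exact (measurable_const.indicator (hA _ _)).comp (hqx e)
    · exact measurable_const
  set S := {x : Coord n → I | (fun v => x (Sum.inl v)) ∈ s ∧ ∀ e : Fin n × Fin n,
        e.1 < e.2 → q e.1 e.2 (x (Sum.inl e.1), x (Sum.inl e.2)) (x (Sum.inr e)) ∈ A e.1 e.2}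
  have hind : ∀ x, f (MeasurableEquiv.sumPiEquivProdPi (fun _ => I) x) =
      S.indicator (fun _ => 1) x := by
    intro x
    change s.indicator 1 (fun v => x (Sum.inl v)) * ∏ e : Fin n × Fin n, (if e.1 < e.2 then
      (A e.1 e.2).indicator (fun _ => (1 : ℝ)) (q e.1 e.2 (x (Sum.inl e.1), x (Sum.inl e.2))
        (x (Sum.inr e))) else 1) = _
    by_cases hx : x ∈ S
    · rw [Set.indicator_of_mem hx, Set.indicator_of_mem hx.1, Finset.prod_eq_one fun e _ => ?_]
      · simp
      · split_ifs with he
        · exact Set.indicator_of_mem (hx.2 e he) _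
        · rfl
    · rw [Set.indicator_of_notMem hx]
      by_cases h1 : (fun v => x (Sum.inl v)) ∈ s
      · have : ∃ e : Fin n × Fin n, e.1 < e.2 ∧
            q e.1 e.2 (x (Sum.inl e.1), x (Sum.inl e.2)) (x (Sum.inr e)) ∉ A e.1 e.2 := by
          by_contra! hcon
          exact hx ⟨h1, hcon⟩
        obtain ⟨e, he, hne⟩ := this
        rw [Finset.prod_eq_zero (Finset.mem_univ e), mul_zero]
        rw [if_pos he, Set.indicator_of_notMem hne]
      · rw [Set.indicator_of_notMem h1, zero_mul]
  have hSm : MeasurableSet S := by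
    have : S = (fun x => f (MeasurableEquiv.sumPiEquivProdPi (fun _ => I) x)) ⁻¹' {1} := by
      ext x
      simp only [Set.mem_preimage, hind, Set.mem_singleton_iff]
      by_cases hx : x ∈ S <;> simp [hx]
    rw [this]
    exact (hfm.comp (MeasurableEquiv.measurable _)) (measurableSet_singleton _)
  have hf01 : ∀ p, ‖f p‖ ≤ 1 := fun p => by
    have hx := hind ((MeasurableEquiv.sumPiEquivProdPi (fun _ => I)).symm p)
    rw [MeasurableEquiv.apply_symm_apply] at hx
    rw [hx]
    by_cases hx : (MeasurableEquiv.sumPiEquivProdPi (fun _ => I)).symm p ∈ S <;> simp [hx]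
  have hmp := measurePreserving_sumPiEquivProdPi (canonLaw P U)
  calc (Measure.pi (canonLaw P U)).real S
      = ∫ x, f (MeasurableEquiv.sumPiEquivProdPi (fun _ => I) x) ∂(Measure.pi (canonLaw P U)) := by
        simp only [hind]
        rw [integral_indicator hSm]
        simp
    _ = ∫ p, f p ∂((Measure.pi fun v => canonLaw P U (Sum.inl v)).prod
          (Measure.pi fun e => canonLaw P U (Sum.inr e))) :=
        hmp.integral_comp (MeasurableEquiv.measurableEmbedding _) f
    _ = ∫ u, ∫ z, f (u, z) ∂(Measure.pi fun e => canonLaw P U (Sum.inr e))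
          ∂(Measure.pi fun v => canonLaw P U (Sum.inl v)) :=
        integral_prod _ (Integrable.of_bound hfm.aestronglyMeasurable 1 (.of_forall hf01))
    _ = _ := by
        refine integral_congr_ae (.of_forall fun u => ?_)
        simp only [f]
        rw [integral_const_mul]
        congr 1
        rw [integral_fintype_prod_eq_prod (μ := fun e => canonLaw P U (Sum.inr e))
          (fun (e : Fin n × Fin n) (z : I) => if e.1 < e.2 then
          (A e.1 e.2).indicator (fun _ => (1 : ℝ)) (q e.1 e.2 (u e.1, u e.2) z) else 1),
          Finset.prod_filter]
        refine Finset.prod_congr rfl fun e _ => ?_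
        split_ifs with he
        · have hm : Measurable (q e.1 e.2 (u e.1, u e.2)) :=
            (hq e.1 e.2).comp measurable_prodMk_left
          rw [← hq', map_measureReal_apply hm (hA _ _)]
          change ∫ z, (q e.1 e.2 (u e.1, u e.2) ⁻¹' A e.1 e.2).indicator (fun _ => (1 : ℝ)) z
            ∂(volume : Measure I) = _
          rw [integral_indicator (hm (hA _ _))]
          simp
        · change ∫ _, (1 : ℝ) ∂(volume : Measure I) = 1
          simp

/-- The joint law of the labels and the edge variables. -/
lemma map_label_edge (hS : IsGraphonSample P κ U Y)
    (hq : ∀ v w, Measurable (Function.uncurry (q v w)))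
    (hq' : ∀ v w st, (volume : Measure I).map (q v w st) =
      condDistrib (Y v w) (fun ω => (U v ω, U w ω)) P st) :
    P.map (fun ω => (fun v => U v ω, fun e : EdgeIndex n => Y e.1.1 e.1.2 ω)) =
      (Measure.pi (canonLaw P U)).map fun x => (fun v => x (Sum.inl v), fun e : EdgeIndex n =>
        q e.1.1 e.1.2 (x (Sum.inl e.1.1), x (Sum.inl e.1.2)) (x (Sum.inr e.1))) := by
  have := isProbabilityMeasure_canonLaw (P := P) hS.measurable_label
  have hm1 : Measurable fun ω => (fun v => U v ω, fun e : EdgeIndex n => Y e.1.1 e.1.2 ω) :=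
    (measurable_pi_lambda _ hS.measurable_label).prodMk
      (measurable_pi_lambda _ fun e => hS.measurable_edge _ _ e.2)
  have hm2 : Measurable fun x : Coord n → I => ((fun v => x (Sum.inl v) : Fin n → I),
      fun e : EdgeIndex n =>
        q e.1.1 e.1.2 (x (Sum.inl e.1.1), x (Sum.inl e.1.2)) (x (Sum.inr e.1))) := by
    refine Measurable.prodMk (by fun_prop) (measurable_pi_lambda _ fun e => ?_)
    have h2 : Measurable fun x : Coord n → I =>
      ((x (Sum.inl e.1.1), x (Sum.inl e.1.2)), x (Sum.inr e.1)) := by fun_prop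
    exact (hq e.1.1 e.1.2).comp h2
  have := Measure.isProbabilityMeasure_map (μ := P) hm1.aemeasurable
  have := Measure.isProbabilityMeasure_map (μ := Measure.pi (canonLaw P U)) hm2.aemeasurable
  refine Measure.ext_prod_pi fun s hs t ht => ?_
  rw [← measureReal_eq_measureReal_iff]
  have hst : MeasurableSet (s ×ˢ Set.univ.pi t) := hs.prod (.univ_pi ht)
  rw [map_measureReal_apply hm1 hst, map_measureReal_apply hm2 hst]
  let A : Fin n → Fin n → Set ℝ := fun v w => if h : v < w then t ⟨(v, w), h⟩ else Set.univ
  have hA : ∀ v w, MeasurableSet (A v w) := fun v w => by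
    simp only [A]
    split_ifs
    · exact ht _
    · exact .univ
  have hA' : ∀ {v w} (h : v < w), A v w = t ⟨(v, w), h⟩ := fun h => dif_pos h
  have h1 := hS.prob_label_edge hs hA
  rw [← prob_canon q hS.measurable_label hq hq' hs hA] at h1
  convert h1 using 2
  · ext ω
    simp only [Set.mem_preimage, Set.mem_prod, Set.mem_pi, Set.mem_univ, true_implies,
      Set.mem_inter_iff, Set.mem_iInter, Subtype.forall, Prod.forall]
    refine and_congr_right fun _ => forall₃_congr fun v w h => by rw [hA' h]
  · ext x
    simp only [Set.mem_preimage, Set.mem_prod, Set.mem_pi, Set.mem_univ, true_implies,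
      Subtype.forall, Prod.forall, Set.mem_ofPred_eq]
    refine and_congr_right fun _ => forall₃_congr fun v w h => by rw [hA' h]

lemma map_canon_label (hS : IsGraphonSample P κ U Y) :
    (Measure.pi (canonLaw P U)).map (fun x v => x (Sum.inl v)) = P.map (fun ω v => U v ω) := by
  have := isProbabilityMeasure_canonLaw (P := P) hS.measurable_label
  rw [hS.map_label]
  have h := (measurePreserving_fst (μ := Measure.pi fun v => canonLaw P U (Sum.inl v))
    (ν := Measure.pi fun e => canonLaw P U (Sum.inr e))).comp
    (measurePreserving_sumPiEquivProdPi (canonLaw P U))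
  exact h.map_eq

lemma ae_canon_iff (hS : IsGraphonSample P κ U Y) {p : (Fin n → I) → Prop}
    (hp : MeasurableSet {u | p u}) :
    (∀ᵐ x ∂(Measure.pi (canonLaw P U)), p fun v => x (Sum.inl v)) ↔
      ∀ᵐ ω ∂P, p fun v => U v ω := by
  have h1 : Measurable fun (x : Coord n → I) v => x (Sum.inl v) := by fun_prop
  have h2 : Measurable fun ω v => U v ω := measurable_pi_lambda _ hS.measurable_label
  rw [← ae_map_iff h1.aemeasurable hp, ← ae_map_iff h2.aemeasurable hp, hS.map_canon_label]

/-- Conditional expectations given the labels can be computed on the canonical space. -/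
lemma condExp_label_of_map_eq (hS : IsGraphonSample P κ U Y) {V : Ω → ℝ} (hV : Measurable V)
    {g : (Coord n → I) → ℝ} (hg : BddMeas g) {r : (Fin n → I) → ℝ} (hr : BddMeas r)
    (hlaw : P.map (fun ω => (fun v => U v ω, V ω)) =
      (Measure.pi (canonLaw P U)).map fun x => (fun v => x (Sum.inl v), g x))
    (hgr : ∀ s, MeasurableSet s → ∫ x, g x * s.indicator 1 (fun v => x (Sum.inl v))
        ∂(Measure.pi (canonLaw P U)) =
      ∫ x, r (fun v => x (Sum.inl v)) * s.indicator 1 (fun v => x (Sum.inl v))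
        ∂(Measure.pi (canonLaw P U))) :
    P[V | labelSigma U] =ᵐ[P] fun ω => r fun v => U v ω := by
  have := isProbabilityMeasure_canonLaw (P := P) hS.measurable_label
  have hU : Measurable fun ω v => U v ω := measurable_pi_lambda _ hS.measurable_label
  have hx : Measurable fun (x : Coord n → I) v => x (Sum.inl v) := by fun_prop
  have hUV : Measurable fun ω => (fun v => U v ω, V ω) := hU.prodMk hV
  have hxg : Measurable fun x : Coord n → I => ((fun v => x (Sum.inl v) : Fin n → I), g x) :=
    hx.prodMk hg.measurable
  have hVint : Integrable V P := by
    have h1 : Integrable (fun p : (Fin n → I) × ℝ => p.2)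
        (P.map (fun ω => (fun v => U v ω, V ω))) := by
      rw [hlaw, integrable_map_measure measurable_snd.aestronglyMeasurable hxg.aemeasurable]
      exact hg.integrable _
    rwa [integrable_map_measure measurable_snd.aestronglyMeasurable hUV.aemeasurable] at h1
  have hrU : BddMeas fun ω => r fun v => U v ω := hr.comp hU
  refine (ae_eq_condExp_of_forall_setIntegral_eq hS.labelSigma_le hVint
    (fun _ _ _ => (hrU.integrable _).integrableOn) ?_ ?_).symm
  · rintro _ ⟨s, hs, rfl⟩ -
    have hind : ∀ f : Ω → ℝ, ∫ ω in (fun ω v => U v ω) ⁻¹' s, f ω ∂P =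
        ∫ ω, f ω * s.indicator 1 (fun v => U v ω) ∂P := fun f => by
      rw [← integral_indicator (hU hs)]
      refine integral_congr_ae (.of_forall fun ω => ?_)
      by_cases h : (fun v => U v ω) ∈ s
      · rw [Set.indicator_of_mem (show ω ∈ (fun ω v => U v ω) ⁻¹' s from h)]
        simp [h]
      · rw [Set.indicator_of_notMem (show ω ∉ (fun ω v => U v ω) ⁻¹' s from h)]
        simp [h]
    have hsm : Measurable (s.indicator (1 : (Fin n → I) → ℝ)) := measurable_const.indicator hs
    rw [hind, hind]
    have h1 : ∫ ω, r (fun v => U v ω) * s.indicator 1 (fun v => U v ω) ∂P =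
        ∫ u, r u * s.indicator 1 u ∂(P.map fun ω v => U v ω) :=
      (integral_map hU.aemeasurable (hr.measurable.mul hsm).aestronglyMeasurable).symm
    have h2 : ∫ ω, V ω * s.indicator 1 (fun v => U v ω) ∂P =
        ∫ p, p.2 * s.indicator 1 p.1 ∂(P.map fun ω => (fun v => U v ω, V ω)) :=
      (integral_map hUV.aemeasurable
        (measurable_snd.mul (hsm.comp measurable_fst)).aestronglyMeasurable).symm
    rw [h1, h2, hlaw, ← hS.map_canon_label]
    exact ((integral_map hx.aemeasurable (hr.measurable.mul hsm).aestronglyMeasurable).trans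
      (hgr s hs).symm).trans (integral_map hxg.aemeasurable
        (measurable_snd.mul (hsm.comp measurable_fst)).aestronglyMeasurable).symm
  · have : Measurable[labelSigma U] fun ω v => U v ω := comap_measurable _
    exact (hr.measurable.comp this).stronglyMeasurable.aestronglyMeasurable

lemma integral_edge_mul_indicator (hU : ∀ v, Measurable (U v)) {f : I × I → I → ℝ}
    (hf : BddMeas (Function.uncurry f)) (e : Fin n × Fin n) {s : Set (Fin n → I)}
    (hs : MeasurableSet s) :
    ∫ x, f (x (Sum.inl e.1), x (Sum.inl e.2)) (x (Sum.inr e)) *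
        s.indicator 1 (fun v => x (Sum.inl v)) ∂(Measure.pi (canonLaw P U)) =
      ∫ x, (∫ z, f (x (Sum.inl e.1), x (Sum.inl e.2)) z) *
        s.indicator 1 (fun v => x (Sum.inl v)) ∂(Measure.pi (canonLaw P U)) := by
  have := isProbabilityMeasure_canonLaw (P := P) hU
  have hg : BddMeas fun x : Coord n → I => f (x (Sum.inl e.1), x (Sum.inl e.2)) (x (Sum.inr e)) := by
    have h2 : Measurable fun x : Coord n → I =>
      ((x (Sum.inl e.1), x (Sum.inl e.2)), x (Sum.inr e)) := by fun_prop
    exact hf.comp h2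
  have hs' : BddMeas fun x : Coord n → I => s.indicator (1 : (Fin n → I) → ℝ) (fun v => x (Sum.inl v)) := by
    have h2 : Measurable fun (x : Coord n → I) v => x (Sum.inl v) := by fun_prop
    refine ⟨(measurable_const.indicator hs).comp h2, 1, fun x => ?_⟩
    by_cases h : (fun v => x (Sum.inl v)) ∈ s <;> simp [h]
  rw [integral_mul_resample (canonLaw P U) hg hs' (s := {Sum.inr e})]
  · refine integral_congr_ae (.of_forall fun x => ?_)
    simp only
    rw [resample_singleton _ _ hg.measurable]
    simp [Function.update, canonLaw]
  · intro x y h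
    simp only
    congr 1
    funext v
    exact h _ (by simp)

end IsGraphonSample

/-- The centred edge variables, indexed by all pairs. -/
def centredEdge (κ : Graphon) (U : Fin n → Ω → I) (Y : Fin n → Fin n → Ω → ℝ) (ω : Ω)
    (e : Fin n × Fin n) : ℝ :=
  if e.1 < e.2 then Y e.1 e.2 ω - κ.toFun (U e.1 ω) (U e.2 ω) else 0

namespace IsGraphonSample

lemma measurable_centredEdge (hS : IsGraphonSample P κ U Y) :
    Measurable (centredEdge κ U Y) := by
  refine measurable_pi_lambda _ fun e => ?_
  unfold centredEdge
  split_ifs with he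
  · have h2 : Measurable fun ω => (U e.1 ω, U e.2 ω) :=
      (hS.measurable_label _).prodMk (hS.measurable_label _)
    exact (hS.measurable_edge _ _ he).sub (κ.measurable_toFun.comp h2)
  · exact measurable_const

/-- A graphon sample has the law of labels and edge noise on the canonical space. -/
theorem exists_canonical (hS : IsGraphonSample P κ U Y) {B : ℝ}
    (hY : ∀ v w, v < w → ∀ᵐ ω ∂P, |Y v w ω| ≤ B) :
    ∃ ε, IsCentredNoise (canonLaw P U) ε (2 * |B|) ∧
      P.map (fun ω => (fun v => U v ω, centredEdge κ U Y ω)) =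
        (Measure.pi (canonLaw P U)).map fun x => (fun v => x (Sum.inl v), edgeNoise ε x) := by
  have := isProbabilityMeasure_canonLaw (P := P) hS.measurable_label
  choose q hq hq' using fun v w => Kernel.exists_measurable_map_eq_unitInterval
    (condDistrib (Y v w) (fun ω => (U v ω, U w ω)) P)
  set b := |B|
  have hb : 0 ≤ b := abs_nonneg B
  let c : Fin n → Fin n → I × I → I → ℝ := fun v w st z => max (-b) (min b (q v w st z))
  have hcm : ∀ v w, BddMeas (Function.uncurry (c v w)) := fun v w =>
    ⟨measurable_const.max (measurable_const.min (hq v w)), b, fun p => abs_le.2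
      ⟨le_max_left _ _, max_le (by linarith) (min_le_left _ _)⟩⟩
  have hcb : ∀ v w st z, |c v w st z| ≤ b := fun v w st z => abs_le.2
      ⟨le_max_left _ _, max_le (by linarith) (min_le_left _ _)⟩
  let m : Fin n → Fin n → I × I → ℝ := fun v w st => ∫ z, c v w st z
  have hm : ∀ v w, BddMeas (m v w) := fun v w => by
    refine ⟨(hcm v w).measurable.stronglyMeasurable.integral_prod_right.measurable, b, fun st => ?_⟩
    have := norm_integral_le_of_norm_le_const (μ := (volume : Measure I)) (C := b)
      (.of_forall fun z => (Real.norm_eq_abs _).trans_le (hcb v w st z))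
    simpa [m] using this
  have hu : Measurable fun ω v => U v ω := measurable_pi_lambda _ hS.measurable_label
  have hx : Measurable fun (x : Coord n → I) v => x (Sum.inl v) := by fun_prop
  have hmY : Measurable fun ω => fun e : EdgeIndex n => Y e.1.1 e.1.2 ω :=
    measurable_pi_lambda _ fun e => hS.measurable_edge _ _ e.2
  have hedge : ∀ e : Fin n × Fin n, Measurable fun x : Coord n → I =>
      ((x (Sum.inl e.1), x (Sum.inl e.2)), x (Sum.inr e)) := fun e => by fun_prop
  have hmq : Measurable fun x : Coord n → I => fun e : EdgeIndex n =>
      q e.1.1 e.1.2 (x (Sum.inl e.1.1), x (Sum.inl e.1.2)) (x (Sum.inr e.1)) :=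
    measurable_pi_lambda _ fun e => (hq _ _).comp (hedge e.1)
  have hmc : Measurable fun x : Coord n → I => fun e : EdgeIndex n =>
      c e.1.1 e.1.2 (x (Sum.inl e.1.1), x (Sum.inl e.1.2)) (x (Sum.inr e.1)) :=
    measurable_pi_lambda _ fun e => (hcm _ _).measurable.comp (hedge e.1)
  have hlaw := hS.map_label_edge q hq hq'
  have hqc : (fun x : Coord n → I => ((fun v => x (Sum.inl v) : Fin n → I), fun e : EdgeIndex n =>
      q e.1.1 e.1.2 (x (Sum.inl e.1.1), x (Sum.inl e.1.2)) (x (Sum.inr e.1))))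
      =ᵐ[Measure.pi (canonLaw P U)] fun x => (fun v => x (Sum.inl v), fun e : EdgeIndex n =>
      c e.1.1 e.1.2 (x (Sum.inl e.1.1), x (Sum.inl e.1.2)) (x (Sum.inr e.1))) := by
    have hset : MeasurableSet {p : (Fin n → I) × (EdgeIndex n → ℝ) | ∀ e, |p.2 e| ≤ b} := by
      have : {p : (Fin n → I) × (EdgeIndex n → ℝ) | ∀ e, |p.2 e| ≤ b} =
          ⋂ e, {p : (Fin n → I) × (EdgeIndex n → ℝ) | |p.2 e| ≤ b} := by
        ext; simp
      rw [this]
      refine .iInter fun e => measurableSet_le ?_ measurable_const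
      exact ((measurable_pi_apply e).comp measurable_snd).abs
    have h1 : ∀ᵐ p ∂(P.map fun ω => (fun v => U v ω, fun e : EdgeIndex n => Y e.1.1 e.1.2 ω)),
        ∀ e, |p.2 e| ≤ b := by
      rw [ae_map_iff (hu.prodMk hmY).aemeasurable hset]
      refine ae_all_iff.2 fun e => ?_
      filter_upwards [hY _ _ e.2] with ω hω
      exact hω.trans (le_abs_self B)
    rw [hlaw, ae_map_iff (hx.prodMk hmq).aemeasurable hset] at h1
    filter_upwards [h1] with x hx
    refine Prod.ext rfl (funext fun e => ?_)
    have := abs_le.1 (hx e)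
    simp only [c]
    rw [min_eq_right this.2, max_eq_right this.1]
  rw [Measure.map_congr hqc] at hlaw
  have hκm : ∀ e : Fin n × Fin n, e.1 < e.2 → ∀ᵐ x ∂(Measure.pi (canonLaw P U)),
      κ.toFun (x (Sum.inl e.1)) (x (Sum.inl e.2)) =
        m e.1 e.2 (x (Sum.inl e.1), x (Sum.inl e.2)) := by
    intro e he
    have h2 : Measurable fun u : Fin n → I => (u e.1, u e.2) := by fun_prop
    refine (hS.ae_canon_iff (p := fun u => κ.toFun (u e.1) (u e.2) = m e.1 e.2 (u e.1, u e.2))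
      (measurableSet_eq_fun (κ.measurable_toFun.comp h2) ((hm _ _).measurable.comp h2))).2 ?_
    have hce := hS.condExp_label_of_map_eq (V := Y e.1 e.2) (hS.measurable_edge _ _ he)
      (g := fun x => c e.1 e.2 (x (Sum.inl e.1), x (Sum.inl e.2)) (x (Sum.inr e)))
      ((hcm _ _).comp (hedge e)) (r := fun u => m e.1 e.2 (u e.1, u e.2)) ((hm _ _).comp h2) ?_
      (fun s hs => integral_edge_mul_indicator hS.measurable_label (hcm _ _) e hs)
    · exact (hS.condExp_edge _ _ he).symm.trans hce
    · have hpr : Measurable fun p : (Fin n → I) × (EdgeIndex n → ℝ) => (p.1, p.2 ⟨e, he⟩) :=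
        measurable_fst.prodMk ((measurable_pi_apply _).comp measurable_snd)
      have := congrArg (Measure.map fun p : (Fin n → I) × (EdgeIndex n → ℝ) => (p.1, p.2 ⟨e, he⟩))
        hlaw
      rwa [Measure.map_map hpr (hu.prodMk hmY), Measure.map_map hpr (hx.prodMk hmc)] at this
  refine ⟨fun v w s t z => if v < w then c v w (s, t) z - m v w (s, t) else 0,
    ⟨fun v w => ?_, fun v w s t z => ?_, fun v w s t => ?_⟩, ?_⟩
  · split_ifs
    · have h2 : Measurable fun p : (I × I) × I => p.1 := measurable_fst
      exact (hcm v w).measurable.sub ((hm v w).measurable.comp h2)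
    · exact measurable_const
  · split_ifs
    · have h1 : |m v w (s, t)| ≤ b := by
        have := norm_integral_le_of_norm_le_const (μ := (volume : Measure I)) (C := b)
          (.of_forall fun z => (Real.norm_eq_abs _).trans_le (hcb v w (s, t) z))
        simpa [m] using this
      exact (abs_sub _ _).trans (by linarith [hcb v w (s, t) z])
    · simpa using hb
  · change ∫ z, _ ∂(volume : Measure I) = 0
    split_ifs
    · have hc1 : BddMeas fun z => c v w (s, t) z := (hcm v w).comp measurable_prodMk_left
      rw [integral_sub (hc1.integrable _) (integrable_const _)]
      simp [m]
    · simp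
  · let G : (Fin n → I) × (EdgeIndex n → ℝ) → (Fin n → I) × (Fin n × Fin n → ℝ) := fun p =>
      (p.1, fun e => if h : e.1 < e.2 then p.2 ⟨e, h⟩ - κ.toFun (p.1 e.1) (p.1 e.2) else 0)
    have hG : Measurable G := by
      refine measurable_fst.prodMk (measurable_pi_lambda _ fun e => ?_)
      split_ifs with h
      · have h2 : Measurable fun p : (Fin n → I) × (EdgeIndex n → ℝ) => (p.1 e.1, p.1 e.2) := by
          fun_prop
        exact ((measurable_pi_apply _).comp measurable_snd).sub (κ.measurable_toFun.comp h2)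
      · exact measurable_const
    have h1 := congrArg (Measure.map G) hlaw
    rw [Measure.map_map hG (hu.prodMk hmY), Measure.map_map hG (hx.prodMk hmc)] at h1
    refine Eq.trans ?_ (h1.trans (Measure.map_congr ?_))
    · rfl
    · have h2 : ∀ᵐ x ∂(Measure.pi (canonLaw P U)), ∀ e : EdgeIndex n,
          κ.toFun (x (Sum.inl e.1.1)) (x (Sum.inl e.1.2)) =
            m e.1.1 e.1.2 (x (Sum.inl e.1.1), x (Sum.inl e.1.2)) :=
        ae_all_iff.2 fun e => hκm e.1 e.2
      filter_upwards [h2] with x hx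
      refine Prod.ext rfl (funext fun e => ?_)
      simp only [Function.comp_apply, G, edgeNoise]
      split_ifs with h
      · rw [hx ⟨e, h⟩]
      · rfl

end IsGraphonSample

end Representation


/-! ### Transfer of the counts to the canonical space -/

section Transfer

set_option linter.unusedSectionVars false

variable {n : ℕ} {Ω : Type*} [MeasurableSpace Ω] {P : Measure Ω} [IsProbabilityMeasure P]
  {κ : Graphon} {U : Fin n → Ω → I} {Y : Fin n → Fin n → Ω → ℝ}

namespace IsGraphonSample

lemma integral_label (hS : IsGraphonSample P κ U Y) {f : (Fin n → I) → ℝ} (hf : Measurable f) :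
    ∫ x, f (fun v => x (Sum.inl v)) ∂(Measure.pi (canonLaw P U)) = ∫ ω, f (fun v => U v ω) ∂P := by
  have h1 : Measurable fun (x : Coord n → I) v => x (Sum.inl v) := by fun_prop
  have h2 : Measurable fun ω v => U v ω := measurable_pi_lambda _ hS.measurable_label
  rw [← integral_map (f := f) h1.aemeasurable hf.aestronglyMeasurable,
    ← integral_map (f := f) h2.aemeasurable hf.aestronglyMeasurable, hS.map_canon_label]

/-- The conditional variances of the edge variables are the variances of the edge noise. -/
lemma condVar_eq (hS : IsGraphonSample P κ U Y) {ε : Fin n → Fin n → I → I → I → ℝ} {L : ℝ}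
    (hε : IsCentredNoise (canonLaw P U) ε L)
    (hlaw : P.map (fun ω => (fun v => U v ω, centredEdge κ U Y ω)) =
        (Measure.pi (canonLaw P U)).map fun x => (fun v => x (Sum.inl v), edgeNoise ε x))
    {v w : Fin n} (hvw : v < w) :
    Var[Y v w; P | labelSigma U] =ᵐ[P]
      fun ω => noiseVar (canonLaw P U) ε v w (U v ω) (U w ω) := by
  have := isProbabilityMeasure_canonLaw (P := P) hS.measurable_label
  have hu : Measurable fun ω v => U v ω := measurable_pi_lambda _ hS.measurable_label
  have hx : Measurable fun (x : Coord n → I) v => x (Sum.inl v) := by fun_prop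
  have hη := hS.measurable_centredEdge
  have hη' : Measurable (edgeNoise ε) := measurable_pi_lambda _ fun e => hε.measurable_edgeNoise e
  have hsq : BddMeas fun x => edgeNoise ε x (v, w) ^ 2 := by
    simpa only [sq] using (hε.bddMeas (v, w)).mul (hε.bddMeas (v, w))
  have hsq' : BddMeas (Function.uncurry fun (st : I × I) z => ε v w st.1 st.2 z ^ 2) := by
    have h0 : BddMeas fun p : (I × I) × I => ε v w p.1.1 p.1.2 p.2 :=
      ⟨hε.measurable v w, L, fun p => hε.bound v w _ _ _⟩
    have h1 : BddMeas fun p : (I × I) × I => ε v w p.1.1 p.1.2 p.2 ^ 2 := by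
      simpa only [sq] using h0.mul h0
    exact h1
  have hr : BddMeas fun u : Fin n → I => noiseVar (canonLaw P U) ε v w (u v) (u w) := by
    let g : (Fin n → I) → Coord n → I := fun u => Sum.elim u fun _ => 0
    have hg : Measurable g := by
      refine measurable_pi_lambda _ fun j => ?_
      rcases j with v | e
      · exact measurable_pi_apply v
      · exact measurable_const
    exact (hε.bddMeas_noiseVar (v, w)).comp hg
  have h1 : Var[Y v w; P | labelSigma U] =ᵐ[P]
      P[fun ω => centredEdge κ U Y ω (v, w) ^ 2 | labelSigma U] := by
    refine condExp_congr_ae ?_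
    filter_upwards [hS.condExp_edge v w hvw] with ω hω
    simp [centredEdge, hvw, hω]
  refine h1.trans ?_
  refine hS.condExp_label_of_map_eq (r := fun u => noiseVar (canonLaw P U) ε v w (u v) (u w))
    (((measurable_pi_apply _).comp hη).pow_const 2) hsq hr ?_ ?_
  · have hpr : Measurable fun p : (Fin n → I) × (Fin n × Fin n → ℝ) => (p.1, p.2 (v, w) ^ 2) :=
      measurable_fst.prodMk (((measurable_pi_apply _).comp measurable_snd).pow_const 2)
    have := congrArg (Measure.map fun p : (Fin n → I) × (Fin n × Fin n → ℝ) =>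
      (p.1, p.2 (v, w) ^ 2)) hlaw
    rwa [Measure.map_map hpr (hu.prodMk hη), Measure.map_map hpr (hx.prodMk hη')] at this
  · intro s hs
    exact integral_edge_mul_indicator hS.measurable_label hsq' (v, w) hs

/-- For `0`-`1`-valued edge variables the conditional variances are `κ (1 - κ)`. -/
lemma condVar_eq_of_zero_one (hS : IsGraphonSample P κ U Y) {v w : Fin n} (hvw : v < w)
    (h01 : ∀ᵐ ω ∂P, Y v w ω = 0 ∨ Y v w ω = 1) :
    Var[Y v w; P | labelSigma U] =ᵐ[P]
      fun ω => κ.toFun (U v ω) (U w ω) * (1 - κ.toFun (U v ω) (U w ω)) := by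
  have hL2 : MemLp (Y v w) 2 P := by
    refine MemLp.of_bound (hS.measurable_edge v w hvw).aestronglyMeasurable 1 ?_
    filter_upwards [h01] with ω hω
    rcases hω with h | h <;> simp [h]
  have h2 : P[Y v w ^ 2 | labelSigma U] =ᵐ[P] P[Y v w | labelSigma U] := by
    refine condExp_congr_ae ?_
    filter_upwards [h01] with ω hω
    rcases hω with h | h <;> simp [h]
  filter_upwards [condVar_ae_eq_condExp_sq_sub_sq_condExp hS.labelSigma_le hL2, h2,
    hS.condExp_edge v w hvw] with ω h3 h4 h5
  rw [h3, Pi.sub_apply, Pi.pow_apply, h4, h5]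
  ring

end IsGraphonSample

variable {d : ℕ} {k : Fin d → ℕ} {F : ∀ i, SimpleGraph (Fin (k i))}
  {φ : ∀ i, (Fin (k i) → ℝ) → ℝ} {ψ : ∀ i, (Fin (k i) → I) → ℝ}

lemma countCov_congr {V V' : Fin n → Fin n → Ω → ℝ} (h : ∀ v w, v < w → V v w =ᵐ[P] V' v w) :
    countCov P U V F φ ψ = countCov P U V' F φ ψ := by
  ext i j
  simp only [countCov, Matrix.of_apply]
  split_ifs with h1 h2
  · rfl
  · congr 1
    refine Finset.sum_congr rfl fun a ha => ?_
    congr 1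
    refine integral_congr_ae ?_
    have : ∀ e ∈ orderedEdges (F i), ∀ᵐ ω ∂P, V (a e.1) (a e.2) ω = V' (a e.1) (a e.2) ω :=
      fun e he => h _ _ (mem_increasingTuples.1 ha (mem_orderedEdges.1 he).1)
    filter_upwards [(Finset.eventually_all _).2 this] with ω hω
    rw [Finset.prod_congr rfl hω]
  · rfl

lemma IsGraphonSample.countCov_canon (hS : IsGraphonSample P κ U Y)
    (hψm : ∀ i, Measurable (ψ i)) {r : Fin n → Fin n → I → I → ℝ}
    (hr : ∀ v w, Measurable fun u : Fin n → I => r v w (u v) (u w)) :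
    countCov (Measure.pi (canonLaw P U)) (fun v x => x (Sum.inl v))
        (fun v w x => r v w (x (Sum.inl v)) (x (Sum.inl w))) F φ ψ =
      countCov P U (fun v w ω => r v w (U v ω) (U w ω)) F φ ψ := by
  have hψ : ∀ {l} (i) (a : Fin (k i) → Fin l), Measurable fun u : Fin l → I => ψ i fun v => u (a v) :=
    fun i a => (hψm i).comp (by fun_prop)
  ext i j
  simp only [countCov, Matrix.of_apply]
  split_ifs with h1 h2
  · congr 1
    refine Finset.sum_congr rfl fun a ha => ?_
    congr 1
    unfold covariance
    rw [hS.integral_label (hψ i fun _ => a), hS.integral_label (hψ j fun _ => a)]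
    exact hS.integral_label (((hψ i fun _ => a).sub_const _).mul ((hψ j fun _ => a).sub_const _))
  · congr 1
    refine Finset.sum_congr rfl fun a ha => ?_
    congr 1
    exact hS.integral_label (f := fun u => ψ i (fun v => u (a v)) *
      ψ j (fun v => u (a (Fin.cast h2.1 v))) * ∏ e ∈ orderedEdges (F i),
        r (a e.1) (a e.2) (u (a e.1)) (u (a e.2)))
      (((hψ i a).mul (hψ j _)).mul (Finset.measurable_prod _ fun e _ => hr _ _))
  · rfl

lemma measurable_tupleStat {k : ℕ} (F : SimpleGraph (Fin k)) (φ : (Fin k → ℝ) → ℝ)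
    {ψ : (Fin k → I) → ℝ} (hψ : Measurable ψ) (c : (Fin k → Fin n) → ℝ) (a : Fin k → Fin n) :
    Measurable fun p : (Fin n → I) × (Fin n × Fin n → ℝ) => tupleStat F φ ψ c a p.1 p.2 := by
  unfold tupleStat
  have h1 : Measurable fun p : (Fin n → I) × (Fin n × Fin n → ℝ) => ψ fun v => p.1 (a v) :=
    hψ.comp (by fun_prop)
  split_ifs
  · exact (h1.sub_const _).const_mul _
  · exact (h1.const_mul _).mul (Finset.measurable_prod _ fun e _ =>
      (measurable_pi_apply _).comp measurable_snd)

lemma IsGraphonSample.centredCount_eq (hS : IsGraphonSample P κ U Y) {k : ℕ}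
    (F : SimpleGraph (Fin k)) (φ : (Fin k → ℝ) → ℝ) {ψ : (Fin k → I) → ℝ} (hψ : Measurable ψ)
    (ω : Ω) : centredCount P κ U Y F φ ψ ω = (√(n.choose k : ℝ))⁻¹ *
      ∑ a ∈ increasingTuples n k, tupleStat F φ ψ (weightMean (canonLaw P U) ψ) a
        (fun v => U v ω) (centredEdge κ U Y ω) := by
  unfold centredCount tupleStat
  split_ifs with hk
  · subst hk
    have hmean : ∀ a : Fin n, weightMean (canonLaw P U) ψ (fun _ => a) =
        ∫ ω, ψ (fun _ => U a ω) ∂P := fun a =>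
      hS.integral_label (f := fun u => ψ fun _ => u a) (hψ.comp (by fun_prop))
    rw [sum_increasingTuples_one, Nat.choose_one_right]
    simp only [hmean]
  · congr 1
    refine Finset.sum_congr rfl fun a ha => ?_
    congr 1
    refine Finset.prod_congr rfl fun e he => ?_
    rw [centredEdge, if_pos]
    exact mem_increasingTuples.1 ha (mem_orderedEdges.1 he).1

/-- The vector of centred counts has the law of a sum of the increments of centred families on
the canonical space. -/
theorem IsGraphonSample.exists_layers (hS : IsGraphonSample P κ U Y) {B : ℝ} {p : ℕ}
    (hF : ∀ i, (F i).Connected) (hk : ∀ i, k i ≤ p)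
    (hY : ∀ v w, v < w → ∀ᵐ ω ∂P, |Y v w ω| ≤ B)
    (hφ : ∀ i, ∀ t ∈ orderedSimplex (k i), |φ i t| ≤ B)
    (hψm : ∀ i, Measurable (ψ i)) (hψ : ∀ i u, |ψ i u| ≤ B) :
    ∃ X : ∀ i, (Fin (k i) → Fin n) → (Coord n → I) → ℝ,
      (∀ i, CentredFamily (canonLaw P U) (F i) (X i) (2 * |B| ^ 2 * (2 * |B| + 1) ^ (p * p))) ∧
      Measurable (fun ω => (WithLp.toLp 2 fun i =>
        centredCount P κ U Y (F i) (φ i) (ψ i) ω : EuclideanSpace ℝ (Fin d))) ∧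
      P.map (fun ω => WithLp.toLp 2 fun i => centredCount P κ U Y (F i) (φ i) (ψ i) ω) =
        (Measure.pi (canonLaw P U)).map (fun x => ∑ m, layer X m x) ∧
      countCov P U (fun v w => Var[Y v w; P | labelSigma U]) F φ ψ =
        ∑ m, layerCov (canonLaw P U) X m := by
  have := isProbabilityMeasure_canonLaw (P := P) hS.measurable_label
  obtain ⟨ε, hε, hlaw⟩ := hS.exists_canonical hY
  have hB := le_abs_self B
  have hε' : IsCentredNoise (canonLaw P U) ε (2 * |B| + 1) :=
    ⟨hε.measurable, fun v w s t z => (hε.bound v w s t z).trans (by linarith), hε.mean⟩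
  have hk0 : ∀ i, k i ≠ 0 := fun i => (Fin.pos_iff_nonempty.2 (hF i).nonempty).ne'
  have hX : ∀ i, CentredFamily (canonLaw P U) (F i)
      (canonStat (canonLaw P U) ε (F i) (φ i) (ψ i))
      (2 * |B| ^ 2 * (2 * |B| + 1) ^ (p * p)) := fun i =>
    centredFamily_canonStat hε' (by linarith [abs_nonneg B]) (abs_nonneg B)
      (fun t ht => (hφ i t ht).trans hB) (hψm i) (fun u => (hψ i u).trans hB) (hk i)
  have hu : Measurable fun ω v => U v ω := measurable_pi_lambda _ hS.measurable_label
  have hx : Measurable fun (x : Coord n → I) v => x (Sum.inl v) := by fun_prop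
  have hη := hS.measurable_centredEdge
  have hη' : Measurable (edgeNoise ε) := measurable_pi_lambda _ fun e => hε.measurable_edgeNoise e
  let T : (Fin n → I) × (Fin n × Fin n → ℝ) → EuclideanSpace ℝ (Fin d) := fun q =>
    WithLp.toLp 2 fun i => (√(n.choose (k i) : ℝ))⁻¹ * ∑ a ∈ increasingTuples n (k i),
      tupleStat (F i) (φ i) (ψ i) (weightMean (canonLaw P U) (ψ i)) a q.1 q.2
  have hT : Measurable T := (PiLp.continuous_toLp 2 _).measurable.comp
    (measurable_pi_lambda _ fun i => (Finset.measurable_sum _ fun a _ =>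
      measurable_tupleStat _ _ (hψm i) _ a).const_mul _)
  have hW : (fun ω => (WithLp.toLp 2 fun i => centredCount P κ U Y (F i) (φ i) (ψ i) ω :
      EuclideanSpace ℝ (Fin d))) = T ∘ fun ω => (fun v => U v ω, centredEdge κ U Y ω) := by
    funext ω
    simp only [Function.comp_apply, T]
    congr 1
    funext i
    exact hS.centredCount_eq (F i) (φ i) (hψm i) ω
  have hsum : (fun x => ∑ m, layer (fun i => canonStat (canonLaw P U) ε (F i) (φ i) (ψ i)) m x) =
      T ∘ fun x => (fun v => x (Sum.inl v), edgeNoise ε x) := by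
    funext x
    ext i
    rw [sum_layer hk0]
    rfl
  refine ⟨fun i => canonStat (canonLaw P U) ε (F i) (φ i) (ψ i), hX, ?_, ?_, ?_⟩
  · rw [hW]
    exact hT.comp (hu.prodMk hη)
  · rw [hW, hsum, ← Measure.map_map hT (hu.prodMk hη), hlaw, Measure.map_map hT (hx.prodMk hη')]
  · rw [countCov_congr fun v w hvw => hS.condVar_eq hε hlaw hvw]
    rw [← hS.countCov_canon hψm]
    · ext i j
      rw [← integral_canonCount_mul hε hF hX hψm hψ, ← integral_sum_layer_mul hF hX]
      refine integral_congr_ae (.of_forall fun x => ?_)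
      simp only [sum_layer hk0]
      rfl
    · intro v w
      let g : (Fin n → I) → Coord n → I := fun u => Sum.elim u fun _ => 0
      have hg : Measurable g := by
        refine measurable_pi_lambda _ fun j => ?_
        rcases j with v | e
        · exact measurable_pi_apply v
        · exact measurable_const
      exact (hε.bddMeas_noiseVar (v, w)).measurable.comp hg

end Transfer


/-! ### Gaussian measure of the boundary layers of convex sets -/

section Shell

set_option linter.unusedSectionVars false

lemma Convex.interior_closure_subset {E : Type*} [NormedAddCommGroup E] [NormedSpace ℝ E]
    [FiniteDimensional ℝ E] {A : Set E} (hA : Convex ℝ A) : interior (closure A) ⊆ A := by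
  intro x hx
  have h1 : affineSpan ℝ (closure A) = ⊤ :=
    hA.closure.interior_nonempty_iff_affineSpan_eq_top.1 ⟨x, hx⟩
  have h2 : affineSpan ℝ A = ⊤ := by
    rw [eq_top_iff, ← h1, affineSpan_le]
    exact closure_minimal (subset_affineSpan ℝ A) (AffineSubspace.closed_of_finiteDimensional _)
  obtain ⟨y, hy⟩ := hA.interior_nonempty_iff_affineSpan_eq_top.2 h2
  have hlim : Filter.Tendsto (fun t : ℝ => x + t • (x - y)) (nhds 0) (nhds x) := by
    have : Continuous fun t : ℝ => x + t • (x - y) := by fun_prop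
    simpa using this.tendsto 0
  have hev := hlim.eventually (isOpen_interior.mem_nhds hx)
  have hev' : ∀ᶠ t in nhdsWithin (0 : ℝ) (Set.Ioi 0),
      x + t • (x - y) ∈ interior (closure A) ∧ t ∈ Set.Ioi (0 : ℝ) :=
    (hev.filter_mono nhdsWithin_le_nhds).and self_mem_nhdsWithin
  obtain ⟨t, ht0, ht⟩ := hev'.exists
  have hz := interior_subset ht0
  have ht' : (0 : ℝ) < t := ht
  have hcombo := hA.combo_interior_closure_mem_interior hy hz (a := t / (1 + t)) (b := 1 / (1 + t))
    (by positivity) (by positivity) (by field_simp; ring)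
  have : (t / (1 + t)) • y + (1 / (1 + t)) • (x + t • (x - y)) = x := by
    have h3 : (1 + t : ℝ) ≠ 0 := by positivity
    have h4 : (1 / (1 + t)) * t = t / (1 + t) := by ring
    have h5 : (1 / (1 + t)) + t / (1 + t) = 1 := by field_simp
    calc _ = ((1 / (1 + t)) + (1 / (1 + t)) * t) • x + (t / (1 + t) - (1 / (1 + t)) * t) • y := by
          module
      _ = x := by rw [h4, h5]; simp
  rw [this] at hcombo
  exact interior_subset hcombo

variable {d : ℕ}

/-- The points at distance less than `r` both from `A` and from its complement. -/
def shell {E : Type*} [PseudoMetricSpace E] (r : ℝ) (A : Set E) : Set E :=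
  Metric.thickening r A ∩ Metric.thickening r Aᶜ

section Basic

variable {E : Type*} [PseudoMetricSpace E] {A : Set E} {r s : ℝ}

lemma shell_compl (r : ℝ) (A : Set E) : shell r Aᶜ = shell r A := by
  rw [shell, shell, compl_compl, Set.inter_comm]

lemma isOpen_shell : IsOpen (shell r A) :=
  Metric.isOpen_thickening.inter Metric.isOpen_thickening

lemma shell_mono (h : r ≤ s) : shell r A ⊆ shell s A :=
  Set.inter_subset_inter (Metric.thickening_mono h _) (Metric.thickening_mono h _)

lemma mem_shell_of_dist_lt {x y : E} (hx : x ∈ shell r A) (h : dist y x < s) :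
    y ∈ shell (r + s) A := by
  simp only [shell, Set.mem_inter_iff, Metric.mem_thickening_iff] at hx ⊢
  obtain ⟨⟨a, ha, hxa⟩, b, hb, hxb⟩ := hx
  exact ⟨⟨a, ha, (dist_triangle y x a).trans_lt (by linarith)⟩,
    b, hb, (dist_triangle y x b).trans_lt (by linarith)⟩

lemma thickening_subset_union_shell (hr : 0 < r) : Metric.thickening r A ⊆ A ∪ shell r A := by
  intro x hx
  by_cases hxA : x ∈ A
  · exact Or.inl hxA
  · exact Or.inr ⟨hx, Metric.self_subset_thickening hr _ hxA⟩

end Basic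

/-- From a point near the complement of a convex set one leaves the set in the direction of
some coordinate. -/
lemma exists_coordinate_escape {A : Set (EuclideanSpace ℝ (Fin d))} (hA : Convex ℝ A) {r : ℝ}
    {x : EuclideanSpace ℝ (Fin d)} (hx : x ∈ shell r A) :
    ∃ (i : Fin d) (s : ℝ), (s = 1 ∨ s = -1) ∧ ∀ t, 2 * r * d ≤ t →
      x + (t * s) • EuclideanSpace.single i 1 ∉ Metric.thickening r A := by
  have hclos : Aᶜ ⊆ closure (closure A)ᶜ := by
    rw [closure_compl, Set.compl_subset_compl]
    exact hA.interior_closure_subset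
  have hx2 : x ∈ Metric.thickening r (closure A)ᶜ := by
    rw [← Metric.thickening_closure]
    exact Metric.thickening_subset_of_subset r hclos hx.2
  obtain ⟨y, hy, hxy⟩ := Metric.mem_thickening_iff.1 hx2
  obtain ⟨a0, ha0, -⟩ := Metric.mem_thickening_iff.1 hx.1
  obtain ⟨f, u, hfA, hfy⟩ := geometric_hahn_banach_closed_point hA.closure isClosed_closure hy
  have hf : ∀ v : EuclideanSpace ℝ (Fin d), f v = ∑ i, v i * f (EuclideanSpace.single i 1) := by
    intro v
    conv_lhs => rw [← (EuclideanSpace.basisFun (Fin d) ℝ).sum_repr v]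
    simp [map_sum]
  have hne : (Finset.univ : Finset (Fin d)).Nonempty := by
    by_contra hemp
    rw [Finset.not_nonempty_iff_eq_empty] at hemp
    have h1 := hfA a0 (subset_closure ha0)
    rw [hf, hemp, Finset.sum_empty] at h1
    rw [hf, hemp, Finset.sum_empty] at hfy
    linarith
  obtain ⟨i, -, hi⟩ := Finset.exists_max_image Finset.univ
    (fun i => |f (EuclideanSpace.single i 1)|) hne
  set M := |f (EuclideanSpace.single i 1)| with hM
  have hfv : ∀ v : EuclideanSpace ℝ (Fin d), |f v| ≤ d * M * ‖v‖ := by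
    intro v
    rw [hf]
    calc _ ≤ ∑ j, |v j * f (EuclideanSpace.single j 1)| := Finset.abs_sum_le_sum_abs _ _
      _ ≤ ∑ _j : Fin d, ‖v‖ * M := Finset.sum_le_sum fun j hj => by
          rw [abs_mul]
          exact mul_le_mul (PiLp.norm_apply_le v j) (hi j hj) (abs_nonneg _) (norm_nonneg _)
      _ = _ := by rw [Finset.sum_const, Finset.card_univ, Fintype.card_fin, nsmul_eq_mul]; ring
  have hdM : 0 < (d : ℝ) * M := by
    have h1 := hfA a0 (subset_closure ha0)
    have h2 := hfv (y - a0)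
    rw [map_sub] at h2
    have h3 : 0 < |f y - f a0| := abs_pos.2 (by linarith)
    by_contra hcon
    have := mul_nonpos_of_nonpos_of_nonneg (not_lt.1 hcon) (norm_nonneg (y - a0))
    linarith
  have hMpos : 0 < M := by
    rcases (abs_nonneg (f (EuclideanSpace.single i 1))).eq_or_lt with h | h
    · rw [hM, ← h, mul_zero] at hdM; exact absurd hdM (lt_irrefl _)
    · exact h
  obtain ⟨s, hs, hsM⟩ : ∃ s : ℝ, (s = 1 ∨ s = -1) ∧ s * f (EuclideanSpace.single i 1) = M := by
    rcases abs_choice (f (EuclideanSpace.single i 1)) with h | h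
    · exact ⟨1, Or.inl rfl, by rw [one_mul, hM, h]⟩
    · exact ⟨-1, Or.inr rfl, by rw [hM, h]; ring⟩
  refine ⟨i, s, hs, fun t ht hmem => ?_⟩
  obtain ⟨a, ha, hxa⟩ := Metric.mem_thickening_iff.1 hmem
  have h1 := hfA a (subset_closure ha)
  have h2 := (le_abs_self _).trans (hfv (x + (t * s) • EuclideanSpace.single i 1 - a))
  have h3 := (le_abs_self _).trans (hfv (y - x))
  rw [← dist_eq_norm] at h2 h3
  rw [dist_comm] at h3
  have h2' := h2.trans_lt (mul_lt_mul_of_pos_left hxa hdM)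
  have h3' := h3.trans_lt (mul_lt_mul_of_pos_left hxy hdM)
  rw [map_sub, map_add, map_smul, smul_eq_mul, mul_assoc, hsM] at h2'
  rw [map_sub] at h3'
  have h4 := mul_le_mul_of_nonneg_right ht hMpos.le
  nlinarith

lemma gaussianReal_le_volume (s : Set ℝ) : gaussianReal 0 1 s ≤ volume s := by
  rw [gaussianReal_apply 0 one_ne_zero]
  calc _ ≤ ∫⁻ _ in s, 1 := by
        refine lintegral_mono fun x => ?_
        rw [gaussianPDF, ← ENNReal.ofReal_one]
        refine ENNReal.ofReal_le_ofReal ?_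
        rw [gaussianPDFReal]
        have h1 : (√(2 * Real.pi * ((1 : NNReal) : ℝ)))⁻¹ ≤ 1 := by
          refine inv_le_one_of_one_le₀ (Real.one_le_sqrt.2 ?_)
          have := Real.pi_gt_three
          simp only [NNReal.coe_one]
          linarith
        have h2 : Real.exp (-(x - 0) ^ 2 / (2 * ((1 : NNReal) : ℝ))) ≤ 1 := by
          rw [Real.exp_le_one_iff]
          simp only [NNReal.coe_one]
          nlinarith [sq_nonneg (x - 0)]
        exact mul_le_one₀ h1 (Real.exp_pos _).le h2
    _ = volume s := by simp

lemma gaussianReal_le_of_forall_sub_le {s : Set ℝ} {c : ℝ}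
    (h : ∀ x ∈ s, ∀ y ∈ s, |x - y| ≤ c) : gaussianReal 0 1 s ≤ ENNReal.ofReal c := by
  refine (gaussianReal_le_volume s).trans ((Real.volume_le_diam s).trans ?_)
  refine Metric.ediam_le fun x hx y hy => ?_
  rw [edist_dist, Real.dist_eq]
  exact ENNReal.ofReal_le_ofReal (h x hx y hy)

/-- The standard Gaussian measure of a set all of whose sections in some coordinate direction
have small diameter. -/
lemma stdGaussian_le_of_sections {S : Set (EuclideanSpace ℝ (Fin d))} (hS : MeasurableSet S)
    (i : Fin d) {c : ℝ} (h : ∀ x ∈ S, ∀ t, x + t • EuclideanSpace.single i 1 ∈ S → |t| ≤ c)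
    (hc : 0 ≤ c) :
    (stdGaussian (EuclideanSpace ℝ (Fin d))).real S ≤ c := by
  have hm : Measurable (WithLp.toLp 2 : (Fin d → ℝ) → EuclideanSpace ℝ (Fin d)) :=
    (PiLp.continuous_toLp 2 _).measurable
  rw [← map_pi_eq_stdGaussian, map_measureReal_apply hm hS]
  set T := (WithLp.toLp 2 : (Fin d → ℝ) → EuclideanSpace ℝ (Fin d)) ⁻¹' S
  have hT : MeasurableSet T := hm hS
  have hG : BddMeas (T.indicator fun _ => (1 : ℝ)) :=
    ⟨measurable_const.indicator hT, 1, fun x => by by_cases hx : x ∈ T <;> simp [hx]⟩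
  have h0 : (Measure.pi fun _ : Fin d => gaussianReal 0 1).real T =
      ∫ x, T.indicator (fun _ => (1 : ℝ)) x ∂(Measure.pi fun _ : Fin d => gaussianReal 0 1) := by
    rw [integral_indicator hT]; simp
  rw [h0, ← integral_resample _ hG {i}]
  have key : ∀ x, resample (fun _ : Fin d => gaussianReal 0 1) {i}
      (T.indicator fun _ => (1 : ℝ)) x ≤ c := by
    intro x
    rw [resample_singleton _ _ hG.measurable]
    have hup : Measurable fun z => Function.update x i z := measurable_update x
    have : (fun z => T.indicator (fun _ => (1 : ℝ)) (Function.update x i z)) =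
        ((fun z => Function.update x i z) ⁻¹' T).indicator fun _ => 1 := rfl
    rw [this, integral_indicator (hup hT)]
    simp only [integral_const, MeasurableSet.univ, measureReal_restrict_apply, Set.univ_inter,
      smul_eq_mul, mul_one]
    refine ENNReal.toReal_le_of_le_ofReal hc (gaussianReal_le_of_forall_sub_le ?_)
    intro z hz w hw
    rw [abs_sub_comm]
    refine h _ hz (w - z) ?_
    have heq : WithLp.toLp 2 (Function.update x i z) + (w - z) • EuclideanSpace.single i 1 =
        WithLp.toLp 2 (Function.update x i w) := by
      ext j
      by_cases hj : j = i
      · subst hj; simp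
      · simp [hj]
    rw [heq]
    exact hw
  calc _ ≤ ∫ _, c ∂(Measure.pi fun _ : Fin d => gaussianReal 0 1) :=
        integral_mono ((hG.resample _ _).integrable _) (integrable_const _) key
    _ = c := by simp

/-- The points of a set from which one leaves the set for good when moving by at least `c` in
the direction `v`. -/
def escapeSet {E : Type*} [AddCommGroup E] [Module ℝ E] (K : Set E) (v : E) (c : ℝ) : Set E :=
  {x | x ∈ K ∧ ∀ t, c ≤ t → x + t • v ∉ K}

lemma measurableSet_escapeSet {K : Set (EuclideanSpace ℝ (Fin d))} (hK : IsOpen K)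
    (v : EuclideanSpace ℝ (Fin d)) (c : ℝ) : MeasurableSet (escapeSet K v c) := by
  have : escapeSet K v c = K \ ⋃ t ∈ Set.Ici c, (fun x => x + t • v) ⁻¹' K := by
    ext x
    simp [escapeSet]
  rw [this]
  exact hK.measurableSet.diff
    (isOpen_biUnion fun t _ => hK.preimage (by fun_prop)).measurableSet

lemma abs_le_of_mem_escapeSet {K : Set (EuclideanSpace ℝ (Fin d))} {i : Fin d} {s c : ℝ}
    (hs : s = 1 ∨ s = -1) {x : EuclideanSpace ℝ (Fin d)}
    (hx : x ∈ escapeSet K (s • EuclideanSpace.single i 1) c) {t : ℝ}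
    (ht : x + t • EuclideanSpace.single i 1 ∈ escapeSet K (s • EuclideanSpace.single i 1) c) :
    |t| ≤ c := by
  by_contra! hcon
  have hss : s * s = 1 := by rcases hs with rfl | rfl <;> norm_num
  rcases le_total 0 (t * s) with h | h
  · have habs : |t| = t * s := by
      rw [← abs_of_nonneg h, abs_mul]
      rcases hs with rfl | rfl <;> simp
    refine hx.2 (t * s) (by linarith) ?_
    rw [smul_smul, mul_assoc, hss, mul_one]
    exact ht.1
  · have habs : |t| = -(t * s) := by
      rw [← abs_of_nonpos h, abs_mul]
      rcases hs with rfl | rfl <;> simp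
    refine ht.2 (-(t * s)) (by linarith) ?_
    rw [smul_smul, neg_mul, mul_assoc, hss, mul_one, add_assoc, ← add_smul, add_neg_cancel,
      zero_smul, add_zero]
    exact hx.1

/-- Boundary layers of convex sets have small Gaussian measure. -/
theorem stdGaussian_shell_le {A : Set (EuclideanSpace ℝ (Fin d))} (hA : Convex ℝ A) {r : ℝ}
    (hr : 0 ≤ r) :
    (stdGaussian (EuclideanSpace ℝ (Fin d))).real (shell r A) ≤ 4 * d ^ 2 * r := by
  set K := Metric.thickening r A
  set c := 2 * r * d
  have hc : 0 ≤ c := by positivity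
  have hcover : shell r A ⊆ ⋃ i : Fin d, (escapeSet K ((1 : ℝ) • EuclideanSpace.single i 1) c ∪
      escapeSet K ((-1 : ℝ) • EuclideanSpace.single i 1) c) := by
    intro x hx
    obtain ⟨i, s, hs, h⟩ := exists_coordinate_escape hA hx
    refine Set.mem_iUnion.2 ⟨i, ?_⟩
    rcases hs with rfl | rfl
    · exact Or.inl ⟨hx.1, fun t ht => by rw [smul_smul]; exact h t ht⟩
    · exact Or.inr ⟨hx.1, fun t ht => by rw [smul_smul]; exact h t ht⟩
  have hone : ∀ (i : Fin d) (s : ℝ), (s = 1 ∨ s = -1) →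
      (stdGaussian (EuclideanSpace ℝ (Fin d))).real
        (escapeSet K (s • EuclideanSpace.single i 1) c) ≤ c := fun i s hs =>
    stdGaussian_le_of_sections (measurableSet_escapeSet Metric.isOpen_thickening _ _) i
      (fun x hx t ht => abs_le_of_mem_escapeSet hs hx ht) hc
  calc _ ≤ (stdGaussian (EuclideanSpace ℝ (Fin d))).real
        (⋃ i : Fin d, (escapeSet K ((1 : ℝ) • EuclideanSpace.single i 1) c ∪
          escapeSet K ((-1 : ℝ) • EuclideanSpace.single i 1) c)) := measureReal_mono hcover
    _ ≤ ∑ i : Fin d, (stdGaussian (EuclideanSpace ℝ (Fin d))).real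
        (escapeSet K ((1 : ℝ) • EuclideanSpace.single i 1) c ∪
          escapeSet K ((-1 : ℝ) • EuclideanSpace.single i 1) c) := measureReal_iUnion_fintype_le _
    _ ≤ ∑ _i : Fin d, (c + c) := Finset.sum_le_sum fun i _ =>
        (measureReal_union_le _ _).trans
          (add_le_add (hone i 1 (Or.inl rfl)) (hone i (-1) (Or.inr rfl)))
    _ = _ := by
        rw [Finset.sum_const, Finset.card_univ, Fintype.card_fin, nsmul_eq_mul]
        simp only [c]
        ring

end Shell


/-! ### Smooth approximations of indicator functions -/

section Mollifier

set_option linter.unusedSectionVars false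

variable {d : ℕ}

/-- Smooth functions supported in the closed unit ball. -/
structure SmoothInBall (g : EuclideanSpace ℝ (Fin d) → ℝ) : Prop where
  smooth : ContDiff ℝ (⊤ : ℕ∞) g
  support : tsupport g ⊆ Metric.closedBall 0 1

namespace SmoothInBall

variable {g : EuclideanSpace ℝ (Fin d) → ℝ}

lemma compactSupport (hg : SmoothInBall g) : HasCompactSupport g :=
  (isCompact_closedBall 0 1).of_isClosed_subset (isClosed_tsupport g) hg.support

lemma eq_zero (hg : SmoothInBall g) {x : EuclideanSpace ℝ (Fin d)} (hx : 1 < ‖x‖) : g x = 0 := by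
  by_contra h
  have := hg.support (subset_tsupport g h)
  rw [mem_closedBall_zero_iff] at this
  linarith

lemma integrable (hg : SmoothInBall g) : Integrable g :=
  hg.smooth.continuous.integrable_of_hasCompactSupport hg.compactSupport

lemma differentiable (hg : SmoothInBall g) : Differentiable ℝ g :=
  hg.smooth.differentiable (by simp)

lemma bounded (hg : SmoothInBall g) : ∃ K, ∀ x, |g x| ≤ K := by
  obtain ⟨K, hK⟩ := hg.smooth.continuous.bounded_above_of_compact_support hg.compactSupport
  exact ⟨K, fun x => hK x⟩

lemma partialDeriv_eq (hg : SmoothInBall g) (i : Fin d) :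
    partialDeriv i g = fun x => fderiv ℝ g x (EuclideanSpace.single i 1) := by
  funext x
  exact (hg.differentiable x).lineDeriv_eq_fderiv

lemma partialDeriv (hg : SmoothInBall g) (i : Fin d) : SmoothInBall (partialDeriv i g) := by
  rw [hg.partialDeriv_eq]
  refine ⟨(hg.smooth.fderiv_right (m := (⊤ : ℕ∞)) (by simp)).clm_apply contDiff_const, ?_⟩
  exact (tsupport_fderiv_apply_subset ℝ _).trans hg.support

lemma iterPartial (hg : SmoothInBall g) (l : List (Fin d)) : SmoothInBall (iterPartial l g) := by
  induction l with
  | nil => exact hg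
  | cons i l ih => exact ih.partialDeriv i

lemma const_mul (hg : SmoothInBall g) (c : ℝ) : SmoothInBall fun x => c * g x :=
  ⟨contDiff_const.mul hg.smooth, (tsupport_mul_subset_right (f := fun _ => c)).trans hg.support⟩

lemma secondCoeff (hg : SmoothInBall g) (i j : Fin d) : SmoothInBall (secondCoeff g i j) := by
  unfold _root_.secondCoeff
  split_ifs
  · exact (hg.partialDeriv j).partialDeriv i
  · have := ((hg.partialDeriv i).partialDeriv i).const_mul 2⁻¹
    simpa only [div_eq_inv_mul] using this
  · have := hg.const_mul 0
    simpa only [zero_mul] using this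

lemma integral_partialDeriv (hg : SmoothInBall g) (i : Fin d) :
    ∫ x, _root_.partialDeriv i g x = 0 := by
  have h := integral_bilinear_hasLineDerivAt_right_eq_neg_left_of_integrable
    (μ := (volume : Measure (EuclideanSpace ℝ (Fin d))))
    (f := fun _ => (1 : ℝ)) (f' := fun _ => (0 : ℝ)) (g := g) (g' := _root_.partialDeriv i g)
    (v := EuclideanSpace.single i 1) (B := ContinuousLinearMap.mul ℝ ℝ)
    (by simp) (by simpa using (hg.partialDeriv i).integrable)
    (by simpa using hg.integrable)
    (fun x _ => by simpa using (hasFDerivAt_const (1 : ℝ) x).hasLineDerivAt _)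
    (fun x _ => (hg.differentiable x).lineDifferentiableAt.hasLineDerivAt)
  simpa using h

lemma integral_secondCoeff (hg : SmoothInBall g) (i j : Fin d) :
    ∫ x, _root_.secondCoeff g i j x = 0 := by
  unfold _root_.secondCoeff
  split_ifs
  · exact (hg.partialDeriv j).integral_partialDeriv i
  · rw [integral_div, (hg.partialDeriv i).integral_partialDeriv i, zero_div]
  · simp

lemma exists_isTaylorThree (hg : SmoothInBall g) : ∃ M, 0 ≤ M ∧
    IsTaylorThree g (fun i => _root_.partialDeriv i g) (_root_.secondCoeff g) M := by
  choose K hK using fun α : Fin d → ℕ =>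
    (hg.iterPartial ((List.finRange d).flatMap fun i => List.replicate (α i) i)).bounded
  have hfin : {α : Fin d → ℕ | ∑ i, α i ≤ 3}.Finite := by
    refine (Set.Finite.pi' (t := fun _ : Fin d => Set.Iic 3) fun _ => Set.finite_Iic 3).subset ?_
    intro α hα i
    exact (Finset.single_le_sum (f := α) (fun _ _ => Nat.zero_le _) (Finset.mem_univ i)).trans hα
  obtain ⟨M, hM⟩ := (hfin.image K).bddAbove
  have hT := isTaylorThree_of_partiallyDifferentiable (h := g) (m := 3) (M := M) le_rfl
    (fun l _ i x => ((hg.iterPartial l).differentiable x).lineDifferentiableAt)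
    (fun α hα x => (hK α x).trans (hM ⟨α, hα, rfl⟩))
  refine ⟨4 * M, ?_, hT⟩
  have := (abs_nonneg _).trans ((hK 0 0).trans (hM ⟨0, by simp, rfl⟩))
  linarith

end SmoothInBall

/-- The convolution of `g` with the indicator of `B`. -/
noncomputable def smear (B : Set (EuclideanSpace ℝ (Fin d))) (g : EuclideanSpace ℝ (Fin d) → ℝ)
    (x : EuclideanSpace ℝ (Fin d)) : ℝ := ∫ z in B, g (x - z)

section Smear

variable {B : Set (EuclideanSpace ℝ (Fin d))} {g : EuclideanSpace ℝ (Fin d) → ℝ}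

lemma SmoothInBall.measurable_smear (hg : SmoothInBall g) (B : Set (EuclideanSpace ℝ (Fin d))) :
    Measurable (smear B g) := by
  have h : Measurable fun q : EuclideanSpace ℝ (Fin d) × EuclideanSpace ℝ (Fin d) =>
      g (q.1 - q.2) := hg.smooth.continuous.measurable.comp (measurable_fst.sub measurable_snd)
  exact h.stronglyMeasurable.integral_prod_right.measurable

lemma SmoothInBall.integrable_shift (hg : SmoothInBall g) (x : EuclideanSpace ℝ (Fin d)) :
    Integrable fun z => g (x - z) := hg.integrable.comp_sub_left x

lemma SmoothInBall.abs_smear_le (hg : SmoothInBall g) (B : Set (EuclideanSpace ℝ (Fin d)))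
    (x : EuclideanSpace ℝ (Fin d)) : |smear B g x| ≤ ∫ u, |g u| := by
  calc _ ≤ ∫ z in B, |g (x - z)| := abs_integral_le_integral_abs
    _ ≤ ∫ z, |g (x - z)| :=
        setIntegral_le_integral (hg.integrable_shift x).abs (.of_forall fun z => abs_nonneg _)
    _ = _ := integral_sub_left_eq_self (fun u => |g u|) volume x

lemma SmoothInBall.smear_add_compl (hg : SmoothInBall g) (hB : MeasurableSet B)
    (x : EuclideanSpace ℝ (Fin d)) : smear B g x + smear Bᶜ g x = ∫ u, g u := by
  rw [smear, smear, integral_add_compl hB (hg.integrable_shift x)]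
  exact integral_sub_left_eq_self g volume x

lemma SmoothInBall.smear_eq_zero (hg : SmoothInBall g) {x : EuclideanSpace ℝ (Fin d)}
    (h : ∀ z ∈ B, 1 < dist x z) : smear B g x = 0 :=
  setIntegral_eq_zero_of_forall_eq_zero fun z hz => hg.eq_zero (by
    rw [← dist_eq_norm]; exact h z hz)

lemma smear_add_of_invariant (g : EuclideanSpace ℝ (Fin d) → ℝ) (v : EuclideanSpace ℝ (Fin d))
    (hv : ∀ z, z + v ∈ B ↔ z ∈ B) (x : EuclideanSpace ℝ (Fin d)) :
    smear B g (x + v) = smear B g x := by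
  have hpre : (fun z => z + v) ⁻¹' B = B := Set.ext hv
  have h := (measurePreserving_add_right (volume : Measure (EuclideanSpace ℝ (Fin d)))
    v).setIntegral_preimage_emb (MeasurableEquiv.addRight v).measurableEmbedding
    (fun z => g (x + v - z)) B
  rw [hpre] at h
  simp only [add_sub_add_right_eq_sub] at h
  exact h.symm

lemma SmoothInBall.taylorRem_smear (hg : SmoothInBall g) (B : Set (EuclideanSpace ℝ (Fin d)))
    (x y : EuclideanSpace ℝ (Fin d)) :
    taylorRem (smear B g) (fun i => smear B (_root_.partialDeriv i g))
      (fun i j => smear B (_root_.secondCoeff g i j)) x y =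
      ∫ z in B, taylorRem g (fun i => _root_.partialDeriv i g) (_root_.secondCoeff g) (x - z) y := by
  unfold taylorRem smear
  have h0 : Integrable (fun z => g (x - z + y)) (volume.restrict B) := by
    simp only [sub_add_eq_add_sub]
    exact (hg.integrable_shift (x + y)).integrableOn (s := B)
  have h1 := (hg.integrable_shift x).integrableOn (s := B)
  have h2 : ∀ i, Integrable (fun z => _root_.partialDeriv i g (x - z) * y i) (volume.restrict B) :=
    fun i => (((hg.partialDeriv i).integrable_shift x).integrableOn (s := B)).mul_const _
  have h3 : ∀ i j, Integrable (fun z => _root_.secondCoeff g i j (x - z) * (y i * y j))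
      (volume.restrict B) :=
    fun i j => (((hg.secondCoeff i j).integrable_shift x).integrableOn (s := B)).mul_const _
  rw [integral_sub, integral_sub, integral_sub h0 h1, integral_finsetSum _ fun i _ => h2 i,
    integral_finsetSum _ fun i _ => integrable_finsetSum _ fun j _ => h3 i j]
  · simp only [integral_finsetSum _ fun j _ => h3 _ j, integral_mul_const, sub_add_eq_add_sub]
  · exact h0.sub h1
  · exact integrable_finsetSum _ fun i _ => h2 i
  · exact (h0.sub h1).sub (integrable_finsetSum _ fun i _ => h2 i)
  · exact integrable_finsetSum _ fun i _ => integrable_finsetSum _ fun j _ => h3 i j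

lemma SmoothInBall.taylorRem_smear_eq_zero (hg : SmoothInBall g)
    {x y : EuclideanSpace ℝ (Fin d)} (h : ∀ z ∈ B, 1 + ‖y‖ < dist x z) :
    taylorRem (smear B g) (fun i => smear B (_root_.partialDeriv i g))
      (fun i j => smear B (_root_.secondCoeff g i j)) x y = 0 := by
  rw [hg.taylorRem_smear]
  refine setIntegral_eq_zero_of_forall_eq_zero fun z hz => ?_
  have h1 := h z hz
  rw [dist_eq_norm] at h1
  have h2 : 1 < ‖x - z‖ := by linarith [norm_nonneg y]
  have h3 : 1 < ‖x - z + y‖ := by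
    have := norm_sub_le (x - z + y) y
    rw [add_sub_cancel_right] at this
    linarith
  simp [taylorRem, hg.eq_zero h2, hg.eq_zero h3, (hg.partialDeriv _).eq_zero h2,
    (hg.secondCoeff _ _).eq_zero h2]

lemma SmoothInBall.taylorRem_smear_compl (hg : SmoothInBall g) (hB : MeasurableSet B)
    (x y : EuclideanSpace ℝ (Fin d)) :
    taylorRem (smear B g) (fun i => smear B (_root_.partialDeriv i g))
      (fun i j => smear B (_root_.secondCoeff g i j)) x y =
    - taylorRem (smear Bᶜ g) (fun i => smear Bᶜ (_root_.partialDeriv i g))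
      (fun i j => smear Bᶜ (_root_.secondCoeff g i j)) x y := by
  have e0 : ∀ x, smear B g x = (∫ u, g u) - smear Bᶜ g x := fun x =>
    eq_sub_of_add_eq (hg.smear_add_compl hB x)
  have e1 : ∀ i x, smear B (_root_.partialDeriv i g) x = - smear Bᶜ (_root_.partialDeriv i g) x :=
    fun i x => by
      have := (hg.partialDeriv i).smear_add_compl hB x
      rw [hg.integral_partialDeriv] at this
      linarith
  have e2 : ∀ i j x, smear B (_root_.secondCoeff g i j) x =
      - smear Bᶜ (_root_.secondCoeff g i j) x := fun i j x => by
      have := (hg.secondCoeff i j).smear_add_compl hB x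
      rw [hg.integral_secondCoeff] at this
      linarith
  simp only [taylorRem, e0, e1, e2, neg_mul, Finset.sum_neg_distrib]
  ring

end Smear

lemma norm_le_sum_abs (y : EuclideanSpace ℝ (Fin d)) : ‖y‖ ≤ ∑ i, |y i| := by
  rw [EuclideanSpace.norm_eq]
  refine Real.sqrt_le_iff.2 ⟨Finset.sum_nonneg fun i _ => abs_nonneg _, ?_⟩
  simpa only [Real.norm_eq_abs] using
    Finset.sum_sq_le_sq_sum_of_nonneg (s := Finset.univ) (f := fun i => |y i|)
      fun i _ => abs_nonneg _

lemma integral_abs_taylorRem_le {g : EuclideanSpace ℝ (Fin d) → ℝ} (hg : SmoothInBall g) :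
    ∃ M, 0 ≤ M ∧ ∀ y : EuclideanSpace ℝ (Fin d),
      ∫ u, |taylorRem g (fun i => partialDeriv i g) (secondCoeff g) u y| ≤
        M * (∑ i, |y i|) ^ 3 := by
  obtain ⟨M, hM0, hT⟩ := hg.exists_isTaylorThree
  set R := taylorRem g (fun i => partialDeriv i g) (secondCoeff g) with hR
  set V := (volume : Measure (EuclideanSpace ℝ (Fin d))).real (Metric.closedBall 0 2)
  set K0 := ∫ u, |g u|
  set K1 := ∑ i, ∫ u, |partialDeriv i g u|
  set K2 := ∑ i, ∑ j, ∫ u, |secondCoeff g i j u|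
  have hK0 : 0 ≤ K0 := integral_nonneg fun _ => abs_nonneg _
  have hK1 : 0 ≤ K1 := Finset.sum_nonneg fun _ _ => integral_nonneg fun _ => abs_nonneg _
  have hK2 : 0 ≤ K2 := Finset.sum_nonneg fun _ _ => Finset.sum_nonneg fun _ _ =>
    integral_nonneg fun _ => abs_nonneg _
  have hV : 0 ≤ V := measureReal_nonneg
  refine ⟨M * V + (2 * K0 + K1 + K2), by positivity, fun y => ?_⟩
  set t := ∑ i, |y i|
  have ht : 0 ≤ t := Finset.sum_nonneg fun _ _ => abs_nonneg _
  have hyt : ∀ i, |y i| ≤ t := fun i =>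
    Finset.single_le_sum (f := fun i => |y i|) (fun _ _ => abs_nonneg _) (Finset.mem_univ i)
  rcases le_total ‖y‖ 1 with hy | hy
  · have hsupp : ∀ u, |R u y| ≤ (Metric.closedBall (0 : EuclideanSpace ℝ (Fin d)) 2).indicator
        (fun _ => M * t ^ 3) u := by
      intro u
      by_cases hu : u ∈ Metric.closedBall (0 : EuclideanSpace ℝ (Fin d)) 2
      · rw [Set.indicator_of_mem hu]
        exact hT.rem_le u y
      · rw [Set.indicator_of_notMem hu]
        rw [mem_closedBall_zero_iff, not_le] at hu
        have h2 : 1 < ‖u‖ := by linarith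
        have h3 : 1 < ‖u + y‖ := by
          have := norm_sub_le (u + y) y
          rw [add_sub_cancel_right] at this
          linarith
        simp [hR, taylorRem, hg.eq_zero h2, hg.eq_zero h3, (hg.partialDeriv _).eq_zero h2,
          (hg.secondCoeff _ _).eq_zero h2]
    have hfin : (volume : Measure (EuclideanSpace ℝ (Fin d))) (Metric.closedBall 0 2) ≠ ⊤ :=
      measure_closedBall_lt_top.ne
    calc ∫ u, |R u y| ≤ ∫ u, (Metric.closedBall (0 : EuclideanSpace ℝ (Fin d)) 2).indicator
          (fun _ => M * t ^ 3) u := by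
          refine integral_mono_of_nonneg (.of_forall fun _ => abs_nonneg _) ?_ (.of_forall hsupp)
          exact (integrableOn_const hfin).integrable_indicator measurableSet_closedBall
      _ = M * V * t ^ 3 := by
          rw [integral_indicator measurableSet_closedBall]
          simp only [integral_const, MeasurableSet.univ, measureReal_restrict_apply,
            Set.univ_inter, smul_eq_mul, V]
          ring
      _ ≤ _ := by
          refine mul_le_mul_of_nonneg_right ?_ (by positivity)
          linarith
  · have ht1 : 1 ≤ t := hy.trans (norm_le_sum_abs y)
    have hpt : ∀ u, |R u y| ≤ |g (u + y)| + |g u| + (∑ i, |partialDeriv i g u|) * t +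
        (∑ i, ∑ j, |secondCoeff g i j u|) * t ^ 2 := by
      intro u
      have e1 : |∑ i, partialDeriv i g u * y i| ≤ (∑ i, |partialDeriv i g u|) * t := by
        rw [Finset.sum_mul]
        refine (Finset.abs_sum_le_sum_abs _ _).trans (Finset.sum_le_sum fun i _ => ?_)
        rw [abs_mul]
        exact mul_le_mul_of_nonneg_left (hyt i) (abs_nonneg _)
      have e2 : |∑ i, ∑ j, secondCoeff g i j u * (y i * y j)| ≤
          (∑ i, ∑ j, |secondCoeff g i j u|) * t ^ 2 := by
        rw [Finset.sum_mul]
        refine (Finset.abs_sum_le_sum_abs _ _).trans (Finset.sum_le_sum fun i _ => ?_)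
        rw [Finset.sum_mul]
        refine (Finset.abs_sum_le_sum_abs _ _).trans (Finset.sum_le_sum fun j _ => ?_)
        rw [abs_mul, abs_mul, sq]
        exact mul_le_mul_of_nonneg_left
          (mul_le_mul (hyt i) (hyt j) (abs_nonneg _) ht) (abs_nonneg _)
      have e3 : |R u y| ≤ |g (u + y)| + |g u| + |∑ i, partialDeriv i g u * y i| +
          |∑ i, ∑ j, secondCoeff g i j u * (y i * y j)| := by
        simp only [hR, taylorRem]
        refine (abs_sub _ _).trans (add_le_add_left ?_ _)
        refine (abs_sub _ _).trans (add_le_add_left ?_ _)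
        exact abs_sub _ _
      linarith
    have i0 : Integrable fun u => |g (u + y)| := (hg.integrable.comp_add_right y).abs
    have i1 : Integrable fun u => (∑ i, |partialDeriv i g u|) * t :=
      (integrable_finsetSum _ fun i _ => (hg.partialDeriv i).integrable.abs).mul_const _
    have i2 : Integrable fun u => (∑ i, ∑ j, |secondCoeff g i j u|) * t ^ 2 :=
      (integrable_finsetSum _ fun i _ => integrable_finsetSum _ fun j _ =>
        (hg.secondCoeff i j).integrable.abs).mul_const _
    calc ∫ u, |R u y| ≤ ∫ u, (|g (u + y)| + |g u| + (∑ i, |partialDeriv i g u|) * t +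
        (∑ i, ∑ j, |secondCoeff g i j u|) * t ^ 2) :=
          integral_mono_of_nonneg (.of_forall fun _ => abs_nonneg _)
            (((i0.add hg.integrable.abs).add i1).add i2) (.of_forall hpt)
      _ = K0 + K0 + K1 * t + K2 * t ^ 2 := by
          have e : ∫ u, |g (u + y)| = K0 := integral_add_right_eq_self (fun u => |g u|) y
          have i3 : Integrable fun u => |g (u + y)| + |g u| := i0.add hg.integrable.abs
          have i4 : Integrable fun u => |g (u + y)| + |g u| + (∑ i, |partialDeriv i g u|) * t :=
            i3.add i1
          rw [integral_add i4 i2, integral_add i3 i1, integral_add i0 hg.integrable.abs, e,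
            integral_mul_const, integral_mul_const,
            integral_finsetSum _ fun i _ => (hg.partialDeriv i).integrable.abs,
            integral_finsetSum _ fun i _ => integrable_finsetSum _ fun j _ =>
              (hg.secondCoeff i j).integrable.abs]
          simp only [integral_finsetSum _ fun j _ => (hg.secondCoeff _ j).integrable.abs]
          rfl
      _ ≤ (2 * K0 + K1 + K2) * t ^ 3 := by
          have h1 : 1 ≤ t ^ 3 := one_le_pow₀ ht1
          have h2 : t ≤ t ^ 3 := le_self_pow₀ ht1 (by norm_num)
          have h3 : t ^ 2 ≤ t ^ 3 := pow_le_pow_right₀ ht1 (by norm_num)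
          nlinarith [mul_le_mul_of_nonneg_left h1 hK0, mul_le_mul_of_nonneg_left h2 hK1,
            mul_le_mul_of_nonneg_left h3 hK2]
      _ ≤ _ := by
          refine mul_le_mul_of_nonneg_right ?_ (by positivity)
          have : 0 ≤ M * V := by positivity
          linarith

/-- A smooth approximation of the indicator function of `B`, at scale `r`. -/
structure IsSmoothIndicator (r : ℝ) (B : Set (EuclideanSpace ℝ (Fin d)))
    (h : EuclideanSpace ℝ (Fin d) → ℝ) (h1 : Fin d → EuclideanSpace ℝ (Fin d) → ℝ)
    (h2 : Fin d → Fin d → EuclideanSpace ℝ (Fin d) → ℝ) (M : ℝ) : Prop where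
  taylor : IsTaylorThree h h1 h2 M
  nonneg : ∀ x, 0 ≤ h x
  le_one : ∀ x, h x ≤ 1
  eq_one : ∀ x ∈ B, h x = 1
  eq_zero : ∀ x, x ∉ Metric.thickening r B → h x = 0
  mem_shell : ∀ x y, taylorRem h h1 h2 x y ≠ 0 → x ∈ shell (r + ‖y‖) B
  invariant : ∀ v, (∀ z, z + v ∈ B ↔ z ∈ B) → ∀ x, h (x + v) = h x

variable (d) in
theorem exists_isSmoothIndicator_unit : ∃ M, 0 ≤ M ∧ ∀ B : Set (EuclideanSpace ℝ (Fin d)),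
    ∃ h h1 h2, IsSmoothIndicator 4 B h h1 h2 M := by
  let f : ContDiffBump (0 : EuclideanSpace ℝ (Fin d)) := ⟨1 / 2, 1, by norm_num, by norm_num⟩
  set ρ := f.normed volume
  have hρ : SmoothInBall ρ := ⟨f.contDiff_normed, (f.tsupport_normed_eq).le⟩
  obtain ⟨M, hM0, hM⟩ := integral_abs_taylorRem_le hρ
  set K2 := ∑ i, ∑ j, ∫ u, |secondCoeff ρ i j u|
  have hK2 : 0 ≤ K2 := Finset.sum_nonneg fun _ _ => Finset.sum_nonneg fun _ _ =>
    integral_nonneg fun _ => abs_nonneg _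
  refine ⟨M + K2, by positivity, fun B => ?_⟩
  set B' := Metric.thickening 2 B
  have hB' : MeasurableSet B' := Metric.isOpen_thickening.measurableSet
  have hmem : ∀ {s : ℝ} {x z : EuclideanSpace ℝ (Fin d)}, z ∈ B' → dist x z ≤ s →
      x ∈ Metric.thickening (s + 2) B := by
    intro s x z hz hxz
    obtain ⟨b, hb, hzb⟩ := Metric.mem_thickening_iff.1 hz
    exact Metric.mem_thickening_iff.2 ⟨b, hb, (dist_triangle x z b).trans_lt (by linarith)⟩
  have hle : ∀ x, smear B' ρ x ≤ 1 := fun x => by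
    calc _ ≤ ∫ z, ρ (x - z) := setIntegral_le_integral (hρ.integrable_shift x)
          (.of_forall fun z => f.nonneg_normed _)
      _ = ∫ u, ρ u := integral_sub_left_eq_self ρ volume x
      _ = 1 := f.integral_normed
  have hT : IsTaylorThree (smear B' ρ) (fun i => smear B' (partialDeriv i ρ))
      (fun i j => smear B' (secondCoeff ρ i j)) (M + K2) := by
    refine ⟨hρ.measurable_smear _, fun i => (hρ.partialDeriv i).measurable_smear _,
      fun i j => (hρ.secondCoeff i j).measurable_smear _, ⟨_, hρ.abs_smear_le _⟩,
      ⟨∑ i, ∫ u, |partialDeriv i ρ u|, fun i x => ?_⟩, fun i j x => ?_, fun x y => ?_⟩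
    · refine ((hρ.partialDeriv i).abs_smear_le _ x).trans ?_
      exact Finset.single_le_sum (f := fun i => ∫ u, |partialDeriv i ρ u|)
        (fun _ _ => integral_nonneg fun _ => abs_nonneg _) (Finset.mem_univ i)
    · refine ((hρ.secondCoeff i j).abs_smear_le _ x).trans ?_
      have h1 := Finset.single_le_sum (f := fun j => ∫ u, |secondCoeff ρ i j u|)
        (fun _ _ => integral_nonneg fun _ => abs_nonneg _) (Finset.mem_univ j)
      have h2 := Finset.single_le_sum (f := fun i => ∑ j, ∫ u, |secondCoeff ρ i j u|)
        (fun _ _ => Finset.sum_nonneg fun _ _ => integral_nonneg fun _ => abs_nonneg _)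
        (Finset.mem_univ i)
      exact (h1.trans h2).trans (by linarith)
    · rw [hρ.taylorRem_smear]
      have hint : Integrable fun z => taylorRem ρ (fun i => partialDeriv i ρ) (secondCoeff ρ)
          (x - z) y := by
        refine Integrable.comp_sub_left (f := fun u => taylorRem ρ (fun i => partialDeriv i ρ)
          (secondCoeff ρ) u y) ?_ x
        unfold taylorRem
        exact (((hρ.integrable.comp_add_right y).sub hρ.integrable).sub
          (integrable_finsetSum _ fun i _ => (hρ.partialDeriv i).integrable.mul_const _)).sub
          (integrable_finsetSum _ fun i _ => integrable_finsetSum _ fun j _ =>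
            (hρ.secondCoeff i j).integrable.mul_const _)
      calc _ ≤ ∫ z in B', |taylorRem ρ (fun i => partialDeriv i ρ) (secondCoeff ρ) (x - z) y| :=
            abs_integral_le_integral_abs
        _ ≤ ∫ z, |taylorRem ρ (fun i => partialDeriv i ρ) (secondCoeff ρ) (x - z) y| :=
            setIntegral_le_integral hint.abs (.of_forall fun z => abs_nonneg _)
        _ = ∫ u, |taylorRem ρ (fun i => partialDeriv i ρ) (secondCoeff ρ) u y| :=
            integral_sub_left_eq_self (fun u => |taylorRem ρ (fun i => partialDeriv i ρ)
              (secondCoeff ρ) u y|) volume x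
        _ ≤ M * (∑ i, |y i|) ^ 3 := hM y
        _ ≤ _ := mul_le_mul_of_nonneg_right (by linarith)
              (pow_nonneg (Finset.sum_nonneg fun _ _ => abs_nonneg _) 3)
  refine ⟨smear B' ρ, fun i => smear B' (partialDeriv i ρ),
      fun i j => smear B' (secondCoeff ρ i j), hT,
    fun x => setIntegral_nonneg hB' fun z _ => f.nonneg_normed _, hle, fun x hx => ?_,
    fun x hx => ?_, fun x y hxy => ⟨?_, ?_⟩, fun v hv x => ?_⟩
  · have h1 := hρ.smear_add_compl hB' x
    rw [hρ.smear_eq_zero (B := B'ᶜ), add_zero] at h1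
    · rw [h1]; exact f.integral_normed
    · intro z hz
      by_contra! hcon
      refine hz (Metric.mem_thickening_iff.2 ⟨x, hx, ?_⟩)
      rw [dist_comm]
      linarith
  · refine hρ.smear_eq_zero fun z hz => ?_
    by_contra! hcon
    exact hx (Metric.thickening_mono (by norm_num) _ (hmem hz hcon))
  · by_contra hx
    refine hxy (hρ.taylorRem_smear_eq_zero fun z hz => ?_)
    by_contra! hcon
    exact hx (Metric.thickening_mono (by linarith) _ (hmem hz hcon))
  · by_contra hx
    rw [hρ.taylorRem_smear_compl hB'] at hxy
    refine hxy (neg_eq_zero.2 (hρ.taylorRem_smear_eq_zero fun z hz => ?_))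
    by_contra! hcon
    refine hx (Metric.mem_thickening_iff.2 ⟨z, fun hzB => hz ?_, by linarith⟩)
    exact Metric.self_subset_thickening (by norm_num) _ hzB
  · refine smear_add_of_invariant ρ v (fun z => ?_) x
    simp only [B', Metric.mem_thickening_iff]
    have hv' : ∀ z, z - v ∈ B ↔ z ∈ B := fun z => by
      rw [← hv (z - v), sub_add_cancel]
    constructor
    · rintro ⟨b, hb, h⟩
      refine ⟨b - v, (hv' b).2 hb, ?_⟩
      rwa [dist_eq_norm, sub_sub_eq_add_sub, ← dist_eq_norm]
    · rintro ⟨b, hb, h⟩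
      exact ⟨b + v, (hv b).2 hb, by rwa [dist_add_right]⟩

end Mollifier


/-! ### Linear changes of variables in test functions -/

section LinearChange

set_option linter.unusedSectionVars false

variable {d : ℕ}

/-- The coefficients of a linear map. -/
noncomputable def coeff (T : EuclideanSpace ℝ (Fin d) →L[ℝ] EuclideanSpace ℝ (Fin d))
    (j i : Fin d) : ℝ := T (EuclideanSpace.single i 1) j

lemma clm_apply_eq (T : EuclideanSpace ℝ (Fin d) →L[ℝ] EuclideanSpace ℝ (Fin d))
    (y : EuclideanSpace ℝ (Fin d)) (j : Fin d) : T y j = ∑ i, coeff T j i * y i := by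
  conv_lhs => rw [← (EuclideanSpace.basisFun (Fin d) ℝ).sum_repr y]
  simp [map_sum, coeff, mul_comm]

variable {h : EuclideanSpace ℝ (Fin d) → ℝ} {h1 : Fin d → EuclideanSpace ℝ (Fin d) → ℝ}
  {h2 : Fin d → Fin d → EuclideanSpace ℝ (Fin d) → ℝ} {M c : ℝ}

lemma taylorRem_comp (T : EuclideanSpace ℝ (Fin d) →L[ℝ] EuclideanSpace ℝ (Fin d))
    (x y : EuclideanSpace ℝ (Fin d)) :
    taylorRem (fun x => h (T x)) (fun i x => ∑ j, h1 j (T x) * coeff T j i)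
      (fun i l x => ∑ j, ∑ m, h2 j m (T x) * (coeff T j i * coeff T m l)) x y =
      taylorRem h h1 h2 (T x) (T y) := by
  unfold taylorRem
  have e1 : ∑ i, (∑ j, h1 j (T x) * coeff T j i) * y i = ∑ j, h1 j (T x) * T y j := by
    simp only [clm_apply_eq T y, Finset.sum_mul, Finset.mul_sum]
    rw [Finset.sum_comm]
    simp only [mul_assoc]
  have e2 : ∑ i, ∑ l, (∑ j, ∑ m, h2 j m (T x) * (coeff T j i * coeff T m l)) * (y i * y l) =
      ∑ j, ∑ m, h2 j m (T x) * (T y j * T y m) := by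
    have e : ∀ j m, T y j * T y m = ∑ i, ∑ l, (coeff T j i * y i) * (coeff T m l * y l) :=
      fun j m => by rw [clm_apply_eq T y j, clm_apply_eq T y m, Finset.sum_mul_sum]
    simp only [e, Finset.sum_mul, Finset.mul_sum]
    calc _ = ∑ i, ∑ j, ∑ l, ∑ m, h2 j m (T x) * (coeff T j i * coeff T m l) * (y i * y l) :=
          Finset.sum_congr rfl fun i _ => Finset.sum_comm
      _ = ∑ j, ∑ i, ∑ m, ∑ l, h2 j m (T x) * (coeff T j i * coeff T m l) * (y i * y l) := by
          rw [Finset.sum_comm]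
          exact Finset.sum_congr rfl fun j _ => Finset.sum_congr rfl fun i _ => Finset.sum_comm
      _ = ∑ j, ∑ m, ∑ i, ∑ l, h2 j m (T x) * (coeff T j i * coeff T m l) * (y i * y l) :=
          Finset.sum_congr rfl fun j _ => Finset.sum_comm
      _ = _ := by
          refine Finset.sum_congr rfl fun j _ => Finset.sum_congr rfl fun m _ =>
            Finset.sum_congr rfl fun i _ => Finset.sum_congr rfl fun l _ => ?_
          ring
  rw [e1, e2]
  simp only [map_add]

/-- `c` bounds `T` in the `ℓ¹` norm. -/
def IsOneNormBound (T : EuclideanSpace ℝ (Fin d) →L[ℝ] EuclideanSpace ℝ (Fin d)) (c : ℝ) : Prop :=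
  ∀ y : EuclideanSpace ℝ (Fin d), ∑ j, |T y j| ≤ c * ∑ i, |y i|

lemma IsOneNormBound.sum_coeff {T : EuclideanSpace ℝ (Fin d) →L[ℝ] EuclideanSpace ℝ (Fin d)}
    (hTc : IsOneNormBound T c) (i : Fin d) : ∑ j, |coeff T j i| ≤ c := by
  have := hTc (EuclideanSpace.single i 1)
  have h1 : ∑ l, |(EuclideanSpace.single i (1 : ℝ) : EuclideanSpace ℝ (Fin d)) l| = 1 := by
    rw [Finset.sum_eq_single i]
    · simp
    · intro b _ hb; simp [hb]
    · simp
  rwa [h1, mul_one] at this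

lemma IsTaylorThree.comp_clm (hT : IsTaylorThree h h1 h2 M) (hM : 0 ≤ M)
    {T : EuclideanSpace ℝ (Fin d) →L[ℝ] EuclideanSpace ℝ (Fin d)} (hTc : IsOneNormBound T c)
    (hc : 1 ≤ c) :
    IsTaylorThree (fun x => h (T x)) (fun i x => ∑ j, h1 j (T x) * coeff T j i)
      (fun i l x => ∑ j, ∑ m, h2 j m (T x) * (coeff T j i * coeff T m l)) (M * c ^ 3) := by
  have hTm : Measurable T := T.continuous.measurable
  have hc0 : 0 ≤ c := by linarith
  refine ⟨hT.measurable.comp hTm, fun i => Finset.measurable_sum _ fun j _ =>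
    ((hT.measurable1 j).comp hTm).mul_const _, fun i l => Finset.measurable_sum _ fun j _ =>
    Finset.measurable_sum _ fun m _ => ((hT.measurable2 j m).comp hTm).mul_const _, ?_, ?_, ?_, ?_⟩
  · obtain ⟨K, hK⟩ := hT.bound
    exact ⟨K, fun x => hK _⟩
  · obtain ⟨K, hK⟩ := hT.bound1
    refine ⟨|K| * c, fun i x => ?_⟩
    calc _ ≤ ∑ j, |h1 j (T x) * coeff T j i| := Finset.abs_sum_le_sum_abs _ _
      _ ≤ ∑ j, |K| * |coeff T j i| := Finset.sum_le_sum fun j _ => by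
          rw [abs_mul]
          exact mul_le_mul_of_nonneg_right ((hK j _).trans (le_abs_self K)) (abs_nonneg _)
      _ ≤ _ := by
          rw [← Finset.mul_sum]
          exact mul_le_mul_of_nonneg_left (hTc.sum_coeff i) (abs_nonneg _)
  · intro i l x
    calc _ ≤ ∑ j, ∑ m, M * (|coeff T j i| * |coeff T m l|) := by
          refine (Finset.abs_sum_le_sum_abs _ _).trans (Finset.sum_le_sum fun j _ => ?_)
          refine (Finset.abs_sum_le_sum_abs _ _).trans (Finset.sum_le_sum fun m _ => ?_)
          rw [abs_mul, abs_mul]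
          exact mul_le_mul_of_nonneg_right (hT.bound2 j m _)
            (mul_nonneg (abs_nonneg _) (abs_nonneg _))
      _ = M * ((∑ j, |coeff T j i|) * ∑ m, |coeff T m l|) := by
          rw [Finset.sum_mul_sum, Finset.mul_sum]
          simp only [Finset.mul_sum]
      _ ≤ M * (c * c) := mul_le_mul_of_nonneg_left
          (mul_le_mul (hTc.sum_coeff i) (hTc.sum_coeff l)
            (Finset.sum_nonneg fun _ _ => abs_nonneg _) hc0) hM
      _ ≤ M * c ^ 3 := mul_le_mul_of_nonneg_left (by nlinarith [mul_nonneg hc0 hc0]) hM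
  · intro x y
    rw [taylorRem_comp]
    refine (hT.rem_le _ _).trans ?_
    rw [mul_assoc, ← mul_pow]
    exact mul_le_mul_of_nonneg_left (pow_le_pow_left₀
      (Finset.sum_nonneg fun _ _ => abs_nonneg _) (hTc y) 3) hM

lemma IsSmoothIndicator.exists_scale {B : Set (EuclideanSpace ℝ (Fin d))} {r : ℝ} {ε : ℝ}
    (hε : 0 < ε) (hε1 : ε ≤ 1) (hM : 0 ≤ M)
    (H : IsSmoothIndicator r ((fun x => ε • x) ⁻¹' B) h h1 h2 M) :
    ∃ g g1 g2, IsSmoothIndicator (r * ε) B g g1 g2 (M / ε ^ 3) := by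
  set T : EuclideanSpace ℝ (Fin d) →L[ℝ] EuclideanSpace ℝ (Fin d) :=
    ε⁻¹ • ContinuousLinearMap.id ℝ _ with hT
  have hTx : ∀ x, T x = ε⁻¹ • x := fun x => rfl
  have hεT : ∀ x, ε • T x = x := fun x => by rw [hTx, smul_inv_smul₀ hε.ne']
  have hTc : IsOneNormBound T ε⁻¹ := fun y => by
    simp [hTx, abs_mul, Finset.mul_sum, abs_of_pos hε]
  have hthick : ∀ (s : ℝ) (D : Set (EuclideanSpace ℝ (Fin d))) x,
      T x ∈ Metric.thickening s ((fun x => ε • x) ⁻¹' D) → x ∈ Metric.thickening (s * ε) D := by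
    intro s D x hx
    obtain ⟨z, hz, hxz⟩ := Metric.mem_thickening_iff.1 hx
    refine Metric.mem_thickening_iff.2 ⟨ε • z, hz, ?_⟩
    rw [← hεT x, dist_smul₀, Real.norm_of_nonneg hε.le, mul_comm]
    exact mul_lt_mul_of_pos_right hxz hε
  have hcomp := H.taylor.comp_clm hM hTc ((one_le_inv₀ hε).2 hε1)
  rw [inv_pow, ← div_eq_mul_inv] at hcomp
  refine ⟨_, _, _, hcomp, fun x => H.nonneg _, fun x => H.le_one _, fun x hx => H.eq_one _ ?_,
    fun x hx => H.eq_zero _ fun hx' => hx (hthick _ _ _ hx'), fun x y hxy => ?_, fun v hv x => ?_⟩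
  · rw [Set.mem_preimage, hεT]
    exact hx
  · rw [taylorRem_comp] at hxy
    have h3 := H.mem_shell _ _ hxy
    have hnorm : (r + ‖T y‖) * ε = r * ε + ‖y‖ := by
      rw [hTx, norm_smul, norm_inv, Real.norm_of_nonneg hε.le, add_mul, mul_comm ε⁻¹, mul_assoc,
        inv_mul_cancel₀ hε.ne', mul_one]
    rw [← hnorm]
    exact ⟨hthick _ _ _ h3.1, hthick _ _ _ h3.2⟩
  · simp only [map_add]
    refine H.invariant (T v) (fun z => ?_) (T x)
    simp only [Set.mem_preimage, smul_add, hεT]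
    exact hv _

variable (d) in
theorem exists_isSmoothIndicator : ∃ M, 0 ≤ M ∧ ∀ ε : ℝ, 0 < ε → ε ≤ 1 →
    ∀ B : Set (EuclideanSpace ℝ (Fin d)),
      ∃ h h1 h2, IsSmoothIndicator (4 * ε) B h h1 h2 (M / ε ^ 3) := by
  obtain ⟨M, hM, H⟩ := exists_isSmoothIndicator_unit d
  refine ⟨M, hM, fun ε hε hε1 B => ?_⟩
  obtain ⟨h, h1, h2, hh⟩ := H ((fun x => ε • x) ⁻¹' B)
  exact hh.exists_scale hε hε1 hM

end LinearChange


/-! ### Pseudo-inverses of square roots, and smoothing of convex sets -/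

section HalfInverse

set_option linter.unusedSectionVars false

open scoped MatrixOrder

variable {d : ℕ} {S : Matrix (Fin d) (Fin d) ℝ}

/-- The conjugate of a diagonal matrix by the eigenbasis of `S`. -/
noncomputable def eigenConj (hS : S.IsHermitian) (f : Fin d → ℝ) : Matrix (Fin d) (Fin d) ℝ :=
  Unitary.conjStarAlgAut ℝ (Matrix (Fin d) (Fin d) ℝ) hS.eigenvectorUnitary (Matrix.diagonal f)

lemma eigenConj_mul (hS : S.IsHermitian) (f g : Fin d → ℝ) :
    eigenConj hS f * eigenConj hS g = eigenConj hS fun i => f i * g i := by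
  rw [eigenConj, eigenConj, ← map_mul, Matrix.diagonal_mul_diagonal, eigenConj]

lemma eigenConj_posSemidef (hS : S.IsHermitian) {f : Fin d → ℝ} (hf : ∀ i, 0 ≤ f i) :
    (eigenConj hS f).PosSemidef := by
  rw [eigenConj, Unitary.conjStarAlgAut_apply]
  exact (Matrix.PosSemidef.diagonal hf).mul_mul_conjTranspose_same _

lemma sqrt_eq_eigenConj (hS : S.PosSemidef) :
    CFC.sqrt S = eigenConj hS.1 fun i => √(hS.1.eigenvalues i) := by
  refine CFC.sqrt_unique ?_ (Matrix.nonneg_iff_posSemidef.2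
    (eigenConj_posSemidef _ fun i => Real.sqrt_nonneg _))
  rw [eigenConj_mul]
  conv_rhs => rw [hS.1.spectral_theorem]
  simp only [Real.mul_self_sqrt (hS.eigenvalues_nonneg _)]
  rfl

lemma abs_eigenConj_le (hS : S.IsHermitian) {f : Fin d → ℝ} {c : ℝ} (hf : ∀ i, |f i| ≤ c)
    (i j : Fin d) : |eigenConj hS f i j| ≤ d * c := by
  rw [eigenConj, Unitary.conjStarAlgAut_apply, Matrix.mul_apply]
  have hu : ∀ a b, |(hS.eigenvectorUnitary : Matrix (Fin d) (Fin d) ℝ) a b| ≤ 1 := fun a b => by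
    have := entry_norm_bound_of_unitary hS.eigenvectorUnitary.2 a b
    rwa [Real.norm_eq_abs] at this
  calc _ ≤ ∑ l, |((hS.eigenvectorUnitary : Matrix (Fin d) (Fin d) ℝ) * Matrix.diagonal f) i l *
        (star (hS.eigenvectorUnitary : Matrix (Fin d) (Fin d) ℝ)) l j| :=
        Finset.abs_sum_le_sum_abs _ _
    _ ≤ ∑ _l : Fin d, c := Finset.sum_le_sum fun l _ => by
        rw [Matrix.mul_diagonal, Matrix.star_apply, star_trivial, abs_mul, abs_mul]
        have h1 := hu i l
        have h2 := hu j l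
        have h3 := hf l
        calc _ ≤ (1 * c) * 1 := mul_le_mul (mul_le_mul h1 h3 (abs_nonneg _) zero_le_one) h2
              (abs_nonneg _) (by linarith [abs_nonneg (f l)])
          _ = c := by ring
    _ = _ := by simp

lemma hasEigenvalue_eigenvalues (hS : S.IsHermitian) (i : Fin d) :
    Module.End.HasEigenvalue (Matrix.toLin' S) (hS.eigenvalues i) := by
  refine Module.End.hasEigenvalue_of_hasEigenvector
    (x := (hS.eigenvectorBasis i).ofLp) ⟨?_, ?_⟩
  · rw [Module.End.mem_eigenspace_iff, Matrix.toLin'_apply]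
    exact hS.mulVec_eigenvectorBasis i
  · intro h
    have h1 : hS.eigenvectorBasis i = 0 := by
      ext j
      exact congrFun h j
    exact hS.eigenvectorBasis.toBasis.ne_zero i (by simpa using h1)

/-- A positive semidefinite matrix has a pseudo-inverse of its square root whose size is
controlled by the smallest nonzero eigenvalue. -/
lemma exists_halfInverse (hS : S.PosSemidef) {lam : ℝ} (hlam : 0 < lam)
    (hev : ∀ μ : ℝ, Module.End.HasEigenvalue (Matrix.toLin' S) μ → μ ≠ 0 → lam ≤ μ) :
    ∃ R : Matrix (Fin d) (Fin d) ℝ, CFC.sqrt S * R * CFC.sqrt S = CFC.sqrt S ∧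
      ∀ i j, |R i j| ≤ d * (√lam)⁻¹ := by
  refine ⟨eigenConj hS.1 fun i => (√(hS.1.eigenvalues i))⁻¹, ?_, abs_eigenConj_le _ fun i => ?_⟩
  · rw [sqrt_eq_eigenConj hS, eigenConj_mul, eigenConj_mul]
    congr 1
    funext i
    exact mul_inv_mul_cancel _
  · rw [abs_of_nonneg (inv_nonneg.2 (Real.sqrt_nonneg _))]
    by_cases h : hS.1.eigenvalues i = 0
    · rw [h, Real.sqrt_zero, inv_zero]
      exact inv_nonneg.2 (Real.sqrt_nonneg _)
    · exact inv_anti₀ (Real.sqrt_pos.2 hlam)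
        (Real.sqrt_le_sqrt (hev _ (hasEigenvalue_eigenvalues hS.1 i) h))

/-- The linear map of the square root of `S`. -/
noncomputable def sqrtMap (S : Matrix (Fin d) (Fin d) ℝ) :
    EuclideanSpace ℝ (Fin d) →L[ℝ] EuclideanSpace ℝ (Fin d) :=
  Matrix.toEuclideanCLM (𝕜 := ℝ) (CFC.sqrt S)

lemma multivariateGaussian_eq_map (S : Matrix (Fin d) (Fin d) ℝ) :
    multivariateGaussian 0 S = (stdGaussian (EuclideanSpace ℝ (Fin d))).map (sqrtMap S) := by
  unfold multivariateGaussian sqrtMap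
  simp only [zero_add]

/-- The linear map `R` is, on the range of `S`, an inverse of the square root of `S`, with
`ℓ¹`-norm at most `c`. -/
structure IsHalfInverse (S : Matrix (Fin d) (Fin d) ℝ)
    (R : EuclideanSpace ℝ (Fin d) →L[ℝ] EuclideanSpace ℝ (Fin d)) (c : ℝ) : Prop where
  comp : ∀ x, sqrtMap S (R (sqrtMap S x)) = sqrtMap S x
  one_le : 1 ≤ c
  bound : IsOneNormBound R c

lemma isOneNormBound_toEuclideanCLM {R : Matrix (Fin d) (Fin d) ℝ} {c : ℝ}
    (hR : ∀ i j, |R i j| ≤ c) :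
    IsOneNormBound (Matrix.toEuclideanCLM (𝕜 := ℝ) R) (d * c) := by
  intro y
  calc _ ≤ ∑ _j : Fin d, c * ∑ i, |y i| := Finset.sum_le_sum fun j _ => by
        rw [Matrix.ofLp_toEuclideanCLM, Matrix.mulVec, dotProduct, Finset.mul_sum]
        refine (Finset.abs_sum_le_sum_abs _ _).trans (Finset.sum_le_sum fun i _ => ?_)
        rw [abs_mul]
        exact mul_le_mul_of_nonneg_right (hR j i) (abs_nonneg _)
    _ = _ := by simp [mul_assoc]

lemma exists_isHalfInverse (hS : S.PosSemidef) {lam : ℝ} (hlam : 0 < lam)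
    (hev : ∀ μ : ℝ, Module.End.HasEigenvalue (Matrix.toLin' S) μ → μ ≠ 0 → lam ≤ μ) :
    ∃ R, IsHalfInverse S R (1 + d * (d * (√lam)⁻¹)) := by
  obtain ⟨R, hR, hb⟩ := exists_halfInverse hS hlam hev
  have h0 : 0 ≤ d * (d * (√lam)⁻¹) := by positivity
  refine ⟨Matrix.toEuclideanCLM (𝕜 := ℝ) R, fun x => ?_, by linarith, fun y => ?_⟩
  · conv_rhs => rw [sqrtMap, ← hR, map_mul, map_mul]
    rfl
  · refine (isOneNormBound_toEuclideanCLM hb y).trans ?_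
    exact mul_le_mul_of_nonneg_right (by linarith) (Finset.sum_nonneg fun _ _ => abs_nonneg _)

/-- The quadratic form of a matrix. -/
def quadForm (u : Fin d → ℝ) (A : Matrix (Fin d) (Fin d) ℝ) : ℝ :=
  ∑ j, ∑ k, u j * u k * A j k

lemma quadForm_sum {ι : Type*} (s : Finset ι) (u : Fin d → ℝ)
    (A : ι → Matrix (Fin d) (Fin d) ℝ) : quadForm u (∑ l ∈ s, A l) = ∑ l ∈ s, quadForm u (A l) := by
  simp only [quadForm, Matrix.sum_apply, Finset.mul_sum]
  rw [Finset.sum_comm]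
  calc _ = ∑ k, ∑ l ∈ s, ∑ j, u j * u k * A l j k :=
        Finset.sum_congr rfl fun k _ => Finset.sum_comm
    _ = ∑ l ∈ s, ∑ k, ∑ j, u j * u k * A l j k := Finset.sum_comm
    _ = _ := Finset.sum_congr rfl fun l _ => Finset.sum_comm

section SecondMoment

variable {Ω : Type*} [MeasurableSpace Ω] {P : Measure Ω} {X : Ω → EuclideanSpace ℝ (Fin d)}
  {A : Matrix (Fin d) (Fin d) ℝ}

lemma integral_sq_linear (hint : ∀ j k, Integrable (fun ω => X ω j * X ω k) P)
    (hA : ∀ j k, ∫ ω, X ω j * X ω k ∂P = A j k) (u : Fin d → ℝ) :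
    Integrable (fun ω => (∑ j, u j * X ω j) ^ 2) P ∧
      ∫ ω, (∑ j, u j * X ω j) ^ 2 ∂P = quadForm u A := by
  have h : (fun ω => (∑ j, u j * X ω j) ^ 2) =
      fun ω => ∑ j, ∑ k, u j * u k * (X ω j * X ω k) := by
    funext ω
    rw [sq, Finset.sum_mul_sum]
    exact Finset.sum_congr rfl fun j _ => Finset.sum_congr rfl fun k _ => by ring
  have hi : ∀ j k, Integrable (fun ω => u j * u k * (X ω j * X ω k)) P := fun j k =>
    (hint j k).const_mul _
  refine ⟨?_, ?_⟩
  · rw [h]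
    exact integrable_finsetSum _ fun j _ => integrable_finsetSum _ fun k _ => hi j k
  · rw [h, integral_finsetSum _ fun j _ => integrable_finsetSum _ fun k _ => hi j k]
    refine Finset.sum_congr rfl fun j _ => ?_
    rw [integral_finsetSum _ fun k _ => hi j k]
    exact Finset.sum_congr rfl fun k _ => by rw [integral_const_mul, hA]

lemma ae_linear_eq_zero (hint : ∀ j k, Integrable (fun ω => X ω j * X ω k) P)
    (hA : ∀ j k, ∫ ω, X ω j * X ω k ∂P = A j k) {u : Fin d → ℝ} (hu : quadForm u A = 0) :
    ∀ᵐ ω ∂P, ∑ j, u j * X ω j = 0 := by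
  obtain ⟨h1, h2⟩ := integral_sq_linear hint hA u
  rw [hu] at h2
  have := (integral_eq_zero_iff_of_nonneg (fun ω => sq_nonneg _) h1).1 h2
  filter_upwards [this] with ω hω
  simpa using hω

end SecondMoment

/-- The quadratic forms that vanish on the range of `S`. -/
noncomputable def rangeDefect (S : Matrix (Fin d) (Fin d) ℝ)
    (R : EuclideanSpace ℝ (Fin d) →L[ℝ] EuclideanSpace ℝ (Fin d)) (i j : Fin d) : ℝ :=
  coeff (ContinuousLinearMap.id ℝ (EuclideanSpace ℝ (Fin d)) - (sqrtMap S).comp R) i j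

section HalfInverse

variable {R : EuclideanSpace ℝ (Fin d) →L[ℝ] EuclideanSpace ℝ (Fin d)} {c : ℝ}

lemma sqrtMap_eq_of_rangeDefect {x : EuclideanSpace ℝ (Fin d)}
    (h : ∀ i, ∑ j, rangeDefect S R i j * x j = 0) : sqrtMap S (R x) = x := by
  have : (ContinuousLinearMap.id ℝ (EuclideanSpace ℝ (Fin d)) - (sqrtMap S).comp R :
      EuclideanSpace ℝ (Fin d) →L[ℝ] EuclideanSpace ℝ (Fin d)) x = 0 := by
    ext i
    rw [clm_apply_eq]
    exact h i
  rw [sub_apply, sub_eq_zero] at this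
  exact this.symm

lemma IsHalfInverse.quadForm_rangeDefect (hR : IsHalfInverse S R c) (hS : S.PosSemidef)
    (i : Fin d) : quadForm (rangeDefect S R i) S = 0 := by
  have hL : ∀ m, ∑ j, rangeDefect S R i j * CFC.sqrt S j m = 0 := by
    intro m
    have h1 : (ContinuousLinearMap.id ℝ (EuclideanSpace ℝ (Fin d)) - (sqrtMap S).comp R :
      EuclideanSpace ℝ (Fin d) →L[ℝ] EuclideanSpace ℝ (Fin d))
        (sqrtMap S (EuclideanSpace.single m 1)) = 0 := by
      rw [sub_apply, ContinuousLinearMap.comp_apply, hR.comp, sub_eq_zero]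
      rfl
    have h2 := congrArg (fun v : EuclideanSpace ℝ (Fin d) => v i) h1
    simp only [clm_apply_eq (ContinuousLinearMap.id ℝ (EuclideanSpace ℝ (Fin d)) -
      (sqrtMap S).comp R)] at h2
    rw [← show (0 : EuclideanSpace ℝ (Fin d)) i = 0 from rfl, ← h2]
    refine Finset.sum_congr rfl fun j _ => ?_
    simp [rangeDefect, sqrtMap, Matrix.ofLp_toEuclideanCLM]
  have hsq := CFC.sqrt_mul_sqrt_self S (Matrix.nonneg_iff_posSemidef.2 hS)
  have hSjk : ∀ j k, S j k = ∑ m, CFC.sqrt S j m * CFC.sqrt S m k := fun j k => by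
    conv_lhs => rw [← hsq, Matrix.mul_apply]
  unfold quadForm
  rw [Finset.sum_comm]
  refine Finset.sum_eq_zero fun k _ => ?_
  calc ∑ j, rangeDefect S R i j * rangeDefect S R i k * S j k
      = ∑ m, rangeDefect S R i k * CFC.sqrt S m k *
          ∑ j, rangeDefect S R i j * CFC.sqrt S j m := by
        simp only [hSjk, Finset.mul_sum]
        rw [Finset.sum_comm]
        exact Finset.sum_congr rfl fun m _ => Finset.sum_congr rfl fun j _ => by ring
    _ = 0 := by simp [hL]

lemma IsHalfInverse.integral_multivariateGaussian (hR : IsHalfInverse S R c)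
    {h : EuclideanSpace ℝ (Fin d) → ℝ} (hm : Measurable h)
    (hinv : ∀ v, sqrtMap S v = 0 → ∀ x, h (x + v) = h x) :
    ∫ z, h (R z) ∂(multivariateGaussian 0 S) =
      ∫ g, h g ∂(stdGaussian (EuclideanSpace ℝ (Fin d))) := by
  have hRm : Measurable R := R.continuous.measurable
  rw [multivariateGaussian_eq_map]
  refine (integral_map (f := fun z => h (R z)) (sqrtMap S).continuous.measurable.aemeasurable
    (hm.comp hRm).aestronglyMeasurable).trans ?_
  refine integral_congr_ae (.of_forall fun g => ?_)
  have := hinv (R (sqrtMap S g) - g) (by rw [map_sub, hR.comp, sub_self]) g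
  simp only at this ⊢
  rw [← this, add_sub_cancel]

/-- One-sided comparison of laws on a set by means of a smooth indicator function. -/
lemma IsHalfInverse.measureReal_le (hR : IsHalfInverse S R c)
    {ν : Measure (EuclideanSpace ℝ (Fin d))} [IsProbabilityMeasure ν]
    (hν : ∀ᵐ x ∂ν, sqrtMap S (R x) = x) {A : Set (EuclideanSpace ℝ (Fin d))}
    (hA : MeasurableSet A) {r M e s : ℝ} (hr : 0 < r) {h : EuclideanSpace ℝ (Fin d) → ℝ}
    {h1 : Fin d → EuclideanSpace ℝ (Fin d) → ℝ}
    {h2 : Fin d → Fin d → EuclideanSpace ℝ (Fin d) → ℝ}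
    (H : IsSmoothIndicator r (sqrtMap S ⁻¹' A) h h1 h2 M)
    (he : |∫ x, h (R x) ∂ν - ∫ z, h (R z) ∂(multivariateGaussian 0 S)| ≤ e)
    (hs : (stdGaussian (EuclideanSpace ℝ (Fin d))).real (shell r (sqrtMap S ⁻¹' A)) ≤ s) :
    ν.real A ≤ (multivariateGaussian 0 S).real A + s + e := by
  set γ := stdGaussian (EuclideanSpace ℝ (Fin d))
  have hLm : Measurable (sqrtMap S) := (sqrtMap S).continuous.measurable
  have hhb : ∀ x, |h x| ≤ 1 := fun x => abs_le.2 ⟨by linarith [H.nonneg x], H.le_one x⟩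
  have hb : BddMeas h := ⟨H.taylor.measurable, 1, hhb⟩
  have hgauss : ∫ z, h (R z) ∂(multivariateGaussian 0 S) = ∫ g, h g ∂γ :=
    hR.integral_multivariateGaussian H.taylor.measurable fun v hv x => H.invariant v (fun z => by
      rw [Set.mem_preimage, Set.mem_preimage, map_add, hv, add_zero]) x
  have hNA : (multivariateGaussian 0 S).real A = γ.real (sqrtMap S ⁻¹' A) := by
    rw [multivariateGaussian_eq_map, map_measureReal_apply hLm hA]
  have hupper : ∫ g, h g ∂γ ≤ γ.real (sqrtMap S ⁻¹' A) + s := by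
    calc ∫ g, h g ∂γ ≤ ∫ g, (Metric.thickening r (sqrtMap S ⁻¹' A)).indicator (fun _ => (1 : ℝ)) g
          ∂γ := by
          refine integral_mono (hb.integrable _) ((integrable_const _).indicator
            Metric.isOpen_thickening.measurableSet) fun g => ?_
          by_cases hg : g ∈ Metric.thickening r (sqrtMap S ⁻¹' A)
          · rw [Set.indicator_of_mem hg]; exact H.le_one g
          · rw [Set.indicator_of_notMem hg]; exact (H.eq_zero g hg).le
      _ = γ.real (Metric.thickening r (sqrtMap S ⁻¹' A)) := by
          rw [integral_indicator Metric.isOpen_thickening.measurableSet]; simp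
      _ ≤ γ.real (sqrtMap S ⁻¹' A ∪ shell r (sqrtMap S ⁻¹' A)) :=
          measureReal_mono (thickening_subset_union_shell hr)
      _ ≤ _ := (measureReal_union_le _ _).trans (by linarith)
  have hlower : ν.real A ≤ ∫ x, h (R x) ∂ν := by
    calc ν.real A = ∫ x, A.indicator (fun _ => (1 : ℝ)) x ∂ν := by
          rw [integral_indicator hA]; simp
      _ ≤ ∫ x, h (R x) ∂ν := by
          refine integral_mono_ae ((integrable_const _).indicator hA)
            ((hb.comp R.continuous.measurable).integrable _) ?_
          filter_upwards [hν] with x hx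
          by_cases hxA : x ∈ A
          · rw [Set.indicator_of_mem hxA, H.eq_one]
            rw [Set.mem_preimage, hx]
            exact hxA
          · rw [Set.indicator_of_notMem hxA]
            exact H.nonneg _
  have := (abs_le.1 he).2
  rw [hgauss] at this
  rw [hNA]
  linarith

/-- Comparison of laws on a convex set by means of smooth indicator functions. -/
lemma IsHalfInverse.abs_measureReal_sub_le (hR : IsHalfInverse S R c)
    {ν : Measure (EuclideanSpace ℝ (Fin d))} [IsProbabilityMeasure ν]
    (hν : ∀ᵐ x ∂ν, sqrtMap S (R x) = x) {A : Set (EuclideanSpace ℝ (Fin d))}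
    (hAc : Convex ℝ A) (hA : MeasurableSet A) {r e : ℝ} (hr : 0 < r)
    (he : ∀ B, (B = sqrtMap S ⁻¹' A ∨ B = (sqrtMap S ⁻¹' A)ᶜ) →
      ∃ h h1 h2 M, IsSmoothIndicator r B h h1 h2 M ∧
        |∫ x, h (R x) ∂ν - ∫ z, h (R z) ∂(multivariateGaussian 0 S)| ≤ e) :
    |ν.real A - (multivariateGaussian 0 S).real A| ≤ 4 * d ^ 2 * r + e := by
  have hcv : Convex ℝ (sqrtMap S ⁻¹' A) := hAc.linear_preimage (sqrtMap S).toLinearMap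
  have hs := stdGaussian_shell_le hcv hr.le
  obtain ⟨h, h1, h2, M, H, heH⟩ := he _ (Or.inl rfl)
  obtain ⟨h', h1', h2', M', H', heH'⟩ := he _ (Or.inr rfl)
  have b1 := hR.measureReal_le hν hA hr H heH hs
  have b2 := hR.measureReal_le (A := Aᶜ) (s := 4 * d ^ 2 * r) hν hA.compl hr H' heH' (by
    rwa [Set.preimage_compl, shell_compl])
  rw [probReal_compl_eq_one_sub hA, probReal_compl_eq_one_sub hA] at b2
  rw [abs_le]
  constructor <;> linarith

end HalfInverse

end HalfInverse


/-! ### Increments and interpolating laws on the range of the covariance matrix -/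

section Interpolation

set_option linter.unusedSectionVars false

variable {d n : ℕ} {Ω : Type*} [MeasurableSpace Ω]

lemma quadForm_nonneg {Q : Matrix (Fin d) (Fin d) ℝ} (hQ : Q.PosSemidef) (u : Fin d → ℝ) :
    0 ≤ quadForm u Q := by
  rw [← (integral_sq_linear (X := fun z : EuclideanSpace ℝ (Fin d) => z)
    (fun j k => (memLp_eval_multivariateGaussian hQ j 2 (by simp)).integrable_mul
      (memLp_eval_multivariateGaussian hQ k 2 (by simp)))
    (integral_eval_mul_multivariateGaussian hQ) u).2]
  exact integral_nonneg fun z => sq_nonneg _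

lemma ae_multivariateGaussian_sqrtMap {S Q : Matrix (Fin d) (Fin d) ℝ}
    {R : EuclideanSpace ℝ (Fin d) →L[ℝ] EuclideanSpace ℝ (Fin d)} (hQ : Q.PosSemidef)
    (h : ∀ i, quadForm (rangeDefect S R i) Q = 0) :
    ∀ᵐ z ∂(multivariateGaussian 0 Q), sqrtMap S (R z) = z := by
  have : ∀ i, ∀ᵐ z ∂(multivariateGaussian 0 Q), ∑ j, rangeDefect S R i j * z j = 0 := fun i =>
    ae_linear_eq_zero (X := fun z : EuclideanSpace ℝ (Fin d) => z)
      (fun j k => (memLp_eval_multivariateGaussian hQ j 2 (by simp)).integrable_mul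
        (memLp_eval_multivariateGaussian hQ k 2 (by simp)))
      (integral_eval_mul_multivariateGaussian hQ) (h i)
  filter_upwards [ae_all_iff.2 this] with z hz
  exact sqrtMap_eq_of_rangeDefect hz

/-- The law of the sum of the first `m` increments and of Gaussian replacements of the others. -/
noncomputable def mixedLaw (P : Measure Ω) (D : Fin n → Ω → EuclideanSpace ℝ (Fin d))
    (Sg : Fin n → Matrix (Fin d) (Fin d) ℝ) (m : ℕ) : Measure (EuclideanSpace ℝ (Fin d)) :=
  (P.prod (multivariateGaussian 0 (tailCov Sg m))).map fun q => partialSum D m q.1 + q.2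

namespace IncrementBounds

variable {P : Measure Ω} [IsProbabilityMeasure P] {D : Fin n → Ω → EuclideanSpace ℝ (Fin d)}
  {Sg : Fin n → Matrix (Fin d) (Fin d) ℝ} {C η : ℝ} (H : IncrementBounds P D Sg C η)
  {R : EuclideanSpace ℝ (Fin d) →L[ℝ] EuclideanSpace ℝ (Fin d)} {c : ℝ}

include H

lemma posSemidef_sum : (∑ l, Sg l).PosSemidef := by
  rw [← tailCov_zero]
  exact H.posSemidef_tailCov 0

lemma quadForm_rangeDefect (hR : IsHalfInverse (∑ l, Sg l) R c) (l : Fin n) (i : Fin d) :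
    quadForm (rangeDefect (∑ l, Sg l) R i) (Sg l) = 0 := by
  have h := hR.quadForm_rangeDefect H.posSemidef_sum i
  rw [quadForm_sum] at h
  exact (Finset.sum_eq_zero_iff_of_nonneg fun l _ => quadForm_nonneg (H.posSemidef l) _).1 h l
    (Finset.mem_univ l)

lemma ae_sqrtMap (hR : IsHalfInverse (∑ l, Sg l) R c) (l : Fin n) :
    ∀ᵐ ω ∂P, sqrtMap (∑ l, Sg l) (R (D l ω)) = D l ω := by
  have : ∀ i, ∀ᵐ ω ∂P, ∑ j, rangeDefect (∑ l, Sg l) R i j * D l ω j = 0 := fun i =>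
    ae_linear_eq_zero (fun j k => ((H.bddMeas l j).mul (H.bddMeas l k)).integrable P)
      (H.cov l) (H.quadForm_rangeDefect hR l i)
  filter_upwards [ae_all_iff.2 this] with ω hω
  exact sqrtMap_eq_of_rangeDefect hω

lemma ae_sqrtMap_partialSum (hR : IsHalfInverse (∑ l, Sg l) R c) (m : ℕ) :
    ∀ᵐ ω ∂P, sqrtMap (∑ l, Sg l) (R (partialSum D m ω)) = partialSum D m ω := by
  filter_upwards [ae_all_iff.2 fun l => H.ae_sqrtMap hR l] with ω hω
  simp only [partialSum, map_sum]
  refine Finset.sum_congr rfl fun l _ => ?_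
  split_ifs
  · exact hω l
  · simp

lemma ae_sqrtMap_tailCov (hR : IsHalfInverse (∑ l, Sg l) R c) (m : ℕ) :
    ∀ᵐ z ∂(multivariateGaussian 0 (tailCov Sg m)), sqrtMap (∑ l, Sg l) (R z) = z := by
  refine ae_multivariateGaussian_sqrtMap (H.posSemidef_tailCov m) fun i => ?_
  rw [tailCov, quadForm_sum]
  refine Finset.sum_eq_zero fun l _ => ?_
  split_ifs
  · exact H.quadForm_rangeDefect hR l i
  · simp [quadForm]

lemma measurable_mixed (m : ℕ) :
    Measurable fun q : Ω × EuclideanSpace ℝ (Fin d) => partialSum D m q.1 + q.2 :=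
  ((H.measurable_partialSum m).comp measurable_fst).add measurable_snd

lemma isProbabilityMeasure_mixedLaw (m : ℕ) : IsProbabilityMeasure (mixedLaw P D Sg m) :=
  Measure.isProbabilityMeasure_map (H.measurable_mixed m).aemeasurable

lemma ae_mixedLaw (hR : IsHalfInverse (∑ l, Sg l) R c) (m : ℕ) :
    ∀ᵐ x ∂(mixedLaw P D Sg m), sqrtMap (∑ l, Sg l) (R x) = x := by
  have hms : MeasurableSet {x | sqrtMap (∑ l, Sg l) (R x) = x} :=
    (isClosed_eq ((sqrtMap _).continuous.comp R.continuous) continuous_id).measurableSet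
  rw [mixedLaw, ae_map_iff (H.measurable_mixed m).aemeasurable hms]
  have h1 := Measure.quasiMeasurePreserving_fst.ae
    (p := fun ω => sqrtMap (∑ l, Sg l) (R (partialSum D m ω)) = partialSum D m ω)
    (μa := P.prod (multivariateGaussian 0 (tailCov Sg m))) (H.ae_sqrtMap_partialSum hR m)
  have h2 := Measure.quasiMeasurePreserving_snd.ae
    (p := fun z => sqrtMap (∑ l, Sg l) (R z) = z)
    (μa := P.prod (multivariateGaussian 0 (tailCov Sg m))) (H.ae_sqrtMap_tailCov hR m)
  filter_upwards [h1, h2] with q e1 e2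
  rw [map_add, map_add, e1, e2]

lemma integral_mixedLaw {h : EuclideanSpace ℝ (Fin d) → ℝ} (hh : Measurable h) (m : ℕ) :
    ∫ x, h x ∂(mixedLaw P D Sg m) =
      ∫ q, h (partialSum D m q.1 + q.2) ∂(P.prod (multivariateGaussian 0 (tailCov Sg m))) :=
  integral_map (H.measurable_mixed m).aemeasurable hh.aestronglyMeasurable

lemma mixedLaw_last : mixedLaw P D Sg n = P.map fun ω => ∑ l, D l ω := by
  rw [mixedLaw, tailCov_last, multivariateGaussian_zero, Measure.prod_dirac,
    Measure.map_map _ (by fun_prop)]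
  · congr 1
    funext ω
    simp [partialSum_last]
  · exact H.measurable_mixed n

omit H in
lemma mixedLaw_zero : mixedLaw P D Sg 0 = multivariateGaussian 0 (∑ l, Sg l) := by
  simp only [mixedLaw, partialSum_zero, zero_add, tailCov_zero]
  rw [Measure.map_snd_prod, measure_univ, one_smul]

end IncrementBounds

end Interpolation


/-! ### Convex sets: the bound without independence -/

section ConvexRough

variable {d n : ℕ} {Ω : Type*} [MeasurableSpace Ω]
  {P : Measure Ω} [IsProbabilityMeasure P] {D : Fin n → Ω → EuclideanSpace ℝ (Fin d)}
  {Sg : Fin n → Matrix (Fin d) (Fin d) ℝ} {C η : ℝ}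
  {R : EuclideanSpace ℝ (Fin d) →L[ℝ] EuclideanSpace ℝ (Fin d)} {c : ℝ}

/-- The constant in the bound for smooth functions. -/
noncomputable def smoothConst (d : ℕ) (C : ℝ) : ℝ :=
  d ^ 3 * (1 + C) + d ^ 3 * (1 + gaussianFourthMoment * C) + d * d * C

lemma rpow_neg_eighth_pow_four (n : ℕ) : ((n : ℝ) ^ (-(1 / 8) : ℝ)) ^ 4 = (√(n : ℝ))⁻¹ := by
  rw [← Real.rpow_natCast, ← Real.rpow_mul (Nat.cast_nonneg n), Real.sqrt_eq_rpow,
    ← Real.rpow_neg (Nat.cast_nonneg n)]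
  norm_num

theorem IncrementBounds.convex_bound_of_smooth (H : IncrementBounds P D Sg C η)
    (hn : 0 < n) (hη : η ≤ C / (n * √n)) (hR : IsHalfInverse (∑ l, Sg l) R c) {M : ℝ} (hM : 0 ≤ M)
    (hind : ∀ ε : ℝ, 0 < ε → ε ≤ 1 → ∀ B : Set (EuclideanSpace ℝ (Fin d)),
      ∃ h h1 h2, IsSmoothIndicator (4 * ε) B h h1 h2 (M / ε ^ 3))
    {A : Set (EuclideanSpace ℝ (Fin d))} (hAc : Convex ℝ A) (hA : MeasurableSet A) :
    |(P.map fun ω => ∑ l, D l ω).real A - (multivariateGaussian 0 (∑ l, Sg l)).real A| ≤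
      (16 * d ^ 2 + smoothConst d C * M * c ^ 3) * (n : ℝ) ^ (-(1 / 8) : ℝ) := by
  have hn' : (0 : ℝ) < n := by exact_mod_cast hn
  set ε : ℝ := (n : ℝ) ^ (-(1 / 8) : ℝ) with hε
  have hε0 : 0 < ε := Real.rpow_pos_of_pos hn' _
  have hε1 : ε ≤ 1 := Real.rpow_le_one_of_one_le_of_nonpos (by exact_mod_cast hn) (by norm_num)
  have h4 : ε ^ 4 = (√(n : ℝ))⁻¹ := rpow_neg_eighth_pow_four n
  have hν := H.ae_mixedLaw hR n
  have hp := H.isProbabilityMeasure_mixedLaw n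
  rw [H.mixedLaw_last] at hν hp
  have hm : Measurable fun ω => ∑ l, D l ω := by
    have := H.measurable_partialSum n
    rwa [show partialSum D n = fun ω => ∑ l, D l ω from funext fun ω => partialSum_last D ω] at this
  refine (hR.abs_measureReal_sub_le hν hAc hA (r := 4 * ε)
    (e := smoothConst d C * (M / ε ^ 3 * c ^ 3) / √n) (by positivity) fun B _ => ?_).trans
    (le_of_eq ?_)
  · obtain ⟨h, h1, h2, hh⟩ := hind ε hε0 hε1 B
    refine ⟨h, h1, h2, _, hh, ?_⟩
    have hc0 : 0 ≤ c := zero_le_one.trans hR.one_le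
    have := H.smooth_bound hn hη (by positivity)
      (hh.taylor.comp_clm (by positivity) hR.bound hR.one_le)
    refine le_trans (le_of_eq ?_) this
    congr 2
    exact integral_map (f := fun x => h (R x)) hm.aemeasurable
      (hh.taylor.measurable.comp R.continuous.measurable).aestronglyMeasurable
  · rw [div_eq_mul_inv _ (√(n : ℝ)), ← h4]
    field_simp
    ring

end ConvexRough

/-! ### Concentration near the boundary of convex sets -/

section Shell

variable {d : ℕ}

lemma add_mem_thickening_iff {E : Type*} [SeminormedAddCommGroup E] {B : Set E} {v : E}
    (hv : ∀ z, z + v ∈ B ↔ z ∈ B) {r : ℝ} {x : E} :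
    x + v ∈ Metric.thickening r B ↔ x ∈ Metric.thickening r B := by
  simp only [Metric.mem_thickening_iff]
  constructor
  · rintro ⟨z, hz, h⟩
    refine ⟨z - v, (hv _).1 (by rwa [sub_add_cancel]), ?_⟩
    rwa [dist_eq_norm, sub_sub_eq_add_sub, ← dist_eq_norm]
  · rintro ⟨z, hz, h⟩
    exact ⟨z + v, (hv z).2 hz, by rwa [dist_add_right]⟩

lemma Convex.compl_thickening_compl {E : Type*} [SeminormedAddCommGroup E] [NormedSpace ℝ E]
    {B : Set E} (hB : Convex ℝ B) (r : ℝ) : Convex ℝ (Metric.thickening r Bᶜ)ᶜ := by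
  intro x hx y hy a b ha hb hab hw
  obtain ⟨z, hz, hd⟩ := Metric.mem_thickening_iff.1 hw
  set v := z - (a • x + b • y) with hv
  have hvr : ‖v‖ < r := by rwa [hv, ← dist_eq_norm, dist_comm]
  have key : ∀ u, u ∉ Metric.thickening r Bᶜ → u + v ∈ B := fun u hu => by
    by_contra hcon
    refine hu (Metric.mem_thickening_iff.2 ⟨u + v, hcon, ?_⟩)
    rwa [dist_self_add_right]
  refine hz ?_
  have := hB (key x hx) (key y hy) ha hb hab
  have e : a • (x + v) + b • (y + v) = z := by
    rw [smul_add, smul_add, add_add_add_comm, ← add_smul, hab, one_smul, hv]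
    abel
  rwa [e] at this

variable {S : Matrix (Fin d) (Fin d) ℝ}
  {R : EuclideanSpace ℝ (Fin d) →L[ℝ] EuclideanSpace ℝ (Fin d)} {c : ℝ}

lemma IsHalfInverse.measureReal_preimage (hR : IsHalfInverse S R c)
    {B : Set (EuclideanSpace ℝ (Fin d))} (hB : MeasurableSet B)
    (hinv : ∀ v, sqrtMap S v = 0 → ∀ x, x + v ∈ B ↔ x ∈ B) :
    (multivariateGaussian 0 S).real (R ⁻¹' B) =
      (stdGaussian (EuclideanSpace ℝ (Fin d))).real B := by
  rw [multivariateGaussian_eq_map, map_measureReal_apply (sqrtMap S).continuous.measurable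
    (R.continuous.measurable hB)]
  congr 1
  ext g
  have := hinv (R (sqrtMap S g) - g) (by rw [map_sub, hR.comp, sub_self]) g
  rw [add_sub_cancel] at this
  exact this

/-- Laws that are close to the Gaussian law on convex sets put little mass near the boundary of a
convex set. -/
lemma IsHalfInverse.measureReal_shell_le (hR : IsHalfInverse S R c)
    {ν : Measure (EuclideanSpace ℝ (Fin d))} [IsProbabilityMeasure ν] {δ : ℝ}
    (hδ : ∀ A, Convex ℝ A → MeasurableSet A →
      |ν.real A - (multivariateGaussian 0 S).real A| ≤ δ)
    {A : Set (EuclideanSpace ℝ (Fin d))} (hAc : Convex ℝ A) {r : ℝ} (hr : 0 < r) :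
    ν.real (R ⁻¹' shell r (sqrtMap S ⁻¹' A)) ≤ 2 * δ + 4 * d ^ 2 * r := by
  set B := sqrtMap S ⁻¹' A with hB
  have hcv : Convex ℝ B := hAc.linear_preimage (sqrtMap S).toLinearMap
  set C1 := Metric.thickening r B with hC1
  set C2 := (Metric.thickening r Bᶜ)ᶜ with hC2
  have hRm : Measurable R := R.continuous.measurable
  have m1 : MeasurableSet (R ⁻¹' C1) := hRm Metric.isOpen_thickening.measurableSet
  have m2 : MeasurableSet (R ⁻¹' C2) := hRm Metric.isOpen_thickening.measurableSet.compl
  have hsub : C2 ⊆ C1 := by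
    intro x hx
    refine Metric.self_subset_thickening hr _ ?_
    by_contra hcon
    exact hx (Metric.self_subset_thickening hr _ hcon)
  have hsh : R ⁻¹' shell r B = R ⁻¹' C1 \ R ⁻¹' C2 := by
    ext x
    simp [shell, hC1, hC2]
  have b1 := hδ _ ((hcv.thickening r).linear_preimage R.toLinearMap) m1
  have b2 := hδ _ ((hcv.compl_thickening_compl r).linear_preimage R.toLinearMap) m2
  have e1 : ∀ ν' : Measure (EuclideanSpace ℝ (Fin d)), IsProbabilityMeasure ν' →
      ν'.real (R ⁻¹' shell r B) = ν'.real (R ⁻¹' C1) - ν'.real (R ⁻¹' C2) := fun ν' _ => by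
    rw [hsh, measureReal_sdiff (Set.preimage_mono hsub) m2]
  have hinv : ∀ v, sqrtMap S v = 0 → ∀ x, x + v ∈ shell r B ↔ x ∈ shell r B := by
    intro v hv x
    have hvB : ∀ z, z + v ∈ B ↔ z ∈ B := fun z => by
      rw [hB, Set.mem_preimage, Set.mem_preimage, map_add, hv, add_zero]
    exact and_congr (add_mem_thickening_iff hvB)
      (add_mem_thickening_iff fun z => not_congr (hvB z))
  have e2 := hR.measureReal_preimage isOpen_shell.measurableSet hinv
  have e3 := stdGaussian_shell_le hcv hr.le
  rw [← e2, e1 _ inferInstance] at e3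
  rw [e1 _ inferInstance]
  have b1' := (abs_le.1 b1).2
  have b2' := (abs_le.1 b2).1
  change ν.real (R ⁻¹' C1) - (multivariateGaussian 0 S).real (R ⁻¹' C1) ≤ δ at b1'
  change -δ ≤ ν.real (R ⁻¹' C2) - (multivariateGaussian 0 S).real (R ⁻¹' C2) at b2'
  linarith

end Shell

section Gap

variable {d n : ℕ} {Ω : Type*} [MeasurableSpace Ω]
  {P : Measure Ω} {D : Fin n → Ω → EuclideanSpace ℝ (Fin d)}
  {Sg : Fin n → Matrix (Fin d) (Fin d) ℝ} {C η : ℝ}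
  {R : EuclideanSpace ℝ (Fin d) →L[ℝ] EuclideanSpace ℝ (Fin d)} {c : ℝ}

/-- The law of the sum of the first `m` increments and of Gaussian replacements of those after
the `m`-th one. -/
noncomputable def gapLaw (P : Measure Ω) (D : Fin n → Ω → EuclideanSpace ℝ (Fin d))
    (Sg : Fin n → Matrix (Fin d) (Fin d) ℝ) (m : ℕ) : Measure (EuclideanSpace ℝ (Fin d)) :=
  (P.prod (multivariateGaussian 0 (tailCov Sg (m + 1)))).map fun q => partialSum D m q.1 + q.2

variable [IsProbabilityMeasure P]

lemma IncrementBounds.mixedLaw_eq_conv (H : IncrementBounds P D Sg C η) (m : Fin n) :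
    mixedLaw P D Sg m = (gapLaw P D Sg m).conv (multivariateGaussian 0 (Sg m)) := by
  have hS := H.measurable_partialSum m
  have key : ∀ Q : Measure (EuclideanSpace ℝ (Fin d)), IsProbabilityMeasure Q →
      (P.prod Q).map (fun q => partialSum D m q.1 + q.2) = (P.map (partialSum D m)).conv Q := by
    intro Q _
    rw [Measure.conv]
    have := Measure.map_prod_map P Q hS measurable_id
    rw [Measure.map_id] at this
    rw [this, Measure.map_map (by fun_prop) (by fun_prop)]
    rfl
  rw [mixedLaw, gapLaw, key _ inferInstance, key _ inferInstance, Measure.conv_assoc,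
    multivariateGaussian_conv (H.posSemidef_tailCov _) (H.posSemidef m), tailCov_eq, add_comm]

lemma IncrementBounds.gapLaw_le (H : IncrementBounds P D Sg C η) (m : Fin n) {t : ℝ}
    (ht : 1 / 2 ≤ (multivariateGaussian 0 (Sg m)).real {y | ‖R y‖ < t}) (r : ℝ)
    (B : Set (EuclideanSpace ℝ (Fin d))) :
    (gapLaw P D Sg m).real (R ⁻¹' shell r B) ≤
      2 * (mixedLaw P D Sg m).real (R ⁻¹' shell (r + t) B) := by
  have hp := H.isProbabilityMeasure_mixedLaw m
  have hg : IsProbabilityMeasure (gapLaw P D Sg m) :=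
    Measure.isProbabilityMeasure_map
      (((H.measurable_partialSum m).comp measurable_fst).add measurable_snd).aemeasurable
  have hRm : Measurable R := R.continuous.measurable
  have h1 : (gapLaw P D Sg m).real (R ⁻¹' shell r B) *
      (multivariateGaussian 0 (Sg m)).real {y | ‖R y‖ < t} ≤
      (mixedLaw P D Sg m).real (R ⁻¹' shell (r + t) B) := by
    rw [H.mixedLaw_eq_conv, Measure.conv, map_measureReal_apply (by fun_prop)
      (hRm isOpen_shell.measurableSet), ← measureReal_prod_prod]
    refine measureReal_mono fun q hq => ?_
    have h2 : ‖R q.2‖ < t := hq.2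
    refine mem_shell_of_dist_lt (x := R q.1) hq.1 ?_
    rwa [map_add, dist_self_add_left]
  have h0 : 0 ≤ (gapLaw P D Sg m).real (R ⁻¹' shell r B) := measureReal_nonneg
  nlinarith

end Gap


/-! ### Convex sets: independent bounded increments -/

section ConvexIndependent

variable {d n : ℕ} {Ω : Type*} [MeasurableSpace Ω]
  {P : Measure Ω} [IsProbabilityMeasure P] {D : Fin n → Ω → EuclideanSpace ℝ (Fin d)}
  {Sg : Fin n → Matrix (Fin d) (Fin d) ℝ} {C η : ℝ}
  {R : EuclideanSpace ℝ (Fin d) →L[ℝ] EuclideanSpace ℝ (Fin d)} {c : ℝ}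
  {B : Set (EuclideanSpace ℝ (Fin d))} {h : EuclideanSpace ℝ (Fin d) → ℝ}
  {h1 : Fin d → EuclideanSpace ℝ (Fin d) → ℝ}
  {h2 : Fin d → Fin d → EuclideanSpace ℝ (Fin d) → ℝ} {r M : ℝ}

lemma IsSmoothIndicator.abs_taylorRem_le (hh : IsSmoothIndicator r B h h1 h2 M) (hM : 0 ≤ M)
    (hRc : IsOneNormBound R c) (hc : 0 ≤ c) (x : EuclideanSpace ℝ (Fin d))
    {y : EuclideanSpace ℝ (Fin d)} {s : ℝ} (hs : ∑ i, |y i| ≤ s) :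
    |taylorRem h h1 h2 (R x) (R y)| ≤
      M * (c * s) ^ 3 * (R ⁻¹' shell (r + c * s) B).indicator (fun _ => 1) x := by
  have h3 : ∑ i, |R y i| ≤ c * s := (hRc y).trans (mul_le_mul_of_nonneg_left hs hc)
  by_cases hx : x ∈ R ⁻¹' shell (r + c * s) B
  · rw [Set.indicator_of_mem hx, mul_one]
    refine (hh.taylor.rem_le _ _).trans (mul_le_mul_of_nonneg_left ?_ hM)
    exact pow_le_pow_left₀ (Finset.sum_nonneg fun _ _ => abs_nonneg _) h3 3
  · rw [Set.indicator_of_notMem hx, mul_zero, abs_nonpos_iff]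
    by_contra hcon
    have h4 : r + ‖R y‖ ≤ r + c * s := by linarith [norm_le_sum_abs (R y)]
    have h5 := hh.mem_shell (R x) (R y) hcon
    have h6 : R x ∈ shell (r + c * s) B := shell_mono h4 h5
    exact hx h6

namespace IncrementBounds

lemma integral_shell_indicator (H : IncrementBounds P D Sg C η) (m : ℕ) (ρ : ℝ) :
    Integrable (fun q : Ω × EuclideanSpace ℝ (Fin d) => (R ⁻¹' shell ρ B).indicator
      (fun _ => (1 : ℝ)) (partialSum D m q.1 + q.2))
      (P.prod (multivariateGaussian 0 (tailCov Sg (m + 1)))) ∧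
    ∫ q, (R ⁻¹' shell ρ B).indicator (fun _ => (1 : ℝ)) (partialSum D m q.1 + q.2)
      ∂(P.prod (multivariateGaussian 0 (tailCov Sg (m + 1)))) =
      (gapLaw P D Sg m).real (R ⁻¹' shell ρ B) := by
  have hms : MeasurableSet (R ⁻¹' shell ρ B) :=
    R.continuous.measurable isOpen_shell.measurableSet
  have hmeas : Measurable fun q : Ω × EuclideanSpace ℝ (Fin d) => partialSum D m q.1 + q.2 :=
    ((H.measurable_partialSum m).comp measurable_fst).add measurable_snd
  have hi : Measurable ((R ⁻¹' shell ρ B).indicator fun _ => (1 : ℝ)) :=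
    measurable_const.indicator hms
  constructor
  · refine Integrable.of_bound (hi.comp hmeas).aestronglyMeasurable 1 (.of_forall fun q => ?_)
    refine (norm_indicator_le_norm_self _ _).trans ?_
    simp
  · refine (integral_map (f := (R ⁻¹' shell ρ B).indicator fun _ => (1 : ℝ)) hmeas.aemeasurable
      hi.aestronglyMeasurable).symm.trans ?_
    rw [← gapLaw, integral_indicator hms]
    simp

lemma integral_taylorRem_increment_le (H : IncrementBounds P D Sg C η) (m : Fin n)
    (hh : IsSmoothIndicator r B h h1 h2 M) (hM : 0 ≤ M) (hRc : IsOneNormBound R c) (hc : 0 ≤ c)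
    {s : ℝ} (hs : ∀ ω, ∑ i, |D m ω i| ≤ s) :
    ∫ q, |taylorRem h h1 h2 (R (partialSum D m q.1 + q.2)) (R (D m q.1))|
      ∂(P.prod (multivariateGaussian 0 (tailCov Sg (m + 1)))) ≤
    M * (c * s) ^ 3 * (gapLaw P D Sg m).real (R ⁻¹' shell (r + c * s) B) := by
  obtain ⟨i1, e1⟩ := H.integral_shell_indicator (R := R) (B := B) m (r + c * s)
  rw [← e1, ← integral_const_mul]
  exact integral_mono_of_nonneg (.of_forall fun q => abs_nonneg _) (i1.const_mul _)
    (.of_forall fun q => hh.abs_taylorRem_le hM hRc hc _ (hs q.1))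

lemma integrable_gaussian_pow (H : IncrementBounds P D Sg C η) (m : Fin n) (k : ℕ) :
    Integrable (fun y : EuclideanSpace ℝ (Fin d) => (∑ i, |y i|) ^ k)
      (multivariateGaussian 0 (Sg m)) := by
  have h1 : MemLp (fun y : EuclideanSpace ℝ (Fin d) => ∑ i, |y i|) k
      (multivariateGaussian 0 (Sg m)) :=
    memLp_finsetSum _ fun i _ => (memLp_eval_multivariateGaussian (H.posSemidef m) i k
      (by simp)).norm
  have := h1.integrable_norm_pow'
  refine this.congr (.of_forall fun y => ?_)
  simp only [Real.norm_eq_abs]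
  rw [abs_of_nonneg (Finset.sum_nonneg fun _ _ => abs_nonneg _)]

lemma gaussian_sum_pow_four_le (H : IncrementBounds P D Sg C η) (m : Fin n) :
    ∫ y, (∑ i, |y i|) ^ 4 ∂(multivariateGaussian 0 (Sg m)) ≤
      d ^ 4 * (gaussianFourthMoment * C) / (n : ℝ) ^ 2 := by
  have hint : Integrable (fun y : EuclideanSpace ℝ (Fin d) => (d : ℝ) ^ 3 * ∑ i, y i ^ 4)
      (multivariateGaussian 0 (Sg m)) :=
    (integrable_finsetSum _ fun i _ => H.integrable_gaussian_fourth m i).const_mul _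
  calc _ ≤ ∫ y : EuclideanSpace ℝ (Fin d), (d : ℝ) ^ 3 * ∑ i, y i ^ 4
        ∂(multivariateGaussian 0 (Sg m)) := by
        refine integral_mono (H.integrable_gaussian_pow m 4) hint fun y => ?_
        have h2 : (∑ i, |y i|) ^ 2 ≤ d * ∑ i, |y i| ^ 2 := by
          simpa using sq_sum_le_card_mul_sum_sq (s := Finset.univ) (f := fun i => |y i|)
        have h3 : (∑ i, |y i| ^ 2) ^ 2 ≤ d * ∑ i, (|y i| ^ 2) ^ 2 := by
          simpa only [Finset.card_univ, Fintype.card_fin] using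
            sq_sum_le_card_mul_sum_sq (s := Finset.univ) (f := fun i => |y i| ^ 2)
        have h4 : ∀ i, (|y i| ^ 2) ^ 2 = y i ^ 4 := fun i => by rw [sq_abs]; ring
        simp only [h4] at h3
        calc (∑ i, |y i|) ^ 4 = ((∑ i, |y i|) ^ 2) ^ 2 := by ring
          _ ≤ (d * ∑ i, |y i| ^ 2) ^ 2 := pow_le_pow_left₀ (sq_nonneg _) h2 2
          _ = (d : ℝ) ^ 2 * (∑ i, |y i| ^ 2) ^ 2 := by ring
          _ ≤ (d : ℝ) ^ 2 * (d * ∑ i, y i ^ 4) := mul_le_mul_of_nonneg_left h3 (by positivity)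
          _ = _ := by ring
    _ = (d : ℝ) ^ 3 * ∑ i, ∫ y : EuclideanSpace ℝ (Fin d), y i ^ 4
          ∂(multivariateGaussian 0 (Sg m)) := by
        rw [integral_const_mul, integral_finsetSum _ fun i _ => H.integrable_gaussian_fourth m i]
    _ ≤ (d : ℝ) ^ 3 * ∑ _i : Fin d, gaussianFourthMoment * C / (n : ℝ) ^ 2 :=
        mul_le_mul_of_nonneg_left (Finset.sum_le_sum fun i _ => H.gaussian_fourth m i)
          (by positivity)
    _ = _ := by
        simp only [Finset.sum_const, Finset.card_univ, Fintype.card_fin, nsmul_eq_mul]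
        ring

lemma gaussian_sum_pow_three_le (H : IncrementBounds P D Sg C η) (hn : 0 < n) (m : Fin n) :
    ∫ y, (∑ i, |y i|) ^ 3 ∂(multivariateGaussian 0 (Sg m)) ≤
      d ^ 3 * (1 + gaussianFourthMoment * C) / (n * √n) := by
  have hpos : ∀ y : EuclideanSpace ℝ (Fin d), 0 ≤ (∑ i, |y i|) ^ 3 := fun y =>
    pow_nonneg (Finset.sum_nonneg fun _ _ => abs_nonneg _) 3
  have := integral_sum_abs_pow_three_le (multivariateGaussian 0 (Sg m))
    (Y := fun y i => y i) hn (H.integrable_gaussian_fourth m) (H.gaussian_fourth m) zero_le_one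
    (u := fun y => (∑ i, |y i|) ^ 3) (fun y => by rw [one_mul, abs_of_nonneg (hpos y)])
  simpa only [abs_of_nonneg (hpos _), one_mul] using this

lemma integral_taylorRem_gaussian_le (H : IncrementBounds P D Sg C η) (hn : 0 < n) (m : Fin n)
    (hh : IsSmoothIndicator r B h h1 h2 M) (hM : 0 ≤ M) (hRc : IsOneNormBound R c) (hc : 0 ≤ c)
    (hr : 0 < r) {a b : ℝ} (ha : 0 ≤ a) (hb : 0 ≤ b)
    (hg : ∀ ρ, 0 < ρ → (gapLaw P D Sg m).real (R ⁻¹' shell ρ B) ≤ a + b * ρ) :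
    ∫ q, |taylorRem h h1 h2 (R (partialSum D m q.1.1 + q.1.2)) (R q.2)|
      ∂((P.prod (multivariateGaussian 0 (tailCov Sg (m + 1)))).prod
        (multivariateGaussian 0 (Sg m))) ≤
    M * c ^ 3 * ((a + b * r) * (d ^ 3 * (1 + gaussianFourthMoment * C) / (n * √n)) +
      b * c * (d ^ 4 * (gaussianFourthMoment * C) / (n : ℝ) ^ 2)) := by
  have hRm : Measurable R := R.continuous.measurable
  have hs0 : ∀ y : EuclideanSpace ℝ (Fin d), 0 ≤ ∑ i, |y i| := fun y =>
    Finset.sum_nonneg fun _ _ => abs_nonneg _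
  have i3 := H.integrable_gaussian_pow m 3
  have i4 := H.integrable_gaussian_pow m 4
  have hsum : Measurable fun q : (Ω × EuclideanSpace ℝ (Fin d)) × EuclideanSpace ℝ (Fin d) =>
      partialSum D m q.1.1 + q.1.2 :=
    ((H.measurable_partialSum m).comp (measurable_fst.comp measurable_fst)).add
      (measurable_snd.comp measurable_fst)
  have hpair : Measurable fun q : (Ω × EuclideanSpace ℝ (Fin d)) × EuclideanSpace ℝ (Fin d) =>
      (R (partialSum D m q.1.1 + q.1.2), R q.2) :=
    (hRm.comp hsum).prodMk (hRm.comp measurable_snd)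
  have hmeas : Measurable fun q : (Ω × EuclideanSpace ℝ (Fin d)) × EuclideanSpace ℝ (Fin d) =>
      taylorRem h h1 h2 (R (partialSum D m q.1.1 + q.1.2)) (R q.2) := by
    have hrem := measurable_taylorRem hh.taylor.measurable hh.taylor.measurable1
      hh.taylor.measurable2
    have hcomp := hrem.comp hpair
    exact hcomp
  have hint : Integrable (fun q : (Ω × EuclideanSpace ℝ (Fin d)) × EuclideanSpace ℝ (Fin d) =>
      |taylorRem h h1 h2 (R (partialSum D m q.1.1 + q.1.2)) (R q.2)|)
      ((P.prod (multivariateGaussian 0 (tailCov Sg (m + 1)))).prod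
        (multivariateGaussian 0 (Sg m))) := by
    have hdom : Integrable (fun q : (Ω × EuclideanSpace ℝ (Fin d)) × EuclideanSpace ℝ (Fin d) =>
        M * c ^ 3 * (∑ i, |q.2 i|) ^ 3)
        ((P.prod (multivariateGaussian 0 (tailCov Sg (m + 1)))).prod
          (multivariateGaussian 0 (Sg m))) := (i3.const_mul (M * c ^ 3)).comp_snd _
    refine hdom.mono' (continuous_abs.measurable.comp hmeas).aestronglyMeasurable
      (ae_of_all _ fun q => ?_)
    rw [Real.norm_eq_abs, abs_abs]
    have hrem := hh.taylor.rem_le (R (partialSum D m q.1.1 + q.1.2)) (R q.2)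
    have hpow := pow_le_pow_left₀ (Finset.sum_nonneg fun _ _ => abs_nonneg _) (hRc q.2) 3
    calc _ ≤ _ := hrem
      _ ≤ M * (c * ∑ i, |q.2 i|) ^ 3 := mul_le_mul_of_nonneg_left hpow hM
      _ = _ := by ring
  rw [integral_prod_symm _ hint]
  have hinner : ∀ y : EuclideanSpace ℝ (Fin d),
      ∫ q, |taylorRem h h1 h2 (R (partialSum D m q.1 + q.2)) (R y)|
        ∂(P.prod (multivariateGaussian 0 (tailCov Sg (m + 1)))) ≤
      M * c ^ 3 * (a + b * r) * (∑ i, |y i|) ^ 3 + M * c ^ 3 * (b * c) * (∑ i, |y i|) ^ 4 := by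
    intro y
    obtain ⟨i1, e1⟩ := H.integral_shell_indicator (R := R) (B := B) m (r + c * ∑ i, |y i|)
    have h0 := hs0 y
    have hgy := hg (r + c * ∑ i, |y i|) (by positivity)
    calc _ ≤ M * (c * ∑ i, |y i|) ^ 3 * (gapLaw P D Sg m).real
          (R ⁻¹' shell (r + c * ∑ i, |y i|) B) := by
          rw [← e1, ← integral_const_mul]
          exact integral_mono_of_nonneg (.of_forall fun q => abs_nonneg _) (i1.const_mul _)
            (.of_forall fun q => hh.abs_taylorRem_le hM hRc hc _ le_rfl)
      _ ≤ M * (c * ∑ i, |y i|) ^ 3 * (a + b * (r + c * ∑ i, |y i|)) :=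
          mul_le_mul_of_nonneg_left hgy (by positivity)
      _ = _ := by ring
  have j3 := i3.const_mul (M * c ^ 3 * (a + b * r))
  have j4 := i4.const_mul (M * c ^ 3 * (b * c))
  calc _ ≤ ∫ y : EuclideanSpace ℝ (Fin d), (M * c ^ 3 * (a + b * r) * (∑ i, |y i|) ^ 3 +
        M * c ^ 3 * (b * c) * (∑ i, |y i|) ^ 4) ∂(multivariateGaussian 0 (Sg m)) :=
        integral_mono hint.integral_prod_right (j3.add j4) hinner
    _ = M * c ^ 3 * (a + b * r) * ∫ y, (∑ i, |y i|) ^ 3 ∂(multivariateGaussian 0 (Sg m)) +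
        M * c ^ 3 * (b * c) * ∫ y, (∑ i, |y i|) ^ 4 ∂(multivariateGaussian 0 (Sg m)) := by
        rw [integral_add j3 j4, integral_const_mul, integral_const_mul]
    _ ≤ M * c ^ 3 * (a + b * r) * (d ^ 3 * (1 + gaussianFourthMoment * C) / (n * √n)) +
        M * c ^ 3 * (b * c) * (d ^ 4 * (gaussianFourthMoment * C) / (n : ℝ) ^ 2) :=
        add_le_add (mul_le_mul_of_nonneg_left (H.gaussian_sum_pow_three_le hn m) (by positivity))
          (mul_le_mul_of_nonneg_left (H.gaussian_sum_pow_four_le m) (by positivity))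
    _ = _ := by ring

/-- A Gaussian increment is small with probability at least one half. -/
lemma half_le_gaussian_ball (H : IncrementBounds P D Sg C η) (hn : 0 < n) (m : Fin n)
    (hRc : IsOneNormBound R c) (hc : 1 ≤ c) {K : ℝ} (hK : 0 ≤ K)
    (hD : ∀ ω i, |D m ω i| ≤ K / √n) :
    1 / 2 ≤ (multivariateGaussian 0 (Sg m)).real
      {y | ‖R y‖ < 2 * c * (d + 1) * (K + 1) / √n} := by
  have hn' : (0 : ℝ) < n := by exact_mod_cast hn
  set t := 2 * c * (d + 1) * (K + 1) / √n with ht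
  have ht0 : 0 < t := by positivity
  set γ := multivariateGaussian 0 (Sg m)
  have hdiag : ∀ i, Sg m i i ≤ K ^ 2 / n := by
    intro i
    rw [← H.cov m i i]
    have := integral_mono (((H.bddMeas m i).mul (H.bddMeas m i)).integrable P)
      (integrable_const (K ^ 2 / (n : ℝ))) fun ω => ?_
    · simpa using this
    · have h1 := mul_le_mul (hD ω i) (hD ω i) (abs_nonneg _) (by positivity)
      rw [abs_mul_abs_self, div_mul_div_comm, Real.mul_self_sqrt hn'.le] at h1
      simpa [sq] using h1
  have hint : ∀ i, Integrable (fun y : EuclideanSpace ℝ (Fin d) => y i * y i) γ := fun i =>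
    (memLp_eval_multivariateGaussian (H.posSemidef m) i 2 (by simp)).integrable_mul
      (memLp_eval_multivariateGaussian (H.posSemidef m) i 2 (by simp))
  have hF : Integrable (fun y : EuclideanSpace ℝ (Fin d) => c ^ 2 * (d * ∑ i, y i * y i)) γ :=
    ((integrable_finsetSum _ fun i _ => hint i).const_mul _).const_mul _
  have hEF : ∫ y, c ^ 2 * (d * ∑ i, y i * y i) ∂γ ≤ t ^ 2 / 2 := by
    rw [integral_const_mul, integral_const_mul, integral_finsetSum _ fun i _ => hint i]
    calc _ ≤ c ^ 2 * (d * ∑ _i : Fin d, K ^ 2 / (n : ℝ)) := by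
          gcongr with i
          rw [integral_eval_mul_multivariateGaussian (H.posSemidef m)]
          exact hdiag i
      _ = (c * d * K) ^ 2 / n := by
          simp only [Finset.sum_const, Finset.card_univ, Fintype.card_fin, nsmul_eq_mul]
          ring
      _ ≤ (c * (d + 1) * (K + 1)) ^ 2 / n := by gcongr <;> linarith
      _ ≤ t ^ 2 / 2 := by
          have h0 : 0 ≤ (c * (d + 1) * (K + 1)) ^ 2 / n := by positivity
          have : t ^ 2 = 4 * ((c * (d + 1) * (K + 1)) ^ 2 / n) := by
            rw [ht, div_pow, Real.sq_sqrt hn'.le]; ring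
          linarith
  have hmarkov := mul_meas_ge_le_integral_of_nonneg (μ := γ)
    (.of_forall fun y : EuclideanSpace ℝ (Fin d) => mul_nonneg (sq_nonneg c)
      (mul_nonneg (Nat.cast_nonneg d) (Finset.sum_nonneg fun i _ => mul_self_nonneg (y i)))) hF
    (t ^ 2)
  have hms : MeasurableSet {y : EuclideanSpace ℝ (Fin d) | ‖R y‖ < t} :=
    (isOpen_lt R.continuous.norm continuous_const).measurableSet
  have hle : γ.real {y | ‖R y‖ < t}ᶜ ≤ γ.real {y | t ^ 2 ≤ c ^ 2 * (d * ∑ i, y i * y i)} := by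
    refine measureReal_mono fun y hy => ?_
    have h1 : t ≤ ‖R y‖ := not_lt.1 hy
    have h2 : ‖R y‖ ≤ c * ∑ i, |y i| := (norm_le_sum_abs _).trans (hRc y)
    have h3 : (∑ i, |y i|) ^ 2 ≤ d * ∑ i, |y i| ^ 2 := by
      simpa using sq_sum_le_card_mul_sum_sq (s := Finset.univ) (f := fun i => |y i|)
    calc t ^ 2 ≤ (c * ∑ i, |y i|) ^ 2 := pow_le_pow_left₀ ht0.le (h1.trans h2) 2
      _ = c ^ 2 * (∑ i, |y i|) ^ 2 := mul_pow _ _ _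
      _ ≤ c ^ 2 * (d * ∑ i, |y i| ^ 2) := mul_le_mul_of_nonneg_left h3 (sq_nonneg c)
      _ = _ := by simp only [sq_abs, ← sq]
  rw [probReal_compl_eq_one_sub hms] at hle
  have h5 : t ^ 2 * γ.real {y | t ^ 2 ≤ c ^ 2 * (d * ∑ i, y i * y i)} ≤ t ^ 2 * (1 / 2) := by
    refine hmarkov.trans (hEF.trans (le_of_eq (by ring)))
  have h6 := le_of_mul_le_mul_left h5 (by positivity)
  linarith

end IncrementBounds

end ConvexIndependent


/-! ### The bootstrap for convex sets -/

section Bootstrap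

variable {d n : ℕ} {Ω : Type*} [MeasurableSpace Ω]
  {P : Measure Ω} [IsProbabilityMeasure P] {D : Fin n → Ω → EuclideanSpace ℝ (Fin d)}
  {Sg : Fin n → Matrix (Fin d) (Fin d) ℝ} {C : ℝ}
  {R : EuclideanSpace ℝ (Fin d) →L[ℝ] EuclideanSpace ℝ (Fin d)} {c : ℝ}
  {h : EuclideanSpace ℝ (Fin d) → ℝ}
  {h1 : Fin d → EuclideanSpace ℝ (Fin d) → ℝ}
  {h2 : Fin d → Fin d → EuclideanSpace ℝ (Fin d) → ℝ} {M : ℝ}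

/-- The coefficient of the third moments in the bootstrap. -/
noncomputable def thirdConst (d : ℕ) (C K : ℝ) : ℝ :=
  (d * K) ^ 3 + d ^ 3 * (1 + gaussianFourthMoment * C)

/-- The coefficient of the fourth moments in the bootstrap. -/
noncomputable def fourthConst (d : ℕ) (C K : ℝ) : ℝ :=
  (d * K) ^ 4 + d ^ 4 * (gaussianFourthMoment * C)

/-- The constant in the bootstrap. -/
noncomputable def bootConst (d : ℕ) (C K c : ℝ) : ℝ :=
  c ^ 3 * (4 * thirdConst d C K + 16 * d ^ 2 * c * (d + 1) * (K + 1) * thirdConst d C K +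
    8 * d ^ 2 * c * fourthConst d C K + 32 * d ^ 2 * thirdConst d C K)

lemma bootConst_nonneg {K : ℝ} (d : ℕ) (hC : 0 ≤ C) (hK : 0 ≤ K) (hc : 0 ≤ c) :
    0 ≤ bootConst d C K c := by
  have hg0 := gaussianFourthMoment_nonneg
  unfold bootConst thirdConst fourthConst
  positivity

namespace IncrementBounds

lemma gapLaw_shell_le (H : IncrementBounds P D Sg C 0) (hn : 0 < n) {K : ℝ} (hK : 0 ≤ K)
    (hD : ∀ l ω i, |D l ω i| ≤ K / √n) (hR : IsHalfInverse (∑ l, Sg l) R c) (m : Fin n) {δ : ℝ}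
    (hδ : ∀ A, Convex ℝ A → MeasurableSet A →
      |(mixedLaw P D Sg m).real A - (multivariateGaussian 0 (∑ l, Sg l)).real A| ≤ δ)
    {A : Set (EuclideanSpace ℝ (Fin d))} (hAc : Convex ℝ A) {ρ : ℝ} (hρ : 0 < ρ) :
    (gapLaw P D Sg m).real (R ⁻¹' shell ρ (sqrtMap (∑ l, Sg l) ⁻¹' A)) ≤
      4 * δ + 16 * d ^ 2 * c * (d + 1) * (K + 1) / √n + 8 * d ^ 2 * ρ := by
  have hn' : (0 : ℝ) < n := by exact_mod_cast hn
  have hc : 0 < c := zero_lt_one.trans_le hR.one_le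
  have := H.isProbabilityMeasure_mixedLaw m
  refine (H.gapLaw_le m (H.half_le_gaussian_ball hn m hR.bound hR.one_le hK (hD m)) ρ _).trans ?_
  refine (mul_le_mul_of_nonneg_left (hR.measureReal_shell_le hδ hAc (by positivity))
    zero_le_two).trans (le_of_eq ?_)
  ring

/-- The error of a single replacement, given a bound for all convex sets. -/
lemma step_smoothIndicator (H : IncrementBounds P D Sg C 0) (hC : 0 ≤ C) (hn : 0 < n) {K : ℝ}
    (hK : 0 ≤ K) (hD : ∀ l ω i, |D l ω i| ≤ K / √n) (hR : IsHalfInverse (∑ l, Sg l) R c)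
    (m : Fin n) {δ : ℝ} (hδ : ∀ A, Convex ℝ A → MeasurableSet A →
      |(mixedLaw P D Sg m).real A - (multivariateGaussian 0 (∑ l, Sg l)).real A| ≤ δ)
    {A B : Set (EuclideanSpace ℝ (Fin d))} (hAc : Convex ℝ A)
    (hB : B = sqrtMap (∑ l, Sg l) ⁻¹' A ∨ B = (sqrtMap (∑ l, Sg l) ⁻¹' A)ᶜ) {ε : ℝ} (hε : 0 < ε)
    (hM : 0 ≤ M) (hh : IsSmoothIndicator (4 * ε) B h h1 h2 M) :
    |∫ x, h (R x) ∂(mixedLaw P D Sg (m + 1)) - ∫ x, h (R x) ∂(mixedLaw P D Sg m)| ≤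
      M * bootConst d C K c * (δ + ε + 1 / √n) / (n * √n) := by
  have hn' : (0 : ℝ) < n := by exact_mod_cast hn
  have hc : 0 < c := zero_lt_one.trans_le hR.one_le
  have hδ0 : 0 ≤ δ := (abs_nonneg _).trans (hδ ∅ convex_empty MeasurableSet.empty)
  have hRm : Measurable fun x => h (R x) :=
    hh.taylor.measurable.comp R.continuous.measurable
  set q : ℝ := 1 / √n with hq
  have hq0 : 0 < q := by positivity
  have hq2 : q ^ 2 = 1 / n := by rw [hq, div_pow, one_pow, Real.sq_sqrt hn'.le]
  have hq3 : q ^ 3 = 1 / (n * √n) := by rw [pow_succ, hq2, hq, div_mul_div_comm, one_mul]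
  have hq4 : q ^ 4 = 1 / (n : ℝ) ^ 2 := by
    rw [show q ^ 4 = (q ^ 2) ^ 2 by ring, hq2, div_pow, one_pow]
  have hg : ∀ ρ, 0 < ρ → (gapLaw P D Sg m).real (R ⁻¹' shell ρ B) ≤
      (4 * δ + 16 * d ^ 2 * c * (d + 1) * (K + 1) * q) + 8 * d ^ 2 * ρ := by
    intro ρ hρ
    have := H.gapLaw_shell_le hn hK hD hR m hδ hAc hρ
    rw [hq, mul_one_div]
    rcases hB with rfl | rfl
    · exact this
    · rwa [shell_compl]
  have hs : ∀ ω, ∑ i, |D m ω i| ≤ d * K * q := fun ω => by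
    refine (Finset.sum_le_sum fun i _ => hD m ω i).trans (le_of_eq ?_)
    simp only [Finset.sum_const, Finset.card_univ, Fintype.card_fin, nsmul_eq_mul, hq]
    ring
  have r1 := H.integral_taylorRem_increment_le m hh hM hR.bound hc.le hs
  have r2 := H.integral_taylorRem_gaussian_le hn m hh hM hR.bound hc.le (by positivity)
    (a := 4 * δ + 16 * d ^ 2 * c * (d + 1) * (K + 1) * q) (b := 8 * d ^ 2)
    (by positivity) (by positivity) hg
  have r1' := r1.trans (mul_le_mul_of_nonneg_left (hg _ (by positivity)) (by positivity))
  have r3 := H.step (hh.taylor.comp_clm hM hR.bound hR.one_le) m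
  simp only [taylorRem_comp, mul_zero, add_zero] at r3
  rw [H.integral_mixedLaw hRm, H.integral_mixedLaw hRm]
  refine r3.trans ((add_le_add r1' r2).trans ?_)
  have e1 : M * bootConst d C K c * (δ + ε + q) / (n * √n) =
      M * bootConst d C K c * (δ + ε + q) * q ^ 3 := by rw [hq3]; ring
  rw [e1, mul_div_assoc _ _ ((n : ℝ) * √n), div_eq_mul_one_div _ ((n : ℝ) * √n), ← hq3,
    div_eq_mul_one_div _ ((n : ℝ) ^ 2), ← hq4]
  have hg0 := gaussianFourthMoment_nonneg
  have h3 : 0 ≤ thirdConst d C K := by unfold thirdConst; positivity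
  have h4 : 0 ≤ fourthConst d C K := by unfold fourthConst; positivity
  have key : M * (c * (d * K * q)) ^ 3 * (4 * δ + 16 * d ^ 2 * c * (d + 1) * (K + 1) * q +
      8 * d ^ 2 * (4 * ε + c * (d * K * q))) + M * c ^ 3 *
      ((4 * δ + 16 * d ^ 2 * c * (d + 1) * (K + 1) * q + 8 * d ^ 2 * (4 * ε)) *
        (d ^ 3 * ((1 + gaussianFourthMoment * C) * q ^ 3)) +
        8 * d ^ 2 * c * (d ^ 4 * (gaussianFourthMoment * C) * q ^ 4)) =
      M * c ^ 3 * q ^ 3 * (4 * thirdConst d C K * δ +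
        (16 * d ^ 2 * c * (d + 1) * (K + 1) * thirdConst d C K +
          8 * d ^ 2 * c * fourthConst d C K) * q + 32 * d ^ 2 * thirdConst d C K * ε) := by
    unfold thirdConst fourthConst
    ring
  have hb : 4 * thirdConst d C K * δ + (16 * d ^ 2 * c * (d + 1) * (K + 1) * thirdConst d C K +
      8 * d ^ 2 * c * fourthConst d C K) * q + 32 * d ^ 2 * thirdConst d C K * ε ≤
      (4 * thirdConst d C K + 16 * d ^ 2 * c * (d + 1) * (K + 1) * thirdConst d C K +
        8 * d ^ 2 * c * fourthConst d C K + 32 * d ^ 2 * thirdConst d C K) * (δ + ε + q) := by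
    have t1 : 0 ≤ 4 * thirdConst d C K := by positivity
    have t2 : 0 ≤ 16 * d ^ 2 * c * (d + 1) * (K + 1) * thirdConst d C K +
      8 * d ^ 2 * c * fourthConst d C K := by positivity
    have t3 : 0 ≤ 32 * d ^ 2 * thirdConst d C K := by positivity
    have s1 := mul_le_mul_of_nonneg_left (show δ ≤ δ + ε + q by linarith) t1
    have s2 := mul_le_mul_of_nonneg_left (show q ≤ δ + ε + q by linarith) t2
    have s3 := mul_le_mul_of_nonneg_left (show ε ≤ δ + ε + q by linarith) t3
    linarith
  rw [key]
  refine (mul_le_mul_of_nonneg_left hb (by positivity)).trans (le_of_eq ?_)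
  unfold bootConst
  ring

/-- One round of the bootstrap. -/
lemma convex_bound_improve (H : IncrementBounds P D Sg C 0) (hC : 0 ≤ C) (hn : 0 < n) {K : ℝ}
    (hK : 0 ≤ K) (hD : ∀ l ω i, |D l ω i| ≤ K / √n) (hR : IsHalfInverse (∑ l, Sg l) R c)
    (hM : 0 ≤ M) (hind : ∀ ε : ℝ, 0 < ε → ε ≤ 1 → ∀ B : Set (EuclideanSpace ℝ (Fin d)),
      ∃ h h1 h2, IsSmoothIndicator (4 * ε) B h h1 h2 (M / ε ^ 3)) {δ : ℝ}
    (hδ : ∀ m, m ≤ n → ∀ A, Convex ℝ A → MeasurableSet A →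
      |(mixedLaw P D Sg m).real A - (multivariateGaussian 0 (∑ l, Sg l)).real A| ≤ δ)
    {ε : ℝ} (hε : 0 < ε) (hε1 : ε ≤ 1) {m : ℕ} (hm : m ≤ n)
    {A : Set (EuclideanSpace ℝ (Fin d))} (hAc : Convex ℝ A) (hA : MeasurableSet A) :
    |(mixedLaw P D Sg m).real A - (multivariateGaussian 0 (∑ l, Sg l)).real A| ≤
      16 * d ^ 2 * ε + M / ε ^ 3 * bootConst d C K c * (δ + ε + 1 / √n) / √n := by
  have hn' : (0 : ℝ) < n := by exact_mod_cast hn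
  have hp := H.isProbabilityMeasure_mixedLaw m
  have hc : 0 < c := zero_lt_one.trans_le hR.one_le
  have hδ0 : 0 ≤ δ := (abs_nonneg _).trans (hδ 0 (Nat.zero_le _) ∅ convex_empty .empty)
  set e : ℝ := M / ε ^ 3 * bootConst d C K c * (δ + ε + 1 / √n) / (n * √n) with he
  have hboot : 0 ≤ bootConst d C K c := bootConst_nonneg d hC hK hc.le
  have he0 : 0 ≤ e := by positivity
  refine (hR.abs_measureReal_sub_le (H.ae_mixedLaw hR m) hAc hA (r := 4 * ε) (e := n * e)
    (by positivity) fun B hB => ?_).trans (le_of_eq ?_)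
  · obtain ⟨h, h1, h2, hh⟩ := hind ε hε hε1 B
    refine ⟨h, h1, h2, _, hh, ?_⟩
    have hstep : ∀ j, j ≤ n → |∫ x, h (R x) ∂(mixedLaw P D Sg j) -
        ∫ z, h (R z) ∂(multivariateGaussian 0 (∑ l, Sg l))| ≤ j * e := by
      intro j
      induction j with
      | zero => intro _; simp [mixedLaw_zero]
      | succ j ih =>
        intro hj
        have h3 := H.step_smoothIndicator hC hn hK hD hR ⟨j, hj⟩
          (hδ j (by omega)) hAc hB hε (by positivity) hh
        have h4 := ih (by omega)
        refine (abs_sub_le _ (∫ x, h (R x) ∂(mixedLaw P D Sg j)) _).trans ?_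
        push_cast
        linarith
    refine (hstep m hm).trans (mul_le_mul_of_nonneg_right ?_ he0)
    exact_mod_cast hm
  · rw [he]
    field_simp
    ring

lemma _root_.rpow_neg_sixth_pow_three (n : ℕ) :
    ((n : ℝ) ^ (-(1 / 6) : ℝ)) ^ 3 = 1 / √(n : ℝ) := by
  rw [← Real.rpow_natCast, ← Real.rpow_mul (Nat.cast_nonneg n), Real.sqrt_eq_rpow,
    one_div ((n : ℝ) ^ (1 / 2 : ℝ)), ← Real.rpow_neg (Nat.cast_nonneg n)]
  norm_num

theorem convex_bound_of_bounded (H : IncrementBounds P D Sg C 0) (hC : 0 ≤ C) (hn : 0 < n) {K : ℝ}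
    (hK : 0 ≤ K) (hD : ∀ l ω i, |D l ω i| ≤ K / √n) (hR : IsHalfInverse (∑ l, Sg l) R c)
    (hM : 0 ≤ M) (hind : ∀ ε : ℝ, 0 < ε → ε ≤ 1 → ∀ B : Set (EuclideanSpace ℝ (Fin d)),
      ∃ h h1 h2, IsSmoothIndicator (4 * ε) B h h1 h2 (M / ε ^ 3))
    {A : Set (EuclideanSpace ℝ (Fin d))} (hAc : Convex ℝ A) (hA : MeasurableSet A) :
    |(P.map fun ω => ∑ l, D l ω).real A - (multivariateGaussian 0 (∑ l, Sg l)).real A| ≤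
      (32 * d ^ 2 + 2) * (1 + 2 * M * bootConst d C K c) * (n : ℝ) ^ (-(1 / 6) : ℝ) := by
  have hn' : (0 : ℝ) < n := by exact_mod_cast hn
  have hc : 0 < c := zero_lt_one.trans_le hR.one_le
  have hboot : 0 ≤ bootConst d C K c := bootConst_nonneg d hC hK hc.le
  set x : ℝ := (n : ℝ) ^ (-(1 / 6) : ℝ) with hx
  have hx0 : 0 < x := Real.rpow_pos_of_pos hn' _
  have hx1 : x ≤ 1 := Real.rpow_le_one_of_one_le_of_nonpos (by exact_mod_cast hn) (by norm_num)
  have hx3 : x ^ 3 = 1 / √(n : ℝ) := rpow_neg_sixth_pow_three n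
  set b : ℝ := bootConst d C K c with hb
  set a : ℝ := 1 + 2 * M * b with ha
  have ha1 : 1 ≤ a := by rw [ha]; nlinarith [mul_nonneg hM hboot]
  have hone : ∀ m (A : Set (EuclideanSpace ℝ (Fin d))),
      |(mixedLaw P D Sg m).real A - (multivariateGaussian 0 (∑ l, Sg l)).real A| ≤ 1 := by
    intro m A
    have := H.isProbabilityMeasure_mixedLaw m
    rw [abs_le]
    constructor <;> linarith [measureReal_nonneg (μ := mixedLaw P D Sg m) (s := A),
      measureReal_nonneg (μ := multivariateGaussian 0 (∑ l, Sg l)) (s := A),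
      measureReal_le_one (μ := mixedLaw P D Sg m) (s := A),
      measureReal_le_one (μ := multivariateGaussian 0 (∑ l, Sg l)) (s := A)]
  rw [← H.mixedLaw_last]
  have hax : 0 < a * x := by positivity
  rw [mul_assoc]
  by_cases hε1 : a * x ≤ 1
  · have hiter : ∀ j : ℕ, ∀ m, m ≤ n → ∀ A, Convex ℝ A → MeasurableSet A →
        |(mixedLaw P D Sg m).real A - (multivariateGaussian 0 (∑ l, Sg l)).real A| ≤
          (1 / 2) ^ j + (32 * d ^ 2 + 2) * (a * x) := by
      intro j
      induction j with
      | zero =>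
        intro m _ A _ _
        refine (hone m A).trans ?_
        have : 0 ≤ (32 * (d : ℝ) ^ 2 + 2) * (a * x) := by positivity
        simpa using this
      | succ j ih =>
        intro m hm A hAc hA
        have h1 := H.convex_bound_improve hC hn hK hD hR hM hind ih hax hε1 hm hAc hA
        refine h1.trans ?_
        rw [← hx3]
        set δ := (1 / 2 : ℝ) ^ j + (32 * d ^ 2 + 2) * (a * x) with hδ
        have hδ0 : 0 ≤ δ := by positivity
        have e1 : M / (a * x) ^ 3 * b * (δ + a * x + x ^ 3) / √n =
            M * b / a ^ 3 * (δ + a * x + x ^ 3) := by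
          rw [div_eq_mul_one_div _ (√(n : ℝ)), ← hx3]
          field_simp
        have e2 : M * b / a ^ 3 ≤ 1 / 2 := by
          rw [div_le_iff₀ (by positivity)]
          have h2 : a ≤ a ^ 3 := le_self_pow₀ ha1 (by norm_num)
          have h3 : 2 * (M * b) ≤ a := by rw [ha]; linarith
          linarith
        have e3 : x ^ 3 ≤ a * x := by
          have h2 : x ^ 3 ≤ x := pow_le_of_le_one hx0.le hx1 (by norm_num)
          nlinarith
        have e4 := mul_le_mul_of_nonneg_right e2
          (show 0 ≤ δ + a * x + x ^ 3 by positivity)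
        rw [e1]
        rw [hδ] at e4 ⊢
        rw [pow_succ (1 / 2 : ℝ) j]
        linarith
    refine ge_of_tendsto' (f := fun j : ℕ => (1 / 2 : ℝ) ^ j + (32 * d ^ 2 + 2) * (a * x))
      (x := Filter.atTop) ?_ fun j => hiter j n le_rfl A hAc hA
    have := (tendsto_pow_atTop_nhds_zero_of_lt_one (r := (1 / 2 : ℝ)) (by norm_num)
      (by norm_num)).add_const ((32 * d ^ 2 + 2) * (a * x))
    rwa [zero_add] at this
  · refine (hone n A).trans ?_
    nlinarith [not_le.1 hε1, mul_nonneg (sq_nonneg (d : ℝ)) hax.le]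

end IncrementBounds

end Bootstrap


/-! ### Normal approximation of the counts -/

section Assembly

variable {d n : ℕ} {k : Fin d → ℕ} {μ : Coord n → Measure I} [∀ j, IsProbabilityMeasure (μ j)]
  {F : ∀ i, SimpleGraph (Fin (k i))} {X : ∀ i, (Fin (k i) → Fin n) → (Coord n → I) → ℝ}
  {K : ℝ} {p : ℕ}

lemma layerConst_nonneg (p : ℕ) (K : ℝ) : 0 ≤ layerConst p K := by
  unfold layerConst
  positivity

lemma bddMeas_sum_layer (hX : ∀ i, CentredFamily μ (F i) (X i) K) (i : Fin d) :
    BddMeas fun x => (∑ m, layer X m x) i := by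
  simp only [WithLp.ofLp_sum, Finset.sum_apply]
  exact BddMeas.sum _ fun m _ => bddMeas_layer hX m i

lemma measurable_sum_layer (hX : ∀ i, CentredFamily μ (F i) (X i) K) :
    Measurable fun x => ∑ m, layer X m x := by
  have := measurable_partialSum_layer hX n
  rwa [show partialSum (layer X) n = fun x => ∑ m, layer X m x from
    funext fun x => partialSum_last _ x] at this

lemma covariance_sum_layer (hF : ∀ i, (F i).Connected)
    (hX : ∀ i, CentredFamily μ (F i) (X i) K) (i j : Fin d) :
    cov[fun y => y i, fun y => y j; (Measure.pi μ).map fun x => ∑ m, layer X m x] =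
      (∑ m, layerCov μ X m) i j := by
  have hL : ∀ i, MemLp (fun x => (∑ m, layer X m x) i) 2 (Measure.pi μ) := fun i => by
    obtain ⟨b, hb⟩ := (bddMeas_sum_layer hX i).bounded
    exact MemLp.of_bound (bddMeas_sum_layer hX i).measurable.aestronglyMeasurable b
      (.of_forall hb)
  have hev : ∀ i : Fin d, Measurable fun y : EuclideanSpace ℝ (Fin d) => y i := fun i => by
    fun_prop
  rw [covariance_map_fun (hev i).aestronglyMeasurable (hev j).aestronglyMeasurable
    (measurable_sum_layer hX).aemeasurable, covariance_eq_sub (hL i) (hL j),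
    integral_sum_layer hF hX i, zero_mul, sub_zero]
  exact integral_sum_layer_mul hF hX i j

/-- The size of a half-inverse of a covariance matrix whose nonzero eigenvalues are at
least `lam`. -/
noncomputable def halfInverseConst (d : ℕ) (lam : ℝ) : ℝ := 1 + d * (d * (√lam)⁻¹)

/-- The constant in the bound for convex sets. -/
noncomputable def convexConst (d : ℕ) (C K M lam : ℝ) : ℝ :=
  (16 * d ^ 2 + smoothConst d C * M * halfInverseConst d lam ^ 3) +
    (32 * d ^ 2 + 2) * (1 + 2 * M * bootConst d C K (halfInverseConst d lam))

lemma smoothConst_nonneg {C : ℝ} (d : ℕ) (hC : 0 ≤ C) : 0 ≤ smoothConst d C := by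
  have := gaussianFourthMoment_nonneg
  unfold smoothConst
  positivity

lemma convexConst_parts_nonneg {C M lam : ℝ} (d : ℕ) (hC : 0 ≤ C) (hK : 0 ≤ K) (hM : 0 ≤ M) :
    0 ≤ 16 * d ^ 2 + smoothConst d C * M * halfInverseConst d lam ^ 3 ∧
    0 ≤ (32 * d ^ 2 + 2) * (1 + 2 * M * bootConst d C K (halfInverseConst d lam)) := by
  have h2 := smoothConst_nonneg d hC
  have h3 : 0 ≤ halfInverseConst d lam := by unfold halfInverseConst; positivity
  have h4 : 0 ≤ bootConst d C K (halfInverseConst d lam) := bootConst_nonneg d hC hK h3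
  constructor <;> positivity

theorem convexSetDist_layer_le (hF : ∀ i, (F i).Connected) (hk : ∀ i, k i ≤ p) (hp : Odd p)
    (hX : ∀ i, CentredFamily μ (F i) (X i) K) (hK : 0 ≤ K) (hn : 0 < n) {M : ℝ} (hM : 0 ≤ M)
    (hind : ∀ ε : ℝ, 0 < ε → ε ≤ 1 → ∀ B : Set (EuclideanSpace ℝ (Fin d)),
      ∃ h h1 h2, IsSmoothIndicator (4 * ε) B h h1 h2 (M / ε ^ 3)) {lam : ℝ} (hlam : 0 < lam)
    (hev : ∀ x : ℝ, Module.End.HasEigenvalue (Matrix.toLin' (∑ m, layerCov μ X m)) x → x ≠ 0 →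
      lam ≤ x) :
    convexSetDist ((Measure.pi μ).map fun x => ∑ m, layer X m x)
      (multivariateGaussian 0 (∑ m, layerCov μ X m)) ≤
      convexConst d (layerConst p K) K M lam * (n : ℝ) ^ (-(1 / (2 * ((p : ℝ) + 2)))) := by
  have hn1 : (1 : ℝ) ≤ n := by exact_mod_cast hn
  have hC := layerConst_nonneg p K
  have H := incrementBounds_layer hF hk hX hn
  obtain ⟨R, hR⟩ := exists_isHalfInverse H.posSemidef_sum hlam hev
  obtain ⟨c1, c2⟩ := convexConst_parts_nonneg (lam := lam) d hC hK hM
  have hpow : 0 ≤ (n : ℝ) ^ (-(1 / (2 * ((p : ℝ) + 2)))) := by positivity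
  refine Real.iSup_le (fun A => ?_) (mul_nonneg (add_nonneg c1 c2) hpow)
  obtain ⟨A, hAc, hA⟩ := A
  rw [convexConst, add_mul]
  rcases eq_or_ne p 1 with rfl | hp1
  · have hk1 : ∀ i, k i = 1 := fun i =>
      le_antisymm (hk i) (Fin.pos_iff_nonempty.2 (hF i).nonempty)
    have h1 := (incrementBounds_layer_one hk1 hF hk hX hn).convex_bound_of_bounded hC hn hK
      (fun m x i => abs_layer_le hk1 hX hK m x i) hR hM hind hAc hA
    have e : (-(1 / 6) : ℝ) = -(1 / (2 * (((1 : ℕ) : ℝ) + 2))) := by norm_num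
    rw [e] at h1
    have := mul_nonneg c1 hpow
    exact h1.trans (le_add_of_nonneg_left this)
  · have hp3 : 3 ≤ p := by obtain ⟨q, rfl⟩ := hp; omega
    have hp3' : (3 : ℝ) ≤ p := by exact_mod_cast hp3
    have h1 := H.convex_bound_of_smooth hn le_rfl hR hM hind hAc hA
    have e : (n : ℝ) ^ (-(1 / 8) : ℝ) ≤ (n : ℝ) ^ (-(1 / (2 * ((p : ℝ) + 2)))) := by
      refine Real.rpow_le_rpow_of_exponent_le hn1 (neg_le_neg ?_)
      exact one_div_le_one_div_of_le (by norm_num) (by linarith)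
    exact (h1.trans (mul_le_mul_of_nonneg_left e c1)).trans
      (le_add_of_nonneg_right (mul_nonneg c2 hpow))

end Assembly

theorem theorem1 (d : ℕ) (k : Fin d → ℕ) (F : ∀ i, SimpleGraph (Fin (k i)))
    (hF : ∀ i, (F i).Connected) (p : ℕ) (hp : Odd p) (hk : ∀ i, k i ≤ p) (B : ℝ) :
    ∃ (C : ℝ) (C' : ℝ → ℝ),
      ∀ (n : ℕ) (_ : 1 ≤ n) (Ω : Type*) [MeasurableSpace Ω] (P : Measure Ω)
        [IsProbabilityMeasure P] (κ : Graphon) (U : Fin n → Ω → I)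
        (Y : Fin n → Fin n → Ω → ℝ) (φ : ∀ i, (Fin (k i) → ℝ) → ℝ)
        (ψ : ∀ i, (Fin (k i) → I) → ℝ),
        IsGraphonSample P κ U Y →
        (∀ v w, v < w → ∀ᵐ ω ∂P, |Y v w ω| ≤ B) →
        (∀ i, ∀ t ∈ orderedSimplex (k i), |φ i t| ≤ B) →
        (∀ i, Measurable (ψ i)) → (∀ i u, |ψ i u| ≤ B) →
        ∀ (W : Ω → EuclideanSpace ℝ (Fin d)) (S : Matrix (Fin d) (Fin d) ℝ),
          W = (fun ω => WithLp.toLp 2 fun i => centredCount P κ U Y (F i) (φ i) (ψ i) ω) →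
          S = countCov P U (fun v w => Var[Y v w; P | labelSigma U]) F φ ψ →
          -- for unweighted graphs `S` has the entries with `κ (1 - κ)` as edge variances
          ((∀ v w, v < w → ∀ᵐ ω ∂P, Y v w ω = 0 ∨ Y v w ω = 1) →
            S = countCov P U
              (fun v w ω => κ.toFun (U v ω) (U w ω) * (1 - κ.toFun (U v ω) (U w ω))) F φ ψ) ∧
          -- `S` is the covariance matrix of `W`
          (∀ i j, cov[fun ω => W ω i, fun ω => W ω j; P] = S i j) ∧
          -- smooth test functions
          (∀ (h : EuclideanSpace ℝ (Fin d) → ℝ) (M : ℝ), PartiallyDifferentiable (p + 2) h →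
            (∀ α : Fin d → ℕ, ∑ i, α i ≤ p + 2 → ∀ x, |multiPartial α h x| ≤ M) →
            |(∫ ω, h (W ω) ∂P) - ∫ z, h z ∂(multivariateGaussian 0 S)| ≤ C * M / √(n : ℝ)) ∧
          -- convex sets
          (∀ lam : ℝ, 0 < lam →
            (∀ μ : ℝ, Module.End.HasEigenvalue (Matrix.toLin' S) μ → μ ≠ 0 → lam ≤ μ) →
            convexSetDist (P.map W) (multivariateGaussian 0 S)
              ≤ C' lam * (n : ℝ) ^ (-(1 / (2 * ((p : ℝ) + 2))))) := by
  set K : ℝ := 2 * |B| ^ 2 * (2 * |B| + 1) ^ (p * p)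
  have hK : 0 ≤ K := by positivity
  obtain ⟨M₀, hM₀, hind⟩ := exists_isSmoothIndicator d
  have hp1 : 1 ≤ p := hp.pos
  refine ⟨4 * smoothConst d (layerConst p K), convexConst d (layerConst p K) K M₀, ?_⟩
  intro n hn Ω _ P _ κ U Y φ ψ hS hY hφ hψm hψ W S hW hcov
  obtain ⟨X, hX, hWm, hlaw, hcovX⟩ := hS.exists_layers hF hk hY hφ hψm hψ
  have := isProbabilityMeasure_canonLaw (P := P) hS.measurable_label
  rw [← hW] at hWm hlaw
  rw [← hcov] at hcovX
  refine ⟨fun h01 => ?_, fun i j => ?_, fun h M hd hM => ?_, fun lam hlam hev => ?_⟩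
  · rw [hcov]
    exact countCov_congr fun v w hvw => hS.condVar_eq_of_zero_one hvw (h01 v w hvw)
  · have hmeas : ∀ i : Fin d, Measurable fun y : EuclideanSpace ℝ (Fin d) => y i := fun i => by
      fun_prop
    rw [hcovX, ← covariance_sum_layer hF hX, ← hlaw]
    exact (covariance_map_fun (hmeas i).aestronglyMeasurable (hmeas j).aestronglyMeasurable
      hWm.aemeasurable).symm
  · have hT := isTaylorThree_of_partiallyDifferentiable (by omega) hd hM
    have hM0 : 0 ≤ M := (abs_nonneg _).trans (hM 0 (by simp) 0)
    have hbound := (incrementBounds_layer hF hk hX hn).smooth_bound hn le_rfl (by positivity) hT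
    have e1 : ∫ ω, h (W ω) ∂P = ∫ x, h (∑ m, layer X m x) ∂(Measure.pi (canonLaw P U)) :=
      calc _ = ∫ y, h y ∂(P.map W) :=
            (integral_map hWm.aemeasurable hT.measurable.aestronglyMeasurable).symm
        _ = _ := by
            rw [hlaw]
            exact integral_map (measurable_sum_layer hX).aemeasurable
              hT.measurable.aestronglyMeasurable
    rw [e1, hcovX]
    refine hbound.trans (le_of_eq ?_)
    unfold smoothConst
    ring
  · rw [hlaw, hcovX]
    rw [hcovX] at hev
    exact convexSetDist_layer_le hF hk hp hX hK hn hM₀ hind hlam hev
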